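/- Let $n\ge 3$, let $\beta\in C^\infty([0,\infty);\mathbb R)$ with $\beta(0)=0$, let $\alpha_0>0$, $c_0>0$, $I=(\alpha_0-c_0,\alpha_0+c_0)$, and let $\phi(x;\alpha)$, $x\in\mathbb R^n$, $\alpha\in I$, be real-valued and $C^\infty$ in $(x,\alpha)$, with $$\tfrac12\Delta\phi-\tfrac{\alpha^2}{2}\phi+\beta(\phi^2)\phi=0 ,$$ such that $\phi$ and all its $x$-derivatives decay faster than any power of $|x|$, uniformly in $\alpha\in I$, and $\sup_{\alpha\in I}\big(\|\partial_\alpha\phi\|_{H^1}+\|\partial_\alpha^2\phi\|_{H^1}\big)<\infty$. On $L^2(\mathbb R^n)$ (complex-valued functions), with domain $H^2(\mathbb R^n)$, put $$L_-=-\tfrac12\Delta+\tfrac{\alpha^2}{2}-\beta(\phi^2),\qquad L_+=-\tfrac12\Delta+\tfrac{\alpha^2}{2}-\beta(\phi^2)-2\beta'(\phi^2)\phi^2,$$ and on $L^2\times L^2$, with domain $H^2\times H^2$, put $A=A(\alpha)=\begin{pmatrix}0&-iL_-\\ iL_+&0\end{pmatrix}$. Powers of $A$ and $A^*$ are taken on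 their natural domains, $\mathcal N(A)=\bigcup_{k\ge1}\ker A^k$, $\mathcal N(A^*)=\bigcup_{k\ge1}\ker (A^*)^k$, and $$\mathcal M=\mathrm{span}\Big\{\tbinom{0}{\phi},\tbinom{\partial_\alpha\phi}{0},\tbinom{0}{x_j\phi},\tbinom{\partial_j\phi}{0}: 1\le j\le n\Big\},\qquad \mathcal M_*=\mathrm{span}\Big\{\tbinom{\phi}{0},\tbinom{0}{\partial_\alpha\phi},\tbinom{x_j\phi}{0},\tbinom{0}{\partial_j\phi}: 1\le j\le n\Big\}.$$ Assume that at $\alpha=\alpha_0$: $\ker L_-=\mathrm{span}\{\phi\}$ and $\ker L_+=\mathrm{span}\{\partial_j\phi:1\le j\le n\}$; $L_+$ has exactly one negative eigenvalue, and its eigenspace is spanned by a positive function; $L_-\ge0$, with $0$ an isolated eigenvalue; and $\langle\partial_\alpha\phi,\phi\rangle>0$. Then, at $\alpha=\alpha_0$: 1. $\mathrm{spec}(A)\subset\mathbb R$; $0$ is the only $z\in\mathbb C$ for which $\ker(A-z)^k\ne\ker(A-z)$ for some $k\ge1$; and $\mathrm{Ran}(A^2)$ is closed. 2. $iA$ generates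 a strongly continuous group $e^{itA}$, $t\in\mathbb R$, on $L^2\times L^2$. For every $s\in\mathbb R$ there is $C_s<\infty$ with $\|e^{itA}\psi\|_{H^s}\le C_s\|\psi\|_{H^s}$ for all $t\in\mathbb R$ and all $\psi\in\mathcal M_*^\perp\cap H^s$ (here $\mathcal M_*^\perp\subset L^2\times L^2$, so that for $s<0$ this is a bound in the $H^s$ norm for $L^2$ data). In particular the linear stability condition holds: if $\mathcal L$ and $\mathcal L_*$ are the spans of the root spaces of $A$ and of $A^*$ belonging to the eigenvalues in $(-\alpha_0^2/2,\alpha_0^2/2)$, then $e^{itA}$ is bounded on $\mathcal L_*^\perp$ uniformly in $t\in\mathbb R$, and $\sup_{t}\|e^{itA}P_s\|_{2\to2}<\infty$ for the bounded projection $P_s$ with kernel $\mathcal L$ and range $\mathcal L_*^\perp$. Likewise $iA^*$ generates a strongly continuous group, and for every $s\in\mathbb R$ there is $C_s'<\infty$ with $\|e^{itA^*}\psi\|_{H^s}\le C_s'\|\psi\|_{H^s}$ for all $t\in\mathbb R$ and all $\psi\in\mathcal M^\perp\cap H^s$. Moreover, the constant for $A$ and $s=1$ is locally uniform in $\alpha$: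 there are $\delta>0$ and constants $C(\alpha)<2\,C(\alpha_0)$ such that for $|\alpha-\alpha_0|<\delta$ one has $\|e^{itA(\alpha)}\psi\|_{H^1}\le C(\alpha)\|\psi\|_{H^1}$ for all $t\in\mathbb R$ and all $\psi\in H^1$ orthogonal to the space $\mathcal M_*$ at $\alpha$. 3. $\mathcal N(A)=\mathcal M$ and $\mathcal N(A^*)=\mathcal M_*$, and the vectors listed in the definitions of $\mathcal M$ and of $\mathcal M_*$ are linearly independent, so that both root spaces have dimension $2n+2$. Moreover $\ker A^2=\ker A^3$ and $\ker (A^*)^2=\ker (A^*)^3$. -/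

import Mathlib

open MeasureTheory Set Filter Topology TemperedDistribution
open scoped ContDiff ENNReal NNReal SchwartzMap Laplacian LineDeriv

namespace NLS

noncomputable section

/-! ### Unbounded operators on a Hilbert space -/

section Operators

variable {H : Type*} [NormedAddCommGroup H] [InnerProductSpace ℂ H]

/-- The kernel of an unbounded operator, as a subspace of the ambient space. -/
def opKer (A : H →ₗ.[ℂ] H) : Submodule ℂ H :=
  (LinearMap.ker A.toFun).map A.domain.subtype

/-- The range of an unbounded operator. -/
def opRange (A : H →ₗ.[ℂ] H) : Submodule ℂ H :=
  LinearMap.range A.toFun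

/-- `A - z`, with the domain of `A`. -/
def opShift (A : H →ₗ.[ℂ] H) (z : ℂ) : H →ₗ.[ℂ] H where
  domain := A.domain
  toFun := A.toFun - z • A.domain.subtype

/-- The composition `B A` on its natural domain `{x ∈ Dom A | A x ∈ Dom B}`. -/
def opComp (B A : H →ₗ.[ℂ] H) : H →ₗ.[ℂ] H where
  domain := (B.domain.comap A.toFun).map A.domain.subtype
  toFun := B.toFun ∘ₗ LinearMap.codRestrict B.domain
    (A.toFun ∘ₗ Submodule.inclusion (Submodule.map_subtype_le A.domain (B.domain.comap A.toFun)))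
    (by
      rintro ⟨x, hx⟩
      obtain ⟨y, hy, rfl⟩ := hx
      exact hy)

/-- The powers of an unbounded operator on their natural domains; `A ^ 0` is the identity. -/
def opPow (A : H →ₗ.[ℂ] H) : ℕ → (H →ₗ.[ℂ] H)
  | 0 => (LinearMap.id : H →ₗ[ℂ] H).toPMap ⊤
  | k + 1 => opComp A (opPow A k)

/-- The root space `⋃ₖ ker (A ^ k)` (the kernels increase, so the union is the supremum). -/
def rootSpace (A : H →ₗ.[ℂ] H) : Submodule ℂ H :=
  ⨆ k : ℕ, opKer (opPow A k)

/-- The spectrum: all `z` for which `A - z : Dom A → H` has no bounded everywhere defined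
two-sided inverse. -/
def opSpectrum (A : H →ₗ.[ℂ] H) : Set ℂ :=
  {z | ¬ ∃ R : H →L[ℂ] H,
    (∀ x : A.domain, R (opShift A z x) = x) ∧
    (∀ y : H, ∃ h : R y ∈ A.domain, opShift A z ⟨R y, h⟩ = y)}

/-- `U` is the strongly continuous one-parameter group `exp (t G)`, `t ∈ ℝ`, i.e. the group
whose infinitesimal generator is exactly `G`. -/
structure IsC0Group (U : ℝ → H →L[ℂ] H) (G : H →ₗ.[ℂ] H) : Prop where
  zero : U 0 = ContinuousLinearMap.id ℂ H
  add : ∀ s t : ℝ, U (s + t) = (U s).comp (U t)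
  continuous : ∀ x : H, Continuous fun t : ℝ => U t x
  generator : ∀ x y : H, (x, y) ∈ G.graph ↔ HasDerivAt (fun t : ℝ => U t x) y 0

/-- The span of the root spaces `⋃ₖ ker ((A - e) ^ k)` of all eigenvalues `e ∈ (-μ, μ)`. -/
def discreteRootSpace (A : H →ₗ.[ℂ] H) (μ : ℝ) : Submodule ℂ H :=
  ⨆ e ∈ Ioo (-μ) μ, rootSpace (opShift A ((e : ℝ) : ℂ))

end Operators

/-! ### Function spaces on `ℝⁿ` -/

/-- Euclidean space `ℝⁿ`. -/
abbrev E (n : ℕ) : Type := EuclideanSpace ℝ (Fin n)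

/-- The complex Hilbert space `L²(ℝⁿ)`. -/
abbrev L2 (n : ℕ) : Type := Lp ℂ 2 (volume : Measure (E n))

/-- The complex Hilbert space `L²(ℝⁿ) × L²(ℝⁿ)`. -/
abbrev L2x2 (n : ℕ) : Type := WithLp 2 (L2 n × L2 n)

variable {n : ℕ}

/-- The tempered distribution given by an `L²` function. -/
abbrev toDist (f : L2 n) : 𝓢'(E n, ℂ) := Lp.toTemperedDistribution f

/-- The `H^s` norm, `s ∈ ℝ`, of an `L²` function: the `L²` norm of its Bessel potential of
order `s`; it is `∞` if the function is not in `H^s`. -/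
def sobNorm (s : ℝ) (f : L2 n) : ℝ≥0∞ :=
  ⨅ (g : L2 n) (_ : besselPotential (E n) ℂ s (toDist f) = toDist g), ‖g‖ₑ

/-- The norm of `H^s × H^s`. -/
def sobNorm₂ (s : ℝ) (ψ : L2x2 n) : ℝ≥0∞ := sobNorm s ψ.fst + sobNorm s ψ.snd

/-- A real-valued function as an element of `L²` (`0` if it is not square integrable). -/
def toL2 (f : E n → ℝ) : L2 n :=
  open Classical in
  if h : MemLp (fun x => (f x : ℂ)) 2 (volume : Measure (E n)) then h.toLp else 0

theorem toDist_injective : Function.Injective (toDist (n := n)) := by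
  have h := Lp.ker_toTemperedDistributionCLM_eq_bot (F := ℂ) (μ := (volume : Measure (E n)))
    (p := 2)
  exact LinearMap.ker_eq_bot.mp h

theorem toDist_add (f g : L2 n) : toDist (f + g) = toDist f + toDist g :=
  map_add (Lp.toTemperedDistributionCLM ℂ (volume : Measure (E n)) 2) f g

theorem toDist_smul (c : ℂ) (f : L2 n) : toDist (c • f) = c • toDist f :=
  map_smul (Lp.toTemperedDistributionCLM ℂ (volume : Measure (E n)) 2) c f

/-- The subspace `H²(ℝⁿ)` of `L²(ℝⁿ)`. -/
def H2 (n : ℕ) : Submodule ℂ (L2 n) where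
  carrier := {f | MemSobolev 2 2 (toDist f)}
  add_mem' {f g} hf hg := by
    simp only [mem_ofPred_eq, toDist_add] at hf hg ⊢
    exact hf.add hg
  zero_mem' := by
    have h : toDist (0 : L2 n) = 0 :=
      map_zero (Lp.toTemperedDistributionCLM ℂ (volume : Measure (E n)) 2)
    simp only [mem_ofPred_eq, h]
    exact memSobolev_fun_zero (E n) ℂ 2 2
  smul_mem' c f hf := by
    simp only [mem_ofPred_eq, toDist_smul] at hf ⊢
    exact hf.smul c

theorem exists_laplacian (f : H2 n) : ∃ g : L2 n, Δ (toDist (f : L2 n)) = toDist g := by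
  have h : MemSobolev 2 2 (toDist (f : L2 n)) := f.2
  have h' := h.laplacian
  rw [sub_self, memSobolev_zero_iff] at h'
  exact h'

/-- The distributional Laplacian as an unbounded operator on `L²(ℝⁿ)` with domain `H²(ℝⁿ)`. -/
def laplacianL2 (n : ℕ) : L2 n →ₗ.[ℂ] L2 n where
  domain := H2 n
  toFun :=
    { toFun := fun f => (exists_laplacian f).choose
      map_add' := fun f g => by
        apply toDist_injective
        rw [toDist_add, ← (exists_laplacian f).choose_spec, ← (exists_laplacian g).choose_spec,
          ← (exists_laplacian (f + g)).choose_spec, Submodule.coe_add, toDist_add]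
        simp only [← laplacianCLM_apply, map_add]
      map_smul' := fun c f => by
        apply toDist_injective
        rw [RingHom.id_apply, toDist_smul, ← (exists_laplacian f).choose_spec,
          ← (exists_laplacian (c • f)).choose_spec, Submodule.coe_smul, toDist_smul]
        simp only [← laplacianCLM_apply, map_smul] }

theorem mul_add_ae (V : E n → ℝ) (f g : L2 n) :
    (fun x => (V x : ℂ) * (f + g : L2 n) x) =ᵐ[volume]
      (fun x => (V x : ℂ) * f x) + (fun x => (V x : ℂ) * g x) := by
  filter_upwards [Lp.coeFn_add f g] with x hx
  rw [hx]
  exact mul_add _ _ _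

theorem mul_smul_ae (V : E n → ℝ) (c : ℂ) (f : L2 n) :
    (fun x => (V x : ℂ) * (c • f : L2 n) x) =ᵐ[volume] c • (fun x => (V x : ℂ) * f x) := by
  filter_upwards [Lp.coeFn_smul c f] with x hx
  simp only [hx, Pi.smul_apply, smul_eq_mul]
  ring

/-- Multiplication by the real function `V`, with its maximal domain `{f ∈ L² | V f ∈ L²}`
(all of `L²` if `V` is bounded and measurable). -/
def mulL2 (V : E n → ℝ) : L2 n →ₗ.[ℂ] L2 n where
  domain :=
    { carrier := {f | MemLp (fun x => (V x : ℂ) * f x) 2 (volume : Measure (E n))}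
      add_mem' := fun {f g} hf hg => (memLp_congr_ae (mul_add_ae V f g)).mpr (hf.add hg)
      zero_mem' := by
        refine (memLp_congr_ae ?_).mpr (MemLp.zero : MemLp (0 : E n → ℂ) 2 volume)
        filter_upwards [Lp.coeFn_zero ℂ 2 (volume : Measure (E n))] with x hx
        rw [hx]
        simp
      smul_mem' := fun c f hf =>
        (memLp_congr_ae (mul_smul_ae V c f)).mpr (MemLp.const_smul hf c) }
  toFun :=
    { toFun := fun f => MemLp.toLp (fun x => (V x : ℂ) * (f : L2 n) x) f.2
      map_add' := fun f g => by
        rw [← MemLp.toLp_add, MemLp.toLp_eq_toLp_iff]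
        exact mul_add_ae V f g
      map_smul' := fun c f => by
        rw [RingHom.id_apply, ← MemLp.toLp_const_smul, MemLp.toLp_eq_toLp_iff]
        exact mul_smul_ae V c f }

/-- The Schrödinger operator `-½ Δ + V` on `L²(ℝⁿ)` (with domain `H²(ℝⁿ)` for bounded `V`). -/
def schrodinger (V : E n → ℝ) : L2 n →ₗ.[ℂ] L2 n :=
  (-(1 / 2 : ℂ)) • laplacianL2 n + mulL2 V

/-- The operator matrix `((0, -i S), (i T, 0))` on `L² × L²` with domain `Dom T × Dom S`. -/
def offDiagonal (S T : L2 n →ₗ.[ℂ] L2 n) : L2x2 n →ₗ.[ℂ] L2x2 n where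
  domain :=
    { carrier := {ψ | ψ.fst ∈ T.domain ∧ ψ.snd ∈ S.domain}
      add_mem' := fun hψ hχ => ⟨T.domain.add_mem hψ.1 hχ.1, S.domain.add_mem hψ.2 hχ.2⟩
      zero_mem' := ⟨T.domain.zero_mem, S.domain.zero_mem⟩
      smul_mem' := fun c _ hψ => ⟨T.domain.smul_mem c hψ.1, S.domain.smul_mem c hψ.2⟩ }
  toFun :=
    { toFun := fun ψ => WithLp.toLp 2
        (-Complex.I • S ⟨(ψ : L2x2 n).snd, ψ.2.2⟩, Complex.I • T ⟨(ψ : L2x2 n).fst, ψ.2.1⟩)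
      map_add' := fun ψ χ => by
        have hS := LinearPMap.map_add S ⟨(ψ : L2x2 n).snd, ψ.2.2⟩ ⟨(χ : L2x2 n).snd, χ.2.2⟩
        have hT := LinearPMap.map_add T ⟨(ψ : L2x2 n).fst, ψ.2.1⟩ ⟨(χ : L2x2 n).fst, χ.2.1⟩
        have h : ∀ a b c d : L2 n, WithLp.toLp 2 (-Complex.I • (a + b), Complex.I • (c + d)) =
            WithLp.toLp 2 (-Complex.I • a, Complex.I • c) +
              WithLp.toLp 2 (-Complex.I • b, Complex.I • d) := by
          intro a b c d
          rw [smul_add, smul_add, ← Prod.mk_add_mk, WithLp.toLp_add]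
        exact (congrArg₂ (fun a c => WithLp.toLp 2 (-Complex.I • a, Complex.I • c)) hS hT).trans
          (h _ _ _ _)
      map_smul' := fun c ψ => by
        have hS := LinearPMap.map_smul S c ⟨(ψ : L2x2 n).snd, ψ.2.2⟩
        have hT := LinearPMap.map_smul T c ⟨(ψ : L2x2 n).fst, ψ.2.1⟩
        have h : ∀ a b : L2 n, WithLp.toLp 2 (-Complex.I • (c • a), Complex.I • (c • b)) =
            c • WithLp.toLp 2 (-Complex.I • a, Complex.I • b) := by
          intro a b
          rw [smul_comm _ c a, smul_comm _ c b, ← Prod.smul_mk, WithLp.toLp_smul]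
        exact (congrArg₂ (fun a b => WithLp.toLp 2 (-Complex.I • a, Complex.I • b)) hS hT).trans
          (h _ _) }

/-! ### The soliton profiles and the linearised operators

`φ α x` is the profile `φ(x; α)`. -/

/-- `∂_α φ(x; α)`. -/
def dAlpha (φ : ℝ → E n → ℝ) (α : ℝ) (x : E n) : ℝ := deriv (fun a => φ a x) α

/-- `∂_α² φ(x; α)`. -/
def dAlpha2 (φ : ℝ → E n → ℝ) (α : ℝ) (x : E n) : ℝ := iteratedDeriv 2 (fun a => φ a x) α

/-- `∂_j φ(x; α)`. -/
def dSpace (φ : ℝ → E n → ℝ) (α : ℝ) (j : Fin n) (x : E n) : ℝ :=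
  fderiv ℝ (φ α) x (EuclideanSpace.single j 1)

/-- `‖f‖_{H¹} ≤ K` (up to a numerical factor), for a smooth function `f`. -/
def H1NormLe (f : E n → ℝ) (K : ℝ≥0) : Prop :=
  eLpNorm f 2 volume ≤ K ∧ eLpNorm (fderiv ℝ f) 2 volume ≤ K

/-- `φ(·; α)`, `|α - α₀| < c₀`, is a family of solutions of
`½ Δφ - ½ α² φ + β(φ²) φ = 0`, smooth in `(α, x)`, rapidly decaying in `x`, with
`∂_α φ`, `∂_α² φ` bounded in `H¹`. -/
structure IsSolitonFamily (β : ℝ → ℝ) (α₀ c₀ : ℝ) (φ : ℝ → E n → ℝ) : Prop where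
  smooth : ContDiffOn ℝ ∞ (fun p : ℝ × E n => φ p.1 p.2) (Ioo (α₀ - c₀) (α₀ + c₀) ×ˢ univ)
  equation : ∀ α ∈ Ioo (α₀ - c₀) (α₀ + c₀), ∀ x : E n,
    (1 / 2) * Δ (φ α) x - α ^ 2 / 2 * φ α x + β (φ α x ^ 2) * φ α x = 0
  decay : ∀ k m : ℕ, ∃ C : ℝ, ∀ α ∈ Ioo (α₀ - c₀) (α₀ + c₀), ∀ x : E n,
    ‖x‖ ^ k * ‖iteratedFDeriv ℝ m (φ α) x‖ ≤ C
  alpha_deriv : ∃ K : ℝ≥0, ∀ α ∈ Ioo (α₀ - c₀) (α₀ + c₀),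
    H1NormLe (dAlpha φ α) K ∧ H1NormLe (dAlpha2 φ α) K

/-- `L₋ = -½ Δ + α²/2 - β(φ²)`. -/
def opLminus (β : ℝ → ℝ) (φ : ℝ → E n → ℝ) (α : ℝ) : L2 n →ₗ.[ℂ] L2 n :=
  schrodinger fun x => α ^ 2 / 2 - β (φ α x ^ 2)

/-- `L₊ = -½ Δ + α²/2 - β(φ²) - 2 β'(φ²) φ²`. (Where `φ` vanishes, so does the last term.) -/
def opLplus (β : ℝ → ℝ) (φ : ℝ → E n → ℝ) (α : ℝ) : L2 n →ₗ.[ℂ] L2 n :=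
  schrodinger fun x => α ^ 2 / 2 - β (φ α x ^ 2) - 2 * deriv β (φ α x ^ 2) * φ α x ^ 2

/-- `A = ((0, -i L₋), (i L₊, 0))`. -/
def opA (β : ℝ → ℝ) (φ : ℝ → E n → ℝ) (α : ℝ) : L2x2 n →ₗ.[ℂ] L2x2 n :=
  offDiagonal (opLminus β φ α) (opLplus β φ α)

/-- The needed properties of `L₊` and `L₋` at the parameter `α`. -/
structure SpectralAssumption (β : ℝ → ℝ) (φ : ℝ → E n → ℝ) (α : ℝ) : Prop where
  ker_minus : opKer (opLminus β φ α) = Submodule.span ℂ {toL2 (φ α)}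
  ker_plus : opKer (opLplus β φ α) =
    Submodule.span ℂ (range fun j : Fin n => toL2 (dSpace φ α j))
  /-- `L₊` has exactly one negative eigenvalue `E₁`; its eigenspace is spanned by a positive
  function. -/
  neg_eigenvalue : ∃ E₁ : ℝ, E₁ < 0 ∧
    (∃ ψ : L2 n, (∀ᵐ x, ∃ r : ℝ, 0 < r ∧ ψ x = r) ∧
      opKer (opShift (opLplus β φ α) E₁) = Submodule.span ℂ {ψ}) ∧
    ∀ E₂ : ℝ, E₂ < 0 → opKer (opShift (opLplus β φ α) E₂) ≠ ⊥ → E₂ = E₁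
  nonneg_minus : ∀ f : (opLminus β φ α).domain,
    0 ≤ (inner ℂ (f : L2 n) (opLminus β φ α f)).re
  /-- `0` (an eigenvalue by `ker_minus`) is isolated in the spectrum of `L₋`. -/
  isolated_minus : ∃ ε : ℝ, 0 < ε ∧ ∀ z ∈ opSpectrum (opLminus β φ α), z ≠ 0 → ε ≤ ‖z‖
  convexity : 0 < ∫ x, dAlpha φ α x * φ α x

/-- Labels for the `2n + 2` root vectors. -/
inductive RootIndex (n : ℕ) : Type
  | phase : RootIndex n
  | scaling : RootIndex n
  | boost (j : Fin n) : RootIndex n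
  | translation (j : Fin n) : RootIndex n

/-- The vectors `(0, φ)`, `(∂_α φ, 0)`, `(0, x_j φ)`, `(∂_j φ, 0)`. -/
def rootVec (φ : ℝ → E n → ℝ) (α : ℝ) : RootIndex n → L2x2 n
  | .phase => WithLp.toLp 2 (0, toL2 (φ α))
  | .scaling => WithLp.toLp 2 (toL2 (dAlpha φ α), 0)
  | .boost j => WithLp.toLp 2 (0, toL2 fun x => x j * φ α x)
  | .translation j => WithLp.toLp 2 (toL2 (dSpace φ α j), 0)

/-- The vectors `(φ, 0)`, `(0, ∂_α φ)`, `(x_j φ, 0)`, `(0, ∂_j φ)`. -/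
def rootVecStar (φ : ℝ → E n → ℝ) (α : ℝ) : RootIndex n → L2x2 n
  | .phase => WithLp.toLp 2 (toL2 (φ α), 0)
  | .scaling => WithLp.toLp 2 (0, toL2 (dAlpha φ α))
  | .boost j => WithLp.toLp 2 (toL2 fun x => x j * φ α x, 0)
  | .translation j => WithLp.toLp 2 (0, toL2 (dSpace φ α j))

/-- The span `M` of the vectors `rootVec`. -/
def spaceM (φ : ℝ → E n → ℝ) (α : ℝ) : Submodule ℂ (L2x2 n) :=
  Submodule.span ℂ (range (rootVec φ α))

/-- The span `M_*` of the vectors `rootVecStar`. -/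
def spaceMStar (φ : ℝ → E n → ℝ) (α : ℝ) : Submodule ℂ (L2x2 n) :=
  Submodule.span ℂ (range (rootVecStar φ α))

/-- `‖U(t) ψ‖_{H^s} ≤ C ‖ψ‖_{H^s}` for all `t ∈ ℝ` and all `ψ ∈ L² × L²` orthogonal to `N`
(the right-hand side is infinite if `ψ` is not in `H^s`). -/
def StableOn (U : ℝ → L2x2 n →L[ℂ] L2x2 n) (N : Submodule ℂ (L2x2 n)) (s : ℝ) (C : ℝ≥0) : Prop :=
  ∀ t : ℝ, ∀ ψ ∈ Nᗮ, sobNorm₂ s (U t ψ) ≤ C * sobNorm₂ s ψ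

/-- The linear stability condition. Let `N`, `N_*` be the spans of the root spaces of `A`, `A*`
belonging to the eigenvalues in `(-μ, μ)`. Then `U` is uniformly bounded on `N_*ᗮ`, and
`sup_t ‖U(t) P‖ < ∞` for the projection `P` with kernel `N` and range `N_*ᗮ`. -/
def LinearStability (U : ℝ → L2x2 n →L[ℂ] L2x2 n) (A Astar : L2x2 n →ₗ.[ℂ] L2x2 n) (μ : ℝ) :
    Prop :=
  (∃ C : ℝ, ∀ t : ℝ, ∀ ψ ∈ (discreteRootSpace Astar μ)ᗮ, ‖U t ψ‖ ≤ C * ‖ψ‖) ∧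
  ∀ P : L2x2 n →L[ℂ] L2x2 n, IsIdempotentElem P →
    P.ker = discreteRootSpace A μ → P.range = (discreteRootSpace Astar μ)ᗮ →
    ∃ C : ℝ, ∀ t : ℝ, ‖(U t).comp P‖ ≤ C

end

end NLS

open NLS

namespace NLS

noncomputable section

set_option linter.unusedSectionVars false

/-! ### Quadratic forms of operators `R⁻² + W` -/

section AbstractForm

variable {X : Type*} [NormedAddCommGroup X] [InnerProductSpace ℂ X]

/-! Write ψ = (u, v). The flow of iA is u' = L₋v, v' = -L₊u, and it conserves the energy ⟨L₊u, u⟩ +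
⟨L₋v, v⟩. Everything rests on one fact: on M_*^⊥, which the flow leaves invariant, this energy is
equivalent to the square of the H¹ norm.

Algebra. The equation for φ and its derivatives in x and α give L₋φ = 0, L₋(x_jφ) = -∂_jφ, L₊∂_jφ =
0 and L₊∂_αφ = -αφ. Because ⟨φ, ∂_αφ⟩ > 0 and ⟨x_iφ, ∂_jφ⟩ = -½‖φ‖²δ_ij, the vectors φ, x_jφ and
suitable combinations of ∂_αφ, ∂_jφ form biorthogonal families a, b (`isRootSystem`). Together with
the assumed kernels of L± and the Fredholm alternative (`exists_solution`) this determines both root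
spaces, shows that chains at 0 have length at most two, and identifies Ran A² with the closed space
M_*^⊥.

Coercivity. With R = (-½Δ + κ)^(-1/2) and x = Rf, the form of L± at x becomes the bounded form of 1
+ RWR at f. When WR is compact this is a compact perturbation of the identity, so strict positivity
on a closed subspace improves to coercivity (`exists_coercive_of_compact`). L₋ is nonnegative and
its null vector φ is not orthogonal to ∂_αφ. L₊ has a single negative direction, and ⟨L₊∂_αφ, ∂_αφ⟩
= -α⟨φ, ∂_αφ⟩ < 0 shows that ∂_αφ already accounts for it, so L₊ ≥ 0 on φ^⊥; the null vectors ∂_jφ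
are excluded by orthogonality to the x_jφ.

Stability. Energy conservation and coercivity give the bound in H¹ (`en2_one_le`). Since A commutes
with the flow and gains exactly two derivatives, the bound passes from H^s to H^(s+2)
(`isStable_add_two`). The adjoint of the projected group is the same group conjugated by the
exchange of components, so duality gives negative orders, and a quadratic form of real interpolation
gives all s (`exists_en2_le`).

Consequences. On M the flow is affine in t, so the group grows at most linearly and its Laplace
transform is a resolvent off the real axis. A Jordan chain at a real r ≠ 0 would produce an
eigenvector in M_*^⊥ of zero energy, contradicting positivity. Finally, coercivity under finitely
many orthogonality conditions survives small changes of the form and of the conditions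
(`eventually_coercive`), which gives the local uniformity in α. -/

/-- The real quadratic form of a bounded operator. -/
def qf (T : X →L[ℂ] X) (f : X) : ℝ := (inner ℂ (T f) f).re

theorem qf_parallelogram (T : X →L[ℂ] X) (f g : X) :
    qf T (f - g) + qf T (f + g) = 2 * qf T f + 2 * qf T g := by
  simp only [qf, map_sub, map_add, inner_sub_left, inner_sub_right, inner_add_left,
    inner_add_right, Complex.add_re, Complex.sub_re]
  ring

theorem qf_smul (T : X →L[ℂ] X) (c : ℂ) (f : X) : qf T (c • f) = ‖c‖ ^ 2 * qf T f := by
  have h : (starRingEnd ℂ) c * c = ((‖c‖ ^ 2 : ℝ) : ℂ) := by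
    rw [mul_comm, Complex.mul_conj, Complex.normSq_eq_norm_sq]
  simp only [qf, map_smul, inner_smul_left, inner_smul_right, ← mul_assoc]
  rw [mul_comm c, h, Complex.re_ofReal_mul]

theorem continuous_qf (T : X →L[ℂ] X) : Continuous (qf T) := by
  unfold qf
  fun_prop

theorem qf_le (T : X →L[ℂ] X) (f : X) : |qf T f| ≤ ‖T‖ * ‖f‖ ^ 2 :=
  calc |qf T f| ≤ ‖inner ℂ (T f) f‖ := Complex.abs_re_le_norm _
    _ ≤ ‖T f‖ * ‖f‖ := norm_inner_le_norm _ _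
    _ ≤ (‖T‖ * ‖f‖) * ‖f‖ := by gcongr; exact T.le_opNorm f
    _ = _ := by ring

theorem qf_add (S T : X →L[ℂ] X) (f : X) : qf (S + T) f = qf S f + qf T f := by
  simp only [qf, add_apply, inner_add_left, Complex.add_re]

theorem qf_one (f : X) : qf (1 : X →L[ℂ] X) f = ‖f‖ ^ 2 := by
  simp only [qf, one_apply_eq_self]
  exact inner_self_eq_norm_sq (𝕜 := ℂ) f

/-- A quadratic form which is a compact perturbation of a coercive one and strictly positive on a
closed subspace is coercive there. -/
theorem exists_coercive_of_compact [CompleteSpace X] (T K : X →L[ℂ] X)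
    (hK : IsCompactOperator K) (hTK : ∀ f, ‖f‖ ^ 2 + qf K f ≤ qf T f)
    (N : Submodule ℂ X) (hN : IsClosed (N : Set X)) (hpos : ∀ f ∈ N, 0 ≤ qf T f)
    (hzero : ∀ f ∈ N, qf T f = 0 → f = 0) :
    ∃ c : ℝ, 0 < c ∧ ∀ f ∈ N, c * ‖f‖ ^ 2 ≤ qf T f := by
  by_contra! hcon
  have hseq : ∀ k : ℕ, ∃ f ∈ N, ‖f‖ = 1 ∧ qf T f < 1 / ((k : ℝ) + 1) := by
    intro k
    obtain ⟨f, hf, hlt⟩ := hcon (1 / ((k : ℝ) + 1)) (by positivity)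
    have hf0 : f ≠ 0 := by
      rintro rfl
      simp [qf] at hlt
    have hn : 0 < ‖f‖ := norm_pos_iff.mpr hf0
    refine ⟨((‖f‖⁻¹ : ℝ) : ℂ) • f, N.smul_mem _ hf, ?_, ?_⟩
    · rw [norm_smul, Complex.norm_real, norm_inv, norm_norm, inv_mul_cancel₀ hn.ne']
    · rw [qf_smul, Complex.norm_real, norm_inv, norm_norm, inv_pow, inv_mul_lt_iff₀ (by positivity)]
      linarith
  choose f hfN hf1 hfq using hseq
  obtain ⟨C, hC, hC'⟩ := hK.image_closedBall_subset_compact 1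
  obtain ⟨y, -, ψ, hψ, hy⟩ := hC.tendsto_subseq
    (x := fun k => K (f k)) (fun k => hC' ⟨f k, by simp [hf1], rfl⟩)
  have hK2 := hy.cauchySeq
  -- Since the form is nonnegative at a + b, the parallelogram law bounds it at a - b by 2 qf(a) + 2
  -- qf(b), which tends to 0. The splitting hypothesis then bounds ‖a - b‖² by this plus a term in
  -- K(a - b), and K converges along the subsequence. So the minimising sequence converges strongly,
  -- to a unit null vector.
  have hcau : CauchySeq (f ∘ ψ) := by
    rw [Metric.cauchySeq_iff] at hK2 ⊢
    intro ε hε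
    obtain ⟨N₁, hN₁⟩ := hK2 (ε ^ 2 / 4) (by positivity)
    obtain ⟨N₂, hN₂⟩ := exists_nat_one_div_lt (show (0 : ℝ) < ε ^ 2 / 8 by positivity)
    refine ⟨max N₁ N₂, fun m hm l hl => ?_⟩
    have hd := hN₁ m (le_trans (le_max_left _ _) hm) l (le_trans (le_max_left _ _) hl)
    have hsmall : ∀ m ≥ max N₁ N₂, qf T (f (ψ m)) < ε ^ 2 / 8 := by
      intro m hm
      refine (hfq _).trans_le (le_trans ?_ hN₂.le)
      have h1 : N₂ ≤ ψ m := le_trans (le_trans (le_max_right _ _) hm) (hψ.id_le m)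
      have h2 : (N₂ : ℝ) ≤ (ψ m : ℝ) := by exact_mod_cast h1
      gcongr
    set a := f (ψ m)
    set b := f (ψ l)
    have hq : qf T (a - b) < ε ^ 2 / 2 := by
      have h1 := qf_parallelogram T a b
      have h2 := hpos (a + b) (N.add_mem (hfN _) (hfN _))
      have h3 := hsmall m hm
      have h4 := hsmall l hl
      linarith
    have hsplit := hTK (a - b)
    have hab : ‖a - b‖ ≤ 2 := by
      calc ‖a - b‖ ≤ ‖a‖ + ‖b‖ := norm_sub_le _ _
        _ = 2 := by rw [hf1, hf1]; norm_num
    have hkk : |qf K (a - b)| ≤ ε ^ 2 / 2 := by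
      calc |qf K (a - b)| ≤ ‖inner ℂ (K (a - b)) (a - b)‖ :=
            Complex.abs_re_le_norm _
        _ ≤ ‖K (a - b)‖ * ‖a - b‖ := norm_inner_le_norm _ _
        _ ≤ (ε ^ 2 / 4) * 2 := by
            have h5 : ‖K (a - b)‖ ≤ ε ^ 2 / 4 := by
              rw [map_sub, ← dist_eq_norm]
              exact hd.le
            gcongr
        _ = _ := by ring
    have h6 : ‖a - b‖ ^ 2 < ε ^ 2 := by
      have := (abs_le.mp hkk).1
      linarith
    show dist a b < ε
    rw [dist_eq_norm]
    exact lt_of_pow_lt_pow_left₀ 2 hε.le h6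
  obtain ⟨g, hg⟩ := cauchySeq_tendsto_of_complete hcau
  have hgN : g ∈ N := hN.mem_of_tendsto hg (Eventually.of_forall fun k => hfN _)
  have hg1 : ‖g‖ = 1 := by
    refine tendsto_nhds_unique hg.norm ?_
    simp [hf1]
  have hg0 : qf T g ≤ 0 := by
    have h1 : Tendsto (fun k => qf T (f (ψ k))) atTop (𝓝 (qf T g)) :=
      ((continuous_qf T).tendsto g).comp hg
    have h2 : Tendsto (fun k => 1 / ((ψ k : ℝ) + 1)) atTop (𝓝 0) :=
      tendsto_one_div_add_atTop_nhds_zero_nat.comp hψ.tendsto_atTop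
    exact le_of_tendsto_of_tendsto' h1 h2 fun k => (hfq _).le
  have := hzero g hgN (le_antisymm hg0 (hpos g hgN))
  rw [this, norm_zero] at hg1
  exact zero_ne_one hg1

/-- The operator `R⁻² + W` on the domain `Ran R²`. -/
structure IsSchr (R W : X →L[ℂ] X) (L : X →ₗ.[ℂ] X) : Prop where
  R_symm : ∀ x y : X, inner ℂ (R x) y = inner ℂ x (R y)
  R_inj : ∀ x : X, R x = 0 → x = 0
  W_symm : ∀ x y : X, inner ℂ (W x) y = inner ℂ x (W y)
  mem_domain : ∀ x : X, x ∈ L.domain ↔ ∃ f, R (R f) = x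
  apply : ∀ (x : L.domain) (f : X), R (R f) = x → L x = f + W x

/-- The form of `R⁻² + W` in terms of `R⁻¹ x`. -/
def formOp (R W : X →L[ℂ] X) : X →L[ℂ] X := 1 + R ∘L W ∘L R

theorem formOp_apply (R W : X →L[ℂ] X) (f : X) : formOp R W f = f + R (W (R f)) := rfl

namespace IsSchr

variable {R W : X →L[ℂ] X} {L : X →ₗ.[ℂ] X}

theorem symm (h : IsSchr R W L) (x y : L.domain) :
    inner ℂ (L x) (y : X) = inner ℂ (x : X) (L y) := by
  obtain ⟨f, hf⟩ := (h.mem_domain x).mp x.2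
  obtain ⟨g, hg⟩ := (h.mem_domain y).mp y.2
  have e : inner ℂ f (y : X) = inner ℂ (x : X) g := by
    rw [← hf, ← hg, h.R_symm, h.R_symm]
  rw [h.apply x f hf, h.apply y g hg, inner_add_left, inner_add_right, h.W_symm, e]

theorem formOp_symm (h : IsSchr R W L) (x y : X) :
    inner ℂ (formOp R W x) y = inner ℂ x (formOp R W y) := by
  simp only [formOp_apply, inner_add_left, inner_add_right, h.R_symm, h.W_symm]

theorem formOp_eq (h : IsSchr R W L) (x : L.domain) (f : X) (hf : R f = x) :
    formOp R W f = R (L x) := by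
  obtain ⟨g, hg⟩ := (h.mem_domain x).mp x.2
  have hfg : f = R g := by
    rw [← sub_eq_zero]
    apply h.R_inj
    rw [map_sub, hg, hf, sub_self]
  rw [h.apply x g hg, formOp_apply, hf, map_add, hfg]

/-- Regularity of weak solutions: the equation rearranges to f = R(y - WRf), so Rf lies in Ran R²,
the operator domain. This turns null vectors of the form into eigenvectors of L. -/
theorem of_formOp_eq (h : IsSchr R W L) (f y : X) (hf : formOp R W f = R y) :
    ∃ hx : R f ∈ L.domain, L ⟨R f, hx⟩ = y := by
  have h1 : R (y - W (R f)) = f := by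
    rw [map_sub, ← hf, formOp_apply]
    abel
  have hx : R f ∈ L.domain := (h.mem_domain _).mpr ⟨y - W (R f), by rw [h1]⟩
  refine ⟨hx, ?_⟩
  rw [h.apply ⟨R f, hx⟩ (y - W (R f)) (by rw [h1])]
  simp

theorem qf_formOp_eq (h : IsSchr R W L) (x : L.domain) (f : X) (hf : R f = x) :
    qf (formOp R W) f = (inner ℂ (L x) (x : X)).re := by
  rw [qf, h.formOp_eq x f hf, h.R_symm, hf]

theorem dense_range (h : IsSchr R W L) [CompleteSpace X] : DenseRange R := by
  have h1 : (LinearMap.range (R : X →ₗ[ℂ] X)).topologicalClosure = ⊤ := by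
    rw [Submodule.topologicalClosure_eq_top_iff, Submodule.eq_bot_iff]
    intro x hx
    apply h.R_inj
    have h2 := (Submodule.mem_orthogonal _ _).mp hx (R (R x)) ⟨R x, rfl⟩
    rw [h.R_symm] at h2
    exact inner_self_eq_zero.mp h2
  have h2 := congrArg (fun S : Submodule ℂ X => (S : Set X)) h1
  simp only [Submodule.topologicalClosure_coe, Submodule.top_coe] at h2
  exact dense_iff_closure_eq.mpr h2

theorem dense_domain (h : IsSchr R W L) [CompleteSpace X] : Dense (L.domain : Set X) := by
  have h1 : (L.domain : Set X) = range (R ∘ R) := by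
    ext x
    exact h.mem_domain x
  rw [h1]
  exact h.dense_range.comp h.dense_range R.continuous

/-- Symmetry of `R⁻² + W` is self-adjointness, because `R⁻²` is onto. -/
theorem mem_domain_of_adjoint (h : IsSchr R W L) (y w : X)
    (hy : ∀ x : L.domain, inner ℂ y (L x) = inner ℂ w (x : X)) :
    ∃ hy : y ∈ L.domain, L ⟨y, hy⟩ = w := by
  have key : R (R (w - W y)) = y := by
    refine ext_inner_right ℂ fun f => ?_
    have hx : R (R f) ∈ L.domain := (h.mem_domain _).mpr ⟨f, rfl⟩
    have h1 := hy ⟨R (R f), hx⟩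
    rw [h.apply ⟨R (R f), hx⟩ f rfl, inner_add_right] at h1
    rw [h.R_symm, h.R_symm, inner_sub_left, ← h1, h.W_symm]
    simp
  have hy' : y ∈ L.domain := (h.mem_domain y).mpr ⟨_, key⟩
  refine ⟨hy', ?_⟩
  rw [h.apply ⟨y, hy'⟩ _ key]
  simp

theorem qf_formOp (R W : X →L[ℂ] X) (f : X) :
    qf (formOp R W) f = ‖f‖ ^ 2 + qf (R ∘L W ∘L R) f := by
  rw [formOp, qf_add, qf_one]

end IsSchr

end AbstractForm

/-! ### Positivity, coercivity and the Fredholm alternative -/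

section AbstractForm

variable {X : Type*} [NormedAddCommGroup X] [InnerProductSpace ℂ X]

theorem mem_opKer_iff (A : X →ₗ.[ℂ] X) (x : X) :
    x ∈ opKer A ↔ ∃ hx : x ∈ A.domain, A ⟨x, hx⟩ = 0 := by
  constructor
  · rintro ⟨y, hy, rfl⟩
    exact ⟨y.2, hy⟩
  · rintro ⟨hx, h⟩
    exact ⟨⟨x, hx⟩, h, rfl⟩

theorem mem_opKer_opShift_iff (A : X →ₗ.[ℂ] X) (z : ℂ) (x : X) :
    x ∈ opKer (opShift A z) ↔ ∃ hx : x ∈ A.domain, A ⟨x, hx⟩ = z • x := by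
  rw [mem_opKer_iff]
  refine exists_congr fun hx => ?_
  show A ⟨x, hx⟩ - z • x = 0 ↔ _
  exact sub_eq_zero

/-- The orthogonal complement of one vector. -/
def perp (y : X) : Submodule ℂ X := LinearMap.ker (innerSL ℂ y : X →ₗ[ℂ] ℂ)

theorem mem_perp (y x : X) : x ∈ perp y ↔ inner ℂ y x = 0 := Iff.rfl

theorem isClosed_perp (y : X) : IsClosed (perp y : Set X) :=
  (innerSL ℂ y : X →L[ℂ] ℂ).isClosed_ker

theorem qf_add_smul (T : X →L[ℂ] X) (hT : ∀ x y, inner ℂ (T x) y = inner ℂ x (T y)) (f g : X)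
    (c : ℂ) : qf T (f + c • g) = qf T f + 2 * (c * inner ℂ (T f) g).re + ‖c‖ ^ 2 * qf T g := by
  have h1 : (inner ℂ (T (c • g)) f).re = (c * inner ℂ (T f) g).re := by
    rw [hT, ← Complex.conj_re, inner_conj_symm, inner_smul_right]
  have h2 := qf_smul T c g
  simp only [qf] at *
  rw [map_add, inner_add_left, inner_add_right, inner_add_right, Complex.add_re, Complex.add_re,
    Complex.add_re, h1, h2, inner_smul_right]
  ring

/-- A null vector of a form which is nonnegative on a subspace is in the kernel of the form. -/
theorem inner_eq_zero_of_qf_eq_zero (T : X →L[ℂ] X)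
    (hT : ∀ x y, inner ℂ (T x) y = inner ℂ x (T y))
    (N : Submodule ℂ X) (hpos : ∀ f ∈ N, 0 ≤ qf T f) (f : X) (hf : f ∈ N) (h0 : qf T f = 0)
    (g : X) (hg : g ∈ N) : inner ℂ (T f) g = 0 := by
  by_contra hne
  set z := inner ℂ (T f) g
  have hz : 0 < ‖z‖ ^ 2 := by positivity
  have key : ∀ t : ℝ, 0 ≤ 2 * t * ‖z‖ ^ 2 + t ^ 2 * (‖z‖ ^ 2 * qf T g) := by
    intro t
    have h1 := hpos (f + ((t : ℂ) * (starRingEnd ℂ) z) • g) (N.add_mem hf (N.smul_mem _ hg))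
    rw [qf_add_smul T hT, h0] at h1
    have h2 : ((t : ℂ) * (starRingEnd ℂ) z * inner ℂ (T f) g).re = t * ‖z‖ ^ 2 := by
      rw [mul_assoc, mul_comm ((starRingEnd ℂ) z), Complex.mul_conj, Complex.normSq_eq_norm_sq,
        ← Complex.ofReal_mul, Complex.ofReal_re]
    rw [h2, norm_mul, Complex.norm_real, Complex.norm_conj, mul_pow, Real.norm_eq_abs, sq_abs] at h1
    linarith
  set q := qf T g
  have hq : 0 ≤ q := hpos g hg
  -- At t = -1/(1+q) the quadratic 2t + t²q equals -(2+q)/(1+q)², which is negative. No case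
  -- distinction on q = 0 is needed.
  have h3 := key (-(1 / (1 + q)))
  have h4 : 2 * -(1 / (1 + q)) * ‖z‖ ^ 2 + (-(1 / (1 + q))) ^ 2 * (‖z‖ ^ 2 * q)
      = -(‖z‖ ^ 2) * ((2 + q) / (1 + q) ^ 2) := by
    field_simp
    ring
  rw [h4] at h3
  have h5 : 0 < ‖z‖ ^ 2 * ((2 + q) / (1 + q) ^ 2) := by positivity
  linarith

namespace IsSchr

variable {R W : X →L[ℂ] X} {L : X →ₗ.[ℂ] X}

/-- The form of an operator with one simple negative eigenvalue is nonnegative on the orthogonal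
complement of its eigenvector. -/
theorem qf_nonneg_of_neg_eigenvalue [CompleteSpace X] (h : IsSchr R W L)
    (hK : IsCompactOperator (W ∘L R)) (E₁ : ℝ) (ψ : X) (hψ0 : ψ ≠ 0)
    (hψ : ψ ∈ opKer (opShift L E₁))
    (huniq : ∀ E₂ : ℝ, E₂ < 0 → opKer (opShift L E₂) ≤ Submodule.span ℂ {ψ})
    (f : X) (hf : inner ℂ (R ψ) f = 0) : 0 ≤ qf (formOp R W) f := by
  obtain ⟨hψD, hLψ⟩ := (mem_opKer_opShift_iff L _ ψ).mp hψ
  obtain ⟨k, hk⟩ := (h.mem_domain ψ).mp hψD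
  set N := perp (R ψ)
  set T : ℝ → (X →L[ℂ] X) := fun μ => formOp R (W + (μ : ℂ) • 1)
  have hTq : ∀ μ f, qf (T μ) f = qf (formOp R W) f + μ * ‖R f‖ ^ 2 := by
    intro μ f
    have h1 : T μ f = formOp R W f + (μ : ℂ) • R (R f) := by
      simp only [T, formOp_apply, add_apply, smul_apply, one_apply_eq_self, map_add, map_smul]
      abel
    rw [qf, h1, inner_add_left, Complex.add_re, inner_smul_left, Complex.conj_ofReal, h.R_symm,
      inner_self_eq_norm_sq_to_K, Complex.re_ofReal_mul]
    norm_cast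
  -- The shifts μ ≥ 0 for which L + μ is nonnegative on the complement of ψ. The infimum m is
  -- attained, and the claim is m = 0. If m > 0, a null vector of L + m in the complement would be
  -- an eigenvector of L for -m < 0, hence a multiple of ψ and so zero. Then L + m is coercive there
  -- and m can be lowered.
  let S : Set ℝ := {μ | 0 ≤ μ ∧ ∀ f ∈ N, 0 ≤ qf (T μ) f}
  have hSne : S.Nonempty := by
    refine ⟨‖W‖, norm_nonneg _, fun f _ => ?_⟩
    rw [hTq]
    have h1 : qf (formOp R W) f = ‖f‖ ^ 2 + qf W (R f) := by
      rw [qf, formOp_apply, inner_add_left, Complex.add_re, h.R_symm, qf]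
      congr 1
      exact inner_self_eq_norm_sq (𝕜 := ℂ) f
    have h2 := (abs_le.mp (qf_le W (R f))).1
    have h3 : 0 ≤ ‖f‖ ^ 2 := by positivity
    linarith
  have hSbdd : BddBelow S := ⟨0, fun μ hμ => hμ.1⟩
  set m := sInf S
  have hm0 : 0 ≤ m := le_csInf hSne fun μ hμ => hμ.1
  have hmS : ∀ f ∈ N, 0 ≤ qf (T m) f := by
    intro f hf
    obtain ⟨u, -, hu, huS⟩ := exists_seq_tendsto_sInf hSne hSbdd
    have h1 : Tendsto (fun j => qf (formOp R W) f + u j * ‖R f‖ ^ 2) atTop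
        (𝓝 (qf (formOp R W) f + m * ‖R f‖ ^ 2)) := (hu.mul_const _).const_add _
    rw [hTq]
    refine ge_of_tendsto' h1 fun j => ?_
    rw [← hTq]
    exact (huS j).2 f hf
  have hWm : ∀ x y : X, inner ℂ ((W + (m : ℂ) • 1 : X →L[ℂ] X) x) y
      = inner ℂ x ((W + (m : ℂ) • 1 : X →L[ℂ] X) y) := by
    intro x y
    simp only [add_apply, smul_apply, one_apply_eq_self, inner_add_left, inner_add_right, h.W_symm,
      inner_smul_left, inner_smul_right, Complex.conj_ofReal]
  have hTm : ∀ x y : X, inner ℂ (T m x) y = inner ℂ x (T m y) := by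
    intro x y
    simp only [T, formOp_apply, inner_add_left, inner_add_right, h.R_symm, hWm]
  rcases hm0.eq_or_lt with hm | hm
  · have := hmS f hf
    rw [hTq, ← hm] at this
    linarith
  exfalso
  have hzero : ∀ f ∈ N, qf (T m) f = 0 → f = 0 := by
    intro f hf h0
    have hTkf : ∀ g, T m g = formOp R W g + (m : ℂ) • R (R g) := by
      intro g
      simp only [T, formOp_apply, add_apply, smul_apply, one_apply_eq_self, map_add, map_smul]
      abel
    have hk2 : formOp R W (R k) = (E₁ : ℂ) • R ψ := by
      rw [h.formOp_eq ⟨ψ, hψD⟩ (R k) hk, hLψ, map_smul]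
    have hψk : inner ℂ (R ψ) (R k) = ((‖ψ‖ ^ 2 : ℝ) : ℂ) := by
      rw [h.R_symm, hk, inner_self_eq_norm_sq_to_K]
      norm_cast
    have hψn : ((‖ψ‖ ^ 2 : ℝ) : ℂ) ≠ 0 := by
      have : ‖ψ‖ ≠ 0 := norm_ne_zero_iff.mpr hψ0
      exact_mod_cast pow_ne_zero 2 this
    -- Minimality gives this only against vectors of N. The missing direction is Rk, that is R⁻¹ψ,
    -- which the form operator sends to a multiple of Rψ, and f is orthogonal to Rψ.
    have hTf : T m f = 0 := by
      refine ext_inner_right ℂ fun g => ?_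
      set c : ℂ := inner ℂ (R ψ) g / ((‖ψ‖ ^ 2 : ℝ) : ℂ)
      have hg' : g - c • R k ∈ N := by
        rw [mem_perp, inner_sub_right, inner_smul_right, hψk, div_mul_cancel₀ _ hψn, sub_self]
      have h1 := inner_eq_zero_of_qf_eq_zero (T m) hTm N hmS f hf h0 _ hg'
      have h2 : inner ℂ (T m f) (R k) = 0 := by
        rw [hTm, hTkf, hk2, hk, ← add_smul, inner_smul_right, ← inner_conj_symm,
          (mem_perp _ _).mp hf, map_zero, mul_zero]
      rw [inner_sub_right, inner_smul_right, h2, mul_zero, sub_zero] at h1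
      rw [h1, inner_zero_left]
    have h3 : formOp R W f = R (-((m : ℂ) • R f)) := by
      rw [map_neg, map_smul]
      exact eq_neg_of_add_eq_zero_left ((hTkf f).symm.trans hTf)
    obtain ⟨hx, hLx⟩ := h.of_formOp_eq f _ h3
    have h4 : R f ∈ opKer (opShift L ((-m : ℝ) : ℂ)) := by
      rw [mem_opKer_opShift_iff]
      refine ⟨hx, ?_⟩
      rw [hLx]
      push_cast
      rw [neg_smul]
    obtain ⟨c, hc⟩ := Submodule.mem_span_singleton.mp (huniq (-m) (by linarith) h4)
    have h5 : inner ℂ ψ (R f) = 0 := by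
      rw [← h.R_symm]
      exact hf
    have hu0 : R f = 0 := by
      rw [← hc] at h5 ⊢
      rw [inner_smul_right, mul_eq_zero, inner_self_eq_zero] at h5
      rw [h5.resolve_right hψ0, zero_smul]
    exact h.R_inj f hu0
  have hcpt : IsCompactOperator (R ∘L W ∘L R : X →L[ℂ] X) := hK.clm_comp R
  obtain ⟨c, hc, hcoer⟩ := exists_coercive_of_compact (T m) (R ∘L W ∘L R) hcpt (fun f => by
    rw [hTq, qf_formOp]
    have : 0 ≤ m * ‖R f‖ ^ 2 := by positivity
    linarith) N (isClosed_perp _) hmS hzero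
  -- Lowering the shift by ε costs at most ε‖R‖²‖f‖², which the coercivity constant c absorbs. The
  -- minimum with m keeps the new shift nonnegative.
  set ε := min m (c / (1 + ‖R‖ ^ 2))
  have hε : 0 < ε := lt_min hm (by positivity)
  have hmem : m - ε ∈ S := by
    refine ⟨sub_nonneg.mpr (min_le_left _ _), fun f hf => ?_⟩
    have h1 := hcoer f hf
    rw [hTq] at h1 ⊢
    have h2 : ε * ‖R f‖ ^ 2 ≤ c * ‖f‖ ^ 2 := by
      calc ε * ‖R f‖ ^ 2 ≤ (c / (1 + ‖R‖ ^ 2)) * (‖R‖ * ‖f‖) ^ 2 := by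
            gcongr
            · exact min_le_right _ _
            · exact R.le_opNorm f
        _ = c * ‖f‖ ^ 2 * (‖R‖ ^ 2 / (1 + ‖R‖ ^ 2)) := by ring
        _ ≤ c * ‖f‖ ^ 2 * 1 := by
            gcongr
            rw [div_le_one (by positivity)]
            linarith
        _ = _ := mul_one _
    linarith
  have := csInf_le hSbdd hmem
  linarith

/-- Nonnegativity of the form follows from nonnegativity of the operator. -/
theorem qf_nonneg_of_nonneg [CompleteSpace X] (h : IsSchr R W L)
    (hpos : ∀ x : L.domain, 0 ≤ (inner ℂ (x : X) (L x)).re) (f : X) :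
    0 ≤ qf (formOp R W) f := by
  have hcl : IsClosed {f : X | 0 ≤ qf (formOp R W) f} :=
    isClosed_le continuous_const (continuous_qf _)
  refine h.dense_range.induction_on (p := fun f => 0 ≤ qf (formOp R W) f) f hcl fun k => ?_
  have hx : R (R k) ∈ L.domain := (h.mem_domain _).mpr ⟨k, rfl⟩
  rw [h.qf_formOp_eq ⟨R (R k), hx⟩ (R k) rfl, ← Complex.conj_re, inner_conj_symm]
  exact hpos _

/-- Coercivity of the form of a nonnegative operator on a closed subspace that does not meet the
kernel. -/
theorem exists_coercive_of_nonneg [CompleteSpace X] (h : IsSchr R W L)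
    (hK : IsCompactOperator (W ∘L R)) (hpos : ∀ x : L.domain, 0 ≤ (inner ℂ (x : X) (L x)).re)
    (N : Submodule ℂ X) (hN : IsClosed (N : Set X))
    (hker : ∀ f ∈ N, R f ∈ opKer L → R f = 0) :
    ∃ c : ℝ, 0 < c ∧ ∀ f ∈ N, c * ‖f‖ ^ 2 ≤ qf (formOp R W) f := by
  have hp := h.qf_nonneg_of_nonneg hpos
  refine exists_coercive_of_compact (formOp R W) (R ∘L W ∘L R) (hK.clm_comp R)
    (fun f => (qf_formOp R W f).ge) N hN (fun f _ => hp f) fun f hf h0 => ?_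
  have h1 : formOp R W f = R 0 := by
    rw [map_zero]
    refine ext_inner_right ℂ fun g => ?_
    rw [inner_zero_left]
    exact inner_eq_zero_of_qf_eq_zero _ h.formOp_symm ⊤ (fun f _ => hp f) f trivial h0 g trivial
  obtain ⟨hx, hL⟩ := h.of_formOp_eq f 0 h1
  exact h.R_inj f (hker f hf ((mem_opKer_iff L _).mpr ⟨hx, hL⟩))

/-- If `L` has one simple negative eigenvalue, `L g = - a φ` and `a ⟨φ, g⟩ > 0`, then the form of
`L` is nonnegative on the orthogonal complement of `φ`, and coercive on closed subspaces of it that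
do not meet the kernel. -/
theorem exists_coercive_of_neg_eigenvalue [CompleteSpace X] (h : IsSchr R W L)
    (hK : IsCompactOperator (W ∘L R)) (E₁ : ℝ) (ψ : X) (hψ0 : ψ ≠ 0)
    (hψ : ψ ∈ opKer (opShift L E₁))
    (huniq : ∀ E₂ : ℝ, E₂ < 0 → opKer (opShift L E₂) ≤ Submodule.span ℂ {ψ})
    (g : L.domain) (φ : X) (a p : ℝ) (ha : 0 < a) (hp : 0 < p) (hg : L g = -((a : ℂ) • φ))
    (hgφ : inner ℂ φ (g : X) = (p : ℂ)) (N : Submodule ℂ X) (hN : IsClosed (N : Set X))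
    (hNφ : ∀ f ∈ N, inner ℂ φ (R f) = 0)
    (hker : ∀ f ∈ N, R f ∈ opKer L → R f = 0) :
    ∃ c : ℝ, 0 < c ∧ ∀ f ∈ N, c * ‖f‖ ^ 2 ≤ qf (formOp R W) f := by
  obtain ⟨k, hk⟩ := (h.mem_domain (g : X)).mp g.2
  have hpsi := h.qf_nonneg_of_neg_eigenvalue hK E₁ ψ hψ0 hψ huniq
  have hTg : formOp R W (R k) = -((a : ℂ) • R φ) := by
    rw [h.formOp_eq g (R k) hk, hg, map_neg, map_smul]
  have hqg : qf (formOp R W) (R k) = -(a * p) := by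
    rw [h.qf_formOp_eq g (R k) hk, hg, inner_neg_left, inner_smul_left, hgφ, Complex.conj_ofReal,
      ← Complex.ofReal_mul, Complex.neg_re, Complex.ofReal_re]
  -- Otherwise the form would be nonnegative at g, where its value is -ap.
  have hne : inner ℂ (R ψ) (R k) ≠ 0 := by
    intro h0
    have h1 := hpsi _ h0
    rw [hqg] at h1
    have : 0 < a * p := by positivity
    linarith
  have hRk : ∀ f, inner ℂ (R φ) f = 0 → inner ℂ (formOp R W f) (R k) = 0 := by
    intro f hf
    rw [h.formOp_symm, hTg, inner_neg_right, inner_smul_right, ← inner_conj_symm, hf, map_zero,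
      mul_zero, neg_zero]
  have hpos : ∀ f ∈ perp (R φ), 0 ≤ qf (formOp R W) f := by
    intro f hf
    -- Adding sg moves the vector into the complement of ψ, where the form is nonnegative. The cross
    -- term vanishes because Lg is a multiple of φ, so the form at f is at least ‖s‖²ap.
    set s : ℂ := -(inner ℂ (R ψ) f / inner ℂ (R ψ) (R k))
    have h1 := hpsi (f + s • R k) (by
      rw [inner_add_right, inner_smul_right, neg_mul, div_mul_cancel₀ _ hne, add_neg_cancel])
    rw [qf_add_smul _ h.formOp_symm, hRk f hf, hqg, mul_zero, Complex.zero_re] at h1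
    have h2 : 0 ≤ ‖s‖ ^ 2 * (a * p) := by positivity
    linarith
  have hNperp : ∀ f ∈ N, f ∈ perp (R φ) := by
    intro f hf
    rw [mem_perp, h.R_symm]
    exact hNφ f hf
  refine exists_coercive_of_compact (formOp R W) (R ∘L W ∘L R) (hK.clm_comp R)
    (fun f => (qf_formOp R W f).ge) N hN (fun f hf => hpos f (hNperp f hf)) fun f hf h0 => ?_
  have hp0 : inner ℂ (R φ) (R k) = (p : ℂ) := by rw [h.R_symm, hk, hgφ]
  have hpC : (p : ℂ) ≠ 0 := by exact_mod_cast hp.ne'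
  have h1 : formOp R W f = R 0 := by
    rw [map_zero]
    refine ext_inner_right ℂ fun v => ?_
    have h2 : v - (inner ℂ (R φ) v / (p : ℂ)) • R k ∈ perp (R φ) := by
      rw [mem_perp, inner_sub_right, inner_smul_right, hp0, div_mul_cancel₀ _ hpC, sub_self]
    have h3 := inner_eq_zero_of_qf_eq_zero _ h.formOp_symm _ hpos f (hNperp f hf) h0 _ h2
    rw [inner_sub_right, inner_smul_right, hRk f (hNperp f hf), mul_zero, sub_zero] at h3
    rw [h3, inner_zero_left]
  obtain ⟨hx, hL⟩ := h.of_formOp_eq f 0 h1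
  exact h.R_inj f (hker f hf ((mem_opKer_iff L _).mpr ⟨hx, hL⟩))

/-- Fredholm alternative: `L x = y` is solvable if `y` is orthogonal to the kernel. -/
theorem exists_solution [CompleteSpace X] (h : IsSchr R W L) (hK : IsCompactOperator (W ∘L R))
    (hfin : FiniteDimensional ℂ (opKer L)) (y : X) (hy : y ∈ (opKer L)ᗮ) :
    ∃ x : L.domain, L x = y := by
  set pr : X →L[ℂ] X := (opKer L).starProjection
  have hpr : IsCompactOperator pr := by
    have : ProperSpace (opKer L) := FiniteDimensional.proper ℂ _
    have h1 : IsCompactOperator (opKer L).orthogonalProjectionOnto :=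
      isCompactOperator_of_locallyCompactSpace_dom _
    exact h1.clm_comp (opKer L).subtypeL
  -- 1 - K is (L + pr)R², with pr the projection onto ker L. By symmetry pr L = 0, so (L + pr)x = 0
  -- forces first pr x = 0, then Lx = 0, then x = 0. Injectivity gives surjectivity since K is
  -- compact, and for y orthogonal to ker L the term pr x of the solution vanishes.
  set K : X →L[ℂ] X := -(W ∘L R ∘L R + pr ∘L R ∘L R)
  have hKc : IsCompactOperator K :=
    ((hK.comp_clm R).add (hpr.comp_clm (R ∘L R))).neg
  have hKapp : ∀ f, K f = -(W (R (R f)) + pr (R (R f))) := fun f => rfl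
  have hsym : ∀ x : L.domain, pr (L x) = 0 := by
    intro x
    rw [Submodule.starProjection_apply_eq_zero_iff, Submodule.mem_orthogonal]
    intro u hu
    obtain ⟨huD, hLu⟩ := (mem_opKer_iff L u).mp hu
    rw [← h.symm ⟨u, huD⟩ x, hLu, inner_zero_left]
  rcases hKc.hasEigenvalue_or_mem_resolventSet (one_ne_zero (α := ℂ)) with hev | hres
  · exfalso
    obtain ⟨f, hf⟩ := hev.exists_hasEigenvector
    have hf1 : K f = f := by simpa using hf.apply_eq_smul
    have hx : R (R f) ∈ L.domain := (h.mem_domain _).mpr ⟨f, rfl⟩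
    have h1 : L ⟨R (R f), hx⟩ + pr (R (R f)) = 0 := by
      rw [h.apply ⟨R (R f), hx⟩ f rfl]
      have := hKapp f
      rw [hf1] at this
      nth_rewrite 1 [this]
      simp
    have hpp : pr (pr (R (R f))) = pr (R (R f)) :=
      Submodule.starProjection_eq_self_iff.mpr (Submodule.starProjection_apply_mem _ _)
    have h2 : pr (R (R f)) = 0 := by
      have := congrArg pr h1
      rwa [map_add, hsym, zero_add, map_zero, hpp] at this
    rw [h2, add_zero] at h1
    have h3 : pr (R (R f)) = R (R f) :=
      Submodule.starProjection_eq_self_iff.mpr ((mem_opKer_iff L _).mpr ⟨hx, h1⟩)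
    rw [h2] at h3
    exact hf.2 (h.R_inj _ (h.R_inj _ h3.symm))
  · have hu : IsUnit (1 - K) := by
      have := spectrum.mem_resolventSet_iff.mp hres
      rwa [map_one] at this
    obtain ⟨f, hf⟩ := (ContinuousLinearMap.isUnit_iff_bijective.mp hu).2 y
    have hx : R (R f) ∈ L.domain := (h.mem_domain _).mpr ⟨f, rfl⟩
    have h1 : L ⟨R (R f), hx⟩ + pr (R (R f)) = y := by
      rw [h.apply ⟨R (R f), hx⟩ f rfl, ← hf, sub_apply, one_apply_eq_self, hKapp]
      simp only
      abel
    have hpp : pr (pr (R (R f))) = pr (R (R f)) :=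
      Submodule.starProjection_eq_self_iff.mpr (Submodule.starProjection_apply_mem _ _)
    have h2 : pr (R (R f)) = 0 := by
      have := congrArg pr h1
      rwa [map_add, hsym, zero_add, hpp,
        (Submodule.starProjection_apply_eq_zero_iff (K := opKer L)).mpr hy] at this
    exact ⟨⟨R (R f), hx⟩, by rw [← h1, h2, add_zero]⟩

end IsSchr

end AbstractForm

/-! ### Strongly continuous groups: perturbation and resolvent -/

section Groups

variable {H : Type*} [NormedAddCommGroup H] [InnerProductSpace ℂ H]

theorem hasDerivAt_clm_apply {H' : Type*} [NormedAddCommGroup H'] [InnerProductSpace ℂ H']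
    (T : H →L[ℂ] H') {f : ℝ → H} {f' : H} {t : ℝ} (hf : HasDerivAt f f' t) :
    HasDerivAt (fun s => T (f s)) (T f') t :=
  (T.restrictScalars ℝ).hasFDerivAt.comp_hasDerivAt t hf

namespace IsC0Group

variable {U : ℝ → H →L[ℂ] H} {G : H →ₗ.[ℂ] H}

theorem apply_mem_domain (h : IsC0Group U G) (x : G.domain) (t : ℝ) :
    ∃ hx : U t x ∈ G.domain, G ⟨U t x, hx⟩ = U t (G x) := by
  have h1 := (h.generator x (G x)).mp (G.mem_graph x)
  have h2 : HasDerivAt (fun s => U s (U t x)) (U t (G x)) 0 := by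
    have h3 : (fun s => U s (U t x)) = fun s => U t (U s x) := by
      ext s
      rw [← ContinuousLinearMap.comp_apply, ← ContinuousLinearMap.comp_apply, ← h.add, ← h.add,
        add_comm]
    rw [h3]
    exact hasDerivAt_clm_apply (U t) h1
  obtain ⟨y, hy, hy'⟩ := G.mem_graph_iff.mp ((h.generator _ _).mpr h2)
  simp only at hy hy'
  refine ⟨hy ▸ y.2, ?_⟩
  rw [← hy']
  congr 1
  exact Subtype.ext hy.symm

theorem hasDerivAt (h : IsC0Group U G) (x : G.domain) (t : ℝ) :
    HasDerivAt (fun s => U s x) (U t (G x)) t := by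
  have h1 := (h.generator x (G x)).mp (G.mem_graph x)
  have h2 : HasDerivAt (fun s => U t (U s x)) (U t (G x)) 0 :=
    hasDerivAt_clm_apply (U t) h1
  have h3 : HasDerivAt (fun s => U t (U (s - t) x)) (U t (G x)) t := by
    have h4 : HasDerivAt (fun s : ℝ => s - t) 1 t := (hasDerivAt_id t).sub_const t
    have h5 := HasDerivAt.scomp (𝕜 := ℝ) (h := fun s : ℝ => s - t)
      (g₁ := fun s => U t (U s x)) t (by simpa using h2) h4
    simpa [Function.comp_def] using h5
  refine h3.congr_of_eventuallyEq (Eventually.of_forall fun s => ?_)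
  show U s x = U t (U (s - t) x)
  rw [← ContinuousLinearMap.comp_apply, ← h.add, add_sub_cancel]

theorem neg_apply_apply (h : IsC0Group U G) (t : ℝ) (x : H) : U (-t) (U t x) = x := by
  rw [← ContinuousLinearMap.comp_apply, ← h.add, neg_add_cancel, h.zero]
  rfl

theorem neg (h : IsC0Group U G) : IsC0Group (fun t => U (-t)) (-G) where
  zero := by simp [h.zero]
  add s t := by rw [neg_add, h.add]
  continuous x := (h.continuous x).comp continuous_neg
  generator x y := by
    have h1 : (x, y) ∈ (-G).graph ↔ (x, -y) ∈ G.graph := by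
      rw [LinearPMap.mem_graph_iff, LinearPMap.mem_graph_iff]
      refine exists_congr fun z => and_congr_right fun _ => ?_
      exact neg_eq_iff_eq_neg
    rw [h1, h.generator]
    constructor
    · intro h2
      have := HasDerivAt.scomp (𝕜 := ℝ) (h := fun s : ℝ => -s) (g₁ := fun s => U s x) 0
        (by simpa using h2) (hasDerivAt_neg (0 : ℝ))
      simpa [Function.comp_def] using this
    · intro h2
      have := HasDerivAt.scomp (𝕜 := ℝ) (h := fun s : ℝ => -s) (g₁ := fun s => U (-s) x) 0
        (by simpa using h2) (hasDerivAt_neg (0 : ℝ))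
      simpa [Function.comp_def] using this

end IsC0Group

/-- Strong convergence together with a uniform norm bound allows the argument to vary. The groups
here are only strongly continuous, so this replaces continuity in operator norm. -/
theorem tendsto_apply_of_bounded {ι : Type*} {l : Filter ι} {F : ι → H →L[ℂ] H} {x₀ z : H}
    (hF : Tendsto (fun i => F i x₀) l (𝓝 z)) {M : ℝ} (hM : ∀ i, ‖F i‖ ≤ M) {y : ι → H}
    (hy : Tendsto y l (𝓝 x₀)) : Tendsto (fun i => F i (y i)) l (𝓝 z) := by
  have h1 : Tendsto (fun i => F i (y i - x₀)) l (𝓝 0) := by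
    refine squeeze_zero_norm (a := fun i => M * ‖y i - x₀‖) (fun i => ?_) ?_
    · exact ((F i).le_opNorm _).trans (by gcongr; exact hM i)
    · simpa using ((hy.sub_const x₀).norm).const_mul M
  have h3 := h1.add hF
  simp only [map_sub, sub_add_cancel, zero_add] at h3
  exact h3

theorem continuous_apply_of_bounded {F : ℝ → H →L[ℂ] H} (hF : ∀ x, Continuous fun t => F t x)
    {M : ℝ} (hM : ∀ t, ‖F t‖ ≤ M) {y : ℝ → H} (hy : Continuous y) :
    Continuous fun t => F t (y t) :=
  continuous_iff_continuousAt.mpr fun t₀ =>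
    tendsto_apply_of_bounded ((hF (y t₀)).tendsto t₀) hM (hy.tendsto t₀)

theorem abs_integral_exp_mul_abs_le {l : ℝ} (hl : 0 < l) (t : ℝ) :
    |∫ s in (0 : ℝ)..t, Real.exp (l * |s|)| ≤ Real.exp (l * |t|) / l := by
  have hpos : ∀ t : ℝ, 0 ≤ t →
      |∫ s in (0 : ℝ)..t, Real.exp (l * |s|)| ≤ Real.exp (l * |t|) / l := by
    intro t ht
    have h1 : ∫ s in (0 : ℝ)..t, Real.exp (l * |s|) = ∫ s in (0 : ℝ)..t, Real.exp (l * s) := by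
      refine intervalIntegral.integral_congr fun s hs => ?_
      rw [uIcc_of_le ht] at hs
      simp only [abs_of_nonneg hs.1]
    have h2 : ∫ s in (0 : ℝ)..t, Real.exp (l * s) = (Real.exp (l * t) - 1) / l := by
      rw [intervalIntegral.integral_comp_mul_left (fun s => Real.exp s) hl.ne', integral_exp]
      simp [div_eq_inv_mul]
    rw [h1, h2, abs_of_nonneg ht, abs_of_nonneg]
    · gcongr
      linarith
    · apply div_nonneg _ hl.le
      have := Real.one_le_exp (show 0 ≤ l * t by positivity)
      linarith
  rcases le_total 0 t with ht | ht
  · exact hpos t ht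
  · have h1 := hpos (-t) (by linarith)
    have h2 := intervalIntegral.integral_comp_neg (a := 0) (b := -t)
      (fun s => Real.exp (l * |s|))
    simp only [abs_neg, neg_neg, neg_zero] at h1 h2
    rw [h2, intervalIntegral.integral_symm, abs_neg] at h1
    exact h1

/-- The propagator of `x' = c(t) x` for a bounded, strongly continuous family `c`. -/
theorem exists_propagator [CompleteSpace H] (c : ℝ → H →L[ℂ] H)
    (hc : ∀ x, Continuous fun t => c t x) (b : ℝ) (hb : ∀ t, ‖c t‖ ≤ b) :
    ∃ Ω : ℝ → H →L[ℂ] H, (∀ x, Ω 0 x = x) ∧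
      ∀ x t, HasDerivAt (fun s => Ω s x) (c t (Ω t x)) t := by
  have hb0 : 0 ≤ b := (norm_nonneg _).trans (hb 0)
  -- In the norm sup e^(-l|t|)‖y(t)‖ the Volterra operator has norm at most b/l < 1, so a Neumann
  -- series solves the integral equation on the whole line at once. The unknown Y below is
  -- e^(-l|t|)Ω(t), which is a bounded function.
  set l : ℝ := 2 * b + 1
  have hl : 0 < l := by positivity
  have hcy : ∀ y : BoundedContinuousFunction ℝ H,
      Continuous fun s => Real.exp (l * |s|) • c s (y s) := fun y =>
    (by fun_prop : Continuous fun s : ℝ => Real.exp (l * |s|)).smul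
      (continuous_apply_of_bounded hc hb y.continuous)
  have hint : ∀ (y : BoundedContinuousFunction ℝ H) (a t : ℝ),
      IntervalIntegrable (fun s => Real.exp (l * |s|) • c s (y s)) volume a t :=
    fun y a t => (hcy y).intervalIntegrable a t
  have hIcont : ∀ y : BoundedContinuousFunction ℝ H, Continuous fun t =>
      Real.exp (-(l * |t|)) • ∫ s in (0 : ℝ)..t, Real.exp (l * |s|) • c s (y s) := by
    intro y
    have h1 : Continuous fun t : ℝ => Real.exp (-(l * |t|)) := by fun_prop
    have h2 := intervalIntegral.continuous_primitive (hint y) 0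
    exact Continuous.smul (M := ℝ) h1 h2
  have hbound : ∀ (y : BoundedContinuousFunction ℝ H) (t : ℝ),
      ‖Real.exp (-(l * |t|)) • ∫ s in (0 : ℝ)..t, Real.exp (l * |s|) • c s (y s)‖
        ≤ b / l * ‖y‖ := by
    intro y t
    have h1 : ‖∫ s in (0 : ℝ)..t, Real.exp (l * |s|) • c s (y s)‖
        ≤ |∫ s in (0 : ℝ)..t, Real.exp (l * |s|) * (b * ‖y‖)| := by
      refine intervalIntegral.norm_integral_le_abs_of_norm_le (Eventually.of_forall fun s => ?_)
        (Continuous.intervalIntegrable (by fun_prop) _ _)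
      rw [norm_smul, Real.norm_eq_abs, Real.abs_exp]
      gcongr
      exact ((c s).le_opNorm _).trans (mul_le_mul (hb s) (y.norm_coe_le_norm s) (norm_nonneg _) hb0)
    rw [intervalIntegral.integral_mul_const, abs_mul, abs_of_nonneg (by positivity : 0 ≤ b * ‖y‖)]
      at h1
    rw [norm_smul, Real.norm_eq_abs, Real.abs_exp]
    calc Real.exp (-(l * |t|)) * ‖∫ s in (0 : ℝ)..t, Real.exp (l * |s|) • c s (y s)‖
        ≤ Real.exp (-(l * |t|)) * (Real.exp (l * |t|) / l * (b * ‖y‖)) := by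
          gcongr
          exact h1.trans (by gcongr; exact abs_integral_exp_mul_abs_le hl t)
      _ = (Real.exp (-(l * |t|)) * Real.exp (l * |t|)) * (b / l * ‖y‖) := by ring
      _ = _ := by rw [← Real.exp_add, neg_add_cancel, Real.exp_zero, one_mul]
  let V₀ : BoundedContinuousFunction ℝ H →ₗ[ℂ] BoundedContinuousFunction ℝ H :=
    { toFun := fun y => BoundedContinuousFunction.ofNormedAddCommGroup
        (fun t => Real.exp (-(l * |t|)) • ∫ s in (0 : ℝ)..t, Real.exp (l * |s|) • c s (y s))
        (hIcont y) _ (hbound y)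
      map_add' := fun y z => by
        ext t
        simp only [BoundedContinuousFunction.coe_ofNormedAddCommGroup,
          BoundedContinuousFunction.coe_add, Pi.add_apply, map_add, smul_add]
        rw [intervalIntegral.integral_add (hint y 0 t) (hint z 0 t), smul_add]
      map_smul' := fun a y => by
        ext t
        simp only [BoundedContinuousFunction.coe_ofNormedAddCommGroup,
          BoundedContinuousFunction.coe_smul, map_smul, RingHom.id_apply]
        simp_rw [smul_comm _ a]
        rw [intervalIntegral.integral_smul, smul_comm] }
  have hV₀ : ∀ y, ‖V₀ y‖ ≤ b / l * ‖y‖ := fun y =>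
    BoundedContinuousFunction.norm_ofNormedAddCommGroup_le _ (by positivity) (hbound y)
  let V := V₀.mkContinuous (b / l) hV₀
  have hV1 : ‖V‖ < 1 := by
    refine (V₀.mkContinuous_norm_le (by positivity) hV₀).trans_lt ?_
    rw [div_lt_one hl]
    linarith
  have hunit : IsUnit (1 - V) := isUnit_one_sub_of_norm_lt_one (x := V) hV1
  have hdec : ∀ t : ℝ, Real.exp (-(l * |t|)) ≤ 1 := fun t =>
    Real.exp_le_one_iff.mpr (by have : 0 ≤ l * |t| := by positivity
                                linarith)
  have hCb : ∀ (x : H) (t : ℝ), ‖Real.exp (-(l * |t|)) • x‖ ≤ 1 * ‖x‖ := by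
    intro x t
    rw [norm_smul, Real.norm_eq_abs, Real.abs_exp]
    gcongr
    exact hdec t
  let C₀ : H →ₗ[ℂ] BoundedContinuousFunction ℝ H :=
    { toFun := fun x => BoundedContinuousFunction.ofNormedAddCommGroup
        (fun t => Real.exp (-(l * |t|)) • x) (by fun_prop) _ (hCb x)
      map_add' := fun x y => by
        ext t
        simp
      map_smul' := fun a x => by
        ext t
        exact smul_comm _ _ _ }
  let C := C₀.mkContinuous 1 fun x =>
    BoundedContinuousFunction.norm_ofNormedAddCommGroup_le _ (by positivity) (hCb x)
  let Y : H →L[ℂ] BoundedContinuousFunction ℝ H := Ring.inverse (1 - V) ∘L C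
  let Ω : ℝ → H →L[ℂ] H := fun t =>
    ((Real.exp (l * |t|) : ℝ) : ℂ) • (BoundedContinuousFunction.evalCLM ℂ t ∘L Y)
  have hΩY : ∀ t x, Ω t x = Real.exp (l * |t|) • Y x t := fun t x => Complex.coe_smul _ _
  have hYeq : ∀ x t, Y x t = Real.exp (-(l * |t|)) • x +
      Real.exp (-(l * |t|)) • ∫ s in (0 : ℝ)..t, Real.exp (l * |s|) • c s (Y x s) := by
    intro x t
    have h1 : (1 - V) (Y x) = C x := by
      show ((1 - V) * Ring.inverse (1 - V)) (C x) = C x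
      rw [Ring.mul_inverse_cancel _ hunit]
      rfl
    have h2 : Y x = C x + V (Y x) := by
      have h3 : (1 - V) (Y x) = Y x - V (Y x) := rfl
      rw [← h1, h3, sub_add_cancel]
    exact congrArg (fun f : BoundedContinuousFunction ℝ H => f t) h2
  have hΩeq : ∀ x t, Ω t x = x + ∫ s in (0 : ℝ)..t, c s (Ω s x) := by
    intro x t
    have h1 : ∀ s, c s (Ω s x) = Real.exp (l * |s|) • c s (Y x s) := by
      intro s
      rw [hΩY, ContinuousLinearMap.map_smul_of_tower]
    simp_rw [h1]
    rw [hΩY, hYeq, smul_add, smul_smul, smul_smul, ← Real.exp_add, add_neg_cancel, Real.exp_zero,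
      one_smul, one_smul]
  have hΩc : ∀ x, Continuous fun s => c s (Ω s x) := by
    intro x
    have h1 : ∀ s, c s (Ω s x) = Real.exp (l * |s|) • c s (Y x s) := by
      intro s
      rw [hΩY, ContinuousLinearMap.map_smul_of_tower]
    simp_rw [h1]
    exact hcy (Y x)
  refine ⟨Ω, fun x => by rw [hΩeq]; simp, fun x t => ?_⟩
  have h1 : (fun s => Ω s x) = fun s => x + ∫ r in (0 : ℝ)..s, c r (Ω r x) := funext (hΩeq x)
  rw [h1]
  exact (intervalIntegral.integral_hasDerivAt_right ((hΩc x).intervalIntegrable _ _)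
    (hΩc x).stronglyMeasurable.stronglyMeasurableAtFilter (hΩc x).continuousAt).const_add x

/-- Bounded perturbation of the generator of a bounded strongly continuous group. -/
theorem exists_isC0Group_add [CompleteSpace H] {U₀ : ℝ → H →L[ℂ] H} {G₀ : H →ₗ.[ℂ] H}
    (h : IsC0Group U₀ G₀) (M : ℝ) (hM : ∀ t, ‖U₀ t‖ ≤ M) (B : H →L[ℂ] H) (G : H →ₗ.[ℂ] H)
    (hG : ∀ x y, (x, y) ∈ G.graph ↔ (x, y - B x) ∈ G₀.graph) :
    ∃ U : ℝ → H →L[ℂ] H, IsC0Group U G := by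
  have hM0 : 0 ≤ M := (norm_nonneg _).trans (hM 0)
  -- Interaction picture: U = U₀Ω with Ω' = cΩ. The unbounded generator disappears and the equation
  -- for Ω has bounded coefficients.
  let c : ℝ → H →L[ℂ] H := fun t => U₀ (-t) ∘L B ∘L U₀ t
  have hcb : ∀ t, ‖c t‖ ≤ M * (‖B‖ * M) := by
    intro t
    refine (ContinuousLinearMap.opNorm_comp_le _ _).trans ?_
    refine mul_le_mul (hM _) ?_ (norm_nonneg _) hM0
    refine (ContinuousLinearMap.opNorm_comp_le _ _).trans ?_
    gcongr
    exact hM t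
  have hcc : ∀ x, Continuous fun t => c t x := by
    intro x
    exact continuous_apply_of_bounded (F := fun t => U₀ (-t))
      (fun x => (h.continuous x).comp continuous_neg) (fun t => hM _)
      (B.continuous.comp (h.continuous x))
  obtain ⟨Ω, hΩ0, hΩ⟩ := exists_propagator c hcc _ hcb
  have hΩcont : ∀ x, Continuous fun t => Ω t x := fun x =>
    continuous_iff_continuousAt.mpr fun t => (hΩ x t).continuousAt
  have huniq : ∀ (y : ℝ → H), (∀ t, HasDerivAt y (c t (y t)) t) → ∀ t, y t = Ω t (y 0) := by
    intro y hy t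
    have hK : ∀ t, LipschitzOnWith (Real.toNNReal (M * (‖B‖ * M))) (fun x => c t x) univ := by
      intro t
      refine ((c t).lipschitz.weaken ?_).lipschitzOnWith
      rw [← NNReal.coe_le_coe, Real.coe_toNNReal _ (by positivity)]
      exact hcb t
    have := ODE_solution_unique_univ (v := fun t x => c t x) (s := fun _ => univ) (t₀ := 0)
      (f := y) (g := fun t => Ω t (y 0)) hK (fun t => ⟨hy t, trivial⟩)
      (fun t => ⟨hΩ _ t, trivial⟩) (hΩ0 _).symm
    exact congrFun this t
  refine ⟨fun t => U₀ t ∘L Ω t, ?_, ?_, ?_, ?_⟩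
  · ext x
    simp [hΩ0, h.zero]
  · intro s t
    ext x
    show U₀ (s + t) (Ω (s + t) x) = U₀ s (Ω s (U₀ t (Ω t x)))
    -- This curve solves the same equation as Ω, with initial value U₀(t)Ω(t)x. Uniqueness is
    -- therefore the group law.
    have h1 := huniq (fun r => U₀ t (Ω (r + t) x)) (fun r => by
      have h2 : HasDerivAt (fun r => Ω (r + t) x) (c (r + t) (Ω (r + t) x)) r :=
        (hΩ x (r + t)).comp_add_const r t
      have h3 := hasDerivAt_clm_apply (U₀ t) h2
      convert h3 using 1
      show U₀ (-r) (B (U₀ r (U₀ t _))) = U₀ t (U₀ (-(r + t)) (B (U₀ (r + t) _)))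
      have e1 : U₀ (r + t) = U₀ r ∘L U₀ t := h.add r t
      have e2 : U₀ (-r) = U₀ t ∘L U₀ (-(r + t)) := by
        have := h.add t (-(r + t))
        rwa [show t + -(r + t) = -r by ring] at this
      rw [e1, e2]
      rfl) s
    simp only [zero_add] at h1
    rw [← h1, h.add]
    rfl
  · intro x
    exact continuous_apply_of_bounded h.continuous hM (hΩcont x)
  · intro x y
    rw [hG, h.generator]
    -- The two groups differ at t = 0 by a term with derivative Bx for every x, smooth or not. Hence
    -- one orbit is differentiable exactly when the other is, and the generators have the same
    -- domain.
    have h1 : HasDerivAt (fun t => U₀ t (Ω t x) - U₀ t x) (B x) 0 := by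
      have h2 := hΩ x 0
      have h3 : c 0 (Ω 0 x) = B x := by
        show U₀ (-0) (B (U₀ 0 (Ω 0 x))) = B x
        rw [neg_zero, h.zero, hΩ0]
        rfl
      rw [h3, hasDerivAt_iff_tendsto_slope_zero] at h2
      rw [hasDerivAt_iff_tendsto_slope_zero]
      have h4 : Tendsto (fun t => U₀ t (B x)) (𝓝[≠] 0) (𝓝 (B x)) := by
        have := ((h.continuous (B x)).tendsto 0).mono_left (nhdsWithin_le_nhds (s := {0}ᶜ))
        rwa [h.zero] at this
      refine (tendsto_apply_of_bounded h4 hM h2).congr fun t => ?_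
      simp only [zero_add, hΩ0, sub_self, sub_zero]
      rw [ContinuousLinearMap.map_smul_of_tower, map_sub]
    constructor
    · intro h2
      have := h1.add h2
      simpa [Pi.add_def] using this
    · intro h2
      have := h2.sub h1
      simpa [Pi.sub_def] using this

/-- The resolvent of the generator of a group as a Laplace transform. -/
theorem IsC0Group.exists_resolvent [CompleteSpace H] {U : ℝ → H →L[ℂ] H} {G : H →ₗ.[ℂ] H}
    (h : IsC0Group U G) (K ε : ℝ) (hK : ∀ t, ‖U t‖ ≤ K * Real.exp (ε * |t|)) (l : ℂ)
    (hl : ε < l.re) :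
    ∃ R : H →L[ℂ] H, (∀ x : G.domain, R (l • (x : H) - G x) = x) ∧
      ∀ y, ∃ hy : R y ∈ G.domain, l • R y - G ⟨R y, hy⟩ = y := by
  have hK0 : 0 ≤ K := by
    have := (norm_nonneg _).trans (hK 0)
    simpa using this
  let F : H → ℝ → H := fun y t => Complex.exp (-(l * t)) • U t y
  have hFc : ∀ y, Continuous (F y) := fun y =>
    (by fun_prop : Continuous fun t : ℝ => Complex.exp (-(l * t))).smul (h.continuous y)
  have hFb : ∀ y, ∀ t : ℝ, 0 < t → ‖F y t‖ ≤ K * Real.exp ((ε - l.re) * t) * ‖y‖ := by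
    intro y t ht
    have h1 : ‖Complex.exp (-(l * t))‖ = Real.exp (-(l.re * t)) := by
      rw [Complex.norm_exp]
      simp
    rw [norm_smul, h1]
    calc Real.exp (-(l.re * t)) * ‖U t y‖
        ≤ Real.exp (-(l.re * t)) * (K * Real.exp (ε * |t|) * ‖y‖) := by
          gcongr
          exact ((U t).le_opNorm y).trans (by gcongr; exact hK t)
      _ = K * (Real.exp (-(l.re * t)) * Real.exp (ε * t)) * ‖y‖ := by rw [abs_of_pos ht]; ring
      _ = _ := by rw [← Real.exp_add]; ring_nf
  have hei : IntegrableOn (fun t => Real.exp ((ε - l.re) * t)) (Ioi 0) :=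
    integrableOn_exp_mul_Ioi (by linarith) 0
  have hgi : ∀ y : H, IntegrableOn (fun t => K * Real.exp ((ε - l.re) * t) * ‖y‖) (Ioi 0) :=
    fun y => (hei.const_mul K).mul_const _
  have hFi : ∀ y, IntegrableOn (F y) (Ioi 0) := fun y =>
    Integrable.mono' (hgi y) (hFc y).aestronglyMeasurable
      ((ae_restrict_iff' measurableSet_Ioi).mpr (Eventually.of_forall fun t ht => hFb y t ht))
  let R₀ : H →ₗ[ℂ] H :=
    { toFun := fun y => ∫ t in Ioi (0 : ℝ), F y t
      map_add' := fun x y => by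
        rw [← integral_add (hFi x) (hFi y)]
        simp [F]
      map_smul' := fun a y => by
        rw [RingHom.id_apply, ← integral_smul]
        congr 1
        ext t
        simp only [F, map_smul, smul_comm a] }
  have hR₀ : ∀ y, ‖R₀ y‖ ≤ (∫ t in Ioi (0 : ℝ), K * Real.exp ((ε - l.re) * t)) * ‖y‖ := by
    intro y
    rw [← integral_mul_const]
    exact norm_integral_le_of_norm_le (hgi y)
      ((ae_restrict_iff' measurableSet_Ioi).mpr (Eventually.of_forall fun t ht => hFb y t ht))
  let R : H →L[ℂ] H := R₀.mkContinuous _ hR₀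
  have hRapp : ∀ y, R y = ∫ t in Ioi (0 : ℝ), F y t := fun y => rfl
  have hcomm : ∀ s y, R (U s y) = U s (R y) := by
    intro s y
    rw [hRapp, hRapp, ← ContinuousLinearMap.integral_comp_comm _ (hFi y)]
    congr 1
    ext t
    simp only [F, map_smul]
    rw [← ContinuousLinearMap.comp_apply, ← ContinuousLinearMap.comp_apply, ← h.add, ← h.add,
      add_comm]
  have hder : ∀ y, HasDerivAt (fun s => U s (R y)) (l • R y - y) 0 := by
    intro y
    -- Translating the Laplace integral moves the dependence on s into the endpoint and an
    -- exponential. This can be differentiated for arbitrary y, which shows that Ry lies in the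
    -- domain.
    have h1 : ∀ s : ℝ, U s (R y) = Complex.exp (l * s) • (R y - ∫ t in (0 : ℝ)..s, F y t) := by
      intro s
      have h2 : ∀ t : ℝ, F (U s y) t = Complex.exp (l * s) • F y (t + s) := by
        intro t
        simp only [F, smul_smul, ← Complex.exp_add]
        rw [h.add]
        congr 2
        push_cast
        ring
      have h3 : ∫ t in Ioi (0 : ℝ), F y (t + s) = ∫ t in Ioi s, F y t := by
        have := (measurePreserving_add_right volume s).setIntegral_preimage_emb
          (measurableEmbedding_addRight s) (F y) (Ioi s)
        simpa using this
      have h4 : IntegrableOn (F y) (Ioi s) := by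
        refine ((hFi y).union ((hFc y).integrableOn_Icc (a := s) (b := 0))).mono_set ?_
        intro t ht
        rcases lt_or_ge 0 t with h0 | h0
        · exact Or.inl h0
        · exact Or.inr ⟨le_of_lt ht, h0⟩
      have h5 := intervalIntegral.integral_Ioi_sub_Ioi' (hFi y) h4
      rw [← hcomm, hRapp, integral_congr_ae (Eventually.of_forall h2), integral_smul, h3, ← h5,
        hRapp, sub_sub_cancel]
    have h6 : (fun s => U s (R y)) =
        fun s : ℝ => Complex.exp (l * s) • (R y - ∫ t in (0 : ℝ)..s, F y t) := funext h1
    rw [h6]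
    have h7 : HasDerivAt (fun s : ℝ => R y - ∫ t in (0 : ℝ)..s, F y t) (-y) 0 := by
      have := (intervalIntegral.integral_hasDerivAt_right ((hFc y).intervalIntegrable 0 0)
        (hFc y).stronglyMeasurable.stronglyMeasurableAtFilter (hFc y).continuousAt).const_sub (R y)
      simpa [F, h.zero] using this
    have h8 : HasDerivAt (fun s : ℝ => Complex.exp (l * s)) l 0 := by
      have h9 : HasDerivAt (fun s : ℝ => l * (s : ℂ)) (l * 1) 0 :=
        (Complex.ofRealCLM.hasDerivAt (x := (0 : ℝ))).const_mul l
      simpa using h9.cexp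
    have h10 := h8.smul h7
    simp only [Complex.ofReal_zero, mul_zero, Complex.exp_zero, one_smul,
      intervalIntegral.integral_same, sub_zero] at h10
    rw [sub_eq_neg_add]
    exact h10
  have hgr : ∀ y, (R y, l • R y - y) ∈ G.graph := fun y => (h.generator _ _).mpr (hder y)
  refine ⟨R, fun x => ?_, fun y => ?_⟩
  · have h1 : HasDerivAt (fun s => R (U s x)) (R (G x)) 0 :=
      hasDerivAt_clm_apply R ((h.generator _ _).mp (G.mem_graph x))
    simp_rw [hcomm] at h1
    rw [map_sub, map_smul, h1.unique (hder x), sub_sub_cancel]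
  · obtain ⟨z, hz, hz'⟩ := G.mem_graph_iff.mp (hgr y)
    simp only at hz hz'
    refine ⟨hz ▸ z.2, ?_⟩
    rw [show (⟨R y, hz ▸ z.2⟩ : G.domain) = z from Subtype.ext hz.symm, hz', sub_sub_cancel]

end Groups

/-! ### Multiplication operators and Fourier multipliers on L² -/

section Multipliers

variable {n : ℕ}

/-- Multiplication by an essentially bounded function. -/
def mulOp (m : E n → ℂ) : L2 n →L[ℂ] L2 n :=
  open Classical in
  if h : MemLp m ∞ (volume : Measure (E n)) then
    (ContinuousLinearMap.mul ℂ ℂ).holderL volume ∞ 2 2 h.toLp else 0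

theorem mulOp_ae {m : E n → ℂ} (h : MemLp m ∞ (volume : Measure (E n))) (f : L2 n) :
    mulOp m f =ᵐ[volume] fun x => m x * f x := by
  have h1 : mulOp m f = (ContinuousLinearMap.mul ℂ ℂ).holder 2 h.toLp f := by
    rw [mulOp, dif_pos h]
    rfl
  rw [h1]
  filter_upwards [(ContinuousLinearMap.mul ℂ ℂ).coeFn_holder (r := 2) h.toLp f, h.coeFn_toLp]
    with x hx hx'
  rw [hx, hx']
  rfl

theorem norm_mulOp_apply_le {m : E n → ℂ} (h : MemLp m ∞ (volume : Measure (E n))) (C : ℝ)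
    (hC : ∀ᵐ x, ‖m x‖ ≤ C) (f : L2 n) : ‖mulOp m f‖ ≤ C * ‖f‖ := by
  refine Lp.norm_le_mul_norm_of_ae_le_mul ?_
  filter_upwards [mulOp_ae h f, hC] with x hx hx'
  rw [hx, norm_mul]
  gcongr

theorem norm_mulOp_le {m : E n → ℂ} (h : MemLp m ∞ (volume : Measure (E n))) (C : ℝ)
    (hC0 : 0 ≤ C) (hC : ∀ᵐ x, ‖m x‖ ≤ C) : ‖mulOp m‖ ≤ C :=
  ContinuousLinearMap.opNorm_le_bound _ hC0 (norm_mulOp_apply_le h C hC)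

theorem L2_inner_def (f g : L2 n) : inner ℂ f g = ∫ x, inner ℂ (f x) (g x) := rfl

theorem mulOp_symm (m : E n → ℝ) (h : MemLp (fun x => (m x : ℂ)) ∞ (volume : Measure (E n)))
    (f g : L2 n) : inner ℂ (mulOp (fun x => (m x : ℂ)) f) g
      = inner ℂ f (mulOp (fun x => (m x : ℂ)) g) := by
  rw [L2_inner_def, L2_inner_def]
  refine integral_congr_ae ?_
  filter_upwards [mulOp_ae h f, mulOp_ae h g] with x hx hx'
  rw [hx, hx', RCLike.inner_apply, RCLike.inner_apply, map_mul, Complex.conj_ofReal]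
  ring

/-- The Fourier transform on `L²`. -/
def ft : L2 n ≃ₗᵢ[ℂ] L2 n := Lp.fourierTransformₗᵢ (E n) ℂ

/-- The Fourier multiplier with bounded symbol `m`. -/
def fmul (m : E n → ℂ) : L2 n →L[ℂ] L2 n :=
  (ft.symm.toLinearIsometry.toContinuousLinearMap ∘L mulOp m) ∘L
    ft.toLinearIsometry.toContinuousLinearMap

theorem fmul_apply (m : E n → ℂ) (f : L2 n) : fmul m f = ft.symm (mulOp m (ft f)) := rfl

theorem ft_fmul (m : E n → ℂ) (f : L2 n) : ft (fmul m f) = mulOp m (ft f) := by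
  rw [fmul_apply, LinearIsometryEquiv.apply_symm_apply]

theorem fmul_symm (m : E n → ℝ) (h : MemLp (fun x => (m x : ℂ)) ∞ (volume : Measure (E n)))
    (f g : L2 n) : inner ℂ (fmul (fun x => (m x : ℂ)) f) g
      = inner ℂ f (fmul (fun x => (m x : ℂ)) g) := by
  rw [← ft.inner_map_map, ft_fmul, mulOp_symm m h, ← ft_fmul, ft.inner_map_map]

theorem fourier_toDist (f : L2 n) :
    FourierTransform.fourier (toDist f) = toDist (ft f) :=
  Lp.fourier_toTemperedDistribution_eq f

/-- The bridge from distributions to functions: both the Bessel potential and the Laplacian become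
pointwise identities of Fourier transforms. A priori mf is only locally integrable, so the forward
direction tests against smooth compactly supported functions. -/
theorem smulLeft_toDist_eq_iff {m : E n → ℂ} (hm : m.HasTemperateGrowth) (f g : L2 n) :
    smulLeftCLM ℂ m (toDist f) = toDist g ↔ (fun x => m x * f x) =ᵐ[volume] g := by
  have hf : LocallyIntegrable f (volume : Measure (E n)) :=
    (Lp.memLp f).locallyIntegrable (by norm_num)
  have hg : LocallyIntegrable g (volume : Measure (E n)) :=
    (Lp.memLp g).locallyIntegrable (by norm_num)
  constructor
  · intro h
    have hmf : LocallyIntegrable (fun x => m x * f x) (volume : Measure (E n)) :=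
      hf.continuous_mul hm.1.continuous
    refine ae_eq_of_integral_contDiff_smul_eq hmf hg ?_
    intro η hη hηc
    have hg₁ : HasCompactSupport (Complex.ofRealCLM ∘ η) := hηc.comp_left rfl
    have hg₂ : ContDiff ℝ ∞ (Complex.ofRealCLM ∘ η) := by fun_prop
    have h1 := congrArg (fun T => T (hg₁.toSchwartzMap hg₂)) h
    simp only [smulLeftCLM_apply_apply, Lp.toTemperedDistribution_apply,
      SchwartzMap.smulLeftCLM_apply_apply hm] at h1
    convert h1 using 1
    · refine integral_congr_ae (Eventually.of_forall fun x => ?_)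
      simp
      ring
    · refine integral_congr_ae (Eventually.of_forall fun x => ?_)
      simp
  · intro h
    ext η
    simp only [smulLeftCLM_apply_apply, Lp.toTemperedDistribution_apply,
      SchwartzMap.smulLeftCLM_apply_apply hm]
    refine integral_congr_ae ?_
    filter_upwards [h] with x hx
    rw [← hx]
    simp only [smul_eq_mul]
    ring

theorem toDist_eq_iff_fourier (T : 𝓢'(E n, ℂ)) (g : L2 n) :
    T = toDist g ↔ FourierTransform.fourier T = toDist (ft g) := by
  rw [← fourier_toDist]
  constructor
  · rintro rfl
    rfl
  · intro h
    have := congrArg FourierTransformInv.fourierInv h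
    rwa [FourierTransform.fourierInv_fourier_eq, FourierTransform.fourierInv_fourier_eq] at this

/-- The weight `1 + |ξ|²`. -/
def wt (ξ : E n) : ℝ := 1 + ‖ξ‖ ^ 2

theorem one_le_wt (ξ : E n) : 1 ≤ wt ξ := by
  unfold wt
  have : 0 ≤ ‖ξ‖ ^ 2 := by positivity
  linarith

theorem wt_pos (ξ : E n) : 0 < wt ξ := zero_lt_one.trans_le (one_le_wt ξ)

@[fun_prop]
theorem continuous_wt : Continuous (wt (n := n)) := by
  unfold wt
  fun_prop

@[fun_prop]
theorem measurable_wt_rpow (s : ℝ) : Measurable fun ξ : E n => wt ξ ^ s :=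
  continuous_wt.measurable.pow_const s

theorem bessel_toDist_eq_iff (s : ℝ) (f g : L2 n) :
    besselPotential (E n) ℂ s (toDist f) = toDist g ↔
      (fun ξ => ((wt ξ ^ (s / 2) : ℝ) : ℂ) * ft f ξ) =ᵐ[volume] ft g := by
  rw [toDist_eq_iff_fourier, fourier_besselPotential_eq_smulLeftCLM_fourier_apply, fourier_toDist,
    smulLeft_toDist_eq_iff (by fun_prop)]
  rfl

theorem laplacian_toDist_eq_iff (f g : L2 n) :
    Δ (toDist f) = toDist g ↔
      (fun ξ => ((-(2 * Real.pi) ^ 2 * ‖ξ‖ ^ 2 : ℝ) : ℂ) * ft f ξ) =ᵐ[volume] ft g := by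
  have hm : (fun ξ : E n => ((-(2 * Real.pi) ^ 2 * ‖ξ‖ ^ 2 : ℝ) : ℂ)).HasTemperateGrowth := by
    fun_prop
  rw [toDist_eq_iff_fourier, ← smulLeft_toDist_eq_iff hm, laplacian_eq_fourierMultiplierCLM]
  have h1 : (fun ξ : E n => ((-(2 * Real.pi) ^ 2 * ‖ξ‖ ^ 2 : ℝ) : ℂ)) =
      ((-(2 * Real.pi) ^ 2 : ℝ) : ℂ) • fun ξ : E n => ((‖ξ‖ ^ 2 : ℝ) : ℂ) := by
    ext ξ
    simp
  rw [h1, smulLeftCLM_smul (by fun_prop)]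
  rw [← Complex.coe_smul, FourierTransform.fourier_smul, fourierMultiplierCLM_apply,
    FourierTransform.fourier_fourierInv_eq, fourier_toDist]
  rfl

/-- The square of the `H^s` norm. -/
def en (s : ℝ) (f : L2 n) : ℝ≥0∞ := ∫⁻ ξ, ENNReal.ofReal (wt ξ ^ s) * ‖ft f ξ‖ₑ ^ 2

theorem enorm_L2_sq (f : L2 n) : ‖f‖ₑ ^ 2 = ∫⁻ x, ‖f x‖ₑ ^ 2 := by
  rw [Lp.enorm_def, eLpNorm_eq_lintegral_rpow_enorm_toReal (by norm_num) (by norm_num)]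
  rw [← ENNReal.rpow_natCast, ← ENNReal.rpow_mul]
  simp

theorem memLp_two_of_lintegral {f : E n → ℂ} (hf : AEStronglyMeasurable f volume)
    (h : ∫⁻ x, ‖f x‖ₑ ^ 2 < ⊤) : MemLp f 2 volume := by
  refine ⟨hf, ?_⟩
  rw [eLpNorm_lt_top_iff_lintegral_rpow_enorm_lt_top (by norm_num) (by norm_num)]
  simpa using h

theorem enorm_wt_mul_sq (s : ℝ) (ξ : E n) (z : ℂ) :
    ‖((wt ξ ^ (s / 2) : ℝ) : ℂ) * z‖ₑ ^ 2 = ENNReal.ofReal (wt ξ ^ s) * ‖z‖ₑ ^ 2 := by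
  have h1 : ‖((wt ξ ^ (s / 2) : ℝ) : ℂ)‖ₑ = ENNReal.ofReal (wt ξ ^ (s / 2)) := by
    rw [← ofReal_norm, Complex.norm_real, Real.norm_of_nonneg (Real.rpow_nonneg (wt_pos ξ).le _)]
  rw [enorm_mul, mul_pow, h1, ← ENNReal.ofReal_pow (Real.rpow_nonneg (wt_pos ξ).le _),
    ← Real.rpow_natCast, ← Real.rpow_mul (wt_pos ξ).le]
  norm_num

theorem exists_of_en_lt_top {s : ℝ} {f : L2 n} (h : en s f < ⊤) :
    ∃ g : L2 n, (fun ξ => ((wt ξ ^ (s / 2) : ℝ) : ℂ) * ft f ξ) =ᵐ[volume] ft g := by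
  have h1 : MemLp (fun ξ => ((wt ξ ^ (s / 2) : ℝ) : ℂ) * ft f ξ) 2 volume := by
    refine memLp_two_of_lintegral ?_ ?_
    · exact ((measurable_wt_rpow (s / 2)).complex_ofReal.aestronglyMeasurable).mul
        (Lp.aestronglyMeasurable _)
    · simpa only [enorm_wt_mul_sq, en] using h
  refine ⟨ft.symm h1.toLp, ?_⟩
  rw [LinearIsometryEquiv.apply_symm_apply]
  exact h1.coeFn_toLp.symm

theorem en_eq_of_ae {s : ℝ} {f g : L2 n}
    (h : (fun ξ => ((wt ξ ^ (s / 2) : ℝ) : ℂ) * ft f ξ) =ᵐ[volume] ft g) : en s f = ‖g‖ₑ ^ 2 := by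
  have h1 : ‖g‖ₑ = ‖ft g‖ₑ := by
    rw [← ofReal_norm, ← ofReal_norm, ft.norm_map]
  rw [h1, enorm_L2_sq, en]
  refine lintegral_congr_ae ?_
  filter_upwards [h] with ξ hξ
  rw [← hξ, enorm_wt_mul_sq]

/-- The infimum defining `sobNorm` runs over at most one candidate, because `toDist` is injective.
If there is none, both sides are infinite. From here on all Sobolev estimates are made with the
weighted integral `en`. -/
theorem sobNorm_sq (s : ℝ) (f : L2 n) : sobNorm s f ^ 2 = en s f := by
  by_cases hex : ∃ g : L2 n, (fun ξ => ((wt ξ ^ (s / 2) : ℝ) : ℂ) * ft f ξ) =ᵐ[volume] ft g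
  · obtain ⟨g, hg⟩ := hex
    rw [en_eq_of_ae hg]
    congr 1
    refine le_antisymm (iInf₂_le g ((bessel_toDist_eq_iff s f g).mpr hg)) ?_
    refine le_iInf₂ fun g' hg' => ?_
    rw [toDist_injective (((bessel_toDist_eq_iff s f g).mpr hg).symm.trans hg')]
  · have h1 : en s f = ⊤ := by
      by_contra h
      exact hex (exists_of_en_lt_top (lt_top_iff_ne_top.mpr h))
    have h2 : sobNorm s f = ⊤ := by
      refine iInf₂_eq_top.mpr fun g hg => ?_
      exact absurd ⟨g, (bessel_toDist_eq_iff s f g).mp hg⟩ hex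
    rw [h1, h2]
    simp

theorem mem_H2_iff (f : L2 n) :
    f ∈ H2 n ↔ ∃ g : L2 n, (fun ξ => ((wt ξ : ℝ) : ℂ) * ft f ξ) =ᵐ[volume] ft g := by
  have h1 : f ∈ H2 n ↔ ∃ g : L2 n, besselPotential (E n) ℂ 2 (toDist f) = toDist g := Iff.rfl
  rw [h1]
  refine exists_congr fun g => ?_
  rw [bessel_toDist_eq_iff]
  norm_num

theorem laplacianL2_ae (f : H2 n) :
    (fun ξ => ((-(2 * Real.pi) ^ 2 * ‖ξ‖ ^ 2 : ℝ) : ℂ) * ft (f : L2 n) ξ)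
      =ᵐ[volume] ft (laplacianL2 n f) :=
  (laplacian_toDist_eq_iff _ _).mp (exists_laplacian f).choose_spec

end Multipliers

/-! ### Graphs and dominated convergence in L² -/

section Tools

variable {n : ℕ}

/-- Lx = y means R⁻²x = y - Wx. In this form the domain condition is part of an equation between
bounded operators. -/
theorem IsSchr.mem_graph_iff {X : Type*} [NormedAddCommGroup X] [InnerProductSpace ℂ X]
    {R W : X →L[ℂ] X} {L : X →ₗ.[ℂ] X} (h : IsSchr R W L) (x y : X) :
    (x, y) ∈ L.graph ↔ R (R (y - W x)) = x := by
  rw [LinearPMap.mem_graph_iff]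
  constructor
  · rintro ⟨z, rfl, rfl⟩
    obtain ⟨f, hf⟩ := (h.mem_domain z).mp z.2
    rw [h.apply z f hf, add_sub_cancel_right, hf]
  · intro hxy
    refine ⟨⟨x, (h.mem_domain x).mpr ⟨_, hxy⟩⟩, rfl, ?_⟩
    rw [h.apply _ _ hxy]
    simp

theorem tendsto_L2_of_dominated {ι : Type*} {l : Filter ι} [l.IsCountablyGenerated]
    {F : ι → L2 n} {f : L2 n} (F' : ι → E n → ℂ) (hF : ∀ i, F i =ᵐ[volume] F' i)
    (g : E n → ℝ) (hg : MemLp g 2 volume) (hb : ∀ᵐ x, ∀ i, ‖F' i x - f x‖ ≤ g x)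
    (hlim : ∀ᵐ x, Tendsto (fun i => F' i x) l (𝓝 (f x))) : Tendsto F l (𝓝 f) := by
  have h1 : ∀ i, ‖F i - f‖ₑ ^ 2 = ∫⁻ x, ‖F' i x - f x‖ₑ ^ 2 := by
    intro i
    rw [enorm_L2_sq]
    refine lintegral_congr_ae ?_
    filter_upwards [Lp.coeFn_sub (F i) f, hF i] with x hx hx'
    rw [hx, Pi.sub_apply, hx']
  have hg2 : ∫⁻ x, ‖g x‖ₑ ^ 2 ≠ ⊤ := by
    have := (eLpNorm_lt_top_iff_lintegral_rpow_enorm_lt_top (by norm_num) (by norm_num)).mp hg.2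
    simpa using this.ne
  have h2 : Tendsto (fun i => ∫⁻ x, ‖F' i x - f x‖ₑ ^ 2) l (𝓝 (∫⁻ _ : E n, 0)) := by
    refine tendsto_lintegral_filter_of_dominated_convergence' (fun x => ‖g x‖ₑ ^ 2) ?_ ?_ hg2 ?_
    · refine Eventually.of_forall fun i => ?_
      have : AEStronglyMeasurable (F' i) volume := (Lp.aestronglyMeasurable (F i)).congr (hF i)
      exact ((this.sub (Lp.aestronglyMeasurable f)).enorm.pow_const 2)
    · refine Eventually.of_forall fun i => ?_
      filter_upwards [hb] with x hx
      gcongr 1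
      exact enorm_le_iff_norm_le.mpr ((hx i).trans (le_abs_self _))
    · filter_upwards [hlim] with x hx
      have h3 : Tendsto (fun i => ‖F' i x - f x‖ₑ) l (𝓝 0) := by
        have := (hx.sub_const (f x)).enorm
        simpa using this
      simpa [Function.comp_def] using (ENNReal.continuous_pow 2).tendsto _ |>.comp h3
  simp only [lintegral_zero, ← h1] at h2
  have h4 : Tendsto (fun i => ‖F i - f‖) l (𝓝 0) := by
    have h5 : Tendsto (fun i => (‖F i - f‖ₑ ^ 2).toReal) l (𝓝 0) :=
      (ENNReal.tendsto_toReal (by norm_num)).comp h2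
    have h6 : ∀ i, (‖F i - f‖ₑ ^ 2).toReal = ‖F i - f‖ ^ 2 := by
      intro i
      rw [ENNReal.toReal_pow, toReal_enorm]
    simp only [h6] at h5
    have h7 := (Real.continuous_sqrt.tendsto _).comp h5
    simpa [Function.comp_def, Real.sqrt_sq] using h7
  exact tendsto_iff_norm_sub_tendsto_zero.mpr h4

/-- Convergence in L² implies convergence in measure, hence almost everywhere along a sequence. It
serves to compute an L² derivative pointwise. -/
theorem exists_subseq_tendsto_ae {l : Filter ℝ} [NeBot l] [l.IsCountablyGenerated] {F : ℝ → L2 n}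
    {f : L2 n} (h : Tendsto F l (𝓝 f)) : ∃ t : ℕ → ℝ, Tendsto t atTop l ∧
      ∀ᵐ x, Tendsto (fun k => F (t k) x) atTop (𝓝 (f x)) :=
  (tendstoInMeasure_of_tendsto_Lp h).exists_seq_tendsto_ae'

end Tools

/-! ### Two-component operators -/

section Matrices

variable {X : Type*} [NormedAddCommGroup X] [InnerProductSpace ℂ X]

/-- The bounded operator with matrix `((a, b), (c, d))`. -/
def mat2 (a b c d : X →L[ℂ] X) : WithLp 2 (X × X) →L[ℂ] WithLp 2 (X × X) :=
  (WithLp.prodContinuousLinearEquiv 2 ℂ X X).symm.toContinuousLinearMap ∘L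
    ((a.coprod b).prod (c.coprod d)) ∘L
      (WithLp.prodContinuousLinearEquiv 2 ℂ X X).toContinuousLinearMap

@[simp]
theorem mat2_fst (a b c d : X →L[ℂ] X) (ψ : WithLp 2 (X × X)) :
    (mat2 a b c d ψ).fst = a ψ.fst + b ψ.snd := rfl

@[simp]
theorem mat2_snd (a b c d : X →L[ℂ] X) (ψ : WithLp 2 (X × X)) :
    (mat2 a b c d ψ).snd = c ψ.fst + d ψ.snd := rfl

theorem pair_ext {ψ χ : WithLp 2 (X × X)} (h1 : ψ.fst = χ.fst) (h2 : ψ.snd = χ.snd) : ψ = χ :=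
  WithLp.ofLp_injective 2 (Prod.ext h1 h2)

theorem pair_norm_sq (ψ : WithLp 2 (X × X)) : ‖ψ‖ ^ 2 = ‖ψ.fst‖ ^ 2 + ‖ψ.snd‖ ^ 2 :=
  WithLp.prod_norm_sq_eq_of_L2 ψ

theorem tendsto_pair_iff {ι : Type*} {l : Filter ι} {F : ι → WithLp 2 (X × X)}
    {y : WithLp 2 (X × X)} : Tendsto F l (𝓝 y) ↔
      Tendsto (fun i => (F i).fst) l (𝓝 y.fst) ∧ Tendsto (fun i => (F i).snd) l (𝓝 y.snd) := by
  have h1 := (WithLp.prodContinuousLinearEquiv 2 ℂ X X).toHomeomorph.isInducing.tendsto_nhds_iff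
    (f := F) (l := l) (y := y)
  rw [h1]
  exact Prod.tendsto_iff _ _

theorem hasDerivAt_pair_iff {F : ℝ → WithLp 2 (X × X)} {y : WithLp 2 (X × X)} {t : ℝ} :
    HasDerivAt F y t ↔
      HasDerivAt (fun s => (F s).fst) y.fst t ∧ HasDerivAt (fun s => (F s).snd) y.snd t := by
  simp only [hasDerivAt_iff_tendsto_slope_zero, tendsto_pair_iff]
  rfl

end Matrices

section Graphs

variable {n : ℕ}

theorem mem_graph_offDiagonal (S T : L2 n →ₗ.[ℂ] L2 n) (ψ y : L2x2 n) :
    (ψ, y) ∈ (offDiagonal S T).graph ↔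
      (ψ.snd, Complex.I • y.fst) ∈ S.graph ∧ (ψ.fst, -Complex.I • y.snd) ∈ T.graph := by
  simp only [LinearPMap.mem_graph_iff]
  constructor
  · rintro ⟨z, rfl, rfl⟩
    refine ⟨⟨⟨_, z.2.2⟩, rfl, ?_⟩, ⟨⟨_, z.2.1⟩, rfl, ?_⟩⟩
    · change _ = Complex.I • (-Complex.I • S ⟨(z : L2x2 n).snd, z.2.2⟩)
      simp [smul_smul]
    · change _ = -Complex.I • (Complex.I • T ⟨(z : L2x2 n).fst, z.2.1⟩)
      simp [smul_smul]
  · rintro ⟨⟨⟨v, hv⟩, h1, h2⟩, ⟨⟨u, hu⟩, h3, h4⟩⟩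
    simp only at h1 h3 h2 h4
    subst h1 h3
    refine ⟨⟨ψ, hu, hv⟩, rfl, pair_ext ?_ ?_⟩
    · change -Complex.I • S ⟨ψ.snd, hv⟩ = _
      rw [h2]
      simp [smul_smul]
    · change Complex.I • T ⟨ψ.fst, hu⟩ = _
      rw [h4]
      simp [smul_smul]

theorem mem_graph_smul {H : Type*} [NormedAddCommGroup H] [InnerProductSpace ℂ H]
    (A : H →ₗ.[ℂ] H) {c : ℂ} (hc : c ≠ 0) (x y : H) :
    (x, y) ∈ (c • A).graph ↔ (x, c⁻¹ • y) ∈ A.graph := by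
  simp only [LinearPMap.mem_graph_iff]
  constructor
  · rintro ⟨z, rfl, rfl⟩
    exact ⟨z, rfl, by rw [LinearPMap.smul_apply, smul_smul, inv_mul_cancel₀ hc, one_smul]⟩
  · rintro ⟨z, h1, h2⟩
    exact ⟨z, h1, by rw [LinearPMap.smul_apply, h2, smul_smul, mul_inv_cancel₀ hc, one_smul]⟩

theorem mem_graph_I_smul_offDiagonal (S T : L2 n →ₗ.[ℂ] L2 n) (ψ y : L2x2 n) :
    (ψ, y) ∈ (Complex.I • offDiagonal S T).graph ↔
      (ψ.snd, y.fst) ∈ S.graph ∧ (ψ.fst, -y.snd) ∈ T.graph := by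
  rw [mem_graph_smul _ Complex.I_ne_zero, mem_graph_offDiagonal]
  have h1 : Complex.I • (Complex.I⁻¹ • y).fst = y.fst := by
    change Complex.I • (Complex.I⁻¹ • y.fst) = _
    rw [smul_smul, mul_inv_cancel₀ Complex.I_ne_zero, one_smul]
  have h2 : -Complex.I • (Complex.I⁻¹ • y).snd = -y.snd := by
    change -Complex.I • (Complex.I⁻¹ • y.snd) = _
    rw [smul_smul, neg_mul, mul_inv_cancel₀ Complex.I_ne_zero, neg_smul, one_smul]
  rw [h1, h2]

end Graphs

/-! ### The operator -½Δ + V in the form `R⁻² + W` -/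

section Schrodinger

variable {n : ℕ}

/-- The symbol of `-½ Δ + κ`. -/
def hs (κ : ℝ) (ξ : E n) : ℝ := 2 * Real.pi ^ 2 * ‖ξ‖ ^ 2 + κ

theorem le_hs (κ : ℝ) (ξ : E n) : κ ≤ hs κ ξ := by
  unfold hs
  have : 0 ≤ 2 * Real.pi ^ 2 * ‖ξ‖ ^ 2 := by positivity
  linarith

theorem hs_pos {κ : ℝ} (hκ : 0 < κ) (ξ : E n) : 0 < hs κ ξ := hκ.trans_le (le_hs κ ξ)

@[fun_prop]
theorem continuous_hs (κ : ℝ) : Continuous (hs (n := n) κ) := by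
  unfold hs
  fun_prop

theorem hs_le_wt {κ : ℝ} (hκ : 0 < κ) (ξ : E n) : hs κ ξ ≤ (2 * Real.pi ^ 2 + κ) * wt ξ := by
  unfold hs wt
  have h1 : 0 ≤ ‖ξ‖ ^ 2 := by positivity
  have h2 : 0 ≤ 2 * Real.pi ^ 2 := by positivity
  nlinarith [mul_nonneg hκ.le h1]

theorem wt_le_hs {κ : ℝ} (hκ : 0 < κ) (ξ : E n) : wt ξ ≤ (1 + κ⁻¹) * hs κ ξ := by
  unfold hs wt
  have h1 : 0 ≤ ‖ξ‖ ^ 2 := by positivity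
  have h2 : 1 ≤ 2 * Real.pi ^ 2 := by nlinarith [Real.pi_gt_three]
  have h3 : κ⁻¹ * κ = 1 := inv_mul_cancel₀ hκ.ne'
  have h4 : 0 ≤ κ⁻¹ := by positivity
  have h5 : ‖ξ‖ ^ 2 ≤ 2 * Real.pi ^ 2 * ‖ξ‖ ^ 2 := by nlinarith
  have h6 : 0 ≤ κ⁻¹ * (2 * Real.pi ^ 2 * ‖ξ‖ ^ 2) := by positivity
  nlinarith

theorem memLp_top_real {m : E n → ℝ} (hm : Measurable m) (C : ℝ)
    (hC : ∀ x, |m x| ≤ C) : MemLp (fun x => (m x : ℂ)) ∞ (volume : Measure (E n)) :=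
  memLp_top_of_bound hm.complex_ofReal.aestronglyMeasurable C (Eventually.of_forall fun x => by
    rw [Complex.norm_real]
    exact hC x)

/-- The operator `(-½ Δ + κ) ^ (-½)`. -/
def resRoot (n : ℕ) (κ : ℝ) : L2 n →L[ℂ] L2 n :=
  fmul fun ξ => ((hs κ ξ ^ (-(1 / 2) : ℝ) : ℝ) : ℂ)

theorem memLp_hs_rpow {κ : ℝ} (hκ : 0 < κ) :
    MemLp (fun ξ : E n => ((hs κ ξ ^ (-(1 / 2) : ℝ) : ℝ) : ℂ)) ∞ volume := by
  refine memLp_top_real ((continuous_hs κ).measurable.pow_const _) (κ ^ (-(1 / 2) : ℝ)) ?_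
  intro ξ
  rw [abs_of_nonneg (Real.rpow_nonneg (hs_pos hκ ξ).le _)]
  exact Real.rpow_le_rpow_of_nonpos hκ (le_hs κ ξ) (by norm_num)

theorem ft_resRoot {κ : ℝ} (hκ : 0 < κ) (f : L2 n) :
    ft (resRoot n κ f) =ᵐ[volume] fun ξ => ((hs κ ξ ^ (-(1 / 2) : ℝ) : ℝ) : ℂ) * ft f ξ := by
  rw [resRoot, ft_fmul]
  exact mulOp_ae (memLp_hs_rpow hκ) _

theorem ft_resRoot_resRoot {κ : ℝ} (hκ : 0 < κ) (f : L2 n) :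
    ft (resRoot n κ (resRoot n κ f)) =ᵐ[volume] fun ξ => ((hs κ ξ : ℝ) : ℂ)⁻¹ * ft f ξ := by
  filter_upwards [ft_resRoot hκ (resRoot n κ f), ft_resRoot hκ f] with ξ h1 h2
  rw [h1, h2, ← mul_assoc, ← Complex.ofReal_mul, ← Real.rpow_add (hs_pos hκ ξ), ← Complex.ofReal_inv]
  norm_num [Real.rpow_neg_one]

theorem ft_ext {f g : L2 n} (h : ft f =ᵐ[volume] ft g) : f = g :=
  ft.injective (Lp.ext h)

theorem resRoot_resRoot_eq_iff {κ : ℝ} (hκ : 0 < κ) (f x : L2 n) :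
    resRoot n κ (resRoot n κ f) = x ↔ (fun ξ => ((hs κ ξ : ℝ) : ℂ) * ft x ξ) =ᵐ[volume] ft f := by
  have h0 : ∀ ξ : E n, ((hs κ ξ : ℝ) : ℂ) ≠ 0 := fun ξ =>
    Complex.ofReal_ne_zero.mpr (hs_pos hκ ξ).ne'
  constructor
  · rintro rfl
    filter_upwards [ft_resRoot_resRoot hκ f] with ξ hξ
    rw [hξ, mul_inv_cancel_left₀ (h0 ξ)]
  · intro h
    refine ft_ext ?_
    filter_upwards [ft_resRoot_resRoot hκ f, h] with ξ h1 h2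
    rw [h1, ← h2, inv_mul_cancel_left₀ (h0 ξ)]

theorem mem_H2_iff_hs {κ : ℝ} (hκ : 0 < κ) (x : L2 n) :
    x ∈ H2 n ↔ ∃ f, resRoot n κ (resRoot n κ f) = x := by
  rw [mem_H2_iff]
  simp only [resRoot_resRoot_eq_iff hκ]
  constructor
  · rintro ⟨g, hg⟩
    have hm : MemLp (fun ξ : E n => ((hs κ ξ / wt ξ : ℝ) : ℂ)) ∞ volume := by
      refine memLp_top_real ((continuous_hs κ).measurable.div continuous_wt.measurable)
        (2 * Real.pi ^ 2 + κ) fun ξ => ?_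
      rw [abs_of_nonneg (div_nonneg (hs_pos hκ ξ).le (wt_pos ξ).le), div_le_iff₀ (wt_pos ξ)]
      exact hs_le_wt hκ ξ
    refine ⟨fmul (fun ξ => ((hs κ ξ / wt ξ : ℝ) : ℂ)) g, ?_⟩
    rw [ft_fmul]
    filter_upwards [mulOp_ae hm (ft g), hg] with ξ h1 h2
    rw [h1, ← h2, ← mul_assoc, ← Complex.ofReal_mul, div_mul_cancel₀ _ (wt_pos ξ).ne']
  · rintro ⟨g, hg⟩
    have hm : MemLp (fun ξ : E n => ((wt ξ / hs κ ξ : ℝ) : ℂ)) ∞ volume := by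
      refine memLp_top_real (continuous_wt.measurable.div (continuous_hs κ).measurable)
        (1 + κ⁻¹) fun ξ => ?_
      rw [abs_of_nonneg (div_nonneg (wt_pos ξ).le (hs_pos hκ ξ).le), div_le_iff₀ (hs_pos hκ ξ)]
      exact wt_le_hs hκ ξ
    refine ⟨fmul (fun ξ => ((wt ξ / hs κ ξ : ℝ) : ℂ)) g, ?_⟩
    rw [ft_fmul]
    filter_upwards [mulOp_ae hm (ft g), hg] with ξ h1 h2
    rw [h1, ← h2, ← mul_assoc, ← Complex.ofReal_mul, div_mul_cancel₀ _ (hs_pos hκ ξ).ne']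

/-- With the Fourier character e^(2πi⟨x,ξ⟩) the symbol of -½Δ + κ is 2π²|ξ|² + κ, and R is its
inverse square root. Any κ > 0 is allowed: the choice κ = α²/2 makes W = V - κ a decaying potential,
while a fixed κ gives one R for all parameters. -/
theorem isSchr_schrodinger {κ : ℝ} (hκ : 0 < κ) {V : E n → ℝ} (hV : Measurable V) (C : ℝ)
    (hC : ∀ x, |V x - κ| ≤ C) :
    IsSchr (resRoot n κ) (mulOp fun x => ((V x - κ : ℝ) : ℂ)) (schrodinger V) := by
  have hW : MemLp (fun x : E n => ((V x - κ : ℝ) : ℂ)) ∞ volume :=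
    memLp_top_real (hV.sub_const κ) C hC
  have hVt : MemLp (fun x : E n => (V x : ℂ)) ∞ volume := by
    refine memLp_top_real hV (C + |κ|) fun x => ?_
    calc |V x| = |(V x - κ) + κ| := by ring_nf
      _ ≤ _ := (abs_add_le _ _).trans (by gcongr; exact hC x)
  refine ⟨?_, ?_, ?_, ?_, ?_⟩
  · exact fmul_symm _ (memLp_hs_rpow hκ)
  · intro x hx
    have h1 : resRoot n κ (resRoot n κ x) = 0 := by rw [hx, map_zero]
    rw [resRoot_resRoot_eq_iff hκ] at h1
    refine ft_ext ?_
    filter_upwards [h1, Lp.coeFn_zero ℂ 2 (volume : Measure (E n))] with ξ h2 h3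
    rw [← h2, map_zero, h3]
    simp
  · exact mulOp_symm _ hW
  · intro x
    rw [← mem_H2_iff_hs hκ]
    constructor
    · rintro ⟨h1, -⟩
      exact h1
    · intro h1
      refine ⟨h1, ?_⟩
      have h2 : MemLp (mulOp (fun x => (V x : ℂ)) x) 2 volume := Lp.memLp _
      exact (memLp_congr_ae (mulOp_ae hVt x)).mp h2
  · intro x f hf
    have hx2 : (x : L2 n) ∈ H2 n := x.2.1
    have hx3 : (x : L2 n) ∈ (mulL2 V).domain := x.2.2
    have h1 : (-(1 / 2 : ℂ)) • laplacianL2 n ⟨(x : L2 n), hx2⟩ = f - (κ : ℂ) • (x : L2 n) := by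
      refine ft_ext ?_
      rw [resRoot_resRoot_eq_iff hκ] at hf
      rw [map_smul, map_sub, map_smul]
      obtain ⟨G, hG⟩ : ∃ G, G = ft (laplacianL2 n ⟨(x : L2 n), hx2⟩) := ⟨_, rfl⟩
      have h2 : (fun ξ => ((-(2 * Real.pi) ^ 2 * ‖ξ‖ ^ 2 : ℝ) : ℂ) * ft (x : L2 n) ξ)
          =ᵐ[volume] G := by
        rw [hG]
        exact laplacianL2_ae ⟨(x : L2 n), hx2⟩
      refine EventuallyEq.trans (g := ((-(1 / 2 : ℂ)) • G : L2 n)) (by rw [hG]) ?_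
      filter_upwards [hf, h2, Lp.coeFn_smul (-(1 / 2 : ℂ)) G,
        Lp.coeFn_sub (ft f) ((κ : ℂ) • ft (x : L2 n)), Lp.coeFn_smul (κ : ℂ) (ft (x : L2 n))]
        with ξ h1 h2 h3 h4 h5
      rw [h3, h4, Pi.smul_apply, Pi.sub_apply, h5, ← h1, ← h2, Pi.smul_apply, hs]
      push_cast
      simp only [smul_eq_mul]
      ring
    have h2 : mulL2 V ⟨(x : L2 n), hx3⟩
        = mulOp (fun x => ((V x - κ : ℝ) : ℂ)) (x : L2 n) + (κ : ℂ) • (x : L2 n) := by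
      refine Lp.ext ?_
      have h3 : mulL2 V ⟨(x : L2 n), hx3⟩ =ᵐ[volume] fun y => (V y : ℂ) * (x : L2 n) y :=
        MemLp.coeFn_toLp hx3
      filter_upwards [h3, Lp.coeFn_add (mulOp (fun x => ((V x - κ : ℝ) : ℂ)) (x : L2 n))
        ((κ : ℂ) • (x : L2 n)), mulOp_ae hW (x : L2 n), Lp.coeFn_smul (κ : ℂ) (x : L2 n)]
        with y h4 h5 h6 h7
      rw [h4, h5, Pi.add_apply, h6, h7, Pi.smul_apply, smul_eq_mul]
      push_cast
      ring
    change (-(1 / 2 : ℂ)) • laplacianL2 n ⟨(x : L2 n), hx2⟩ + mulL2 V ⟨(x : L2 n), hx3⟩ = _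
    rw [h1, h2]
    abel

end Schrodinger

/-! ### The free group and the group of the matrix operator -/

section FreeGroup

variable {n : ℕ}

theorem memLp_cos (h : E n → ℝ) (hh : Measurable h) (t : ℝ) :
    MemLp (fun ξ => ((Real.cos (t * h ξ) : ℝ) : ℂ)) ∞ (volume : Measure (E n)) :=
  memLp_top_real (Real.measurable_cos.comp (hh.const_mul t)) 1 fun _ => Real.abs_cos_le_one _

theorem memLp_sin (h : E n → ℝ) (hh : Measurable h) (t : ℝ) :
    MemLp (fun ξ => ((Real.sin (t * h ξ) : ℝ) : ℂ)) ∞ (volume : Measure (E n)) :=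
  memLp_top_real (Real.measurable_sin.comp (hh.const_mul t)) 1 fun _ => Real.abs_sin_le_one _

/-- `cos (t h) F + sin (t h) G`. -/
def rot (h : E n → ℝ) (t : ℝ) (F G : L2 n) : L2 n :=
  mulOp (fun ξ => ((Real.cos (t * h ξ) : ℝ) : ℂ)) F +
    mulOp (fun ξ => ((Real.sin (t * h ξ) : ℝ) : ℂ)) G

theorem rot_ae (h : E n → ℝ) (hh : Measurable h) (t : ℝ) (F G : L2 n) :
    rot h t F G =ᵐ[volume] fun ξ => ((Real.cos (t * h ξ) : ℝ) : ℂ) * F ξ +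
      ((Real.sin (t * h ξ) : ℝ) : ℂ) * G ξ := by
  unfold rot
  filter_upwards [Lp.coeFn_add (mulOp (fun ξ => ((Real.cos (t * h ξ) : ℝ) : ℂ)) F)
    (mulOp (fun ξ => ((Real.sin (t * h ξ) : ℝ) : ℂ)) G), mulOp_ae (memLp_cos h hh t) F,
    mulOp_ae (memLp_sin h hh t) G] with ξ h1 h2 h3
  rw [h1, Pi.add_apply, h2, h3]

theorem rot_zero (h : E n → ℝ) (hh : Measurable h) (F G : L2 n) : rot h 0 F G = F := by
  refine Lp.ext ?_
  filter_upwards [rot_ae h hh 0 F G] with ξ h1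
  rw [h1]
  simp

theorem memLp_norm_add (F G : L2 n) : MemLp (fun ξ => 2 * ‖F ξ‖ + ‖G ξ‖) 2 volume :=
  ((Lp.memLp F).norm.const_mul 2).add (Lp.memLp G).norm

theorem continuous_rot (h : E n → ℝ) (hh : Measurable h) (F G : L2 n) :
    Continuous fun t => rot h t F G := by
  rw [continuous_iff_continuousAt]
  intro t
  refine tendsto_L2_of_dominated (fun s ξ => ((Real.cos (s * h ξ) : ℝ) : ℂ) * F ξ +
      ((Real.sin (s * h ξ) : ℝ) : ℂ) * G ξ) (fun s => rot_ae h hh s F G)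
      (fun ξ => 2 * (2 * ‖F ξ‖ + ‖G ξ‖)) ((memLp_norm_add F G).const_mul 2) ?_ ?_
  · filter_upwards [rot_ae h hh t F G] with ξ h1 s
    have h2 : ∀ s, ‖((Real.cos (s * h ξ) : ℝ) : ℂ) * F ξ + ((Real.sin (s * h ξ) : ℝ) : ℂ) * G ξ‖
        ≤ 2 * ‖F ξ‖ + ‖G ξ‖ := by
      intro s
      refine (norm_add_le _ _).trans ?_
      rw [norm_mul, norm_mul, Complex.norm_real, Complex.norm_real]
      have h3 := mul_le_of_le_one_left (norm_nonneg (F ξ)) (Real.abs_cos_le_one (s * h ξ))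
      have h4 := mul_le_of_le_one_left (norm_nonneg (G ξ)) (Real.abs_sin_le_one (s * h ξ))
      simp only [Real.norm_eq_abs]
      linarith [norm_nonneg (F ξ)]
    rw [h1]
    refine (norm_sub_le _ _).trans ?_
    linarith [h2 s, h2 t]
  · filter_upwards [rot_ae h hh t F G] with ξ h1
    rw [h1]
    have h2 : Continuous fun s : ℝ => ((Real.cos (s * h ξ) : ℝ) : ℂ) * F ξ +
      ((Real.sin (s * h ξ) : ℝ) : ℂ) * G ξ := by fun_prop
    exact h2.tendsto t

theorem slope_rot_ae (h : E n → ℝ) (hh : Measurable h) (t : ℝ) (F G : L2 n) :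
    (t⁻¹ • (rot h (0 + t) F G - rot h 0 F G) : L2 n) =ᵐ[volume] fun ξ =>
      ((t⁻¹ * (Real.cos (t * h ξ) - 1) : ℝ) : ℂ) * F ξ +
      ((t⁻¹ * Real.sin (t * h ξ) : ℝ) : ℂ) * G ξ := by
  rw [zero_add, rot_zero h hh]
  filter_upwards [rot_ae h hh t F G, Lp.coeFn_smul t⁻¹ (rot h t F G - F),
    Lp.coeFn_sub (rot h t F G) F] with ξ h1 h2 h3
  rw [h2, Pi.smul_apply, h3, Pi.sub_apply, h1, Complex.real_smul]
  push_cast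
  ring

theorem tendsto_slope_cos (h : ℝ) :
    Tendsto (fun t : ℝ => t⁻¹ * (Real.cos (t * h) - 1)) (𝓝[≠] 0) (𝓝 0) := by
  have h1 : HasDerivAt (fun t : ℝ => Real.cos (t * h)) (-Real.sin (0 * h) * (1 * h)) 0 :=
    ((hasDerivAt_id (0 : ℝ)).mul_const h).cos
  have h2 := hasDerivAt_iff_tendsto_slope_zero.mp h1
  simpa using h2

theorem tendsto_slope_sin (h : ℝ) :
    Tendsto (fun t : ℝ => t⁻¹ * Real.sin (t * h)) (𝓝[≠] 0) (𝓝 h) := by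
  have h1 : HasDerivAt (fun t : ℝ => Real.sin (t * h)) (Real.cos (0 * h) * (1 * h)) 0 :=
    ((hasDerivAt_id (0 : ℝ)).mul_const h).sin
  have h2 := hasDerivAt_iff_tendsto_slope_zero.mp h1
  simpa using h2

/-- The majorant for the difference quotients, independent of t: it makes hF and hG the dominating
functions. At t = 0 the convention 0⁻¹ = 0 makes the left side vanish. -/
theorem abs_slope_cos_le (t h : ℝ) : |t⁻¹ * (Real.cos (t * h) - 1)| ≤ |h| := by
  by_cases ht : t = 0
  · simp [ht]
  have h1 : |Real.cos (t * h) - 1| ≤ |t * h| := by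
    have h3 := Real.abs_sin_le_one (t * h / 2)
    have h4 : |Real.sin (t * h / 2)| ≤ |t * h / 2| := Real.abs_sin_le_abs
    have h2 : Real.cos (t * h) - 1 = -2 * (Real.sin (t * h / 2) * Real.sin (t * h / 2)) := by
      have h6 : Real.cos (t * h) = 2 * Real.cos (t * h / 2) ^ 2 - 1 := by
        rw [← Real.cos_two_mul]
        ring_nf
      have h7 := Real.sin_sq_add_cos_sq (t * h / 2)
      rw [h6]
      linarith
    rw [h2, abs_mul, abs_mul]
    have h5 : |t * h / 2| = |t * h| / 2 := by rw [abs_div]; norm_num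
    rw [h5] at h4
    have h8 := mul_le_mul h3 h4 (abs_nonneg _) zero_le_one
    rw [abs_neg, abs_two]
    linarith
  rw [abs_mul, abs_inv, inv_mul_le_iff₀ (abs_pos.mpr ht), ← abs_mul]
  exact h1

theorem abs_slope_sin_le (t h : ℝ) : |t⁻¹ * Real.sin (t * h)| ≤ |h| := by
  by_cases ht : t = 0
  · simp [ht]
  rw [abs_mul, abs_inv, inv_mul_le_iff₀ (abs_pos.mpr ht), ← abs_mul]
  exact Real.abs_sin_le_abs

theorem hasDerivAt_rot (h : E n → ℝ) (hh : Measurable h) (F G F' G' : L2 n)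
    (hF : (fun ξ => (h ξ : ℂ) * F ξ) =ᵐ[volume] F')
    (hG : (fun ξ => (h ξ : ℂ) * G ξ) =ᵐ[volume] G') :
    HasDerivAt (fun t => rot h t F G) G' 0 := by
  rw [hasDerivAt_iff_tendsto_slope_zero]
  refine tendsto_L2_of_dominated _ (fun t => slope_rot_ae h hh t F G)
    (fun ξ => 2 * ‖F' ξ‖ + ‖(2 : ℂ) • G' ξ‖)
    (((Lp.memLp F').norm.const_mul 2).add ((Lp.memLp G').const_smul (2 : ℂ)).norm) ?_ ?_
  · filter_upwards [hF, hG] with ξ h1 h2 t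
    rw [← h2, ← h1]
    refine (norm_sub_le _ _).trans ?_
    have h3 : ‖((t⁻¹ * (Real.cos (t * h ξ) - 1) : ℝ) : ℂ) * F ξ‖ ≤ ‖(h ξ : ℂ) * F ξ‖ := by
      rw [norm_mul, norm_mul, Complex.norm_real, Complex.norm_real]
      gcongr
      exact abs_slope_cos_le _ _
    have h4 : ‖((t⁻¹ * Real.sin (t * h ξ) : ℝ) : ℂ) * G ξ‖ ≤ ‖(h ξ : ℂ) * G ξ‖ := by
      rw [norm_mul, norm_mul, Complex.norm_real, Complex.norm_real]
      gcongr
      exact abs_slope_sin_le _ _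
    have h5 := norm_add_le (((t⁻¹ * (Real.cos (t * h ξ) - 1) : ℝ) : ℂ) * F ξ)
      (((t⁻¹ * Real.sin (t * h ξ) : ℝ) : ℂ) * G ξ)
    rw [norm_smul, Complex.norm_two]
    linarith [norm_nonneg ((h ξ : ℂ) * F ξ)]
  · filter_upwards [hG] with ξ h1
    rw [← h1]
    have h2 := ((Complex.continuous_ofReal.tendsto _).comp (tendsto_slope_cos (h ξ))).mul_const
      (F ξ)
    have h3 := ((Complex.continuous_ofReal.tendsto _).comp (tendsto_slope_sin (h ξ))).mul_const
      (G ξ)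
    simpa [Function.comp_def] using h2.add h3

/-- The pointwise limit of the difference quotients is hG, and along a sequence they converge almost
everywhere to G'. So differentiability forces hG to be square integrable, and the generator has no
larger domain than expected. -/
theorem ae_of_hasDerivAt_rot (h : E n → ℝ) (hh : Measurable h) (F G G' : L2 n)
    (hd : HasDerivAt (fun t => rot h t F G) G' 0) :
    (fun ξ => (h ξ : ℂ) * G ξ) =ᵐ[volume] G' := by
  rw [hasDerivAt_iff_tendsto_slope_zero] at hd
  obtain ⟨t, ht, hae⟩ := exists_subseq_tendsto_ae hd
  have h1 : ∀ᵐ ξ, ∀ k : ℕ, ((t k)⁻¹ • (rot h (0 + t k) F G - rot h 0 F G) : L2 n) ξ =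
      ((( t k)⁻¹ * (Real.cos (t k * h ξ) - 1) : ℝ) : ℂ) * F ξ +
      (((t k)⁻¹ * Real.sin (t k * h ξ) : ℝ) : ℂ) * G ξ :=
    ae_all_iff.mpr fun k => slope_rot_ae h hh (t k) F G
  filter_upwards [hae, h1] with ξ h2 h3
  have h4 := ((Complex.continuous_ofReal.tendsto _).comp
    ((tendsto_slope_cos (h ξ)).comp ht)).mul_const (F ξ)
  have h5 := ((Complex.continuous_ofReal.tendsto _).comp
    ((tendsto_slope_sin (h ξ)).comp ht)).mul_const (G ξ)
  have h6 := h4.add h5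
  simp only [Complex.ofReal_zero, zero_mul, zero_add] at h6
  refine tendsto_nhds_unique h6 (h2.congr fun k => ?_)
  exact h3 k

/-- The unitary group generated by `((0, H), (-H, 0))`, `H` the multiplier with symbol `h`. -/
def freeGroup (h : E n → ℝ) (t : ℝ) : L2x2 n →L[ℂ] L2x2 n :=
  mat2 (fmul fun ξ => ((Real.cos (t * h ξ) : ℝ) : ℂ)) (fmul fun ξ => ((Real.sin (t * h ξ) : ℝ) : ℂ))
    (-(fmul fun ξ => ((Real.sin (t * h ξ) : ℝ) : ℂ)))
    (fmul fun ξ => ((Real.cos (t * h ξ) : ℝ) : ℂ))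

theorem ft_freeGroup_fst (h : E n → ℝ) (t : ℝ) (ψ : L2x2 n) :
    ft (freeGroup h t ψ).fst = rot h t (ft ψ.fst) (ft ψ.snd) := by
  simp only [freeGroup, mat2_fst, map_add, ft_fmul]
  rfl

theorem ft_freeGroup_snd (h : E n → ℝ) (t : ℝ) (ψ : L2x2 n) :
    ft (freeGroup h t ψ).snd = rot h t (ft ψ.snd) (-ft ψ.fst) := by
  simp only [freeGroup, mat2_snd, map_add, ft_fmul, _root_.neg_apply, map_neg]
  rw [rot, map_neg, add_comm]

theorem hasDerivAt_isometry_iff {X Y : Type*} [NormedAddCommGroup X] [InnerProductSpace ℂ X]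
    [NormedAddCommGroup Y] [InnerProductSpace ℂ Y] (e : X ≃ₗᵢ[ℂ] Y) (F : ℝ → X) (y : X) (t : ℝ) :
    HasDerivAt F y t ↔ HasDerivAt (fun s => e (F s)) (e y) t := by
  constructor
  · intro hF
    exact (e.toLinearIsometry.toContinuousLinearMap.restrictScalars ℝ).hasFDerivAt.comp_hasDerivAt
      t hF
  · intro hF
    have := (e.symm.toLinearIsometry.toContinuousLinearMap.restrictScalars
      ℝ).hasFDerivAt.comp_hasDerivAt t hF
    simpa [Function.comp_def] using this

theorem rot_add (h : E n → ℝ) (hh : Measurable h) (s t : ℝ) (F G : L2 n) :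
    rot h (s + t) F G = rot h s (rot h t F G) (rot h t G (-F)) := by
  refine Lp.ext ?_
  filter_upwards [rot_ae h hh (s + t) F G, rot_ae h hh s (rot h t F G) (rot h t G (-F)),
    rot_ae h hh t F G, rot_ae h hh t G (-F), Lp.coeFn_neg F] with ξ h1 h2 h3 h4 h5
  rw [h1, h2, h3, h4, h5, add_mul, Real.cos_add, Real.sin_add, Pi.neg_apply]
  push_cast
  ring

theorem rot_neg (h : E n → ℝ) (t : ℝ) (F G : L2 n) : rot h t (-F) (-G) = -rot h t F G := by
  simp only [rot, map_neg]
  abel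

/-- On the Fourier side, at each ξ, the system u' = hv, v' = -hu with h = `hs κ ξ` is solved by
rotation through the angle th. -/
theorem isC0Group_free {κ : ℝ} (hκ : 0 < κ) :
    IsC0Group (freeGroup (n := n) (hs κ))
      (Complex.I • offDiagonal (schrodinger fun _ => κ) (schrodinger fun _ => κ)) := by
  have hh : Measurable (hs (n := n) κ) := (continuous_hs κ).measurable
  have hS := isSchr_schrodinger (n := n) hκ (V := fun _ => κ) measurable_const 0 (by simp)
  have hW : (mulOp fun _ : E n => ((κ - κ : ℝ) : ℂ)) = 0 := by
    ext1 f
    refine Lp.ext ?_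
    have hm : MemLp (fun _ : E n => ((κ - κ : ℝ) : ℂ)) ∞ volume :=
      memLp_top_real measurable_const 0 (by simp)
    filter_upwards [mulOp_ae hm f, Lp.coeFn_zero ℂ 2 (volume : Measure (E n))] with x h1 h2
    rw [h1, _root_.zero_apply, h2]
    simp
  have hg : ∀ x y, (x, y) ∈ (schrodinger fun _ : E n => κ).graph ↔
      (fun ξ => ((hs κ ξ : ℝ) : ℂ) * ft x ξ) =ᵐ[volume] ft y := by
    intro x y
    rw [hS.mem_graph_iff, hW, _root_.zero_apply, sub_zero,
      resRoot_resRoot_eq_iff hκ]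
  refine ⟨?_, ?_, ?_, ?_⟩
  · ext1 ψ
    refine pair_ext (ft.injective ?_) (ft.injective ?_)
    · rw [ft_freeGroup_fst, rot_zero _ hh]
      rfl
    · rw [ft_freeGroup_snd, rot_zero _ hh]
      rfl
  · intro s t
    ext1 ψ
    refine pair_ext (ft.injective ?_) (ft.injective ?_)
    · rw [ContinuousLinearMap.comp_apply, ft_freeGroup_fst, ft_freeGroup_fst, ft_freeGroup_fst,
        ft_freeGroup_snd, rot_add _ hh]
    · rw [ContinuousLinearMap.comp_apply, ft_freeGroup_snd, ft_freeGroup_snd, ft_freeGroup_fst,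
        ft_freeGroup_snd, rot_add _ hh, ← rot_neg]
  · intro ψ
    rw [continuous_iff_continuousAt]
    intro t
    refine tendsto_pair_iff.mpr ⟨?_, ?_⟩
    · refine (ft (n := n)).toHomeomorph.isInducing.tendsto_nhds_iff.mpr ?_
      exact ((continuous_rot _ hh (ft ψ.fst) (ft ψ.snd)).tendsto t).congr'
        (Eventually.of_forall fun s => (ft_freeGroup_fst _ _ _).symm) |>.trans_eq
          (congrArg 𝓝 (ft_freeGroup_fst _ _ _).symm)
    · refine (ft (n := n)).toHomeomorph.isInducing.tendsto_nhds_iff.mpr ?_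
      exact ((continuous_rot _ hh (ft ψ.snd) (-ft ψ.fst)).tendsto t).congr'
        (Eventually.of_forall fun s => (ft_freeGroup_snd _ _ _).symm) |>.trans_eq
          (congrArg 𝓝 (ft_freeGroup_snd _ _ _).symm)
  · intro ψ y
    rw [mem_graph_I_smul_offDiagonal, hg, hg, hasDerivAt_pair_iff,
      hasDerivAt_isometry_iff ft (fun s => (freeGroup (hs κ) s ψ).fst),
      hasDerivAt_isometry_iff ft (fun s => (freeGroup (hs κ) s ψ).snd)]
    simp only [ft_freeGroup_fst, ft_freeGroup_snd]
    have hneg : ∀ F G : L2 n, (fun ξ => ((hs κ ξ : ℝ) : ℂ) * F ξ) =ᵐ[volume] G →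
        (fun ξ => ((hs κ ξ : ℝ) : ℂ) * (-F : L2 n) ξ) =ᵐ[volume] (-G : L2 n) := by
      intro F G hFG
      filter_upwards [hFG, Lp.coeFn_neg F, Lp.coeFn_neg G] with ξ h1 h2 h3
      rw [h2, h3, Pi.neg_apply, Pi.neg_apply, ← h1, mul_neg]
    constructor
    · rintro ⟨h1, h2⟩
      rw [map_neg] at h2
      have h3 := hneg _ _ h2
      rw [neg_neg] at h3
      exact ⟨hasDerivAt_rot _ hh _ _ _ _ h2 h1, hasDerivAt_rot _ hh _ _ _ _ h1 h3⟩
    · rintro ⟨h1, h2⟩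
      have h3 := hneg _ _ (ae_of_hasDerivAt_rot _ hh _ _ _ h2)
      rw [neg_neg, ← map_neg] at h3
      exact ⟨ae_of_hasDerivAt_rot _ hh _ _ _ h1, h3⟩

theorem norm_freeGroup_le (h : E n → ℝ) (hh : Measurable h) (t : ℝ) : ‖freeGroup h t‖ ≤ 2 := by
  refine ContinuousLinearMap.opNorm_le_bound _ zero_le_two fun ψ => ?_
  have hrot : ∀ F G : L2 n, ‖rot h t F G‖ ≤ ‖F‖ + ‖G‖ := by
    intro F G
    refine (norm_add_le _ _).trans ?_
    have h1 := norm_mulOp_apply_le (memLp_cos h hh t) 1 (Eventually.of_forall fun x => by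
      rw [Complex.norm_real]; exact Real.abs_cos_le_one _) F
    have h2 := norm_mulOp_apply_le (memLp_sin h hh t) 1 (Eventually.of_forall fun x => by
      rw [Complex.norm_real]; exact Real.abs_sin_le_one _) G
    linarith
  have h1 : ‖(freeGroup h t ψ).fst‖ ≤ ‖ψ.fst‖ + ‖ψ.snd‖ := by
    rw [← ft.norm_map, ft_freeGroup_fst]
    refine (hrot _ _).trans ?_
    rw [ft.norm_map, ft.norm_map]
  have h2 : ‖(freeGroup h t ψ).snd‖ ≤ ‖ψ.fst‖ + ‖ψ.snd‖ := by
    rw [← ft.norm_map, ft_freeGroup_snd]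
    refine (hrot _ _).trans ?_
    rw [norm_neg, ft.norm_map, ft.norm_map, add_comm]
  refine abs_le_of_sq_le_sq' ?_ (by positivity) |>.2
  rw [mul_pow, pair_norm_sq, pair_norm_sq]
  have h3 : ‖(freeGroup h t ψ).fst‖ ^ 2 ≤ (‖ψ.fst‖ + ‖ψ.snd‖) ^ 2 := by gcongr
  have h4 : ‖(freeGroup h t ψ).snd‖ ^ 2 ≤ (‖ψ.fst‖ + ‖ψ.snd‖) ^ 2 := by gcongr
  nlinarith [sq_nonneg (‖ψ.fst‖ - ‖ψ.snd‖)]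

/-- The potentials enter u' = Sv, v' = -Tu as the bounded perturbation (u, v) ↦ (W₁v, -W₂u) of the
free system. -/
theorem exists_isC0Group_offDiagonal {κ : ℝ} (hκ : 0 < κ) {W₁ W₂ : L2 n →L[ℂ] L2 n}
    {S T : L2 n →ₗ.[ℂ] L2 n} (hS : IsSchr (resRoot n κ) W₁ S) (hT : IsSchr (resRoot n κ) W₂ T) :
    ∃ U : ℝ → L2x2 n →L[ℂ] L2x2 n, IsC0Group U (Complex.I • offDiagonal S T) := by
  have h0 := isSchr_schrodinger (n := n) hκ (V := fun _ => κ) measurable_const 0 (by simp)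
  have hW : (mulOp fun _ : E n => ((κ - κ : ℝ) : ℂ)) = 0 := by
    refine norm_le_zero_iff.mp (norm_mulOp_le
      (memLp_top_real measurable_const 0 (by simp)) 0 le_rfl (by simp))
  rw [hW] at h0
  refine exists_isC0Group_add (isC0Group_free hκ) 2
    (norm_freeGroup_le _ (continuous_hs κ).measurable) (mat2 0 W₁ (-W₂) 0) _ fun ψ y => ?_
  rw [mem_graph_I_smul_offDiagonal, mem_graph_I_smul_offDiagonal, hS.mem_graph_iff,
    hT.mem_graph_iff, h0.mem_graph_iff, h0.mem_graph_iff]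
  have h1 : (y - mat2 0 W₁ (-W₂) 0 ψ).fst = y.fst - W₁ ψ.snd := by
    change y.fst - (mat2 0 W₁ (-W₂) 0 ψ).fst = _
    simp
  have h2 : -(y - mat2 0 W₁ (-W₂) 0 ψ).snd = -y.snd - W₂ ψ.fst := by
    change -(y.snd - (mat2 0 W₁ (-W₂) 0 ψ).snd) = _
    simp
    abel
  rw [h1, h2]
  simp

end FreeGroup

/-! ### Weighted norms, duality and lower semicontinuity -/

section Sobolev

variable {n : ℕ}

theorem aemeasurable_enorm_ft_sq (f : L2 n) : AEMeasurable (fun ξ => ‖ft f ξ‖ₑ ^ 2) volume :=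
  (Lp.aestronglyMeasurable (ft f)).enorm.pow_const 2

@[fun_prop]
theorem measurable_ofReal_wt_rpow (s : ℝ) :
    Measurable fun ξ : E n => ENNReal.ofReal (wt ξ ^ s) :=
  (measurable_wt_rpow s).ennreal_ofReal

theorem aemeasurable_en (s : ℝ) (f : L2 n) :
    AEMeasurable (fun ξ => ENNReal.ofReal (wt ξ ^ s) * ‖ft f ξ‖ₑ ^ 2) volume :=
  (measurable_ofReal_wt_rpow s).aemeasurable.mul (aemeasurable_enorm_ft_sq f)

theorem sq_lintegral_mul_le {α : Type*} [MeasurableSpace α] {μ : Measure α} {f g : α → ℝ≥0∞}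
    (hf : AEMeasurable f μ) (hg : AEMeasurable g μ) :
    (∫⁻ a, f a * g a ∂μ) ^ 2 ≤ (∫⁻ a, f a ^ 2 ∂μ) * ∫⁻ a, g a ^ 2 ∂μ := by
  have h := ENNReal.lintegral_mul_le_Lp_mul_Lq μ Real.HolderConjugate.two_two hf hg
  have h2 : ∀ x : ℝ≥0∞, (x ^ (1 / 2 : ℝ)) ^ 2 = x := by
    intro x
    rw [← ENNReal.rpow_natCast, ← ENNReal.rpow_mul]
    norm_num
  calc (∫⁻ a, f a * g a ∂μ) ^ 2
      ≤ ((∫⁻ a, f a ^ (2 : ℝ) ∂μ) ^ (1 / 2 : ℝ) * (∫⁻ a, g a ^ (2 : ℝ) ∂μ) ^ (1 / 2 : ℝ)) ^ 2 := by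
        gcongr
        exact h
    _ = _ := by
        rw [mul_pow, h2, h2]
        simp

theorem sq_add_le (a b : ℝ≥0∞) : (a + b) ^ 2 ≤ 2 * a ^ 2 + 2 * b ^ 2 := by
  have h := ENNReal.rpow_add_le_mul_rpow_add_rpow a b (p := 2) (by norm_num)
  norm_num [mul_add] at h
  exact h

theorem ft_add_ae (f g : L2 n) : ft (f + g) =ᵐ[volume] fun ξ => ft f ξ + ft g ξ := by
  rw [map_add]
  exact Lp.coeFn_add _ _

theorem ft_smul_ae (c : ℂ) (f : L2 n) : ft (c • f) =ᵐ[volume] fun ξ => c * ft f ξ := by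
  rw [map_smul]
  exact Lp.coeFn_smul _ _

theorem en_add_le (s : ℝ) (f g : L2 n) : en s (f + g) ≤ 2 * en s f + 2 * en s g := by
  unfold en
  rw [← lintegral_const_mul' _ _ (by norm_num), ← lintegral_const_mul' _ _ (by norm_num),
    ← lintegral_add_left']
  · refine lintegral_mono_ae ?_
    filter_upwards [ft_add_ae f g] with ξ h1
    rw [h1, mul_left_comm, mul_left_comm 2, ← mul_add]
    gcongr
    refine le_trans ?_ (sq_add_le _ _)
    gcongr
    exact enorm_add_le _ _
  · exact (((measurable_ofReal_wt_rpow s).aemeasurable).mul (aemeasurable_enorm_ft_sq f)).const_mul 2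

theorem en_smul (s : ℝ) (c : ℂ) (f : L2 n) : en s (c • f) = ‖c‖ₑ ^ 2 * en s f := by
  unfold en
  rw [← lintegral_const_mul' _ _ (by simp)]
  refine lintegral_congr_ae ?_
  filter_upwards [ft_smul_ae c f] with ξ h1
  rw [h1, enorm_mul, mul_pow]
  ring

theorem en_zero (s : ℝ) : en s (0 : L2 n) = 0 := by
  have := en_smul s (0 : ℂ) (0 : L2 n)
  simpa using this

theorem en_neg (s : ℝ) (f : L2 n) : en s (-f) = en s f := by
  have := en_smul s (-1 : ℂ) f
  simpa using this

theorem en_sub_le (s : ℝ) (f g : L2 n) : en s (f - g) ≤ 2 * en s f + 2 * en s g := by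
  rw [sub_eq_add_neg, ← en_neg s g]
  exact en_add_le s f (-g)

theorem en_mono {s t : ℝ} (h : s ≤ t) (f : L2 n) : en s f ≤ en t f := by
  refine lintegral_mono fun ξ => ?_
  gcongr
  exact one_le_wt ξ

theorem enorm_ft (f : L2 n) : ‖ft f‖ₑ = ‖f‖ₑ := by
  rw [← ofReal_norm, ← ofReal_norm, ft.norm_map]

theorem en_zero_eq (f : L2 n) : en 0 f = ‖f‖ₑ ^ 2 := by
  rw [← enorm_ft, enorm_L2_sq]
  simp [en]

theorem en_zero_lt_top (f : L2 n) : en 0 f < ⊤ := by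
  rw [en_zero_eq]
  exact ENNReal.pow_lt_top enorm_lt_top

/-- Plancherel, then Cauchy–Schwarz after splitting 1 = wt^(-s/2) · wt^(s/2). -/
theorem enorm_inner_sq_le (s : ℝ) (g f : L2 n) :
    ‖(inner ℂ g f : ℂ)‖ₑ ^ 2 ≤ en (-s) g * en s f := by
  have h1 : ‖(inner ℂ g f : ℂ)‖ₑ ≤ ∫⁻ ξ, (ENNReal.ofReal (wt ξ ^ (-s / 2)) * ‖ft g ξ‖ₑ) *
      (ENNReal.ofReal (wt ξ ^ (s / 2)) * ‖ft f ξ‖ₑ) := by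
    rw [← ft.inner_map_map, L2_inner_def]
    refine (enorm_integral_le_lintegral_enorm _).trans (le_of_eq ?_)
    refine lintegral_congr fun ξ => ?_
    rw [mul_mul_mul_comm, ← ENNReal.ofReal_mul (Real.rpow_nonneg (wt_pos ξ).le _),
      ← Real.rpow_add (wt_pos ξ), RCLike.inner_apply, enorm_mul, RCLike.enorm_conj]
    norm_num [← add_div]
    rw [mul_comm]
  have h2 : ∀ (s : ℝ) (f : L2 n),
      ∫⁻ ξ, (ENNReal.ofReal (wt ξ ^ (s / 2)) * ‖ft f ξ‖ₑ) ^ 2 = en s f := by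
    intro s f
    refine lintegral_congr fun ξ => ?_
    rw [mul_pow, ← ENNReal.ofReal_pow (Real.rpow_nonneg (wt_pos ξ).le _), ← Real.rpow_natCast,
      ← Real.rpow_mul (wt_pos ξ).le]
    norm_num
  calc ‖(inner ℂ g f : ℂ)‖ₑ ^ 2 ≤ _ := pow_le_pow_left₀ zero_le h1 2
    _ ≤ _ := sq_lintegral_mul_le
        ((measurable_ofReal_wt_rpow _).aemeasurable.mul (Lp.aestronglyMeasurable _).enorm)
        ((measurable_ofReal_wt_rpow _).aemeasurable.mul (Lp.aestronglyMeasurable _).enorm)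
    _ = _ := by rw [h2, h2]

/-- The square of the norm of `H^s × H^s`. -/
def en2 (s : ℝ) (ψ : L2x2 n) : ℝ≥0∞ := en s ψ.fst + en s ψ.snd

theorem en2_zero_eq (ψ : L2x2 n) : en2 0 ψ = ‖ψ‖ₑ ^ 2 := by
  rw [en2, en_zero_eq, en_zero_eq, ← ofReal_norm, ← ofReal_norm, ← ofReal_norm,
    ← ENNReal.ofReal_pow (norm_nonneg _), ← ENNReal.ofReal_pow (norm_nonneg _),
    ← ENNReal.ofReal_pow (norm_nonneg _), ← ENNReal.ofReal_add (by positivity) (by positivity),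
    pair_norm_sq]

theorem enorm_inner2_sq_le (s : ℝ) (χ ψ : L2x2 n) :
    ‖(inner ℂ χ ψ : ℂ)‖ₑ ^ 2 ≤ 2 * (en2 (-s) χ * en2 s ψ) := by
  have h1 : (inner ℂ χ ψ : ℂ) = inner ℂ χ.fst ψ.fst + inner ℂ χ.snd ψ.snd :=
    WithLp.prod_inner_apply χ ψ
  rw [h1]
  calc _ ≤ (‖(inner ℂ χ.fst ψ.fst : ℂ)‖ₑ + ‖(inner ℂ χ.snd ψ.snd : ℂ)‖ₑ) ^ 2 := by
        gcongr
        exact enorm_add_le _ _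
    _ ≤ _ := sq_add_le _ _
    _ ≤ 2 * (en (-s) χ.fst * en s ψ.fst) + 2 * (en (-s) χ.snd * en s ψ.snd) := by
        gcongr <;> exact enorm_inner_sq_le _ _ _
    _ ≤ _ := by
        rw [← mul_add, en2, en2, add_mul, mul_add, mul_add]
        gcongr
        · exact le_self_add
        · exact le_add_self

/-- Smooth truncations `f_k` of `f` for which `⟪f_k, f⟫` is the `H^{-s}` norm of `f_k`. -/
theorem exists_truncation (s : ℝ) (f : L2 n) : ∃ (g : ℕ → L2 n) (X : ℕ → ℝ),
    (∀ k, 0 ≤ X k) ∧ (∀ k, inner ℂ (g k) f = (X k : ℂ)) ∧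
    (∀ k, en (-s) (g k) = ENNReal.ofReal (X k)) ∧
    Tendsto (fun k => ENNReal.ofReal (X k)) atTop (𝓝 (en s f)) := by
  -- The square root of wt^s cut off where it exceeds k, so that the symbol is bounded. With g = m²f
  -- both ⟪g, f⟫ and the squared H^(-s) norm of g equal ∫ m²|f̂|², since wt^(-s)m⁴ = m². These
  -- integrals increase to the squared H^s norm of f.
  let m : ℕ → E n → ℝ := fun k ξ => if wt ξ ^ s ≤ k then wt ξ ^ (s / 2) else 0
  have hm0 : ∀ k ξ, 0 ≤ m k ξ := by
    intro k ξ
    simp only [m]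
    split_ifs
    · exact Real.rpow_nonneg (wt_pos ξ).le _
    · exact le_rfl
  have hsq : ∀ ξ : E n, (wt ξ ^ (s / 2)) ^ 2 = wt ξ ^ s := by
    intro ξ
    rw [← Real.rpow_natCast, ← Real.rpow_mul (wt_pos ξ).le]
    norm_num
  have hm2 : ∀ k ξ, m k ξ ^ 2 = if wt ξ ^ s ≤ k then wt ξ ^ s else 0 := by
    intro k ξ
    simp only [m]
    split_ifs
    · exact hsq ξ
    · norm_num
  have hmm : ∀ k, Measurable (m k) := fun k =>
    Measurable.ite (measurableSet_le (measurable_wt_rpow s) measurable_const)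
      (measurable_wt_rpow _) measurable_const
  have hmem : ∀ k, MemLp (fun ξ => (m k ξ : ℂ)) ∞ (volume : Measure (E n)) := by
    intro k
    refine memLp_top_real (hmm k) (Real.sqrt k) fun ξ => ?_
    rw [abs_of_nonneg (hm0 k ξ)]
    refine Real.le_sqrt_of_sq_le ?_
    rw [hm2]
    split_ifs with h
    · exact h
    · positivity
  let a : ℕ → L2 n := fun k => fmul (fun ξ => (m k ξ : ℂ)) f
  have ha : ∀ k, ft (a k) =ᵐ[volume] fun ξ => (m k ξ : ℂ) * ft f ξ := by
    intro k
    simp only [a]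
    rw [ft_fmul]
    exact mulOp_ae (hmem k) _
  have he : ∀ k ξ, ‖(m k ξ : ℂ)‖ₑ ^ 2 = ENNReal.ofReal (m k ξ ^ 2) := by
    intro k ξ
    rw [← ofReal_norm, Complex.norm_real, Real.norm_of_nonneg (hm0 k ξ),
      ENNReal.ofReal_pow (hm0 k ξ)]
  have hX : ∀ k, ENNReal.ofReal (‖a k‖ ^ 2) = ∫⁻ ξ, ENNReal.ofReal (m k ξ ^ 2) * ‖ft f ξ‖ₑ ^ 2 := by
    intro k
    rw [ENNReal.ofReal_pow (norm_nonneg _), ofReal_norm, ← enorm_ft, enorm_L2_sq]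
    refine lintegral_congr_ae ?_
    filter_upwards [ha k] with ξ h1
    rw [h1, enorm_mul, mul_pow, he]
  refine ⟨fun k => fmul (fun ξ => (m k ξ : ℂ)) (a k), fun k => ‖a k‖ ^ 2, fun k => by positivity,
    fun k => ?_, fun k => ?_, ?_⟩
  · rw [fmul_symm _ (hmem k)]
    change inner ℂ (a k) (a k) = _
    rw [inner_self_eq_norm_sq_to_K]
    push_cast
    rfl
  · rw [hX, en]
    refine lintegral_congr_ae ?_
    rw [ft_fmul]
    filter_upwards [mulOp_ae (hmem k) (ft (a k)), ha k] with ξ h1 h2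
    rw [h1, h2, enorm_mul, enorm_mul, mul_pow, mul_pow, he, ← mul_assoc, ← mul_assoc,
      ← ENNReal.ofReal_mul (Real.rpow_nonneg (wt_pos ξ).le _), ← ENNReal.ofReal_mul]
    · congr 2
      rw [hm2]
      split_ifs
      · rw [← Real.rpow_add (wt_pos ξ), neg_add_cancel, Real.rpow_zero, one_mul]
      · simp
    · exact mul_nonneg (Real.rpow_nonneg (wt_pos ξ).le _) (sq_nonneg _)
  · simp only [hX, en]
    refine lintegral_tendsto_of_tendsto_of_monotone ?_ ?_ ?_
    · exact fun k => (((hmm k).pow_const 2).ennreal_ofReal.aemeasurable).mul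
        (aemeasurable_enorm_ft_sq f)
    · refine Eventually.of_forall fun ξ k l hkl => ?_
      simp only [hm2]
      gcongr
      split_ifs with h1 h2 h2
      · exact le_rfl
      · exact absurd (h1.trans (Nat.cast_le.mpr hkl)) h2
      · exact Real.rpow_nonneg (wt_pos ξ).le _
      · exact le_rfl
    · refine Eventually.of_forall fun ξ => tendsto_const_nhds.congr' ?_
      filter_upwards [eventually_ge_atTop ⌈wt ξ ^ s⌉₊] with k hk
      rw [hm2, if_pos ((Nat.le_ceil _).trans (Nat.cast_le.mpr hk))]

/-- Testing with truncations of ψ itself makes the hypothesis read X² ≤ CX, and X tends to `en2 s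
ψ`. Finiteness of ‖ψ‖ in H^s is a conclusion here and is not presupposed. -/
theorem en2_le_of_inner_le (s : ℝ) (ψ : L2x2 n) (C : ℝ≥0∞)
    (h : ∀ χ : L2x2 n, en2 (-s) χ ≠ ⊤ → ‖(inner ℂ χ ψ : ℂ)‖ₑ ^ 2 ≤ C * en2 (-s) χ) :
    en2 s ψ ≤ C := by
  obtain ⟨g, X, hX0, hX1, hX2, hX3⟩ := exists_truncation s ψ.fst
  obtain ⟨g', Y, hY0, hY1, hY2, hY3⟩ := exists_truncation s ψ.snd
  refine le_of_tendsto (hX3.add hY3) (Eventually.of_forall fun k => ?_)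
  have h2 : (inner ℂ (WithLp.toLp 2 (g k, g' k)) ψ : ℂ) = ((X k + Y k : ℝ) : ℂ) := by
    rw [WithLp.prod_inner_apply]
    change inner ℂ (g k) ψ.fst + inner ℂ (g' k) ψ.snd = _
    rw [hX1, hY1]
    push_cast
    rfl
  have h3 : en2 (-s) (WithLp.toLp 2 (g k, g' k)) = ENNReal.ofReal (X k + Y k) := by
    change en (-s) (g k) + en (-s) (g' k) = _
    rw [hX2, hY2, ENNReal.ofReal_add (hX0 k) (hY0 k)]
  have h1 := h (WithLp.toLp 2 (g k, g' k)) (by rw [h3]; exact ENNReal.ofReal_ne_top)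
  have h0 : 0 ≤ X k + Y k := add_nonneg (hX0 k) (hY0 k)
  rw [h2, h3, ← ofReal_norm, Complex.norm_real, Real.norm_of_nonneg h0, sq] at h1
  rw [← ENNReal.ofReal_add (hX0 k) (hY0 k)]
  by_cases hz : ENNReal.ofReal (X k + Y k) = 0
  · rw [hz]
    exact zero_le
  · exact (ENNReal.mul_le_mul_iff_left hz ENNReal.ofReal_ne_top).mp h1

/-- Lower semicontinuity by duality: pairings with a fixed χ of finite H^(-s) norm pass to the
limit. The factor 2 is the one in `enorm_inner2_sq_le`. -/
theorem en2_le_of_tendsto {s : ℝ} {ψ : ℕ → L2x2 n} {ψ₀ : L2x2 n} (hψ : Tendsto ψ atTop (𝓝 ψ₀))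
    {c : ℕ → ℝ≥0∞} {c₀ : ℝ≥0∞} (hc : Tendsto c atTop (𝓝 c₀)) (h : ∀ k, en2 s (ψ k) ≤ c k) :
    en2 s ψ₀ ≤ 2 * c₀ := by
  refine en2_le_of_inner_le s ψ₀ _ fun χ hχ => ?_
  have h1 : Tendsto (fun k => ‖(inner ℂ χ (ψ k) : ℂ)‖ₑ ^ 2) atTop
      (𝓝 (‖(inner ℂ χ ψ₀ : ℂ)‖ₑ ^ 2)) :=
    (ENNReal.continuous_pow 2).tendsto _ |>.comp (tendsto_const_nhds.inner hψ).enorm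
  have h2 : Tendsto (fun k => 2 * c k * en2 (-s) χ) atTop (𝓝 (2 * c₀ * en2 (-s) χ)) :=
    ENNReal.Tendsto.mul_const (ENNReal.Tendsto.const_mul hc (by simp)) (Or.inr hχ)
  refine le_of_tendsto_of_tendsto' h1 h2 fun k => ?_
  refine (enorm_inner2_sq_le s χ (ψ k)).trans ?_
  rw [mul_comm (en2 (-s) χ), ← mul_assoc]
  gcongr
  exact h k

end Sobolev

/-! ### Quadratic interpolation between H^(-N) and H^N -/

section Interpolation

variable {n : ℕ}

/-- `1 / (2 cosh x)`. -/
def sech (x : ℝ) : ℝ := (Real.exp x + Real.exp (-x))⁻¹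

theorem sech_pos (x : ℝ) : 0 < sech x := by
  unfold sech
  positivity

@[fun_prop]
theorem continuous_sech : Continuous sech := by
  unfold sech
  exact (by fun_prop : Continuous fun x => Real.exp x + Real.exp (-x)).inv₀ fun x => by positivity

theorem sech_mul (x : ℝ) : sech x * (Real.exp x + Real.exp (-x)) = 1 :=
  inv_mul_cancel₀ (by positivity)

theorem sech_le_exp (x : ℝ) : sech x ≤ Real.exp x := by
  rw [← neg_neg x, Real.exp_neg (-x), sech, neg_neg]
  exact inv_anti₀ (by positivity) (by linarith [Real.exp_pos x])

theorem sech_le_exp_neg (x : ℝ) : sech x ≤ Real.exp (-x) := by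
  unfold sech
  rw [Real.exp_neg]
  exact inv_anti₀ (by positivity) (by linarith [inv_pos.mpr (Real.exp_pos x)])

theorem lintegral_exp_mul_sech_lt_top {θ : ℝ} (hθ : |θ| < 1) :
    ∫⁻ τ : ℝ, ENNReal.ofReal (Real.exp (θ * τ) * sech τ) < ⊤ := by
  obtain ⟨h1, h2⟩ := abs_lt.mp hθ
  rw [← lintegral_add_compl _ (measurableSet_Iic (a := (0 : ℝ))), compl_Iic]
  refine ENNReal.add_lt_top.mpr ⟨?_, ?_⟩
  · have h3 := (integrableOn_exp_mul_Iic (a := θ + 1) (by linarith) 0).lintegral_lt_top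
    refine lt_of_le_of_lt (lintegral_mono fun τ => ENNReal.ofReal_le_ofReal ?_) h3
    rw [add_mul, one_mul, Real.exp_add]
    gcongr
    exact sech_le_exp τ
  · have h3 := (integrableOn_exp_mul_Ioi (a := θ - 1) (by linarith) 0).lintegral_lt_top
    refine lt_of_le_of_lt (lintegral_mono fun τ => ENNReal.ofReal_le_ofReal ?_) h3
    rw [sub_mul, one_mul, sub_eq_add_neg, Real.exp_add]
    gcongr
    exact sech_le_exp_neg τ

theorem lintegral_exp_mul_sech_ne_zero (θ : ℝ) :
    ∫⁻ τ : ℝ, ENNReal.ofReal (Real.exp (θ * τ) * sech τ) ≠ 0 := by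
  refine ((lintegral_pos_iff_support ?_).mpr ?_).ne'
  · exact (by fun_prop : Continuous fun τ => Real.exp (θ * τ) * sech τ).measurable.ennreal_ofReal
  · have : Function.support (fun τ : ℝ => ENNReal.ofReal (Real.exp (θ * τ) * sech τ)) = univ := by
      ext τ
      simp [mul_pos (Real.exp_pos (θ * τ)) (sech_pos τ)]
    rw [this]
    simp

theorem sech_mul_sq_le (x a b : ℝ) :
    sech x * (a + b) ^ 2 ≤ Real.exp x * a ^ 2 + Real.exp (-x) * b ^ 2 := by
  have h0 : Real.exp x * Real.exp (-x) = 1 := by rw [← Real.exp_add]; simp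
  rw [sech, inv_mul_le_iff₀ (by positivity)]
  nlinarith [sq_nonneg (Real.exp x * a - Real.exp (-x) * b)]

/-- The argument of `sech` in the interpolation functional. -/
def lw (N τ : ℝ) (ξ : E n) : ℝ := τ + N * Real.log (wt ξ)

theorem exp_lw (N τ : ℝ) (ξ : E n) : Real.exp (lw N τ ξ) = Real.exp τ * wt ξ ^ N := by
  rw [lw, Real.exp_add, Real.rpow_def_of_pos (wt_pos ξ), mul_comm N]

theorem exp_neg_lw (N τ : ℝ) (ξ : E n) : Real.exp (-lw N τ ξ) = Real.exp (-τ) * wt ξ ^ (-N) := by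
  rw [lw, neg_add, Real.exp_add, Real.rpow_def_of_pos (wt_pos ξ)]
  ring_nf

theorem continuous_lw (N : ℝ) : Continuous fun p : ℝ × E n => lw N p.1 p.2 := by
  unfold lw
  refine continuous_fst.add (continuous_const.mul ?_)
  exact (continuous_wt.comp continuous_snd).log fun p => (wt_pos p.2).ne'

/-- The functional of the real interpolation method. -/
def kf (N τ : ℝ) (f : L2 n) : ℝ≥0∞ := ∫⁻ ξ, ENNReal.ofReal (sech (lw N τ ξ)) * ‖ft f ξ‖ₑ ^ 2

/-- `kf` is the quadratic K-functional, the minimum of e^τ‖a‖²_N + e^(-τ)‖b‖²_(-N) over splittings a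
+ b. At each frequency, with weights X and 1/X, the minimum of Xa² + b²/X is |a + b|²/(X + 1/X), and
X = exp(lw). -/
theorem kf_add_le (N τ : ℝ) (a b : L2 n) :
    kf N τ (a + b) ≤ ENNReal.ofReal (Real.exp τ) * en N a +
      ENNReal.ofReal (Real.exp (-τ)) * en (-N) b := by
  unfold kf en
  rw [← lintegral_const_mul' _ _ (by simp), ← lintegral_const_mul' _ _ (by simp),
    ← lintegral_add_left' ((aemeasurable_en _ _).const_mul _)]
  refine lintegral_mono_ae ?_
  filter_upwards [ft_add_ae a b] with ξ h1
  rw [h1, ← mul_assoc, ← mul_assoc, ← ENNReal.ofReal_mul (Real.exp_pos _).le,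
    ← ENNReal.ofReal_mul (Real.exp_pos _).le, ← exp_lw, ← exp_neg_lw, ← ofReal_norm,
    ← ofReal_norm, ← ofReal_norm, ← ENNReal.ofReal_pow (norm_nonneg _),
    ← ENNReal.ofReal_pow (norm_nonneg _), ← ENNReal.ofReal_pow (norm_nonneg _),
    ← ENNReal.ofReal_mul (sech_pos _).le, ← ENNReal.ofReal_mul (Real.exp_pos _).le,
    ← ENNReal.ofReal_mul (Real.exp_pos _).le, ← ENNReal.ofReal_add (by positivity) (by positivity)]
  refine ENNReal.ofReal_le_ofReal (le_trans ?_ (sech_mul_sq_le _ _ _))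
  have := (sech_pos (lw N τ ξ)).le
  gcongr
  exact norm_add_le _ _

theorem enorm_ofReal_sq {r : ℝ} (hr : 0 ≤ r) : ‖(r : ℂ)‖ₑ ^ 2 = ENNReal.ofReal (r ^ 2) := by
  rw [← ofReal_norm, Complex.norm_real, Real.norm_of_nonneg hr, ENNReal.ofReal_pow hr]

/-- The minimising splitting: at each frequency f is divided in the ratio 1/X to X, by two Fourier
multipliers with values in [0, 1] and sum 1. -/
theorem exists_decomposition (N τ : ℝ) (f : L2 n) : ∃ a b : L2 n, a + b = f ∧
    ENNReal.ofReal (Real.exp τ) * en N a + ENNReal.ofReal (Real.exp (-τ)) * en (-N) b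
      = kf N τ f := by
  have hlw : Continuous (lw (n := n) N τ) :=
    (continuous_lw N).comp (continuous_const.prodMk continuous_id)
  have hb1 : ∀ ξ : E n, 0 ≤ Real.exp (-lw N τ ξ) * sech (lw N τ ξ) := fun ξ =>
    mul_nonneg (Real.exp_pos _).le (sech_pos _).le
  have hb2 : ∀ ξ : E n, 0 ≤ Real.exp (lw N τ ξ) * sech (lw N τ ξ) := fun ξ =>
    mul_nonneg (Real.exp_pos _).le (sech_pos _).le
  have hsum : ∀ ξ : E n, Real.exp (-lw N τ ξ) * sech (lw N τ ξ) +
      Real.exp (lw N τ ξ) * sech (lw N τ ξ) = 1 := by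
    intro ξ
    rw [← sech_mul (lw N τ ξ)]
    ring
  have hm1 : MemLp (fun ξ : E n => ((Real.exp (-lw N τ ξ) * sech (lw N τ ξ) : ℝ) : ℂ)) ∞ volume := by
    refine memLp_top_real (by fun_prop : Continuous _).measurable 1 fun ξ => ?_
    rw [abs_of_nonneg (hb1 ξ)]
    linarith [hsum ξ, hb2 ξ]
  have hm2 : MemLp (fun ξ : E n => ((Real.exp (lw N τ ξ) * sech (lw N τ ξ) : ℝ) : ℂ)) ∞ volume := by
    refine memLp_top_real (by fun_prop : Continuous _).measurable 1 fun ξ => ?_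
    rw [abs_of_nonneg (hb2 ξ)]
    linarith [hsum ξ, hb1 ξ]
  refine ⟨fmul (fun ξ : E n => ((Real.exp (-lw N τ ξ) * sech (lw N τ ξ) : ℝ) : ℂ)) f,
    fmul (fun ξ : E n => ((Real.exp (lw N τ ξ) * sech (lw N τ ξ) : ℝ) : ℂ)) f, ?_, ?_⟩
  · refine ft_ext ?_
    refine (ft_add_ae _ _).trans ?_
    rw [ft_fmul, ft_fmul]
    filter_upwards [mulOp_ae hm1 (ft f), mulOp_ae hm2 (ft f)] with ξ h1 h2
    rw [h1, h2, ← add_mul, ← Complex.ofReal_add, hsum, Complex.ofReal_one, one_mul]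
  · unfold kf en
    rw [← lintegral_const_mul' _ _ (by simp), ← lintegral_const_mul' _ _ (by simp),
      ← lintegral_add_left' ((aemeasurable_en _ _).const_mul _)]
    refine lintegral_congr_ae ?_
    rw [ft_fmul, ft_fmul]
    filter_upwards [mulOp_ae hm1 (ft f), mulOp_ae hm2 (ft f)] with ξ h1 h2
    rw [h1, h2, ← mul_assoc, ← mul_assoc, ← ENNReal.ofReal_mul (Real.exp_pos _).le,
      ← ENNReal.ofReal_mul (Real.exp_pos _).le, ← exp_lw, ← exp_neg_lw, enorm_mul, enorm_mul,
      mul_pow, mul_pow, enorm_ofReal_sq (hb1 ξ), enorm_ofReal_sq (hb2 ξ), ← mul_assoc,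
      ← mul_assoc, ← add_mul,
      ← ENNReal.ofReal_mul (Real.exp_pos _).le, ← ENNReal.ofReal_mul (Real.exp_pos _).le,
      ← ENNReal.ofReal_add (by positivity) (by positivity)]
    congr 2
    have h0 : Real.exp (lw N τ ξ) * Real.exp (-lw N τ ξ) = 1 := by rw [← Real.exp_add]; simp
    have h3 := sech_mul (lw N τ ξ)
    calc _ = (Real.exp (lw N τ ξ) * Real.exp (-lw N τ ξ)) * sech (lw N τ ξ) *
          (sech (lw N τ ξ) * (Real.exp (lw N τ ξ) + Real.exp (-lw N τ ξ))) := by ring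
      _ = _ := by rw [h0, h3]; ring

/-- For fixed ξ, the translation of τ by N log(wt ξ) turns the integral into a constant times
wt^(-θN). So integrating the K-functional against e^(θτ) recovers the norm of order -θN exactly, up
to that constant. -/
theorem lintegral_kf (N θ : ℝ) (f : L2 n) :
    ∫⁻ τ : ℝ, ENNReal.ofReal (Real.exp (θ * τ)) * kf N τ f =
      (∫⁻ τ : ℝ, ENNReal.ofReal (Real.exp (θ * τ) * sech τ)) * en (-(θ * N)) f := by
  have h1 : ∀ ξ : E n, ∫⁻ τ : ℝ, ENNReal.ofReal (Real.exp (θ * τ) * sech (lw N τ ξ)) =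
      (∫⁻ τ : ℝ, ENNReal.ofReal (Real.exp (θ * τ) * sech τ)) *
        ENNReal.ofReal (wt ξ ^ (-(θ * N))) := by
    intro ξ
    rw [← lintegral_add_right_eq_self (μ := volume)
      (fun τ : ℝ => ENNReal.ofReal (Real.exp (θ * τ) * sech τ)) (N * Real.log (wt ξ)),
      ← lintegral_mul_const' _ _ (by simp)]
    refine lintegral_congr fun τ => ?_
    rw [← ENNReal.ofReal_mul (mul_nonneg (Real.exp_pos _).le (sech_pos _).le)]
    congr 1
    rw [Real.rpow_def_of_pos (wt_pos ξ), mul_right_comm, ← Real.exp_add, lw]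
    ring_nf
  have hmeas : AEMeasurable (Function.uncurry fun (τ : ℝ) (ξ : E n) =>
      ENNReal.ofReal (Real.exp (θ * τ) * sech (lw N τ ξ)) * ‖ft f ξ‖ₑ ^ 2)
      ((volume : Measure ℝ).prod (volume : Measure (E n))) := by
    have h2 : Continuous fun p : ℝ × E n => Real.exp (θ * p.1) * sech (lw N p.1 p.2) :=
      (by fun_prop : Continuous fun p : ℝ × E n => Real.exp (θ * p.1)).mul
        (continuous_sech.comp (continuous_lw N))
    have h3 : AEMeasurable (fun p : ℝ × E n => ‖ft f p.2‖ₑ ^ 2)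
        ((volume : Measure ℝ).prod (volume : Measure (E n))) :=
      (aemeasurable_enorm_ft_sq f).comp_quasiMeasurePreserving Measure.quasiMeasurePreserving_snd
    exact h2.measurable.ennreal_ofReal.aemeasurable.mul h3
  calc _ = ∫⁻ τ : ℝ, ∫⁻ ξ, ENNReal.ofReal (Real.exp (θ * τ) * sech (lw N τ ξ)) * ‖ft f ξ‖ₑ ^ 2 := by
        refine lintegral_congr fun τ => ?_
        rw [kf, ← lintegral_const_mul' _ _ (by simp)]
        refine lintegral_congr fun ξ => ?_
        rw [← mul_assoc, ← ENNReal.ofReal_mul (Real.exp_pos _).le]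
    _ = ∫⁻ ξ, ∫⁻ τ : ℝ, ENNReal.ofReal (Real.exp (θ * τ) * sech (lw N τ ξ)) * ‖ft f ξ‖ₑ ^ 2 :=
        lintegral_lintegral_swap hmeas
    _ = ∫⁻ ξ, (∫⁻ τ : ℝ, ENNReal.ofReal (Real.exp (θ * τ) * sech τ)) *
          (ENNReal.ofReal (wt ξ ^ (-(θ * N))) * ‖ft f ξ‖ₑ ^ 2) := by
        refine lintegral_congr fun ξ => ?_
        rw [lintegral_mul_const' _ _ (by simp), h1, mul_assoc]
    _ = _ := by
        rw [lintegral_const_mul'' _ (aemeasurable_en _ _), en]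

/-- Split ψ optimally, bound the image of the smooth part in H^N and of the rough part in H^(-N).
The images are an admissible splitting of Tψ. -/
theorem kf_le_of_bounds (T : L2x2 n →L[ℂ] L2x2 n) (N : ℝ) (C : ℝ≥0)
    (h1 : ∀ ψ, en2 N (T ψ) ≤ C * en2 N ψ) (h2 : ∀ ψ, en2 (-N) (T ψ) ≤ C * en2 (-N) ψ)
    (τ : ℝ) (ψ : L2x2 n) :
    kf N τ (T ψ).fst + kf N τ (T ψ).snd ≤ C * (kf N τ ψ.fst + kf N τ ψ.snd) := by
  obtain ⟨a₁, b₁, hab₁, hk₁⟩ := exists_decomposition N τ ψ.fst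
  obtain ⟨a₂, b₂, hab₂, hk₂⟩ := exists_decomposition N τ ψ.snd
  have hψ : ψ = WithLp.toLp 2 (a₁, a₂) + WithLp.toLp 2 (b₁, b₂) :=
    pair_ext hab₁.symm hab₂.symm
  have h3 := h1 (WithLp.toLp 2 (a₁, a₂))
  have h4 := h2 (WithLp.toLp 2 (b₁, b₂))
  have h5 : en2 N (WithLp.toLp 2 (a₁, a₂)) = en N a₁ + en N a₂ := rfl
  have h6 : en2 (-N) (WithLp.toLp 2 (b₁, b₂)) = en (-N) b₁ + en (-N) b₂ := rfl
  have hT : T ψ = T (WithLp.toLp 2 (a₁, a₂)) + T (WithLp.toLp 2 (b₁, b₂)) := by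
    rw [hψ, map_add]
  rw [h5, en2] at h3
  rw [h6, en2] at h4
  rw [← hk₁, ← hk₂, hT]
  set a := T (WithLp.toLp 2 (a₁, a₂))
  set b := T (WithLp.toLp 2 (b₁, b₂))
  calc kf N τ (a + b).fst + kf N τ (a + b).snd
      ≤ (ENNReal.ofReal (Real.exp τ) * en N a.fst +
          ENNReal.ofReal (Real.exp (-τ)) * en (-N) b.fst) +
        (ENNReal.ofReal (Real.exp τ) * en N a.snd +
          ENNReal.ofReal (Real.exp (-τ)) * en (-N) b.snd) :=
        add_le_add (kf_add_le N τ _ _) (kf_add_le N τ _ _)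
    _ = ENNReal.ofReal (Real.exp τ) * (en N a.fst + en N a.snd) +
        ENNReal.ofReal (Real.exp (-τ)) * (en (-N) b.fst + en (-N) b.snd) := by ring
    _ ≤ ENNReal.ofReal (Real.exp τ) * (C * (en N a₁ + en N a₂)) +
        ENNReal.ofReal (Real.exp (-τ)) * (C * (en (-N) b₁ + en (-N) b₂)) := by gcongr
    _ = _ := by ring

/-- Interpolation between `H^{-N}` and `H^N`. -/
theorem en2_le_of_interpolation (T : L2x2 n →L[ℂ] L2x2 n) {N : ℝ} (C : ℝ≥0)
    (h1 : ∀ ψ, en2 N (T ψ) ≤ C * en2 N ψ) (h2 : ∀ ψ, en2 (-N) (T ψ) ≤ C * en2 (-N) ψ)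
    {s : ℝ} (hs : |s| < N) (ψ : L2x2 n) : en2 s (T ψ) ≤ C * en2 s ψ := by
  have hN : 0 < N := (abs_nonneg s).trans_lt hs
  have hθ : |-(s / N)| < 1 := by
    rw [abs_neg, abs_div, abs_of_pos hN, div_lt_one hN]
    exact hs
  have hsN : -(-(s / N) * N) = s := by
    rw [neg_mul, neg_neg, div_mul_cancel₀ _ hN.ne']
  have hmeas : ∀ f : L2 n, AEMeasurable (fun τ : ℝ =>
      ENNReal.ofReal (Real.exp (-(s / N) * τ)) * kf N τ f) volume := by
    intro f
    have h5 : AEMeasurable (Function.uncurry fun (τ : ℝ) (ξ : E n) =>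
        ENNReal.ofReal (sech (lw N τ ξ)) * ‖ft f ξ‖ₑ ^ 2)
        ((volume : Measure ℝ).prod (volume : Measure (E n))) := by
      have h6 : AEMeasurable (fun p : ℝ × E n => ‖ft f p.2‖ₑ ^ 2)
          ((volume : Measure ℝ).prod (volume : Measure (E n))) :=
        (aemeasurable_enorm_ft_sq f).comp_quasiMeasurePreserving
          Measure.quasiMeasurePreserving_snd
      exact (continuous_sech.comp (continuous_lw N)).measurable.ennreal_ofReal.aemeasurable.mul h6
    exact (by fun_prop : Continuous fun τ : ℝ =>
      Real.exp (-(s / N) * τ)).measurable.ennreal_ofReal.aemeasurable.mul h5.lintegral_prod_right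
  have h3 : ∀ ψ : L2x2 n, ∫⁻ τ : ℝ, ENNReal.ofReal (Real.exp (-(s / N) * τ)) *
      (kf N τ ψ.fst + kf N τ ψ.snd) =
      (∫⁻ τ : ℝ, ENNReal.ofReal (Real.exp (-(s / N) * τ) * sech τ)) * en2 s ψ := by
    intro ψ
    simp only [mul_add]
    rw [lintegral_add_left' (hmeas _), lintegral_kf, lintegral_kf, hsN, en2, mul_add]
  have h4 : ∫⁻ τ : ℝ, ENNReal.ofReal (Real.exp (-(s / N) * τ)) *
        (kf N τ (T ψ).fst + kf N τ (T ψ).snd) ≤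
      C * ∫⁻ τ : ℝ, ENNReal.ofReal (Real.exp (-(s / N) * τ)) * (kf N τ ψ.fst + kf N τ ψ.snd) := by
    rw [← lintegral_const_mul' _ _ (by simp)]
    refine lintegral_mono fun τ => ?_
    rw [mul_left_comm]
    gcongr
    exact kf_le_of_bounds T N C h1 h2 τ ψ
  rw [h3, h3, mul_left_comm] at h4
  exact (ENNReal.mul_le_mul_iff_right (lintegral_exp_mul_sech_ne_zero _)
    (lintegral_exp_mul_sech_lt_top hθ).ne).mp h4

end Interpolation

/-! ### Schwartz potentials are bounded on every H^s -/

section SchwartzMultipliers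

variable {n : ℕ}

theorem continuous_fourier_of_integrable {f : E n → ℂ} (hf : Integrable f) :
    Continuous (FourierTransform.fourier f) :=
  VectorFourier.fourierIntegral_continuous Real.continuous_fourierChar (by exact continuous_inner) hf

/-- The L² transform and the Fourier integral define the same distribution, by the multiplication
formula against test functions. -/
theorem ft_ae_of_integrable (f : L2 n) (hf : Integrable f) :
    ft f =ᵐ[volume] FourierTransform.fourier (f : E n → ℂ) := by
  have hc := continuous_fourier_of_integrable hf
  have hg : LocallyIntegrable (ft f) (volume : Measure (E n)) :=
    (Lp.memLp (ft f)).locallyIntegrable (by norm_num)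
  refine ae_eq_of_integral_contDiff_smul_eq hg hc.locallyIntegrable ?_
  intro η hη hηc
  have hg₁ : HasCompactSupport (Complex.ofRealCLM ∘ η) := hηc.comp_left rfl
  have hg₂ : ContDiff ℝ ∞ (Complex.ofRealCLM ∘ η) := by fun_prop
  have h1 := congrArg (fun T => T (hg₁.toSchwartzMap hg₂)) (fourier_toDist f)
  simp only [TemperedDistribution.fourier_apply, Lp.toTemperedDistribution_apply,
    SchwartzMap.fourier_coe] at h1
  have h2 := VectorFourier.integral_fourierIntegral_smul_eq_flip (L := innerₗ (E n))
    (μ := volume) (ν := volume) Real.continuous_fourierChar continuous_inner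
    (hg₁.toSchwartzMap hg₂).integrable hf
  have h3 : ∀ x, VectorFourier.fourierIntegral Real.fourierChar volume (innerₗ (E n)).flip f x =
      FourierTransform.fourier (f : E n → ℂ) x := by
    intro x
    rw [flip_innerₗ]
    rfl
  simp only [h3] at h2
  have h4 := h1.symm.trans h2
  simpa using h4

theorem Real.fourierChar_norm_mul (t : ℝ) (z : ℂ) : ‖((Real.fourierChar t : Circle) : ℂ) * z‖ = ‖z‖ := by
  rw [norm_mul, Circle.norm_coe, one_mul]

theorem memLp_modulated (W : 𝓢(E n, ℂ)) (ξ : E n) :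
    MemLp (fun x => (Real.fourierChar (inner ℝ x ξ) : ℂ) * W x) 2 volume := by
  have h1 : Continuous fun x : E n => (Real.fourierChar (inner ℝ x ξ) : ℂ) * W x :=
    (continuous_subtype_val.comp (Real.continuous_fourierChar.comp (by fun_prop))).mul W.continuous
  refine (W.memLp 2 volume).mono h1.aestronglyMeasurable (Eventually.of_forall fun x => ?_)
  rw [Real.fourierChar_norm_mul]

/-- The function `e^{2πi⟨x, ξ⟩} W(x)`. -/
def modulated (W : 𝓢(E n, ℂ)) (ξ : E n) : L2 n := (memLp_modulated W ξ).toLp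

theorem modulated_ae (W : 𝓢(E n, ℂ)) (ξ : E n) :
    modulated W ξ =ᵐ[volume] fun x => (Real.fourierChar (inner ℝ x ξ) : ℂ) * W x :=
  MemLp.coeFn_toLp _

theorem continuous_modulated (W : 𝓢(E n, ℂ)) : Continuous (modulated W) := by
  rw [continuous_iff_continuousAt]
  intro ξ
  refine tendsto_L2_of_dominated _ (modulated_ae W) (fun x => 2 * ‖W x‖)
    ((W.memLp 2 volume).norm.const_mul 2) ?_ ?_
  · filter_upwards [modulated_ae W ξ] with x h1 η
    rw [h1]
    refine (norm_sub_le _ _).trans ?_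
    rw [Real.fourierChar_norm_mul, Real.fourierChar_norm_mul, two_mul]
  · filter_upwards [modulated_ae W ξ] with x h1
    rw [h1]
    have h2 : Continuous fun η : E n => (Real.fourierChar (inner ℝ x η) : ℂ) * W x :=
      (continuous_subtype_val.comp (Real.continuous_fourierChar.comp (by fun_prop))).mul
        continuous_const
    exact h2.tendsto ξ

theorem memLp_top_schwartz (W : 𝓢(E n, ℂ)) : MemLp (W : E n → ℂ) ∞ volume := W.memLp ∞ volume

theorem integrable_mulOp_schwartz (W : 𝓢(E n, ℂ)) (f : L2 n) : Integrable (mulOp W f) :=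
  ((W.memLp 2 volume).integrable_mul (Lp.memLp f)).congr (mulOp_ae (memLp_top_schwartz W) f).symm

theorem integrable_modulated (W : 𝓢(E n, ℂ)) (ξ : E n) : Integrable (modulated W ξ) := by
  refine W.integrable.norm.mono' (Lp.aestronglyMeasurable _) ?_
  filter_upwards [modulated_ae W ξ] with x h1
  rw [h1, Real.fourierChar_norm_mul]

theorem fourier_modulated (W : 𝓢(E n, ℂ)) (ξ η : E n) :
    FourierTransform.fourier (modulated W ξ : E n → ℂ) η = FourierTransform.fourier W (η - ξ) := by
  rw [SchwartzMap.fourier_coe, Real.fourier_eq, Real.fourier_eq]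
  refine integral_congr_ae ?_
  filter_upwards [modulated_ae W ξ] with x h1
  rw [h1, Circle.smul_def, Circle.smul_def, smul_eq_mul, smul_eq_mul, ← mul_assoc,
    ← Circle.coe_mul, ← AddChar.map_add_eq_mul, inner_sub_right]
  ring_nf

theorem inner_modulated_ae (W : E n → ℝ) (W' : 𝓢(E n, ℂ)) (hW : ∀ x, W' x = W x) (g : L2 n) :
    (fun η => (inner ℂ (modulated W' η) g : ℂ)) =ᵐ[volume] ft (mulOp W' g) := by
  filter_upwards [ft_ae_of_integrable _ (integrable_mulOp_schwartz W' g)] with η h1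
  rw [h1, L2_inner_def, Real.fourier_eq]
  refine integral_congr_ae ?_
  filter_upwards [modulated_ae W' η, mulOp_ae (memLp_top_schwartz W') g] with x h2 h3
  rw [h2, h3, RCLike.inner_apply, map_mul, hW, Complex.conj_ofReal, Circle.smul_def,
    AddChar.map_neg_eq_inv, Circle.coe_inv_eq_conj, smul_eq_mul]
  ring

/-- The convolution formula. For real W the transform of Wg at ξ is the pairing of g with
e^(2πi⟨x,ξ⟩)W, and Plancherel rewrites this as an integral with the translated kernel. -/
theorem ft_mulOp_schwartz (W : E n → ℝ) (W' : 𝓢(E n, ℂ)) (hW : ∀ x, W' x = W x) (g : L2 n) :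
    ft (mulOp W' g) =ᵐ[volume] fun ξ =>
      ∫ η, ft g η * (starRingEnd ℂ) (FourierTransform.fourier W' (η - ξ)) := by
  refine (inner_modulated_ae W W' hW g).symm.trans (Eventually.of_forall fun ξ => ?_)
  simp only
  rw [← ft.inner_map_map, L2_inner_def]
  refine integral_congr_ae ?_
  filter_upwards [ft_ae_of_integrable _ (integrable_modulated W' ξ)] with η h1
  rw [h1, fourier_modulated, RCLike.inner_apply]

theorem wt_le_two_mul (ξ η : E n) : wt ξ ≤ 2 * wt (η - ξ) * wt η := by
  unfold wt
  have h1 : ‖ξ‖ ≤ ‖η - ξ‖ + ‖η‖ := by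
    calc ‖ξ‖ = ‖η - (η - ξ)‖ := by rw [sub_sub_cancel]
      _ ≤ _ := by rw [add_comm]; exact norm_sub_le _ _
  have h2 := mul_nonneg (sq_nonneg ‖η - ξ‖) (sq_nonneg ‖η‖)
  nlinarith [sq_nonneg (‖η - ξ‖ - ‖η‖), norm_nonneg ξ]

theorem wt_neg (ξ : E n) : wt (-ξ) = wt ξ := by
  simp [wt]

/-- Peetre's inequality. For negative s it follows from the positive case by exchanging ξ and η,
since the weight is even. -/
theorem wt_rpow_le (s : ℝ) (ξ η : E n) :
    wt ξ ^ s ≤ (2 ^ |s| * wt (η - ξ) ^ |s|) * wt η ^ s := by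
  rw [← Real.mul_rpow zero_le_two (wt_pos _).le]
  have hp : 0 < 2 * wt (η - ξ) := mul_pos two_pos (wt_pos _)
  rcases le_total 0 s with hs | hs
  · rw [abs_of_nonneg hs, ← Real.mul_rpow hp.le (wt_pos _).le]
    exact Real.rpow_le_rpow (wt_pos _).le (wt_le_two_mul ξ η) hs
  · rw [abs_of_nonpos hs]
    have h1 : wt η ≤ 2 * wt (η - ξ) * wt ξ := by
      have := wt_le_two_mul η ξ
      rwa [← neg_sub, wt_neg] at this
    have h2 := Real.rpow_le_rpow (wt_pos _).le h1 (neg_nonneg.mpr hs)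
    rw [Real.mul_rpow hp.le (wt_pos _).le, Real.rpow_neg (wt_pos η).le,
      Real.rpow_neg (wt_pos ξ).le] at h2
    have h3 : 0 < wt η ^ s := Real.rpow_pos_of_pos (wt_pos _) _
    have h4 : 0 < wt ξ ^ s := Real.rpow_pos_of_pos (wt_pos _) _
    rw [← div_eq_mul_inv, inv_eq_one_div, div_le_div_iff₀ h3 h4] at h2
    linarith

theorem hasTemperateGrowth_wt_rpow (s : ℝ) :
    (fun ξ : E n => ((wt ξ ^ s : ℝ) : ℂ)).HasTemperateGrowth := by
  have h : (fun ξ : E n => (((1 + ‖ξ‖ ^ 2) ^ s : ℝ) : ℂ)).HasTemperateGrowth := by fun_prop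
  exact h

theorem lintegral_wt_mul_schwartz_lt_top (s : ℝ) (G : 𝓢(E n, ℂ)) :
    ∫⁻ ξ, ENNReal.ofReal (wt ξ ^ s) * ‖G ξ‖ₑ < ⊤ := by
  have h1 := (SchwartzMap.smulLeftCLM ℂ (fun ξ : E n => ((wt ξ ^ s : ℝ) : ℂ)) G).integrable
    (μ := volume) |>.2
  rw [HasFiniteIntegral] at h1
  refine lt_of_eq_of_lt (lintegral_congr fun ξ => ?_) h1
  rw [SchwartzMap.smulLeftCLM_apply_apply (hasTemperateGrowth_wt_rpow s), smul_eq_mul, enorm_mul,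
    ← ofReal_norm ((wt ξ ^ s : ℝ) : ℂ), Complex.norm_real,
    Real.norm_of_nonneg (Real.rpow_nonneg (wt_pos ξ).le _)]

/-- A Schur test. On the Fourier side multiplication is convolution with Ŵ; Cauchy–Schwarz with the
kernel split into two square roots, then Tonelli. Peetre's inequality moves wt^s from ξ to η at the
cost of the weight wt^|s| on Ŵ, which stays integrable because Ŵ is Schwartz. -/
theorem exists_en_mulOp_le (W : E n → ℝ) (W' : 𝓢(E n, ℂ)) (hW : ∀ x, W' x = W x) (s : ℝ) :
    ∃ C : ℝ≥0, ∀ g : L2 n, en s (mulOp W' g) ≤ C * en s g := by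
  let k : E n → ℝ≥0∞ := fun ζ => ‖FourierTransform.fourier W' ζ‖ₑ
  have hk : Measurable k := (FourierTransform.fourier W').continuous.enorm.measurable
  let k₂ : E n → ℝ≥0∞ := fun ζ => ENNReal.ofReal (2 ^ |s| * wt ζ ^ |s|) * k ζ
  have hk₂ : Measurable k₂ :=
    ((measurable_wt_rpow |s|).const_mul _).ennreal_ofReal.mul hk
  have hK₁ : ∫⁻ ζ, k ζ < ⊤ := by
    simpa [k] using lintegral_wt_mul_schwartz_lt_top 0 (FourierTransform.fourier W')
  have hK₂ : ∫⁻ ζ, k₂ ζ < ⊤ := by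
    have h1 := lintegral_wt_mul_schwartz_lt_top |s| (FourierTransform.fourier W')
    have h2 : ∫⁻ ζ, k₂ ζ = ENNReal.ofReal (2 ^ |s|) *
        ∫⁻ ξ, ENNReal.ofReal (wt ξ ^ |s|) * ‖FourierTransform.fourier W' ξ‖ₑ := by
      rw [← lintegral_const_mul' _ _ (by simp)]
      refine lintegral_congr fun ξ => ?_
      simp only [k₂, k]
      rw [ENNReal.ofReal_mul (by positivity), mul_assoc]
    rw [h2]
    exact ENNReal.mul_lt_top (by simp) h1
  refine ⟨((∫⁻ ζ, k ζ) * ∫⁻ ζ, k₂ ζ).toNNReal, fun g => ?_⟩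
  rw [ENNReal.coe_toNNReal (ENNReal.mul_lt_top hK₁ hK₂).ne]
  have hG : AEMeasurable (fun η => ‖ft g η‖ₑ) volume := (Lp.aestronglyMeasurable (ft g)).enorm
  have h1 : ∀ ξ : E n, ‖∫ η, ft g η * (starRingEnd ℂ) (FourierTransform.fourier W' (η - ξ))‖ₑ ^ 2
      ≤ (∫⁻ ζ, k ζ) * ∫⁻ η, k (η - ξ) * ‖ft g η‖ₑ ^ 2 := by
    intro ξ
    have hks : Measurable fun η => k (η - ξ) := hk.comp (measurable_sub_const ξ)
    have hsq : ∀ x : ℝ≥0∞, (x ^ (1 / 2 : ℝ)) ^ 2 = x := by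
      intro x
      rw [← ENNReal.rpow_natCast, ← ENNReal.rpow_mul]
      norm_num
    calc _ ≤ (∫⁻ η, k (η - ξ) ^ (1 / 2 : ℝ) * (k (η - ξ) ^ (1 / 2 : ℝ) * ‖ft g η‖ₑ)) ^ 2 := by
          gcongr
          refine (enorm_integral_le_lintegral_enorm _).trans (le_of_eq ?_)
          refine lintegral_congr fun η => ?_
          rw [← mul_assoc, ← sq, hsq, enorm_mul, RCLike.enorm_conj, mul_comm]
      _ ≤ _ := sq_lintegral_mul_le (hks.pow_const _).aemeasurable
          ((hks.pow_const _).aemeasurable.mul hG)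
      _ = _ := by
          simp only [mul_pow, hsq]
          rw [lintegral_sub_right_eq_self k ξ]
  calc en s (mulOp W' g) ≤ ∫⁻ ξ, (∫⁻ ζ, k ζ) * ∫⁻ η, k₂ (η - ξ) *
        (ENNReal.ofReal (wt η ^ s) * ‖ft g η‖ₑ ^ 2) := by
        refine lintegral_mono_ae ?_
        filter_upwards [ft_mulOp_schwartz W W' hW g] with ξ h2
        rw [h2]
        refine (mul_le_mul_right (h1 ξ) _).trans ?_
        rw [mul_left_comm]
        gcongr
        rw [← lintegral_const_mul' _ _ (by simp)]
        refine lintegral_mono fun η => ?_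
        simp only [k₂]
        rw [mul_right_comm, ← mul_assoc, ← mul_assoc, ← ENNReal.ofReal_mul (by
          have := wt_pos (η - ξ); positivity), mul_right_comm _ (k (η - ξ))]
        gcongr
        exact wt_rpow_le s ξ η
    _ = (∫⁻ ζ, k ζ) * ∫⁻ ξ, ∫⁻ η, k₂ (η - ξ) *
        (ENNReal.ofReal (wt η ^ s) * ‖ft g η‖ₑ ^ 2) := lintegral_const_mul' _ _ hK₁.ne
    _ = (∫⁻ ζ, k ζ) * ∫⁻ η, ∫⁻ ξ, k₂ (η - ξ) *
        (ENNReal.ofReal (wt η ^ s) * ‖ft g η‖ₑ ^ 2) := by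
        congr 1
        refine lintegral_lintegral_swap ?_
        have h3 : AEMeasurable (fun p : E n × E n => ENNReal.ofReal (wt p.2 ^ s) * ‖ft g p.2‖ₑ ^ 2)
            ((volume : Measure (E n)).prod (volume : Measure (E n))) :=
          (aemeasurable_en s g).comp_quasiMeasurePreserving Measure.quasiMeasurePreserving_snd
        exact (hk₂.comp (measurable_snd.sub measurable_fst)).aemeasurable.mul h3
    _ = (∫⁻ ζ, k ζ) * ∫⁻ η, (∫⁻ ζ, k₂ ζ) *
        (ENNReal.ofReal (wt η ^ s) * ‖ft g η‖ₑ ^ 2) := by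
        congr 1
        refine lintegral_congr fun η => ?_
        have h4 : Measurable fun ξ => k₂ (η - ξ) := hk₂.comp (measurable_const_sub η)
        rw [lintegral_mul_const _ h4,
          lintegral_sub_left_eq_self k₂ η]
    _ = _ := by
        rw [lintegral_const_mul' _ _ hK₂.ne, mul_assoc, en]

end SchwartzMultipliers

/-! ### Compactness of `W R` -/

section Compactness

variable {n : ℕ}

/-- The operator `F ↦ ∫ F(η) k(η) dη` for a square integrable `L²`-valued kernel. -/
def kernelOp : Lp (L2 n) 2 (volume : Measure (E n)) →L[ℂ] L2 n →L[ℂ] L2 n :=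
  ((ContinuousLinearMap.lsmul ℂ ℂ (E := L2 n)).lpPairing volume 2 2).flip

theorem kernelOp_apply (k : Lp (L2 n) 2 (volume : Measure (E n))) (F : L2 n) :
    kernelOp k F = ∫ η, F η • k η := by
  rw [kernelOp, ContinuousLinearMap.flip_apply, ContinuousLinearMap.lpPairing_eq_integral]
  rfl

/-- Indicator kernels give operators of rank at most one, sums preserve compactness, and the compact
operators are closed while the operator depends continuously on its kernel. -/
theorem isCompactOperator_kernelOp (k : Lp (L2 n) 2 (volume : Measure (E n))) :
    IsCompactOperator (kernelOp k) := by
  refine Lp.induction (by norm_num) (fun k => IsCompactOperator (kernelOp k)) ?_ ?_ ?_ k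
  · intro c s hs hμ
    let ℓ : L2 n →L[ℂ] ℂ :=
      ((ContinuousLinearMap.mul ℂ ℂ).lpPairing volume 2 2).flip (indicatorConstLp 2 hs hμ.ne 1)
    have h1 : kernelOp (Lp.simpleFunc.indicatorConst 2 hs hμ.ne c : Lp (L2 n) 2 volume) =
        (ContinuousLinearMap.toSpanSingleton ℂ c) ∘L ℓ := by
      ext1 F
      rw [kernelOp_apply, ContinuousLinearMap.comp_apply, ContinuousLinearMap.toSpanSingleton_apply]
      simp only [ℓ]
      rw [ContinuousLinearMap.flip_apply, ContinuousLinearMap.lpPairing_eq_integral,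
        ← integral_smul_const]
      refine integral_congr_ae ?_
      rw [Lp.simpleFunc.coe_indicatorConst]
      filter_upwards [indicatorConstLp_coeFn (p := 2) (hs := hs) (hμs := hμ.ne) (c := c),
        indicatorConstLp_coeFn (p := 2) (hs := hs) (hμs := hμ.ne) (c := (1 : ℂ))] with x h2 h3
      rw [h2, ContinuousLinearMap.mul_apply', h3]
      by_cases hx : x ∈ s
      · simp [hx]
      · simp [hx]
    rw [h1]
    have h2 : IsCompactOperator (ContinuousLinearMap.toSpanSingleton ℂ c) :=
      isCompactOperator_of_locallyCompactSpace_rng _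
    exact h2.comp_clm ℓ
  · intro f g hf hg _ h1 h2
    rw [map_add]
    exact h1.add h2
  · exact isClosed_setOfPred_isCompactOperator.preimage kernelOp.continuous

/-- Restrict R to frequencies |ξ| ≤ N. The kernel η ↦ m(η)e^(2πi⟨x,η⟩)W is then bounded with compact
support in η, so square integrable with values in L², and the operator is compact. The discarded
part has norm at most ‖W‖/N, since the symbol is at least N² there. -/
theorem isCompactOperator_mulOp_resRoot {κ : ℝ} (hκ : 0 < κ) (W : E n → ℝ) (W' : 𝓢(E n, ℂ))
    (hW : ∀ x, W' x = W x) : IsCompactOperator (mulOp W' ∘L resRoot n κ) := by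
  let m : ℕ → E n → ℝ := fun N => (Metric.closedBall (0 : E n) N).indicator
    fun ξ => hs κ ξ ^ (-(1 / 2) : ℝ)
  have hmm : ∀ N, Measurable (m N) := fun N =>
    ((continuous_hs κ).measurable.pow_const _).indicator Metric.isClosed_closedBall.measurableSet
  have hh0 : ∀ ξ : E n, 0 ≤ hs κ ξ ^ (-(1 / 2) : ℝ) := fun ξ => Real.rpow_nonneg (hs_pos hκ ξ).le _
  have hhb : ∀ ξ : E n, hs κ ξ ^ (-(1 / 2) : ℝ) ≤ κ ^ (-(1 / 2) : ℝ) := fun ξ =>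
    Real.rpow_le_rpow_of_nonpos hκ (le_hs κ ξ) (by norm_num)
  have hmem : ∀ N, MemLp (fun ξ => (m N ξ : ℂ)) ∞ (volume : Measure (E n)) := by
    intro N
    refine memLp_top_real (hmm N) (κ ^ (-(1 / 2) : ℝ)) fun ξ => ?_
    simp only [m, indicator]
    split_ifs
    · rw [abs_of_nonneg (hh0 ξ)]
      exact hhb ξ
    · rw [abs_zero]
      exact (hh0 ξ).trans (hhb ξ)
  have hcomp : ∀ N, IsCompactOperator (mulOp W' ∘L fmul fun ξ => (m N ξ : ℂ)) := by
    intro N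
    have hk : MemLp (fun η => (m N η : ℂ) • modulated W' η) 2 (volume : Measure (E n)) := by
      have h1 : (fun η => (m N η : ℂ) • modulated W' η) = (Metric.closedBall (0 : E n) N).indicator
          fun η => ((hs κ η ^ (-(1 / 2) : ℝ) : ℝ) : ℂ) • modulated W' η := by
        ext1 η
        simp only [m, indicator]
        split_ifs <;> simp
      have h2 : Continuous fun η => ((hs κ η ^ (-(1 / 2) : ℝ) : ℝ) : ℂ) • modulated W' η :=
        (Complex.continuous_ofReal.comp ((continuous_hs κ).rpow_const fun ξ =>
          Or.inl (hs_pos hκ ξ).ne')).smul (continuous_modulated W')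
      have hcpt : IsCompact (Metric.closedBall (0 : E n) N) := isCompact_closedBall _ _
      rw [h1, memLp_indicator_iff_restrict hcpt.measurableSet]
      have : IsFiniteMeasure ((volume : Measure (E n)).restrict (Metric.closedBall (0 : E n) N)) :=
        ⟨by rw [Measure.restrict_apply_univ]; exact hcpt.measure_lt_top⟩
      obtain ⟨C, hC⟩ := hcpt.exists_bound_of_continuousOn h2.continuousOn
      exact MemLp.of_bound h2.aestronglyMeasurable C
        ((ae_restrict_iff' hcpt.measurableSet).mpr (Eventually.of_forall hC))
    obtain ⟨K, hK⟩ : ∃ K : Lp (L2 n) 2 (volume : Measure (E n)),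
        K =ᵐ[volume] fun η => (m N η : ℂ) • modulated W' η := ⟨hk.toLp, hk.coeFn_toLp⟩
    have h3 : mulOp W' ∘L fmul (fun ξ => (m N ξ : ℂ)) =
        kernelOp K ∘L ft.toLinearIsometry.toContinuousLinearMap := by
      ext1 f
      refine ext_inner_left ℂ fun g => ?_
      change inner ℂ g (mulOp W' (fmul (fun ξ => (m N ξ : ℂ)) f)) = inner ℂ g (kernelOp K (ft f))
      have hW'' : (W' : E n → ℂ) = fun x => (W x : ℂ) := funext hW
      have hWm := memLp_top_schwartz W'
      rw [kernelOp_apply]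
      have hint : Integrable fun η => ft f η • K η :=
        memLp_one_iff_integrable.mp (MemLp.smul (Lp.memLp K) (Lp.memLp (ft f)))
      rw [← integral_inner hint]
      have h4 : inner ℂ g (mulOp W' (fmul (fun ξ => (m N ξ : ℂ)) f)) =
          inner ℂ (mulOp W' g) (fmul (fun ξ => (m N ξ : ℂ)) f) := by
        rw [hW''] at hWm ⊢
        exact (mulOp_symm W hWm _ _).symm
      rw [h4, ← ft.inner_map_map, ft_fmul, L2_inner_def]
      refine integral_congr_ae ?_
      filter_upwards [hK, mulOp_ae (hmem N) (ft f), inner_modulated_ae W W' hW g]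
        with η h5 h6 h7
      rw [h5, h6, ← h7, inner_smul_right, inner_smul_right, RCLike.inner_apply, inner_conj_symm]
      ring
    rw [h3]
    exact (isCompactOperator_kernelOp _).comp_clm _
  have hlim : Tendsto (fun N : ℕ => mulOp W' ∘L fmul fun ξ => (m N ξ : ℂ)) atTop
      (𝓝 (mulOp W' ∘L resRoot n κ)) := by
    rw [tendsto_iff_norm_sub_tendsto_zero]
    have hb : ∀ N : ℕ, 1 ≤ N → ‖mulOp W' ∘L fmul (fun ξ => (m N ξ : ℂ)) - mulOp W' ∘L resRoot n κ‖
        ≤ ‖mulOp (n := n) W'‖ * (N : ℝ)⁻¹ := by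
      intro N hN
      have hN' : (0 : ℝ) < N := by exact_mod_cast hN
      rw [← ContinuousLinearMap.comp_sub]
      refine (ContinuousLinearMap.opNorm_comp_le _ _).trans ?_
      gcongr
      refine ContinuousLinearMap.opNorm_le_bound _ (by positivity) fun f => ?_
      rw [← ft.norm_map, ← ft.norm_map f]
      refine Lp.norm_le_mul_norm_of_ae_le_mul ?_
      rw [_root_.sub_apply, map_sub]
      have h1 := ft_fmul (fun ξ => (m N ξ : ℂ)) f
      filter_upwards [Lp.coeFn_sub (ft (fmul (fun ξ => (m N ξ : ℂ)) f)) (ft (resRoot n κ f)),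
        ft_resRoot hκ f, mulOp_ae (hmem N) (ft f)] with ξ h2 h3 h4
      rw [h2, Pi.sub_apply, h3, h1, h4, ← sub_mul, norm_mul, ← Complex.ofReal_sub,
        Complex.norm_real]
      gcongr
      simp only [m, indicator]
      split_ifs with h5
      · rw [sub_self, norm_zero]
        positivity
      · rw [zero_sub, norm_neg, Real.norm_of_nonneg (hh0 ξ)]
        rw [Metric.mem_closedBall, dist_zero_right, not_le] at h5
        have h6 : (N : ℝ) ^ 2 ≤ hs κ ξ := by
          have h7 : (N : ℝ) ^ 2 ≤ ‖ξ‖ ^ 2 := by gcongr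
          have h8 : 1 ≤ 2 * Real.pi ^ 2 := by nlinarith [Real.pi_gt_three]
          unfold hs
          nlinarith [sq_nonneg ‖ξ‖]
        refine (Real.rpow_le_rpow_of_nonpos (by positivity) h6 (by norm_num)).trans_eq ?_
        rw [← Real.rpow_natCast, ← Real.rpow_mul hN'.le]
        norm_num [Real.rpow_neg_one]
    refine squeeze_zero' (Eventually.of_forall fun _ => norm_nonneg _)
      (eventually_atTop.mpr ⟨1, hb⟩) ?_
    simpa using (tendsto_inv_atTop_nhds_zero_nat (𝕜 := ℝ)).const_mul ‖mulOp (n := n) W'‖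
  exact isCompactOperator_of_tendsto hlim (Eventually.of_forall hcomp)

end Compactness

/-! ### Graphs and kernels of powers of unbounded operators -/

section Powers

variable {X : Type*} [NormedAddCommGroup X] [InnerProductSpace ℂ X]

theorem mem_opKer_iff_graph (A : X →ₗ.[ℂ] X) (x : X) : x ∈ opKer A ↔ (x, (0 : X)) ∈ A.graph := by
  rw [mem_opKer_iff, LinearPMap.mem_graph_iff]
  constructor
  · rintro ⟨hx, h⟩
    exact ⟨⟨x, hx⟩, rfl, h⟩
  · rintro ⟨⟨y, hy⟩, rfl, h⟩
    exact ⟨hy, h⟩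

theorem mem_opRange_iff_graph (A : X →ₗ.[ℂ] X) (y : X) :
    y ∈ opRange A ↔ ∃ x, (x, y) ∈ A.graph := by
  simp only [LinearPMap.mem_graph_iff]
  constructor
  · rintro ⟨x, rfl⟩
    exact ⟨x, x, rfl, rfl⟩
  · rintro ⟨_, x, -, h⟩
    exact ⟨x, h⟩

theorem mem_graph_opComp (B A : X →ₗ.[ℂ] X) (x z : X) :
    (x, z) ∈ (opComp B A).graph ↔ ∃ y, (x, y) ∈ A.graph ∧ (y, z) ∈ B.graph := by
  simp only [LinearPMap.mem_graph_iff]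
  constructor
  · rintro ⟨⟨_, w, hw, rfl⟩, rfl, rfl⟩
    exact ⟨A w, ⟨w, rfl, rfl⟩, ⟨⟨A w, hw⟩, rfl, rfl⟩⟩
  · rintro ⟨_, ⟨w, rfl, rfl⟩, ⟨v, hv, rfl⟩⟩
    have hw : w ∈ B.domain.comap A.toFun := by
      change A w ∈ B.domain
      rw [← hv]
      exact v.2
    refine ⟨⟨w, w, hw, rfl⟩, rfl, ?_⟩
    exact congrArg B (Subtype.ext hv.symm)

theorem mem_graph_opPow_zero (A : X →ₗ.[ℂ] X) (x z : X) :
    (x, z) ∈ (opPow A 0).graph ↔ z = x := by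
  rw [LinearPMap.mem_graph_iff]
  constructor
  · rintro ⟨w, rfl, rfl⟩
    rfl
  · rintro rfl
    exact ⟨⟨z, trivial⟩, rfl, rfl⟩

/-- `opPow` applies the additional factor last. Inductions on chains of root vectors need it applied
first. -/
theorem mem_graph_opPow_succ (A : X →ₗ.[ℂ] X) (k : ℕ) (x z : X) :
    (x, z) ∈ (opPow A (k + 1)).graph ↔ ∃ y, (x, y) ∈ A.graph ∧ (y, z) ∈ (opPow A k).graph := by
  induction k generalizing z with
  | zero =>
    change (x, z) ∈ (opComp A (opPow A 0)).graph ↔ _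
    rw [mem_graph_opComp]
    simp only [mem_graph_opPow_zero]
    constructor
    · rintro ⟨y, rfl, h⟩
      exact ⟨z, h, rfl⟩
    · rintro ⟨y, h, rfl⟩
      exact ⟨x, rfl, h⟩
  | succ k ih =>
    change (x, z) ∈ (opComp A (opPow A (k + 1))).graph ↔ _
    rw [mem_graph_opComp]
    simp only [ih]
    constructor
    · rintro ⟨y, ⟨w, h1, h2⟩, h3⟩
      exact ⟨w, h1, (mem_graph_opComp _ _ _ _).mpr ⟨y, h2, h3⟩⟩
    · rintro ⟨w, h1, h2⟩
      obtain ⟨y, h3, h4⟩ := (mem_graph_opComp _ _ _ _).mp h2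
      exact ⟨y, ⟨w, h1, h3⟩, h4⟩

theorem mem_opKer_opPow_succ (A : X →ₗ.[ℂ] X) (k : ℕ) (x : X) :
    x ∈ opKer (opPow A (k + 1)) ↔ ∃ y, (x, y) ∈ A.graph ∧ y ∈ opKer (opPow A k) := by
  simp only [mem_opKer_iff_graph, mem_graph_opPow_succ]

theorem mem_opKer_opPow_zero (A : X →ₗ.[ℂ] X) (x : X) : x ∈ opKer (opPow A 0) ↔ x = 0 := by
  rw [mem_opKer_iff_graph, mem_graph_opPow_zero, eq_comm]

theorem mem_graph_opShift (A : X →ₗ.[ℂ] X) (z : ℂ) (x y : X) :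
    (x, y) ∈ (opShift A z).graph ↔ (x, y + z • x) ∈ A.graph := by
  simp only [LinearPMap.mem_graph_iff]
  constructor
  · rintro ⟨w, rfl, rfl⟩
    refine ⟨w, rfl, ?_⟩
    change A w = (A w - z • (w : X)) + z • (w : X)
    rw [sub_add_cancel]
  · rintro ⟨w, rfl, h⟩
    refine ⟨w, rfl, ?_⟩
    change A w - z • (w : X) = y
    rw [h, add_sub_cancel_right]

theorem graph_unique (A : X →ₗ.[ℂ] X) {x y z : X} (h1 : (x, y) ∈ A.graph) (h2 : (x, z) ∈ A.graph) :
    y = z := by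
  rw [LinearPMap.mem_graph_iff] at h1 h2
  obtain ⟨a, ha, rfl⟩ := h1
  obtain ⟨b, hb, rfl⟩ := h2
  rw [Subtype.ext (ha.trans hb.symm)]

theorem opKer_opPow_one (A : X →ₗ.[ℂ] X) : opKer (opPow A 1) = opKer A := by
  ext x
  rw [mem_opKer_opPow_succ, mem_opKer_iff_graph]
  simp only [mem_opKer_opPow_zero]
  exact ⟨fun ⟨y, h, hy⟩ => hy ▸ h, fun h => ⟨0, h, rfl⟩⟩

theorem opKer_opPow_eq_of_two (A : X →ₗ.[ℂ] X) (h : opKer (opPow A 2) ≤ opKer A) (k : ℕ)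
    (hk : 1 ≤ k) : opKer (opPow A k) = opKer A := by
  induction k, hk using Nat.le_induction with
  | base => exact opKer_opPow_one A
  | succ k hk ih =>
    refine le_antisymm (fun x hx => ?_) (fun x hx => ?_)
    · obtain ⟨y, h1, h2⟩ := (mem_opKer_opPow_succ A k x).mp hx
      rw [ih, ← opKer_opPow_one] at h2
      exact h ((mem_opKer_opPow_succ A 1 x).mpr ⟨y, h1, h2⟩)
    · exact (mem_opKer_opPow_succ A k x).mpr
        ⟨0, (mem_opKer_iff_graph A x).mp hx, Submodule.zero_mem _⟩

theorem opKer_opPow_mono (A : X →ₗ.[ℂ] X) (k : ℕ) :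
    opKer (opPow A k) ≤ opKer (opPow A (k + 1)) := by
  induction k with
  | zero =>
    intro x hx
    rw [(mem_opKer_opPow_zero A x).mp hx]
    exact Submodule.zero_mem _
  | succ k ih =>
    intro x hx
    obtain ⟨y, h1, h2⟩ := (mem_opKer_opPow_succ A k x).mp hx
    exact (mem_opKer_opPow_succ A _ x).mpr ⟨y, h1, ih h2⟩

theorem graph_add (A : X →ₗ.[ℂ] X) {x y x' y' : X} (h : (x, y) ∈ A.graph)
    (h' : (x', y') ∈ A.graph) : (x + x', y + y') ∈ A.graph := A.graph.add_mem h h'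

theorem graph_sub (A : X →ₗ.[ℂ] X) {x y x' y' : X} (h : (x, y) ∈ A.graph)
    (h' : (x', y') ∈ A.graph) : (x - x', y - y') ∈ A.graph := A.graph.sub_mem h h'

theorem graph_smul (A : X →ₗ.[ℂ] X) (c : ℂ) {x y : X} (h : (x, y) ∈ A.graph) :
    (c • x, c • y) ∈ A.graph := A.graph.smul_mem c h

theorem graph_map_span (G : Submodule ℂ (X × X)) (s : Set X) (p : Submodule ℂ X)
    (h : ∀ x ∈ s, ∃ w ∈ p, (x, w) ∈ G) (x : X) (hx : x ∈ Submodule.span ℂ s) :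
    ∃ w ∈ p, (x, w) ∈ G := by
  induction hx using Submodule.span_induction with
  | mem x hx => exact h x hx
  | zero => exact ⟨0, p.zero_mem, G.zero_mem⟩
  | add x y _ _ hx hy =>
    obtain ⟨w, hw, h1⟩ := hx
    obtain ⟨v, hv, h2⟩ := hy
    exact ⟨w + v, p.add_mem hw hv, G.add_mem h1 h2⟩
  | smul c x _ hx =>
    obtain ⟨w, hw, h1⟩ := hx
    exact ⟨c • w, p.smul_mem c hw, G.smul_mem c h1⟩

theorem graph_comap_span (G : Submodule ℂ (X × X)) (s : Set X) (p : Submodule ℂ X)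
    (h : ∀ x ∈ s, ∃ w ∈ p, (w, x) ∈ G) (x : X) (hx : x ∈ Submodule.span ℂ s) :
    ∃ w ∈ p, (w, x) ∈ G := by
  have := graph_map_span (G.comap (LinearMap.prod (LinearMap.snd ℂ X X) (LinearMap.fst ℂ X X))) s p
    h x hx
  exact this

end Powers

/-! ### Biorthogonal projections and product subspaces -/

section Projections

variable {X : Type*} [NormedAddCommGroup X] [InnerProductSpace ℂ X] {ι : Type*} [Fintype ι]
  [DecidableEq ι]

/-- The operator `u ↦ u - ∑ ⟪aᵢ, u⟫ bᵢ`. -/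
def biproj (a b : ι → X) : X →L[ℂ] X := 1 - ∑ i, (innerSL ℂ (a i)).smulRight (b i)

theorem biproj_apply (a b : ι → X) (u : X) :
    biproj a b u = u - ∑ i, (inner ℂ (a i) u : ℂ) • b i := by
  simp [biproj, _root_.sub_apply]

theorem inner_biproj_right (a b : ι → X)
    (h : ∀ i j, (inner ℂ (a i) (b j) : ℂ) = if i = j then 1 else 0) (i : ι) (u : X) :
    (inner ℂ (a i) (biproj a b u) : ℂ) = 0 := by
  rw [biproj_apply, inner_sub_right, inner_sum]
  simp [inner_smul_right, h]

theorem biproj_eq_self (a b : ι → X) (u : X) (h : ∀ i, (inner ℂ (a i) u : ℂ) = 0) :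
    biproj a b u = u := by
  simp [biproj_apply, h]

theorem inner_biproj_left (a b : ι → X) (x y : X) :
    (inner ℂ (biproj b a x) y : ℂ) = inner ℂ x (biproj a b y) := by
  rw [biproj_apply, biproj_apply, inner_sub_left, inner_sub_right, inner_sum, sum_inner]
  congr 1
  refine Finset.sum_congr rfl fun i _ => ?_
  rw [inner_smul_left, inner_smul_right, inner_conj_symm, mul_comm]

theorem eq_sum_of_mem_span (a b : ι → X)
    (h : ∀ i j, (inner ℂ (a i) (b j) : ℂ) = if i = j then 1 else 0) (y : X)
    (hy : y ∈ Submodule.span ℂ (range b)) : y = ∑ i, (inner ℂ (a i) y : ℂ) • b i := by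
  induction hy using Submodule.span_induction with
  | mem x hx =>
    obtain ⟨j, rfl⟩ := hx
    simp [h]
  | zero => simp
  | add x y _ _ hx hy =>
    nth_rw 1 [hx, hy]
    simp [add_smul, Finset.sum_add_distrib]
  | smul c x _ hx =>
    nth_rw 1 [hx]
    simp [mul_smul, Finset.smul_sum]

theorem biorth_symm {a b : ι → X}
    (h : ∀ i j, (inner ℂ (a i) (b j) : ℂ) = if i = j then 1 else 0) (i j : ι) :
    (inner ℂ (b i) (a j) : ℂ) = if i = j then 1 else 0 := by
  rw [← inner_conj_symm, h]
  split_ifs with h1 h2 h2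
  · simp
  · exact absurd h1.symm h2
  · exact absurd h2.symm h1
  · simp

theorem sub_biproj_mem (a b : ι → X) (u : X) : u - biproj a b u ∈ Submodule.span ℂ (range b) := by
  rw [biproj_apply, sub_sub_cancel]
  exact Submodule.sum_mem _ fun i _ => Submodule.smul_mem _ _ (Submodule.subset_span ⟨i, rfl⟩)

/-- The subspace `p × q`. -/
def prodSub (p q : Submodule ℂ X) : Submodule ℂ (WithLp 2 (X × X)) where
  carrier := {ψ | ψ.fst ∈ p ∧ ψ.snd ∈ q}
  add_mem' h h' := ⟨p.add_mem h.1 h'.1, q.add_mem h.2 h'.2⟩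
  zero_mem' := ⟨p.zero_mem, q.zero_mem⟩
  smul_mem' c _ h := ⟨p.smul_mem c h.1, q.smul_mem c h.2⟩

theorem mem_prodSub {p q : Submodule ℂ X} {ψ : WithLp 2 (X × X)} :
    ψ ∈ prodSub p q ↔ ψ.fst ∈ p ∧ ψ.snd ∈ q := Iff.rfl

theorem pair_inner (ψ χ : WithLp 2 (X × X)) :
    (inner ℂ ψ χ : ℂ) = inner ℂ ψ.fst χ.fst + inner ℂ ψ.snd χ.snd :=
  WithLp.prod_inner_apply ψ χ

theorem mem_prodSub_orthogonal {p q : Submodule ℂ X} {ψ : WithLp 2 (X × X)} :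
    ψ ∈ (prodSub p q)ᗮ ↔ ψ.fst ∈ pᗮ ∧ ψ.snd ∈ qᗮ := by
  simp only [Submodule.mem_orthogonal]
  constructor
  · intro h
    refine ⟨fun u hu => ?_, fun u hu => ?_⟩
    · have := h (WithLp.toLp 2 (u, 0)) ⟨hu, q.zero_mem⟩
      rw [pair_inner] at this
      simpa using this
    · have := h (WithLp.toLp 2 (0, u)) ⟨p.zero_mem, hu⟩
      rw [pair_inner] at this
      simpa using this
  · rintro ⟨h1, h2⟩ χ hχ
    rw [pair_inner, h1 _ hχ.1, h2 _ hχ.2, add_zero]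

theorem mem_span_range_orthogonal {κ : Type*} (a : κ → X) (u : X) :
    u ∈ (Submodule.span ℂ (range a))ᗮ ↔ ∀ i, (inner ℂ (a i) u : ℂ) = 0 := by
  rw [Submodule.mem_orthogonal]
  constructor
  · intro h i
    exact h _ (Submodule.subset_span ⟨i, rfl⟩)
  · intro h x hx
    induction hx using Submodule.span_induction with
    | mem x hx =>
      obtain ⟨i, rfl⟩ := hx
      exact h i
    | zero => simp
    | add x y _ _ hx hy => rw [inner_add_left, hx, hy, add_zero]
    | smul c x _ hx => rw [inner_smul_left, hx, mul_zero]

end Projections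

/-! ### Abstract root systems -/

section RootSystem

variable {X : Type*} [NormedAddCommGroup X] [InnerProductSpace ℂ X] {ι : Type*} [Fintype ι]
  [DecidableEq ι]

/-- Biorthogonal families describing the root space of `((0, -i S), (i T, 0))`. -/
structure IsRootSystem (S T : X →ₗ.[ℂ] X) (a b : Option ι → X) (c q : ℝ) : Prop where
  symm_S : ∀ x x' y y', (x, x') ∈ S.graph → (y, y') ∈ S.graph →
    (inner ℂ x' y : ℂ) = inner ℂ x y'
  symm_T : ∀ x x' y y', (x, x') ∈ T.graph → (y, y') ∈ T.graph →
    (inner ℂ x' y : ℂ) = inner ℂ x y'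
  c_pos : 0 < c
  q_pos : 0 < q
  biorth : ∀ i j, (inner ℂ (a i) (b j) : ℂ) = if i = j then 1 else 0
  S_none : (a none, 0) ∈ S.graph
  S_some : ∀ j, (a (some j), (q : ℂ) • b (some j)) ∈ S.graph
  T_none : (b none, -(c : ℂ) • a none) ∈ T.graph
  T_some : ∀ j, (b (some j), 0) ∈ T.graph

/-- The root system exhausts the kernels, and the ranges are closed. -/
structure IsRootSystem.IsFull (S T : X →ₗ.[ℂ] X) (a b : Option ι → X) : Prop where
  ker_S : ∀ x, (x, 0) ∈ S.graph → x ∈ Submodule.span ℂ {a none}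
  ker_T : ∀ x, (x, 0) ∈ T.graph → x ∈ Submodule.span ℂ (range fun j => b (some j))
  ran_S : ∀ y, (inner ℂ (a none) y : ℂ) = 0 → ∃ x, (x, y) ∈ S.graph
  ran_T : ∀ y, (∀ j, (inner ℂ (b (some j)) y : ℂ) = 0) → ∃ x, (x, y) ∈ T.graph

namespace IsRootSystem

variable {S T : X →ₗ.[ℂ] X} {a b : Option ι → X} {c q : ℝ}

theorem S_ker (h : IsRootSystem S T a b c q) (x : X) (hx : x ∈ Submodule.span ℂ {a none}) :
    (x, 0) ∈ S.graph := by
  obtain ⟨w, hw, h1⟩ := graph_map_span S.graph {a none} ⊥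
    (fun x hx => ⟨0, Submodule.zero_mem _, by rw [mem_singleton_iff.mp hx]; exact h.S_none⟩) x hx
  rwa [(Submodule.mem_bot ℂ).mp hw] at h1

theorem T_ker (h : IsRootSystem S T a b c q) (x : X)
    (hx : x ∈ Submodule.span ℂ (range fun j => b (some j))) : (x, 0) ∈ T.graph := by
  obtain ⟨w, hw, h1⟩ := graph_map_span T.graph _ ⊥
    (fun x hx => ⟨0, Submodule.zero_mem _, by obtain ⟨j, rfl⟩ := hx; exact h.T_some j⟩) x hx
  rwa [(Submodule.mem_bot ℂ).mp hw] at h1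

theorem S_map (h : IsRootSystem S T a b c q) (x : X) (hx : x ∈ Submodule.span ℂ (range a)) :
    ∃ w ∈ Submodule.span ℂ (range fun j => b (some j)), (x, w) ∈ S.graph := by
  refine graph_map_span S.graph _ _ ?_ x hx
  rintro _ ⟨i, rfl⟩
  cases i with
  | none => exact ⟨0, Submodule.zero_mem _, h.S_none⟩
  | some j => exact ⟨_, Submodule.smul_mem _ _ (Submodule.subset_span (mem_range_self _)), h.S_some j⟩

theorem T_map (h : IsRootSystem S T a b c q) (x : X) (hx : x ∈ Submodule.span ℂ (range b)) :
    ∃ w ∈ Submodule.span ℂ {a none}, (x, w) ∈ T.graph := by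
  refine graph_map_span T.graph _ _ ?_ x hx
  rintro _ ⟨i, rfl⟩
  cases i with
  | none => exact ⟨_, Submodule.smul_mem _ _ (Submodule.subset_span rfl), h.T_none⟩
  | some j => exact ⟨0, Submodule.zero_mem _, h.T_some j⟩

theorem S_lift (h : IsRootSystem S T a b c q) (w : X)
    (hw : w ∈ Submodule.span ℂ (range fun j => b (some j))) :
    ∃ x ∈ Submodule.span ℂ (range a), (x, w) ∈ S.graph := by
  refine graph_comap_span S.graph _ _ ?_ w hw
  rintro _ ⟨j, rfl⟩
  refine ⟨(q : ℂ)⁻¹ • a (some j), Submodule.smul_mem _ _ (Submodule.subset_span (mem_range_self _)), ?_⟩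
  have := graph_smul S (q : ℂ)⁻¹ (h.S_some j)
  rwa [smul_smul, inv_mul_cancel₀ (Complex.ofReal_ne_zero.mpr h.q_pos.ne'), one_smul] at this

theorem T_lift (h : IsRootSystem S T a b c q) (w : X) (hw : w ∈ Submodule.span ℂ {a none}) :
    ∃ x ∈ Submodule.span ℂ (range b), (x, w) ∈ T.graph := by
  refine graph_comap_span T.graph _ _ ?_ w hw
  rintro _ rfl
  refine ⟨(-(c : ℂ))⁻¹ • b none, Submodule.smul_mem _ _ (Submodule.subset_span (mem_range_self _)), ?_⟩
  have := graph_smul T (-(c : ℂ))⁻¹ h.T_none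
  rwa [smul_smul, inv_mul_cancel₀ (neg_ne_zero.mpr (Complex.ofReal_ne_zero.mpr h.c_pos.ne')),
    one_smul] at this

/-- Since S kills a_none, symmetry gives ⟨a_none, w⟩ = 0, so w has no component along b_none and is
S of a combination of the a's. The difference lies in ker S, which is spanned by a_none. -/
theorem mem_span_a (h : IsRootSystem S T a b c q) (hf : IsFull S T a b) (x w : X)
    (hx : (x, w) ∈ S.graph) (hw : w ∈ Submodule.span ℂ (range b)) :
    x ∈ Submodule.span ℂ (range a) := by
  have h0 : (inner ℂ (a none) w : ℂ) = 0 := by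
    rw [← h.symm_S _ _ _ _ h.S_none hx, inner_zero_left]
  have h1 : w ∈ Submodule.span ℂ (range fun j => b (some j)) := by
    rw [eq_sum_of_mem_span a b h.biorth w hw, Fintype.sum_option, h0, zero_smul, zero_add]
    exact Submodule.sum_mem _ fun j _ => Submodule.smul_mem _ _ (Submodule.subset_span (mem_range_self _))
  obtain ⟨x', hx', h2⟩ := h.S_lift w h1
  have h3 := graph_sub S hx h2
  rw [sub_self] at h3
  have h4 : x - x' ∈ Submodule.span ℂ (range a) :=
    Submodule.span_mono (singleton_subset_iff.mpr (mem_range_self none)) (hf.ker_S _ h3)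
  simpa using Submodule.add_mem _ h4 hx'

theorem mem_span_b (h : IsRootSystem S T a b c q) (hf : IsFull S T a b) (x w : X)
    (hx : (x, w) ∈ T.graph) (hw : w ∈ Submodule.span ℂ (range a)) :
    x ∈ Submodule.span ℂ (range b) := by
  have h0 : ∀ j, (inner ℂ (b (some j)) w : ℂ) = 0 := by
    intro j
    rw [← h.symm_T _ _ _ _ (h.T_some j) hx, inner_zero_left]
  have h1 : w ∈ Submodule.span ℂ {a none} := by
    rw [eq_sum_of_mem_span b a (biorth_symm h.biorth) w hw, Fintype.sum_option]
    simp only [h0, zero_smul, Finset.sum_const_zero, add_zero]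
    exact Submodule.smul_mem _ _ (Submodule.subset_span rfl)
  obtain ⟨x', hx', h2⟩ := h.T_lift w h1
  have h3 := graph_sub T hx h2
  rw [sub_self] at h3
  have h4 : x - x' ∈ Submodule.span ℂ (range b) :=
    Submodule.span_mono (range_subset_iff.mpr fun j => mem_range_self (some j)) (hf.ker_T _ h3)
  simpa using Submodule.add_mem _ h4 hx'

end IsRootSystem

end RootSystem

/-! ### Root spaces of the matrix operator -/

section RootSpaces

variable {n : ℕ} {ι : Type*} [Fintype ι] [DecidableEq ι] {S T : L2 n →ₗ.[ℂ] L2 n}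
  {a b : Option ι → L2 n} {c q : ℝ}

/-- The root space of `offDiagonal S T`. -/
def rootM (a b : Option ι → L2 n) : Submodule ℂ (L2x2 n) :=
  prodSub (Submodule.span ℂ (range b)) (Submodule.span ℂ (range a))

/-- The root space of the adjoint of `offDiagonal S T`. -/
def rootMStar (a b : Option ι → L2 n) : Submodule ℂ (L2x2 n) :=
  prodSub (Submodule.span ℂ (range a)) (Submodule.span ℂ (range b))

namespace IsRootSystem

/-- S maps the span of a into the b_j, which T kills, and T maps the span of b into multiples of
a_none, which S kills. So the matrix operator squares to zero on this space. -/
theorem exists_map_of_mem_rootM (h : IsRootSystem S T a b c q) (ψ : L2x2 n) (hψ : ψ ∈ rootM a b) :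
    ∃ y ∈ rootM a b, (ψ, y) ∈ (offDiagonal S T).graph ∧ (y, 0) ∈ (offDiagonal S T).graph := by
  obtain ⟨w, hw, h1⟩ := h.S_map _ hψ.2
  obtain ⟨v, hv, h2⟩ := h.T_map _ hψ.1
  refine ⟨WithLp.toLp 2 (-Complex.I • w, Complex.I • v), ⟨?_, ?_⟩, ?_, ?_⟩
  · exact Submodule.smul_mem _ _
      (Submodule.span_mono (range_subset_iff.mpr fun j => mem_range_self (some j)) hw)
  · exact Submodule.smul_mem _ _
      (Submodule.span_mono (singleton_subset_iff.mpr (mem_range_self none)) hv)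
  · rw [mem_graph_offDiagonal]
    simpa [smul_smul] using And.intro h1 h2
  · rw [mem_graph_offDiagonal]
    have h3 := graph_smul S Complex.I (h.S_ker _ hv)
    have h4 := graph_smul T (-Complex.I) (h.T_ker _ hw)
    simpa using And.intro h3 h4

theorem mem_rootM_of_map (h : IsRootSystem S T a b c q) (hf : IsFull S T a b) (ψ y : L2x2 n)
    (hψ : (ψ, y) ∈ (offDiagonal S T).graph) (hy : y ∈ rootM a b) : ψ ∈ rootM a b := by
  rw [mem_graph_offDiagonal] at hψ
  exact ⟨h.mem_span_b hf _ _ hψ.2 (Submodule.smul_mem _ _ hy.2),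
    h.mem_span_a hf _ _ hψ.1 (Submodule.smul_mem _ _ hy.1)⟩

theorem opKer_opPow_le (h : IsRootSystem S T a b c q) (hf : IsFull S T a b) (k : ℕ) :
    opKer (opPow (offDiagonal S T) k) ≤ rootM a b := by
  induction k with
  | zero =>
    intro ψ hψ
    rw [(mem_opKer_opPow_zero _ _).mp hψ]
    exact Submodule.zero_mem _
  | succ k ih =>
    intro ψ hψ
    obtain ⟨y, h1, h2⟩ := (mem_opKer_opPow_succ _ _ _).mp hψ
    exact h.mem_rootM_of_map hf ψ y h1 (ih h2)

theorem rootM_le_opKer (h : IsRootSystem S T a b c q) :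
    rootM a b ≤ opKer (opPow (offDiagonal S T) 2) := by
  intro ψ hψ
  obtain ⟨y, -, h1, h2⟩ := h.exists_map_of_mem_rootM ψ hψ
  refine (mem_opKer_opPow_succ _ _ _).mpr ⟨y, h1, ?_⟩
  rw [opKer_opPow_one, mem_opKer_iff_graph]
  exact h2

theorem opKer_opPow_eq (h : IsRootSystem S T a b c q) (hf : IsFull S T a b) (k : ℕ) (hk : 2 ≤ k) :
    opKer (opPow (offDiagonal S T) k) = rootM a b := by
  refine le_antisymm (h.opKer_opPow_le hf k) ?_
  induction k, hk using Nat.le_induction with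
  | base => exact h.rootM_le_opKer
  | succ k _ ih => exact ih.trans (opKer_opPow_mono _ k)

theorem rootSpace_eq (h : IsRootSystem S T a b c q) (hf : IsFull S T a b) :
    rootSpace (offDiagonal S T) = rootM a b :=
  le_antisymm (iSup_le fun k => h.opKer_opPow_le hf k)
    (h.rootM_le_opKer.trans (le_iSup (fun k => opKer (opPow (offDiagonal S T) k)) 2))

theorem mem_rootMStar_orthogonal {ψ : L2x2 n} : ψ ∈ (rootMStar a b)ᗮ ↔
    (∀ i, (inner ℂ (a i) ψ.fst : ℂ) = 0) ∧ ∀ i, (inner ℂ (b i) ψ.snd : ℂ) = 0 := by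
  rw [rootMStar, mem_prodSub_orthogonal, mem_span_range_orthogonal, mem_span_range_orthogonal]

/-- The range of `offDiagonal S T` on the complement of the root space stays there. -/
theorem map_mem_orthogonal (h : IsRootSystem S T a b c q) (ψ y : L2x2 n)
    (hψ : ψ ∈ (rootMStar a b)ᗮ) (hy : (ψ, y) ∈ (offDiagonal S T).graph) :
    y ∈ (rootMStar a b)ᗮ := by
  rw [mem_rootMStar_orthogonal] at hψ ⊢
  rw [mem_graph_offDiagonal] at hy
  obtain ⟨h1, h2⟩ := hψ
  obtain ⟨h3, h4⟩ := hy
  have hI : ∀ (x : L2 n) (y : L2 n), (inner ℂ x (Complex.I • y) : ℂ) = 0 → (inner ℂ x y : ℂ) = 0 := by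
    intro x y hxy
    rw [inner_smul_right] at hxy
    simpa using hxy
  have hI' : ∀ (x : L2 n) (y : L2 n), (inner ℂ x (-Complex.I • y) : ℂ) = 0 →
      (inner ℂ x y : ℂ) = 0 := by
    intro x y hxy
    rw [inner_smul_right] at hxy
    simpa using hxy
  refine ⟨fun i => hI _ _ ?_, fun i => hI' _ _ ?_⟩
  · cases i with
    | none => rw [← h.symm_S _ _ _ _ h.S_none h3, inner_zero_left]
    | some j => rw [← h.symm_S _ _ _ _ (h.S_some j) h3, inner_smul_left, h2, mul_zero]
  · cases i with
    | none => rw [← h.symm_T _ _ _ _ h.T_none h4, inner_smul_left, h1, mul_zero]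
    | some j => rw [← h.symm_T _ _ _ _ (h.T_some j) h4, inner_zero_left]

/-- Moving the operator twice to the other side of the scalar product annihilates the root vectors
of the adjoint. Conversely the Fredholm conditions are exactly the orthogonality relations. Being an
orthogonal complement, the range is closed. -/
theorem opRange_sq_eq (h : IsRootSystem S T a b c q) (hf : IsFull S T a b) :
    opRange (opPow (offDiagonal S T) 2) = (rootMStar a b)ᗮ := by
  ext ψ
  rw [mem_opRange_iff_graph]
  constructor
  · rintro ⟨χ, hχ⟩
    obtain ⟨y, h1, h2⟩ := (mem_graph_opPow_succ _ 1 _ _).mp hχ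
    obtain ⟨z, h3, h4⟩ := (mem_graph_opPow_succ _ 0 _ _).mp h2
    rw [mem_graph_opPow_zero] at h4
    subst h4
    rw [mem_graph_offDiagonal] at h1 h3
    rw [mem_rootMStar_orthogonal]
    have e1 : ∀ j, (inner ℂ (b (some j)) y.snd : ℂ) = 0 := by
      intro j
      have := h.symm_T _ _ _ _ (h.T_some j) h1.2
      simpa [inner_smul_right] using this.symm
    have e2 : (inner ℂ (a none) y.fst : ℂ) = 0 := by
      have := h.symm_S _ _ _ _ h.S_none h1.1
      simpa [inner_smul_right] using this.symm
    refine ⟨fun i => ?_, fun i => ?_⟩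
    · cases i with
      | none =>
        have := h.symm_S _ _ _ _ h.S_none h3.1
        simpa [inner_smul_right] using this.symm
      | some j =>
        have := h.symm_S _ _ _ _ (h.S_some j) h3.1
        simpa [inner_smul_right, inner_smul_left, e1] using this.symm
    · cases i with
      | none =>
        have := h.symm_T _ _ _ _ h.T_none h3.2
        rw [inner_smul_left, e2, mul_zero, inner_smul_right] at this
        simpa using this.symm
      | some j =>
        have := h.symm_T _ _ _ _ (h.T_some j) h3.2
        simpa [inner_smul_right] using this.symm
  · intro hψ
    rw [mem_rootMStar_orthogonal] at hψ
    -- Solve twice. No correction by kernel vectors is needed in between: orthogonality of ψ to the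
    -- a_j passes to orthogonality of y₂ to the b_j through S a_j = q b_j, and similarly for y₁
    -- through T b_none = -c a_none.
    obtain ⟨y₂, hy₂⟩ := hf.ran_S (Complex.I • ψ.fst) (by rw [inner_smul_right, hψ.1, mul_zero])
    obtain ⟨u, hu⟩ := hf.ran_T (-Complex.I • y₂) (by
      intro j
      have h1 := h.symm_S _ _ _ _ (h.S_some j) hy₂
      rw [inner_smul_right, hψ.1, mul_zero, inner_smul_left] at h1
      have h2 : (inner ℂ (b (some j)) y₂ : ℂ) = 0 := by
        simpa [h.q_pos.ne'] using h1
      rw [inner_smul_right, h2, mul_zero])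
    obtain ⟨y₁, hy₁⟩ := hf.ran_T (-Complex.I • ψ.snd) (by
      intro j
      rw [inner_smul_right, hψ.2, mul_zero])
    obtain ⟨v, hv⟩ := hf.ran_S (Complex.I • y₁) (by
      have h1 := h.symm_T _ _ _ _ h.T_none hy₁
      rw [inner_smul_right, hψ.2, mul_zero, inner_smul_left] at h1
      have h2 : (inner ℂ (a none) y₁ : ℂ) = 0 := by
        simpa [h.c_pos.ne'] using h1
      rw [inner_smul_right, h2, mul_zero])
    refine ⟨WithLp.toLp 2 (u, v), (mem_graph_opPow_succ _ 1 _ _).mpr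
      ⟨WithLp.toLp 2 (y₁, y₂), ?_, (mem_graph_opPow_succ _ 0 _ _).mpr
        ⟨ψ, ?_, (mem_graph_opPow_zero _ _ _).mpr rfl⟩⟩⟩
    · rw [mem_graph_offDiagonal]
      exact ⟨hv, hu⟩
    · rw [mem_graph_offDiagonal]
      exact ⟨hy₂, hy₁⟩

theorem isClosed_opRange_sq (h : IsRootSystem S T a b c q) (hf : IsFull S T a b) :
    IsClosed (opRange (opPow (offDiagonal S T) 2) : Set (L2x2 n)) := by
  rw [h.opRange_sq_eq hf]
  exact Submodule.isClosed_orthogonal _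

theorem opKer_sq_ne (h : IsRootSystem S T a b c q) :
    opKer (opPow (offDiagonal S T) 2) ≠ opKer (offDiagonal S T) := by
  intro heq
  have h1 : WithLp.toLp 2 (b none, 0) ∈ opKer (offDiagonal S T) := by
    rw [← heq]
    exact h.rootM_le_opKer ⟨Submodule.subset_span (mem_range_self _), Submodule.zero_mem _⟩
  rw [mem_opKer_iff_graph, mem_graph_offDiagonal] at h1
  have h2 := graph_unique T h.T_none h1.2
  have h3 : a none = 0 := by
    have h4 : -(c : ℂ) • a none = 0 := by simpa using h2
    exact (smul_eq_zero.mp h4).resolve_left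
      (neg_ne_zero.mpr (Complex.ofReal_ne_zero.mpr h.c_pos.ne'))
  have h5 := h.biorth none none
  simp [h3] at h5

/-- There are no Jordan blocks at real nonzero eigenvalues. -/
theorem opKer_opShift_sq_le (h : IsRootSystem S T a b c q)
    (hS : ∀ v w, (v, w) ∈ S.graph → (∀ i, (inner ℂ (b i) v : ℂ) = 0) → v ≠ 0 →
      0 < (inner ℂ v w : ℂ).re)
    (hT : ∀ v w, (v, w) ∈ T.graph → (∀ i, (inner ℂ (a i) v : ℂ) = 0) → v ≠ 0 →
      0 < (inner ℂ v w : ℂ).re) (r : ℝ) (hr : r ≠ 0) :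
    opKer (opPow (opShift (offDiagonal S T) (r : ℂ)) 2) ≤ opKer (opShift (offDiagonal S T) (r : ℂ))
    := by
  intro ψ hψ
  obtain ⟨χ, h1, h2⟩ := (mem_opKer_opPow_succ _ _ _).mp hψ
  rw [opKer_opPow_one, mem_opKer_iff_graph, mem_graph_opShift, zero_add,
    mem_graph_offDiagonal] at h2
  rw [mem_opKer_iff_graph]
  suffices hχ : χ = 0 by rwa [hχ] at h1
  rw [mem_graph_opShift, mem_graph_offDiagonal] at h1
  have hrc : (r : ℂ) ≠ 0 := Complex.ofReal_ne_zero.mpr hr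
  obtain ⟨hS1, hT1⟩ := h1
  obtain ⟨hS2, hT2⟩ := h2
  change (χ.snd, Complex.I • ((r : ℂ) • χ.fst)) ∈ S.graph at hS2
  change (χ.fst, -Complex.I • ((r : ℂ) • χ.snd)) ∈ T.graph at hT2
  change (ψ.snd, Complex.I • (χ.fst + (r : ℂ) • ψ.fst)) ∈ S.graph at hS1
  change (ψ.fst, -Complex.I • (χ.snd + (r : ℂ) • ψ.snd)) ∈ T.graph at hT1
  -- χ is an eigenvector for r ≠ 0. The symmetry of S and T makes it orthogonal to the root vectors
  -- of the adjoint: first to the kernel vectors, then to their preimages.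
  have a0 : (inner ℂ (a none) χ.fst : ℂ) = 0 := by
    have := h.symm_S _ _ _ _ h.S_none hS2
    simpa [inner_smul_right, hr] using this.symm
  have b1 : ∀ j, (inner ℂ (b (some j)) χ.snd : ℂ) = 0 := by
    intro j
    have := h.symm_T _ _ _ _ (h.T_some j) hT2
    rw [inner_zero_left, inner_smul_right, inner_smul_right] at this
    simpa [hr] using this.symm
  have ha : ∀ i, (inner ℂ (a i) χ.fst : ℂ) = 0 := by
    intro i
    cases i with
    | none => exact a0
    | some j =>
      have := h.symm_S _ _ _ _ (h.S_some j) hS2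
      simpa [inner_smul_right, inner_smul_left, hr, b1] using this.symm
  have hb : ∀ i, (inner ℂ (b i) χ.snd : ℂ) = 0 := by
    intro i
    cases i with
    | none =>
      have := h.symm_T _ _ _ _ h.T_none hT2
      rw [inner_smul_left, a0, mul_zero, inner_smul_right, inner_smul_right] at this
      simpa [hr] using this.symm
    | some j => exact b1 j
  have e1 := h.symm_S _ _ _ _ hS1 hS2
  have e2 := h.symm_T _ _ _ _ hT1 hT2
  -- Pairing the relation between ψ and χ with χ eliminates ψ, and r times the result says that ⟨χ₁,
  -- Tχ₁⟩ + ⟨χ₂, Sχ₂⟩ = 0. Both terms are nonnegative, and positive for nonzero components.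
  have e3 : (inner ℂ χ.fst (-Complex.I • ((r : ℂ) • χ.snd)) : ℂ) +
      inner ℂ χ.snd (Complex.I • ((r : ℂ) • χ.fst)) = 0 := by
    simp only [inner_smul_left, inner_smul_right, inner_add_left, map_neg, Complex.conj_I,
      Complex.conj_ofReal] at e1 e2 ⊢
    linear_combination (r : ℂ) * e1 + (r : ℂ) * e2
  have e4 := congrArg Complex.re e3
  rw [Complex.add_re, Complex.zero_re] at e4
  by_contra hne
  rcases not_and_or.mp (fun h5 : χ.fst = 0 ∧ χ.snd = 0 =>
    hne (pair_ext h5.1 h5.2)) with h5 | h5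
  · have h6 := hT _ _ hT2 ha h5
    have h7 : 0 ≤ (inner ℂ χ.snd (Complex.I • ((r : ℂ) • χ.fst)) : ℂ).re := by
      by_cases h8 : χ.snd = 0
      · simp [h8]
      · exact (hS _ _ hS2 hb h8).le
    linarith
  · have h6 := hS _ _ hS2 hb h5
    have h7 : 0 ≤ (inner ℂ χ.fst (-Complex.I • ((r : ℂ) • χ.snd)) : ℂ).re := by
      by_cases h8 : χ.fst = 0
      · simp [h8]
      · exact (hT _ _ hT2 ha h8).le
    linarith

end IsRootSystem

/-- The exchange of the two components. -/
def swap : L2x2 n →L[ℂ] L2x2 n := mat2 0 1 1 0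

@[simp]
theorem swap_fst (ψ : L2x2 n) : (swap ψ).fst = ψ.snd := by simp [swap]

@[simp]
theorem swap_snd (ψ : L2x2 n) : (swap ψ).snd = ψ.fst := by simp [swap]

@[simp]
theorem swap_swap (ψ : L2x2 n) : swap (swap ψ) = ψ := pair_ext (by simp) (by simp)

/-- The exchange of components conjugates A* to -A. Every statement about A* is obtained from one
about A, with time reversed for the groups. -/
theorem mem_graph_offDiagonal_swap (S T : L2 n →ₗ.[ℂ] L2 n) (ψ y : L2x2 n) :
    (ψ, y) ∈ (offDiagonal T S).graph ↔ (swap ψ, -swap y) ∈ (offDiagonal S T).graph := by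
  rw [mem_graph_offDiagonal, mem_graph_offDiagonal, and_comm]
  have h1 : Complex.I • (-swap y).fst = -Complex.I • y.snd := by
    change Complex.I • (-(swap y).fst) = _
    simp
  have h2 : -Complex.I • (-swap y).snd = Complex.I • y.fst := by
    change -Complex.I • (-(swap y).snd) = _
    simp
  rw [h1, h2, swap_fst, swap_snd]

theorem mem_opKer_opPow_swap (S T : L2 n →ₗ.[ℂ] L2 n) (k : ℕ) (ψ : L2x2 n) :
    ψ ∈ opKer (opPow (offDiagonal T S) k) ↔ swap ψ ∈ opKer (opPow (offDiagonal S T) k) := by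
  induction k generalizing ψ with
  | zero =>
    rw [mem_opKer_opPow_zero, mem_opKer_opPow_zero]
    constructor
    · rintro rfl
      exact map_zero _
    · intro h
      rw [← swap_swap ψ, h, map_zero]
  | succ k ih =>
    rw [mem_opKer_opPow_succ, mem_opKer_opPow_succ]
    constructor
    · rintro ⟨y, h1, h2⟩
      exact ⟨_, (mem_graph_offDiagonal_swap _ _ _ _).mp h1,
        Submodule.neg_mem _ ((ih y).mp h2)⟩
    · rintro ⟨y, h1, h2⟩
      refine ⟨-swap y, (mem_graph_offDiagonal_swap _ _ _ _).mpr ?_, (ih _).mpr ?_⟩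
      · simpa using h1
      · simpa using h2

theorem mem_rootMStar_iff_swap (ψ : L2x2 n) : ψ ∈ rootMStar a b ↔ swap ψ ∈ rootM a b := by
  rw [rootMStar, rootM, mem_prodSub, mem_prodSub, swap_fst, swap_snd, and_comm]

namespace IsRootSystem

theorem opKer_opPow_adjoint_eq (h : IsRootSystem S T a b c q) (hf : IsFull S T a b) (k : ℕ)
    (hk : 2 ≤ k) : opKer (opPow (offDiagonal T S) k) = rootMStar a b := by
  ext ψ
  rw [mem_opKer_opPow_swap, h.opKer_opPow_eq hf k hk, mem_rootMStar_iff_swap]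

theorem rootSpace_adjoint_eq (h : IsRootSystem S T a b c q) (hf : IsFull S T a b) :
    rootSpace (offDiagonal T S) = rootMStar a b := by
  refine le_antisymm (iSup_le fun k ψ hψ => ?_) ?_
  · rw [mem_rootMStar_iff_swap]
    exact h.opKer_opPow_le hf k ((mem_opKer_opPow_swap S T k ψ).mp hψ)
  · rw [← h.opKer_opPow_adjoint_eq hf 2 le_rfl]
    exact le_iSup (fun k => opKer (opPow (offDiagonal T S) k)) 2

end IsRootSystem

end RootSpaces

/-! ### The adjoint of the matrix operator -/

section Adjoint

variable {n : ℕ}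

theorem IsSchr.symm_graph {X : Type*} [NormedAddCommGroup X] [InnerProductSpace ℂ X]
    {R W : X →L[ℂ] X} {L : X →ₗ.[ℂ] X} (h : IsSchr R W L) (x x' y y' : X)
    (hx : (x, x') ∈ L.graph) (hy : (y, y') ∈ L.graph) : (inner ℂ x' y : ℂ) = inner ℂ x y' := by
  rw [LinearPMap.mem_graph_iff] at hx hy
  obtain ⟨u, rfl, rfl⟩ := hx
  obtain ⟨v, rfl, rfl⟩ := hy
  exact h.symm u v

theorem IsSchr.mem_graph_of_adjoint {X : Type*} [NormedAddCommGroup X] [InnerProductSpace ℂ X]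
    {R W : X →L[ℂ] X} {L : X →ₗ.[ℂ] X} (h : IsSchr R W L) (y w : X)
    (hyw : ∀ x x', (x, x') ∈ L.graph → (inner ℂ y x' : ℂ) = inner ℂ w x) : (y, w) ∈ L.graph := by
  obtain ⟨hy, h1⟩ := h.mem_domain_of_adjoint y w fun x => hyw _ _ (LinearPMap.mem_graph _ x)
  rw [LinearPMap.mem_graph_iff]
  exact ⟨⟨y, hy⟩, rfl, h1⟩

theorem dense_offDiagonal {S T : L2 n →ₗ.[ℂ] L2 n} (hS : Dense (S.domain : Set (L2 n)))
    (hT : Dense (T.domain : Set (L2 n))) : Dense ((offDiagonal S T).domain : Set (L2x2 n)) := by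
  have h1 : Dense ((T.domain : Set (L2 n)) ×ˢ (S.domain : Set (L2 n))) := hT.prod hS
  exact h1.preimage (WithLp.prodContinuousLinearEquiv 2 ℂ (L2 n) (L2 n)).toHomeomorph.isOpenMap

/-- Testing with vectors having one component zero separates the adjoint relation into one for T and
one for S, and these two operators are self-adjoint. -/
theorem adjoint_offDiagonal {R W₁ W₂ : L2 n →L[ℂ] L2 n} {S T : L2 n →ₗ.[ℂ] L2 n}
    (hS : IsSchr R W₁ S) (hT : IsSchr R W₂ T) :
    (offDiagonal S T).adjoint = offDiagonal T S := by
  have hd := dense_offDiagonal hS.dense_domain hT.dense_domain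
  refine LinearPMap.eq_of_eq_graph (Submodule.ext fun p => ?_)
  obtain ⟨y, w⟩ := p
  have h1 : (y, w) ∈ (offDiagonal S T).adjoint.graph ↔
      ∀ x : (offDiagonal S T).domain, (inner ℂ w (x : L2x2 n) : ℂ) = inner ℂ y (offDiagonal S T x) := by
    rw [LinearPMap.mem_graph_iff]
    constructor
    · rintro ⟨z, rfl, rfl⟩ x
      exact LinearPMap.adjoint_isFormalAdjoint hd z x
    · intro h
      have hy := LinearPMap.mem_adjoint_domain_of_exists y ⟨w, h⟩
      exact ⟨⟨y, hy⟩, rfl, LinearPMap.adjoint_apply_eq hd ⟨y, hy⟩ h⟩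
  rw [h1, mem_graph_offDiagonal]
  constructor
  · intro h
    refine ⟨hT.mem_graph_of_adjoint _ _ fun x x' hx => ?_,
      hS.mem_graph_of_adjoint _ _ fun x x' hx => ?_⟩
    · have h2 : (WithLp.toLp 2 (x, 0), WithLp.toLp 2 (0, Complex.I • x')) ∈
          (offDiagonal S T).graph := by
        rw [mem_graph_offDiagonal]
        simpa [smul_smul] using hx
      obtain ⟨z, hz1, hz2⟩ := (LinearPMap.mem_graph_iff _).mp h2
      have h3 := h z
      rw [hz1, hz2, pair_inner, pair_inner] at h3
      replace h3 : (inner ℂ w.fst x + inner ℂ w.snd 0 : ℂ) =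
        inner ℂ y.fst 0 + inner ℂ y.snd (Complex.I • x') := h3
      rw [inner_zero_right, inner_zero_right, add_zero, zero_add, inner_smul_right] at h3
      rw [inner_smul_left, Complex.conj_I, h3, ← mul_assoc]
      simp
    · have h2 : (WithLp.toLp 2 (0, x), WithLp.toLp 2 (-Complex.I • x', 0)) ∈
          (offDiagonal S T).graph := by
        rw [mem_graph_offDiagonal]
        simpa [smul_smul] using hx
      obtain ⟨z, hz1, hz2⟩ := (LinearPMap.mem_graph_iff _).mp h2
      have h3 := h z
      rw [hz1, hz2, pair_inner, pair_inner] at h3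
      replace h3 : (inner ℂ w.fst 0 + inner ℂ w.snd x : ℂ) =
        inner ℂ y.fst (-Complex.I • x') + inner ℂ y.snd 0 := h3
      rw [inner_zero_right, inner_zero_right, add_zero, zero_add, inner_smul_right] at h3
      rw [inner_smul_left, map_neg, Complex.conj_I, h3, ← mul_assoc]
      simp
  · rintro ⟨h2, h3⟩ x
    have h4 : (((x : L2x2 n), offDiagonal S T x) : L2x2 n × L2x2 n) ∈ (offDiagonal S T).graph :=
      LinearPMap.mem_graph _ x
    rw [mem_graph_offDiagonal] at h4
    have e1 := hT.symm_graph _ _ _ _ h2 h4.2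
    have e2 := hS.symm_graph _ _ _ _ h3 h4.1
    rw [pair_inner, pair_inner]
    simp only [inner_smul_left, inner_smul_right, map_neg, Complex.conj_I] at e1 e2
    linear_combination Complex.I * e1 - Complex.I * e2 +
      (inner ℂ w.fst (x : L2x2 n).fst + inner ℂ w.snd (x : L2x2 n).snd -
        inner ℂ y.fst (offDiagonal S T x).fst - inner ℂ y.snd (offDiagonal S T x).snd) *
        Complex.I_mul_I

end Adjoint

/-! ### Invariants of the flow -/

section GroupGraph

variable {H : Type*} [NormedAddCommGroup H] [InnerProductSpace ℂ H] {U V : ℝ → H →L[ℂ] H}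
  {G A B : H →ₗ.[ℂ] H}

theorem IsC0Group.graph_apply (h : IsC0Group U G) {x y : H} (hx : (x, y) ∈ G.graph) (t : ℝ) :
    (U t x, U t y) ∈ G.graph := by
  rw [LinearPMap.mem_graph_iff] at hx ⊢
  obtain ⟨z, rfl, rfl⟩ := hx
  obtain ⟨hz, h1⟩ := h.apply_mem_domain z t
  exact ⟨⟨_, hz⟩, rfl, h1⟩

theorem IsC0Group.hasDerivAt_graph (h : IsC0Group U G) {x y : H} (hx : (x, y) ∈ G.graph) (t : ℝ) :
    HasDerivAt (fun s => U s x) (U t y) t := by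
  rw [LinearPMap.mem_graph_iff] at hx
  obtain ⟨z, rfl, rfl⟩ := hx
  exact h.hasDerivAt z t

theorem mem_graph_iff_I_smul (A : H →ₗ.[ℂ] H) (x y : H) :
    (x, y) ∈ A.graph ↔ (x, Complex.I • y) ∈ (Complex.I • A).graph := by
  rw [mem_graph_smul _ Complex.I_ne_zero, smul_smul, inv_mul_cancel₀ Complex.I_ne_zero, one_smul]

theorem IsC0Group.graph_apply_I (h : IsC0Group U (Complex.I • A)) {x y : H}
    (hx : (x, y) ∈ A.graph) (t : ℝ) : (U t x, U t y) ∈ A.graph := by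
  rw [mem_graph_iff_I_smul] at hx ⊢
  rw [← map_smul]
  exact h.graph_apply hx t

theorem eq_of_hasDerivAt_zero {F : Type*} [NormedAddCommGroup F] [NormedSpace ℝ F] {f : ℝ → F}
    (hf : ∀ t, HasDerivAt f 0 t) (s t : ℝ) : f s = f t :=
  is_const_of_deriv_eq_zero (fun t => (hf t).differentiableAt) (fun t => (hf t).deriv) s t

theorem hasDerivAt_apply (L : H →L[ℂ] H) {F : ℝ → H} {y : H} {t : ℝ} (hF : HasDerivAt F y t) :
    HasDerivAt (fun t => L (F t)) (L y) t :=
  (L.restrictScalars ℝ).hasFDerivAt.comp_hasDerivAt t hF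

theorem IsC0Group.apply_of_nilpotent (h : IsC0Group U G) {x y : H} (hx : (x, y) ∈ G.graph)
    (hy : (y, 0) ∈ G.graph) (t : ℝ) : U t x = x + (t : ℂ) • y := by
  have h0 : ∀ z, U 0 z = z := fun z => by rw [h.zero]; rfl
  have h1 : ∀ s, U s y = y := by
    intro s
    have h2 : ∀ t, HasDerivAt (fun s => U s y) 0 t := fun t => by
      simpa using h.hasDerivAt_graph hy t
    rw [eq_of_hasDerivAt_zero h2 s 0, h0]
  have h3 : ∀ s : ℝ, HasDerivAt (fun s : ℝ => U s x - s • y) 0 s := by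
    intro s
    have h4 := (h.hasDerivAt_graph hx s).sub ((hasDerivAt_id s).smul_const y)
    rw [h1, one_smul, sub_self] at h4
    exact h4
  have h5 := eq_of_hasDerivAt_zero h3 t 0
  rw [h0, zero_smul, sub_zero, sub_eq_iff_eq_add] at h5
  rw [h5]
  rfl

/-- The derivative of ⟨U(t)x, V(t)y⟩ is -i⟨Ax, y⟩ + i⟨x, By⟩ along the orbits, which vanishes.
Density of the domains extends the identity to all vectors. -/
theorem IsC0Group.inner_apply_apply (hU : IsC0Group U (Complex.I • A))
    (hV : IsC0Group V (Complex.I • B)) (hA : Dense (A.domain : Set H))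
    (hB : Dense (B.domain : Set H))
    (hAB : ∀ x x' y y', (x, x') ∈ A.graph → (y, y') ∈ B.graph →
      (inner ℂ x' y : ℂ) = inner ℂ x y') (t : ℝ) (x y : H) :
    (inner ℂ (U t x) (V t y) : ℂ) = inner ℂ x y := by
  have h1 : ∀ x x' y y', (x, x') ∈ A.graph → (y, y') ∈ B.graph →
      (inner ℂ (U t x) (V t y) : ℂ) = inner ℂ x y := by
    intro x x' y y' hx hy
    have h2 : ∀ s, HasDerivAt (fun s => (inner ℂ (U s x) (V s y) : ℂ)) 0 s := by
      intro s
      have h3 := hU.hasDerivAt_graph ((mem_graph_iff_I_smul _ _ _).mp hx) s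
      have h4 := hV.hasDerivAt_graph ((mem_graph_iff_I_smul _ _ _).mp hy) s
      have h5 := h3.inner ℂ h4
      have h6 := hAB _ _ _ _ (hU.graph_apply_I hx s) (hV.graph_apply_I hy s)
      rw [map_smul, map_smul, inner_smul_left, inner_smul_right, h6, Complex.conj_I] at h5
      rw [neg_mul, add_neg_cancel] at h5
      exact h5
    have h7 := eq_of_hasDerivAt_zero h2 t 0
    rw [hU.zero, hV.zero] at h7
    exact h7
  have h8 : ∀ x x', (x, x') ∈ A.graph → ∀ y, (inner ℂ (U t x) (V t y) : ℂ) = inner ℂ x y := by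
    intro x x' hx
    refine congrFun (Continuous.ext_on hB (by fun_prop) (by fun_prop) fun y hy => ?_)
    obtain ⟨y', hy'⟩ := LinearPMap.mem_domain_iff.mp hy
    exact h1 x x' y y' hx hy'
  refine congrFun (f := fun x => (inner ℂ (U t x) (V t y) : ℂ)) (g := fun x => inner ℂ x y)
    (Continuous.ext_on hA (by fun_prop) (by fun_prop) fun x hx => ?_) x
  obtain ⟨x', hx'⟩ := LinearPMap.mem_domain_iff.mp hx
  exact h8 x x' hx' y

theorem IsC0Group.energy_eq (h : IsC0Group U G) (Ω : H →L[ℂ] H)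
    (hsymm : ∀ x x' y y', (x, x') ∈ G.graph → (y, y') ∈ G.graph →
      (inner ℂ (Ω x') y : ℂ) = inner ℂ x (Ω y'))
    (hskew : ∀ x, (inner ℂ (Ω x) x : ℂ).re = 0) {x x' : H} (hx : (x, x') ∈ G.graph) (t : ℝ) :
    (inner ℂ (U t x) (Ω (U t x')) : ℂ).re = (inner ℂ x (Ω x') : ℂ).re := by
  -- The curve U(t)x' is continuous but need not be differentiable, so the product rule is not
  -- available. Symmetry of ΩG writes the energy difference with increments of U(t)x alone, and in
  -- the limit the derivative is 2 Re⟨Ωx', x'⟩ along the orbit, which is zero.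
  have h1 : ∀ s t, (inner ℂ (U s x) (Ω (U s x')) : ℂ).re - (inner ℂ (U t x) (Ω (U t x')) : ℂ).re =
      (inner ℂ (Ω (U s x') + Ω (U t x')) (U s x - U t x) : ℂ).re := by
    intro s t
    have e1 := hsymm _ _ _ _ (h.graph_apply hx s) (h.graph_apply hx s)
    have e2 := hsymm _ _ _ _ (h.graph_apply hx t) (h.graph_apply hx t)
    have e3 := hsymm _ _ _ _ (h.graph_apply hx s) (h.graph_apply hx t)
    have e4 : (inner ℂ (Ω (U t x')) (U s x) : ℂ).re = (inner ℂ (U s x) (Ω (U t x')) : ℂ).re := by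
      rw [← inner_conj_symm, Complex.conj_re]
    rw [← e1, ← e2, inner_add_left, inner_sub_right, inner_sub_right, e3]
    simp only [Complex.add_re, Complex.sub_re, e4]
    ring
  have h2 : ∀ t, HasDerivAt (fun s => (inner ℂ (U s x) (Ω (U s x')) : ℂ).re) 0 t := by
    intro t
    rw [hasDerivAt_iff_tendsto_slope_zero]
    have h3 := hasDerivAt_iff_tendsto_slope_zero.mp (h.hasDerivAt_graph hx t)
    have h4 : Tendsto (fun s => Ω (U (t + s) x') + Ω (U t x')) (𝓝[≠] 0)
        (𝓝 (Ω (U t x') + Ω (U t x'))) := by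
      have h5 : Continuous fun s => Ω (U (t + s) x') + Ω (U t x') :=
        (Ω.continuous.comp ((h.continuous x').comp (by fun_prop))).add continuous_const
      have h6 := h5.tendsto 0
      rw [add_zero] at h6
      exact h6.mono_left nhdsWithin_le_nhds
    have h7 := (Complex.continuous_re.tendsto _).comp (h4.inner (𝕜 := ℂ) h3)
    rw [inner_add_left, Complex.add_re, hskew, add_zero] at h7
    refine h7.congr fun s => ?_
    rw [h1, Function.comp_apply]
    have h8 : (s⁻¹ • (U (t + s) x - U t x) : H) = ((s⁻¹ : ℝ) : ℂ) • (U (t + s) x - U t x) := rfl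
    rw [h8, inner_smul_right, Complex.re_ofReal_mul, smul_eq_mul]
  have h9 := eq_of_hasDerivAt_zero h2 t 0
  rw [h.zero] at h9
  exact h9

end GroupGraph

/-! ### The adjoint group and invariant subspaces -/

section SwapGroup

variable {n : ℕ} {S T : L2 n →ₗ.[ℂ] L2 n} {U : ℝ → L2x2 n →L[ℂ] L2x2 n}

theorem IsC0Group.swap_group (h : IsC0Group U (Complex.I • offDiagonal S T)) :
    IsC0Group (fun t => swap ∘L U (-t) ∘L swap) (Complex.I • offDiagonal T S) := by
  have hn := h.neg
  refine ⟨?_, ?_, ?_, ?_⟩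
  · ext1 ψ
    have := congrArg (fun F => F (swap ψ)) hn.zero
    simp only [ContinuousLinearMap.comp_apply]
    rw [this]
    simp
  · intro s t
    ext1 ψ
    have := congrArg (fun F => F (swap ψ)) (hn.add s t)
    simp only [ContinuousLinearMap.comp_apply] at this ⊢
    rw [this, swap_swap]
  · intro ψ
    exact swap.continuous.comp (hn.continuous (swap ψ))
  · intro ψ y
    have h1 : (ψ, y) ∈ (Complex.I • offDiagonal T S).graph ↔
        (swap ψ, swap y) ∈ (-(Complex.I • offDiagonal S T)).graph := by
      have h2 : (swap ψ, swap y) ∈ (-(Complex.I • offDiagonal S T)).graph ↔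
          (swap ψ, -swap y) ∈ (Complex.I • offDiagonal S T).graph := by
        rw [LinearPMap.mem_graph_iff, LinearPMap.mem_graph_iff]
        constructor
        · rintro ⟨z, h3, h4⟩
          exact ⟨z, h3, neg_eq_iff_eq_neg.mp h4⟩
        · rintro ⟨z, h3, h4⟩
          exact ⟨z, h3, by rw [LinearPMap.neg_apply]; exact neg_eq_iff_eq_neg.mpr h4⟩
      rw [h2, mem_graph_smul _ Complex.I_ne_zero, mem_graph_smul _ Complex.I_ne_zero,
        mem_graph_offDiagonal_swap, map_smul, smul_neg]
    rw [h1, hn.generator]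
    constructor
    · intro h6
      have h7 := hasDerivAt_apply swap h6
      rw [swap_swap] at h7
      exact h7
    · intro h6
      have h7 := hasDerivAt_apply swap h6
      simp only [ContinuousLinearMap.comp_apply, swap_swap] at h7
      exact h7

variable {R W₁ W₂ : L2 n →L[ℂ] L2 n}

/-- The adjoint of U(t) is U(t) conjugated by the exchange of components, with no reversal of time:
the sign in the conjugation and the one in passing to the adjoint cancel. -/
theorem IsC0Group.inner_apply_eq_swap (h : IsC0Group U (Complex.I • offDiagonal S T))
    (hS : IsSchr R W₁ S) (hT : IsSchr R W₂ T) (t : ℝ) (χ ψ : L2x2 n) :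
    (inner ℂ χ (U t ψ) : ℂ) = inner ℂ (swap (U t (swap χ))) ψ := by
  have h1 := h.swap_group.inner_apply_apply h
    (dense_offDiagonal hT.dense_domain hS.dense_domain)
    (dense_offDiagonal hS.dense_domain hT.dense_domain) (by
      intro x x' y y' hx hy
      rw [mem_graph_offDiagonal] at hx hy
      have e1 := hT.symm_graph _ _ _ _ hx.1 hy.2
      have e2 := hS.symm_graph _ _ _ _ hx.2 hy.1
      rw [pair_inner, pair_inner]
      simp only [inner_smul_left, inner_smul_right, map_neg, Complex.conj_I] at e1 e2
      linear_combination Complex.I * e1 - Complex.I * e2 +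
        (inner ℂ x'.fst y.fst + inner ℂ x'.snd y.snd -
          inner ℂ x.fst y'.fst - inner ℂ x.snd y'.snd) * Complex.I_mul_I) t
    (swap (U t (swap χ))) ψ
  rw [← h1]
  simp only [ContinuousLinearMap.comp_apply, swap_swap]
  rw [h.neg_apply_apply, swap_swap]

variable {ι : Type*} [Fintype ι] [DecidableEq ι] {a b : Option ι → L2 n} {c q : ℝ}

theorem IsRootSystem.apply_mem_rootM (hr : IsRootSystem S T a b c q)
    (h : IsC0Group U (Complex.I • offDiagonal S T)) (t : ℝ) (ψ : L2x2 n) (hψ : ψ ∈ rootM a b) :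
    ∃ y, U t ψ = ψ + (t : ℂ) • y ∧ U t ψ ∈ rootM a b := by
  obtain ⟨y, hy, h1, h2⟩ := hr.exists_map_of_mem_rootM ψ hψ
  rw [mem_graph_iff_I_smul] at h1 h2
  have h3 := graph_smul _ Complex.I h2
  rw [smul_zero, smul_zero] at h3
  have h4 := h.apply_of_nilpotent h1 h3 t
  refine ⟨_, h4, ?_⟩
  rw [h4]
  exact Submodule.add_mem _ hψ (Submodule.smul_mem _ _ (Submodule.smul_mem _ _ hy))

/-- Dual to the invariance of the root space, which is explicit because the flow is affine in t
there. -/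
theorem IsRootSystem.apply_mem_orthogonal (hr : IsRootSystem S T a b c q)
    (h : IsC0Group U (Complex.I • offDiagonal S T)) (hS : IsSchr R W₁ S) (hT : IsSchr R W₂ T)
    (t : ℝ) (ψ : L2x2 n) (hψ : ψ ∈ (rootMStar a b)ᗮ) : U t ψ ∈ (rootMStar a b)ᗮ := by
  rw [Submodule.mem_orthogonal] at hψ ⊢
  intro χ hχ
  rw [h.inner_apply_eq_swap hS hT]
  refine hψ _ ?_
  rw [mem_rootMStar_iff_swap] at hχ ⊢
  rw [swap_swap]
  obtain ⟨y, -, h1⟩ := hr.apply_mem_rootM h t (swap χ) hχ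
  exact h1

end SwapGroup

/-! ### The H¹ bound from conservation of energy -/

section EnergyBound

variable {n : ℕ}

/-- With the next two lemmas: R is an isomorphism of L² onto H¹. The constants compare the symbol
with 1 + |ξ|² and depend on κ only, which matters for uniformity in α. -/
theorem en_one_resRoot_le {κ : ℝ} (hκ : 0 < κ) (f : L2 n) :
    en 1 (resRoot n κ f) ≤ ENNReal.ofReal (1 + κ⁻¹) * ‖f‖ₑ ^ 2 := by
  rw [← en_zero_eq, en, en, ← lintegral_const_mul' _ _ (by simp)]
  refine lintegral_mono_ae ?_
  filter_upwards [ft_resRoot hκ f] with ξ h1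
  have h2 : 0 < hs κ ξ := hs_pos hκ ξ
  have h3 : (hs κ ξ ^ (-(1 / 2) : ℝ)) ^ 2 = (hs κ ξ)⁻¹ := by
    rw [← Real.rpow_natCast, ← Real.rpow_mul h2.le, ← Real.rpow_neg_one]
    norm_num
  rw [h1, enorm_mul, mul_pow, enorm_ofReal_sq (Real.rpow_nonneg h2.le _), h3, ← mul_assoc,
    ← mul_assoc, Real.rpow_one, Real.rpow_zero, ENNReal.ofReal_one, mul_one,
    ← ENNReal.ofReal_mul (wt_pos ξ).le]
  gcongr
  rw [← div_eq_mul_inv, div_le_iff₀ h2]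
  exact wt_le_hs hκ ξ

theorem enorm_sq_le_en_one {κ : ℝ} (hκ : 0 < κ) (f : L2 n) :
    ‖f‖ₑ ^ 2 ≤ ENNReal.ofReal (2 * Real.pi ^ 2 + κ) * en 1 (resRoot n κ f) := by
  rw [← en_zero_eq, en, en, ← lintegral_const_mul' _ _ (by simp)]
  refine lintegral_mono_ae ?_
  filter_upwards [ft_resRoot hκ f] with ξ h1
  have h2 : 0 < hs κ ξ := hs_pos hκ ξ
  have h3 : (hs κ ξ ^ (-(1 / 2) : ℝ)) ^ 2 = (hs κ ξ)⁻¹ := by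
    rw [← Real.rpow_natCast, ← Real.rpow_mul h2.le, ← Real.rpow_neg_one]
    norm_num
  rw [h1, enorm_mul, mul_pow, enorm_ofReal_sq (Real.rpow_nonneg h2.le _), h3, ← mul_assoc,
    ← mul_assoc, Real.rpow_one, Real.rpow_zero, ← ENNReal.ofReal_mul (by positivity),
    ← ENNReal.ofReal_mul (mul_nonneg (by positivity) (wt_pos ξ).le)]
  gcongr
  rw [← div_eq_mul_inv, le_div_iff₀ h2, one_mul]
  exact hs_le_wt hκ ξ

theorem exists_resRoot_of_en_lt_top {κ : ℝ} (hκ : 0 < κ) {f : L2 n} (hf : en 1 f < ⊤) :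
    ∃ g, resRoot n κ g = f := by
  obtain ⟨g, hg⟩ := exists_of_en_lt_top hf
  have hm : MemLp (fun ξ : E n => ((hs κ ξ ^ (1 / 2 : ℝ) / wt ξ ^ (1 / 2 : ℝ) : ℝ) : ℂ)) ∞ volume := by
    refine memLp_top_real (((continuous_hs κ).measurable.pow_const _).div
      (measurable_wt_rpow _)) ((2 * Real.pi ^ 2 + κ) ^ (1 / 2 : ℝ)) fun ξ => ?_
    rw [abs_of_nonneg (div_nonneg (Real.rpow_nonneg (hs_pos hκ ξ).le _)
      (Real.rpow_nonneg (wt_pos ξ).le _)), div_le_iff₀ (Real.rpow_pos_of_pos (wt_pos ξ) _),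
      ← Real.mul_rpow (by positivity) (wt_pos ξ).le]
    exact Real.rpow_le_rpow (hs_pos hκ ξ).le (hs_le_wt hκ ξ) (by norm_num)
  refine ⟨fmul (fun ξ : E n => ((hs κ ξ ^ (1 / 2 : ℝ) / wt ξ ^ (1 / 2 : ℝ) : ℝ) : ℂ)) g, ft_ext ?_⟩
  have h0 := ft_fmul (fun ξ : E n => ((hs κ ξ ^ (1 / 2 : ℝ) / wt ξ ^ (1 / 2 : ℝ) : ℝ) : ℂ)) g
  filter_upwards [ft_resRoot hκ (fmul (fun ξ : E n =>
    ((hs κ ξ ^ (1 / 2 : ℝ) / wt ξ ^ (1 / 2 : ℝ) : ℝ) : ℂ)) g), mulOp_ae hm (ft g), hg] with ξ h1 h2 h3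
  rw [h1, h0, h2, ← h3, ← mul_assoc, ← mul_assoc, ← Complex.ofReal_mul, ← Complex.ofReal_mul]
  have h4 : hs κ ξ ^ (-(1 / 2) : ℝ) * (hs κ ξ ^ (1 / 2 : ℝ) / wt ξ ^ (1 / 2 : ℝ)) *
      wt ξ ^ (1 / 2 : ℝ) = 1 := by
    rw [mul_assoc, div_mul_cancel₀ _ (Real.rpow_pos_of_pos (wt_pos ξ) _).ne',
      ← Real.rpow_add (hs_pos hκ ξ)]
    norm_num
  rw [h4, Complex.ofReal_one, one_mul]

variable {S T : L2 n →ₗ.[ℂ] L2 n} {U : ℝ → L2x2 n →L[ℂ] L2x2 n}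
  {W₁ W₂ : L2 n →L[ℂ] L2 n} {κ : ℝ}

/-- The energy of `(R f₁, R f₂)` is conserved. -/
theorem energy_conservation (h : IsC0Group U (Complex.I • offDiagonal S T))
    (hS : IsSchr (resRoot n κ) W₁ S) (hT : IsSchr (resRoot n κ) W₂ T) (t : ℝ) (ψ : L2x2 n)
    (hψ1 : ψ.fst ∈ T.domain) (hψ2 : ψ.snd ∈ S.domain) (f₁ f₂ : L2 n)
    (hf₁ : resRoot n κ f₁ = ψ.fst) (hf₂ : resRoot n κ f₂ = ψ.snd) :
    ∃ g₁ g₂, resRoot n κ g₁ = (U t ψ).fst ∧ resRoot n κ g₂ = (U t ψ).snd ∧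
      qf (formOp (resRoot n κ) W₂) g₁ + qf (formOp (resRoot n κ) W₁) g₂ =
      qf (formOp (resRoot n κ) W₂) f₁ + qf (formOp (resRoot n κ) W₁) f₂ := by
  let y : L2x2 n := WithLp.toLp 2 (S ⟨ψ.snd, hψ2⟩, -T ⟨ψ.fst, hψ1⟩)
  have hy : (ψ, y) ∈ (Complex.I • offDiagonal S T).graph := by
    rw [mem_graph_I_smul_offDiagonal]
    refine ⟨LinearPMap.mem_graph S ⟨ψ.snd, hψ2⟩, ?_⟩
    have := LinearPMap.mem_graph T ⟨ψ.fst, hψ1⟩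
    simpa [y] using this
  -- The matrix (0, -1; 1, 0) is the symplectic form: composed with the generator (u, v) ↦ (Sv, -Tu)
  -- it gives diag(T, S), so this pairing is the energy.
  have key : ∀ ψ y : L2x2 n, (ψ, y) ∈ (Complex.I • offDiagonal S T).graph → ∀ f₁ f₂,
      resRoot n κ f₁ = ψ.fst → resRoot n κ f₂ = ψ.snd →
      (inner ℂ ψ (mat2 0 (-1) 1 0 y) : ℂ).re =
        qf (formOp (resRoot n κ) W₂) f₁ + qf (formOp (resRoot n κ) W₁) f₂ := by
    intro ψ y hy f₁ f₂ hf₁ hf₂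
    rw [mem_graph_I_smul_offDiagonal, LinearPMap.mem_graph_iff, LinearPMap.mem_graph_iff] at hy
    obtain ⟨⟨v, hv1, hv2⟩, ⟨u, hu1, hu2⟩⟩ := hy
    simp only at hv1 hv2 hu1 hu2
    rw [hT.qf_formOp_eq u f₁ (by rw [hf₁, hu1]), hS.qf_formOp_eq v f₂ (by rw [hf₂, hv1]), pair_inner,
      Complex.add_re, hu2, hv2, hu1, hv1]
    simp only [mat2_fst, mat2_snd]
    rw [← Complex.conj_re (inner ℂ (-y.snd) ψ.fst), ← Complex.conj_re (inner ℂ y.fst ψ.snd),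
      inner_conj_symm, inner_conj_symm]
    simp
  have h1 := h.graph_apply hy t
  have h2 := h1
  rw [mem_graph_I_smul_offDiagonal] at h2
  obtain ⟨g₁, hg₁⟩ := (hT.mem_domain _).mp (LinearPMap.mem_domain_of_mem_graph h2.2)
  obtain ⟨g₂, hg₂⟩ := (hS.mem_domain _).mp (LinearPMap.mem_domain_of_mem_graph h2.1)
  refine ⟨_, _, hg₁, hg₂, ?_⟩
  rw [← key _ _ h1 _ _ hg₁ hg₂, ← key _ _ hy _ _ hf₁ hf₂]
  refine h.energy_eq (mat2 0 (-1) 1 0) ?_ ?_ hy t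
  · intro x x' y y' hx hy
    rw [mem_graph_I_smul_offDiagonal] at hx hy
    have e1 := hS.symm_graph _ _ _ _ hx.1 hy.1
    have e2 := hT.symm_graph _ _ _ _ hx.2 hy.2
    rw [pair_inner, pair_inner]
    simp only [mat2_fst, mat2_snd]
    simpa [add_comm] using congrArg₂ (· + ·) e1 e2
  · intro x
    rw [pair_inner]
    simp only [mat2_fst, mat2_snd]
    have e1 : (inner ℂ x.fst x.snd : ℂ).re = (inner ℂ x.snd x.fst : ℂ).re := by
      rw [← inner_conj_symm, Complex.conj_re]
    simp [e1]

variable {ι : Type*} [Fintype ι] [DecidableEq ι] {a b : Option ι → L2 n} {c q : ℝ}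

/-- The chain is: c₁‖g‖² ≤ energy at time t = energy at time 0 ≤ C₂‖f‖², where g and f are the
R-preimages at the two times. Conservation is available only for data in the operator domain. -/
theorem IsRootSystem.en2_one_le_of_mem_domain (hr : IsRootSystem S T a b c q) (hκ : 0 < κ)
    (h : IsC0Group U (Complex.I • offDiagonal S T))
    (hS : IsSchr (resRoot n κ) W₁ S) (hT : IsSchr (resRoot n κ) W₂ T) {c₁ C₂ : ℝ} (hc₁ : 0 < c₁)
    (hcT : ∀ f, (∀ i, (inner ℂ (a i) (resRoot n κ f) : ℂ) = 0) →
      c₁ * ‖f‖ ^ 2 ≤ qf (formOp (resRoot n κ) W₂) f)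
    (hcS : ∀ f, (∀ i, (inner ℂ (b i) (resRoot n κ f) : ℂ) = 0) →
      c₁ * ‖f‖ ^ 2 ≤ qf (formOp (resRoot n κ) W₁) f)
    (hCT : ‖formOp (resRoot n κ) W₂‖ ≤ C₂) (hCS : ‖formOp (resRoot n κ) W₁‖ ≤ C₂) (t : ℝ)
    (ψ : L2x2 n) (hψ : ψ ∈ (rootMStar a b)ᗮ) (hψ1 : ψ.fst ∈ T.domain) (hψ2 : ψ.snd ∈ S.domain)
    (f₁ f₂ : L2 n) (hf₁ : resRoot n κ f₁ = ψ.fst) (hf₂ : resRoot n κ f₂ = ψ.snd) :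
    en2 1 (U t ψ) ≤ ENNReal.ofReal ((1 + κ⁻¹) * (C₂ / c₁)) * (‖f₁‖ₑ ^ 2 + ‖f₂‖ₑ ^ 2) := by
  obtain ⟨g₁, g₂, hg₁, hg₂, hq⟩ := energy_conservation h hS hT t ψ hψ1 hψ2 f₁ f₂ hf₁ hf₂
  have h1 := hr.apply_mem_orthogonal h hS hT t ψ hψ
  rw [mem_rootMStar_orthogonal, ← hg₁, ← hg₂] at h1
  have h2 := hcT g₁ h1.1
  have h3 := hcS g₂ h1.2
  have h4 : qf (formOp (resRoot n κ) W₂) f₁ ≤ C₂ * ‖f₁‖ ^ 2 :=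
    (le_abs_self _).trans ((qf_le _ _).trans (by gcongr))
  have h5 : qf (formOp (resRoot n κ) W₁) f₂ ≤ C₂ * ‖f₂‖ ^ 2 :=
    (le_abs_self _).trans ((qf_le _ _).trans (by gcongr))
  have h6 : ‖g₁‖ ^ 2 + ‖g₂‖ ^ 2 ≤ C₂ / c₁ * (‖f₁‖ ^ 2 + ‖f₂‖ ^ 2) := by
    rw [div_mul_eq_mul_div, le_div_iff₀ hc₁]
    linarith
  have hC₂ : 0 ≤ C₂ := (norm_nonneg _).trans hCT
  have he : ∀ f : L2 n, ‖f‖ₑ ^ 2 = ENNReal.ofReal (‖f‖ ^ 2) := fun f => by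
    rw [← ofReal_norm, ENNReal.ofReal_pow (norm_nonneg _)]
  rw [en2, ← hg₁, ← hg₂]
  calc _ ≤ ENNReal.ofReal (1 + κ⁻¹) * ‖g₁‖ₑ ^ 2 + ENNReal.ofReal (1 + κ⁻¹) * ‖g₂‖ₑ ^ 2 :=
        add_le_add (en_one_resRoot_le hκ g₁) (en_one_resRoot_le hκ g₂)
    _ = ENNReal.ofReal ((1 + κ⁻¹) * (‖g₁‖ ^ 2 + ‖g₂‖ ^ 2)) := by
        rw [← mul_add, he, he, ← ENNReal.ofReal_add (by positivity) (by positivity),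
          ENNReal.ofReal_mul (by positivity)]
    _ ≤ ENNReal.ofReal ((1 + κ⁻¹) * (C₂ / c₁ * (‖f₁‖ ^ 2 + ‖f₂‖ ^ 2))) := by gcongr
    _ = _ := by
        rw [← mul_assoc, ENNReal.ofReal_mul (by positivity), he, he,
          ← ENNReal.ofReal_add (by positivity) (by positivity)]

/-- Density of domain vectors among H¹ vectors satisfying the orthogonality conditions. Approximate
without the conditions, then project along b; the projection stays in the domain and its correction
tends to 0 because the limit already satisfies the conditions. -/
theorem exists_approximation {R W : L2 n →L[ℂ] L2 n} {L : L2 n →ₗ.[ℂ] L2 n} (hL : IsSchr R W L)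
    {κ' : Type*} [Fintype κ'] [DecidableEq κ'] (a b : κ' → L2 n) (hb : ∀ i, b i ∈ L.domain) (f : L2 n)
    (hf : ∀ i, (inner ℂ (a i) (R f) : ℂ) = 0) :
    ∃ (u F : ℕ → L2 n), (∀ k, R (F k) = biproj a b (u k)) ∧ (∀ k, biproj a b (u k) ∈ L.domain) ∧
      Tendsto F atTop (𝓝 f) := by
  have h1 : f ∈ closure (range R) := by
    rw [hL.dense_range.closure_eq]
    trivial
  obtain ⟨g, hg, hlim⟩ := mem_closure_iff_seq_limit.mp h1
  choose g' hg' using hg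
  choose β hβ using fun i => (hL.mem_domain _).mp (hb i)
  have h2 : ∀ k, R (g k - ∑ i, (inner ℂ (a i) (R (g k)) : ℂ) • R (β i)) = biproj a b (R (g k)) := by
    intro k
    rw [biproj_apply, map_sub, map_sum]
    simp only [map_smul, hβ]
  refine ⟨fun k => R (g k), fun k => g k - ∑ i, (inner ℂ (a i) (R (g k)) : ℂ) • R (β i), h2,
    fun k => ?_, ?_⟩
  · rw [biproj_apply]
    refine Submodule.sub_mem _ ((hL.mem_domain _).mpr ⟨g' k, by rw [hg']⟩)
      (Submodule.sum_mem _ fun i _ => Submodule.smul_mem _ _ (hb i))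
  · have h3 : Tendsto (fun k => g k - ∑ i, (inner ℂ (a i) (R (g k)) : ℂ) • R (β i)) atTop
        (𝓝 (f - ∑ i, (inner ℂ (a i) (R f) : ℂ) • R (β i))) := by
      have h4 : Continuous fun g => g - ∑ i, (inner ℂ (a i) (R g) : ℂ) • R (β i) := by fun_prop
      exact (h4.tendsto f).comp hlim
    simpa [hf] using h3

/-- Stability in `H¹`, with an explicit constant. -/
theorem IsRootSystem.en2_one_le (hr : IsRootSystem S T a b c q) (hκ : 0 < κ)
    (h : IsC0Group U (Complex.I • offDiagonal S T))
    (hS : IsSchr (resRoot n κ) W₁ S) (hT : IsSchr (resRoot n κ) W₂ T) {c₁ C₂ : ℝ} (hc₁ : 0 < c₁)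
    (hcT : ∀ f, (∀ i, (inner ℂ (a i) (resRoot n κ f) : ℂ) = 0) →
      c₁ * ‖f‖ ^ 2 ≤ qf (formOp (resRoot n κ) W₂) f)
    (hcS : ∀ f, (∀ i, (inner ℂ (b i) (resRoot n κ f) : ℂ) = 0) →
      c₁ * ‖f‖ ^ 2 ≤ qf (formOp (resRoot n κ) W₁) f)
    (hCT : ‖formOp (resRoot n κ) W₂‖ ≤ C₂) (hCS : ‖formOp (resRoot n κ) W₁‖ ≤ C₂) (t : ℝ)
    (ψ : L2x2 n) (hψ : ψ ∈ (rootMStar a b)ᗮ) :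
    en2 1 (U t ψ) ≤ ((2 * ((1 + κ⁻¹) * (C₂ / c₁)).toNNReal *
      (2 * Real.pi ^ 2 + κ).toNNReal + 1 : ℝ≥0) : ℝ≥0∞) * en2 1 ψ := by
  -- The summand 1 in the constant makes it positive, so that the right side is infinite in this
  -- case.
  by_cases htop : en2 1 ψ = ⊤
  · rw [htop, ENNReal.mul_top (by norm_cast; positivity)]
    exact le_top
  obtain ⟨ht1, ht2⟩ := ENNReal.add_lt_top.mp (lt_top_iff_ne_top.mpr htop)
  obtain ⟨f₁, hf₁⟩ := exists_resRoot_of_en_lt_top hκ ht1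
  obtain ⟨f₂, hf₂⟩ := exists_resRoot_of_en_lt_top hκ ht2
  have hψ' := hψ
  rw [mem_rootMStar_orthogonal, ← hf₁, ← hf₂] at hψ'
  have hbT : ∀ i, b i ∈ T.domain := by
    intro i
    cases i with
    | none => exact LinearPMap.mem_domain_of_mem_graph hr.T_none
    | some j => exact LinearPMap.mem_domain_of_mem_graph (hr.T_some j)
  have haS : ∀ i, a i ∈ S.domain := by
    intro i
    cases i with
    | none => exact LinearPMap.mem_domain_of_mem_graph hr.S_none
    | some j => exact LinearPMap.mem_domain_of_mem_graph (hr.S_some j)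
  obtain ⟨u, F, hF, hFd, hFlim⟩ := exists_approximation hT a b hbT f₁ hψ'.1
  obtain ⟨v, F', hF', hFd', hFlim'⟩ := exists_approximation hS b a haS f₂ hψ'.2
  have hlim : Tendsto (fun k => (WithLp.toLp 2 (resRoot n κ (F k), resRoot n κ (F' k)) : L2x2 n))
      atTop (𝓝 ψ) := by
    rw [tendsto_pair_iff, ← hf₁, ← hf₂]
    exact ⟨((resRoot n κ).continuous.tendsto _).comp hFlim,
      ((resRoot n κ).continuous.tendsto _).comp hFlim'⟩
  have hlim2 := ((U t).continuous.tendsto _).comp hlim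
  have hc : Tendsto (fun k => ENNReal.ofReal ((1 + κ⁻¹) * (C₂ / c₁)) *
      (‖F k‖ₑ ^ 2 + ‖F' k‖ₑ ^ 2)) atTop
      (𝓝 (ENNReal.ofReal ((1 + κ⁻¹) * (C₂ / c₁)) * (‖f₁‖ₑ ^ 2 + ‖f₂‖ₑ ^ 2))) := by
    refine ENNReal.Tendsto.const_mul ?_ (Or.inr ENNReal.ofReal_ne_top)
    exact (((ENNReal.continuous_pow 2).tendsto _).comp hFlim.enorm).add
      (((ENNReal.continuous_pow 2).tendsto _).comp hFlim'.enorm)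
  have h1 := en2_le_of_tendsto hlim2 hc (s := 1) fun k =>
    hr.en2_one_le_of_mem_domain hκ h hS hT hc₁ hcT hcS hCT hCS t _ (by
      rw [mem_rootMStar_orthogonal]
      change (∀ i, (inner ℂ (a i) (resRoot n κ (F k)) : ℂ) = 0) ∧
        ∀ i, (inner ℂ (b i) (resRoot n κ (F' k)) : ℂ) = 0
      rw [hF, hF']
      exact ⟨fun i => inner_biproj_right a b hr.biorth i _,
        fun i => inner_biproj_right b a (biorth_symm hr.biorth) i _⟩)
      (by change resRoot n κ (F k) ∈ _; rw [hF]; exact hFd k)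
      (by change resRoot n κ (F' k) ∈ _; rw [hF']; exact hFd' k) (F k) (F' k) rfl rfl
  refine h1.trans ?_
  have h2 : ‖f₁‖ₑ ^ 2 + ‖f₂‖ₑ ^ 2 ≤ ENNReal.ofReal (2 * Real.pi ^ 2 + κ) * en2 1 ψ := by
    rw [en2, mul_add, ← hf₁, ← hf₂]
    exact add_le_add (enorm_sq_le_en_one hκ f₁) (enorm_sq_le_en_one hκ f₂)
  calc _ ≤ 2 * (ENNReal.ofReal ((1 + κ⁻¹) * (C₂ / c₁)) *
        (ENNReal.ofReal (2 * Real.pi ^ 2 + κ) * en2 1 ψ)) := by gcongr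
    _ = ((2 * ((1 + κ⁻¹) * (C₂ / c₁)).toNNReal * (2 * Real.pi ^ 2 + κ).toNNReal : ℝ≥0) : ℝ≥0∞)
          * en2 1 ψ := by
        push_cast
        rw [ENNReal.ofReal, ENNReal.ofReal]
        ring
    _ ≤ _ := by
        gcongr
        exact le_self_add

end EnergyBound

/-! ### Elliptic regularity in H^s -/

section Elliptic

variable {n : ℕ} {κ : ℝ}

/-- A bounded operator on `L²` that is bounded in every Sobolev norm. -/
def SobBounded (W : L2 n →L[ℂ] L2 n) : Prop :=
  ∀ s : ℝ, ∃ C : ℝ≥0, ∀ g : L2 n, en s (W g) ≤ C * en s g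

theorem enorm_ofReal_mul_sq {r : ℝ} (hr : 0 ≤ r) (z : ℂ) :
    ‖(r : ℂ) * z‖ₑ ^ 2 = ENNReal.ofReal (r ^ 2) * ‖z‖ₑ ^ 2 := by
  rw [enorm_mul, mul_pow, enorm_ofReal_sq hr]

theorem en_add_two_le (hκ : 0 < κ) (s : ℝ) {f x : L2 n} (h : resRoot n κ (resRoot n κ f) = x) :
    en (s + 2) x ≤ ENNReal.ofReal ((1 + κ⁻¹) ^ 2) * en s f := by
  rw [en, en, ← lintegral_const_mul' _ _ (by simp)]
  refine lintegral_mono_ae ?_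
  filter_upwards [(resRoot_resRoot_eq_iff hκ f x).mp h] with ξ h1
  rw [← h1, enorm_ofReal_mul_sq (hs_pos hκ ξ).le, ← mul_assoc, ← mul_assoc,
    ← ENNReal.ofReal_mul (by positivity),
    ← ENNReal.ofReal_mul (mul_nonneg (by positivity) (Real.rpow_nonneg (wt_pos ξ).le _))]
  gcongr
  rw [Real.rpow_add (wt_pos ξ), Real.rpow_two]
  have h2 := wt_le_hs hκ ξ
  have h3 : wt ξ ^ 2 ≤ ((1 + κ⁻¹) * hs κ ξ) ^ 2 := pow_le_pow_left₀ (wt_pos ξ).le h2 2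
  nlinarith [mul_le_mul_of_nonneg_left h3 (Real.rpow_nonneg (wt_pos ξ).le s)]

theorem en_le_add_two (hκ : 0 < κ) (s : ℝ) {f x : L2 n} (h : resRoot n κ (resRoot n κ f) = x) :
    en s f ≤ ENNReal.ofReal ((2 * Real.pi ^ 2 + κ) ^ 2) * en (s + 2) x := by
  rw [en, en, ← lintegral_const_mul' _ _ (by simp)]
  refine lintegral_mono_ae ?_
  filter_upwards [(resRoot_resRoot_eq_iff hκ f x).mp h] with ξ h1
  rw [← h1, enorm_ofReal_mul_sq (hs_pos hκ ξ).le, ← mul_assoc, ← mul_assoc,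
    ← ENNReal.ofReal_mul (Real.rpow_nonneg (wt_pos ξ).le _),
    ← ENNReal.ofReal_mul (by positivity)]
  refine mul_le_mul_left (ENNReal.ofReal_le_ofReal ?_) _
  rw [Real.rpow_add (wt_pos ξ), Real.rpow_two]
  have h2 := hs_le_wt hκ ξ
  have h3 : hs κ ξ ^ 2 ≤ ((2 * Real.pi ^ 2 + κ) * wt ξ) ^ 2 :=
    pow_le_pow_left₀ (hs_pos hκ ξ).le h2 2
  nlinarith [mul_le_mul_of_nonneg_left h3 (Real.rpow_nonneg (wt_pos ξ).le s)]

variable {W : L2 n →L[ℂ] L2 n} {L : L2 n →ₗ.[ℂ] L2 n}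

theorem IsSchr.mem_domain_of_en_lt_top (hL : IsSchr (resRoot n κ) W L) (hκ : 0 < κ) {x : L2 n}
    (hx : en 2 x < ⊤) : x ∈ L.domain := by
  obtain ⟨g, hg⟩ := exists_of_en_lt_top hx
  rw [hL.mem_domain, ← mem_H2_iff_hs hκ, mem_H2_iff]
  refine ⟨g, ?_⟩
  simpa using hg

/-- Lx = y is equivalent to x = R²(y - Wx). R² gains exactly two derivatives and W loses none. -/
theorem IsSchr.exists_en_graph_le (hL : IsSchr (resRoot n κ) W L) (hκ : 0 < κ)
    (hW : SobBounded W) (s : ℝ) : ∃ C : ℝ≥0, ∀ x y, (x, y) ∈ L.graph →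
      en s y ≤ C * en (s + 2) x ∧ en (s + 2) x ≤ C * (en s y + en s x) := by
  obtain ⟨D, hD⟩ := hW s
  let C₁ : ℝ≥0 := ((2 * Real.pi ^ 2 + κ) ^ 2).toNNReal
  let C₂ : ℝ≥0 := ((1 + κ⁻¹) ^ 2).toNNReal
  refine ⟨(2 * C₁ + 2 * D) + 2 * C₂ * (1 + D), fun x y hxy => ?_⟩
  rw [hL.mem_graph_iff] at hxy
  have h1 : en (s + 2) x ≤ C₂ * en s (y - W x) := en_add_two_le hκ s hxy
  have h2 : en s (y - W x) ≤ C₁ * en (s + 2) x := en_le_add_two hκ s hxy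
  have h3 : en s x ≤ en (s + 2) x := en_mono (by linarith) x
  constructor
  · calc en s y = en s ((y - W x) + W x) := by rw [sub_add_cancel]
      _ ≤ 2 * en s (y - W x) + 2 * en s (W x) := en_add_le _ _ _
      _ ≤ 2 * (C₁ * en (s + 2) x) + 2 * (D * en (s + 2) x) := by
          gcongr
          exact (hD x).trans (by gcongr)
      _ = ((2 * C₁ + 2 * D : ℝ≥0) : ℝ≥0∞) * en (s + 2) x := by push_cast; ring
      _ ≤ _ := mul_le_mul_left (by exact_mod_cast le_self_add) _
  · calc en (s + 2) x ≤ C₂ * (2 * en s y + 2 * (D * en s x)) := by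
          refine h1.trans (mul_le_mul_right ((en_sub_le _ _ _).trans ?_) _)
          gcongr
          exact hD x
      _ ≤ C₂ * (2 * ((1 + D) * en s y) + 2 * ((1 + D) * en s x)) := by
          gcongr
          · exact le_mul_of_one_le_left (zero_le) le_self_add
          · exact le_add_self
      _ = ((2 * C₂ * (1 + D) : ℝ≥0) : ℝ≥0∞) * (en s y + en s x) := by push_cast; ring
      _ ≤ _ := mul_le_mul_left (by exact_mod_cast le_add_self) _

theorem en2_mono {s t : ℝ} (h : s ≤ t) (ψ : L2x2 n) : en2 s ψ ≤ en2 t ψ :=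
  add_le_add (en_mono h _) (en_mono h _)

theorem en2_swap (s : ℝ) (ψ : L2x2 n) : en2 s (swap ψ) = en2 s ψ := by
  rw [en2, en2, swap_fst, swap_snd, add_comm]

theorem exists_en2_graph_le {S T : L2 n →ₗ.[ℂ] L2 n} {W₁ W₂ : L2 n →L[ℂ] L2 n} (hκ : 0 < κ)
    (hS : IsSchr (resRoot n κ) W₁ S) (hT : IsSchr (resRoot n κ) W₂ T) (hW₁ : SobBounded W₁)
    (hW₂ : SobBounded W₂) (s : ℝ) : ∃ C : ℝ≥0, ∀ ψ y, (ψ, y) ∈ (offDiagonal S T).graph →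
      en2 s y ≤ C * en2 (s + 2) ψ ∧ en2 (s + 2) ψ ≤ C * (en2 s y + en2 s ψ) := by
  obtain ⟨C₁, h₁⟩ := hS.exists_en_graph_le hκ hW₁ s
  obtain ⟨C₂, h₂⟩ := hT.exists_en_graph_le hκ hW₂ s
  refine ⟨C₁ + C₂, fun ψ y h => ?_⟩
  rw [mem_graph_offDiagonal] at h
  obtain ⟨h3, h4⟩ := h₁ _ _ h.1
  obtain ⟨h5, h6⟩ := h₂ _ _ h.2
  rw [en_smul] at h3 h4 h5 h6
  have e1 : ‖Complex.I‖ₑ ^ 2 = 1 := by simp [← ofReal_norm]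
  have e2 : ‖-Complex.I‖ₑ ^ 2 = 1 := by simp [← ofReal_norm]
  rw [e1, one_mul] at h3 h4
  rw [e2, one_mul] at h5 h6
  have l1 : (C₁ : ℝ≥0∞) ≤ ((C₁ + C₂ : ℝ≥0) : ℝ≥0∞) := by exact_mod_cast le_self_add
  have l2 : (C₂ : ℝ≥0∞) ≤ ((C₁ + C₂ : ℝ≥0) : ℝ≥0∞) := by exact_mod_cast le_add_self
  simp only [en2]
  generalize ((C₁ + C₂ : ℝ≥0) : ℝ≥0∞) = D at l1 l2
  constructor
  · calc en s y.fst + en s y.snd ≤ D * en (s + 2) ψ.snd + D * en (s + 2) ψ.fst :=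
        add_le_add (h3.trans (by gcongr)) (h5.trans (by gcongr))
      _ = _ := by ring
  · calc en (s + 2) ψ.fst + en (s + 2) ψ.snd
        ≤ D * (en s y.snd + en s ψ.fst) + D * (en s y.fst + en s ψ.snd) :=
        add_le_add (h6.trans (by gcongr)) (h4.trans (by gcongr))
      _ = _ := by ring

end Elliptic

/-! ### The projection along the root space -/

section Projection

variable {n : ℕ} {ι : Type*} [Fintype ι] [DecidableEq ι]

theorem exists_en_sum_le (s : ℝ) (a b : ι → L2 n) (ha : ∀ i, en (-s) (a i) < ⊤)
    (hb : ∀ i, en s (b i) < ⊤) (F : Finset ι) :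
    ∃ C : ℝ≥0, ∀ u, en s (∑ i ∈ F, (inner ℂ (a i) u : ℂ) • b i) ≤ C * en s u := by
  induction F using Finset.induction_on with
  | empty => exact ⟨0, fun u => by simp [en_zero]⟩
  | insert i F hi ih =>
    obtain ⟨C, hC⟩ := ih
    refine ⟨2 * ((en (-s) (a i)).toNNReal * (en s (b i)).toNNReal) + 2 * C, fun u => ?_⟩
    rw [Finset.sum_insert hi]
    refine (en_add_le _ _ _).trans ?_
    rw [en_smul]
    have h1 := enorm_inner_sq_le s (a i) u
    calc _ ≤ 2 * ((en (-s) (a i) * en s u) * en s (b i)) + 2 * (C * en s u) := by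
          gcongr
          exact hC u
      _ = _ := by
          push_cast
          rw [ENNReal.coe_toNNReal (ha i).ne, ENNReal.coe_toNNReal (hb i).ne]
          ring

theorem exists_en_biproj_le (s : ℝ) (a b : ι → L2 n) (ha : ∀ i, en (-s) (a i) < ⊤)
    (hb : ∀ i, en s (b i) < ⊤) : ∃ C : ℝ≥0, ∀ u, en s (biproj a b u) ≤ C * en s u := by
  obtain ⟨C, hC⟩ := exists_en_sum_le s a b ha hb Finset.univ
  refine ⟨2 + 2 * C, fun u => ?_⟩
  rw [biproj_apply]
  refine (en_sub_le _ _ _).trans ?_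
  calc _ ≤ 2 * en s u + 2 * (C * en s u) := by gcongr; exact hC u
    _ = _ := by push_cast; ring

/-- The projection onto `(rootMStar a b)ᗮ` along `rootM a b`. -/
def rootProj (a b : Option ι → L2 n) : L2x2 n →L[ℂ] L2x2 n :=
  mat2 (biproj a b) 0 0 (biproj b a)

variable {a b : Option ι → L2 n}

theorem rootProj_fst (ψ : L2x2 n) : (rootProj a b ψ).fst = biproj a b ψ.fst := by
  simp [rootProj]

theorem rootProj_snd (ψ : L2x2 n) : (rootProj a b ψ).snd = biproj b a ψ.snd := by
  simp [rootProj]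

theorem exists_en2_rootProj_le (s : ℝ) (ha : ∀ s i, en s (a i) < ⊤) (hb : ∀ s i, en s (b i) < ⊤) :
    ∃ C : ℝ≥0, ∀ ψ, en2 s (rootProj a b ψ) ≤ C * en2 s ψ := by
  obtain ⟨C₁, h₁⟩ := exists_en_biproj_le s a b (ha _) (hb _)
  obtain ⟨C₂, h₂⟩ := exists_en_biproj_le s b a (hb _) (ha _)
  refine ⟨C₁ + C₂, fun ψ => ?_⟩
  rw [en2, en2, rootProj_fst, rootProj_snd, mul_add]
  refine add_le_add ((h₁ _).trans ?_) ((h₂ _).trans ?_)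
  · gcongr
    exact le_self_add
  · gcongr
    exact le_add_self

theorem rootProj_mem (h : ∀ i j, (inner ℂ (a i) (b j) : ℂ) = if i = j then 1 else 0)
    (ψ : L2x2 n) : rootProj a b ψ ∈ (rootMStar a b)ᗮ := by
  rw [IsRootSystem.mem_rootMStar_orthogonal, rootProj_fst, rootProj_snd]
  exact ⟨fun i => inner_biproj_right a b h i _,
    fun i => inner_biproj_right b a (biorth_symm h) i _⟩

theorem rootProj_eq_self {ψ : L2x2 n} (hψ : ψ ∈ (rootMStar a b)ᗮ) : rootProj a b ψ = ψ := by
  rw [IsRootSystem.mem_rootMStar_orthogonal] at hψ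
  refine pair_ext ?_ ?_
  · rw [rootProj_fst, biproj_eq_self _ _ _ hψ.1]
  · rw [rootProj_snd, biproj_eq_self _ _ _ hψ.2]

theorem sub_rootProj_mem (ψ : L2x2 n) : ψ - rootProj a b ψ ∈ rootM a b := by
  have h1 : (ψ - rootProj a b ψ).fst = ψ.fst - biproj a b ψ.fst := by
    rw [← rootProj_fst]; rfl
  have h2 : (ψ - rootProj a b ψ).snd = ψ.snd - biproj b a ψ.snd := by
    rw [← rootProj_snd]; rfl
  rw [rootM, mem_prodSub, h1, h2]
  exact ⟨sub_biproj_mem a b _, sub_biproj_mem b a _⟩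

theorem rootProj_eq_zero (h : ∀ i j, (inner ℂ (a i) (b j) : ℂ) = if i = j then 1 else 0)
    {ψ : L2x2 n} (hψ : ψ ∈ rootM a b) : rootProj a b ψ = 0 := by
  rw [rootM, mem_prodSub] at hψ
  refine pair_ext ?_ ?_
  · rw [rootProj_fst, biproj_apply]
    nth_rw 1 [eq_sum_of_mem_span a b h _ hψ.1]
    exact sub_self _
  · rw [rootProj_snd, biproj_apply]
    nth_rw 1 [eq_sum_of_mem_span b a (biorth_symm h) _ hψ.2]
    exact sub_self _

theorem inner_rootProj (ψ χ : L2x2 n) :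
    (inner ℂ ψ (rootProj a b χ) : ℂ) = inner ℂ (swap (rootProj a b (swap ψ))) χ := by
  rw [pair_inner, pair_inner, swap_fst, swap_snd, rootProj_fst, rootProj_snd, rootProj_fst,
    rootProj_snd, swap_fst, swap_snd, inner_biproj_left, inner_biproj_left]

end Projection

/-! ### Stability in H^s, spectrum and Jordan chains -/

section Stability

variable {n : ℕ} {ι : Type*} [Fintype ι] [DecidableEq ι] {a b : Option ι → L2 n} {c q κ : ℝ}
  {S T : L2 n →ₗ.[ℂ] L2 n} {W₁ W₂ : L2 n →L[ℂ] L2 n} {U : ℝ → L2x2 n →L[ℂ] L2x2 n}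

/-- Stability on `(rootMStar a b)ᗮ` in the norm of order `s`. -/
def IsStable (U : ℝ → L2x2 n →L[ℂ] L2x2 n) (N : Submodule ℂ (L2x2 n)) (s : ℝ) : Prop :=
  ∃ C : ℝ≥0, ∀ t : ℝ, ∀ ψ ∈ Nᗮ, en2 s (U t ψ) ≤ C * en2 s ψ

theorem sobNorm₂_sq_le (s : ℝ) (ψ : L2x2 n) : sobNorm₂ s ψ ^ 2 ≤ 2 * en2 s ψ := by
  rw [sobNorm₂, en2, ← sobNorm_sq, ← sobNorm_sq, mul_add]
  exact sq_add_le _ _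

theorem en2_le_sobNorm₂_sq (s : ℝ) (ψ : L2x2 n) : en2 s ψ ≤ sobNorm₂ s ψ ^ 2 := by
  rw [sobNorm₂, en2, ← sobNorm_sq, ← sobNorm_sq, add_sq]
  gcongr
  exact le_self_add

/-- `sobNorm₂` adds the norms of the components and `en2` adds their squares, hence the square root
and the factor 2. -/
theorem stableOn_of_en2_le {N : Submodule ℂ (L2x2 n)} {s : ℝ} {C : ℝ≥0}
    (h : ∀ t : ℝ, ∀ ψ ∈ Nᗮ, en2 s (U t ψ) ≤ C * en2 s ψ) : StableOn U N s (NNReal.sqrt (2 * C)) := by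
  intro t ψ hψ
  have h1 : sobNorm₂ s (U t ψ) ^ 2 ≤ ((NNReal.sqrt (2 * C) : ℝ≥0∞) * sobNorm₂ s ψ) ^ 2 := by
    refine (sobNorm₂_sq_le _ _).trans ?_
    have h2 : ((NNReal.sqrt (2 * C) : ℝ≥0) : ℝ≥0∞) ^ 2 = 2 * C := by
      rw [← ENNReal.coe_pow, NNReal.sq_sqrt]
      push_cast
      rfl
    rw [mul_pow, h2, mul_assoc]
    gcongr
    exact (h t ψ hψ).trans (by gcongr; exact en2_le_sobNorm₂_sq s ψ)
  exact (ENNReal.pow_le_pow_left_iff two_ne_zero).mp h1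

/-- The operator commutes with the flow and preserves the complement, and its graph norm over H^s is
the H^(s+2) norm. So apply the H^s bound to ψ and to Aψ. For s ≥ 0 a vector in H^(s+2) lies in the
domain. -/
theorem IsRootSystem.isStable_add_two (hr : IsRootSystem S T a b c q) (hκ : 0 < κ)
    (h : IsC0Group U (Complex.I • offDiagonal S T))
    (hS : IsSchr (resRoot n κ) W₁ S) (hT : IsSchr (resRoot n κ) W₂ T)
    (hW₁ : SobBounded W₁) (hW₂ : SobBounded W₂) {s : ℝ} (hs : 0 ≤ s)
    (hst : IsStable U (rootMStar a b) s) : IsStable U (rootMStar a b) (s + 2) := by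
  obtain ⟨C, hC⟩ := hst
  obtain ⟨D, hD⟩ := exists_en2_graph_le hκ hS hT hW₁ hW₂ s
  refine ⟨D * (C * (D + 1)) + 1, fun t ψ hψ => ?_⟩
  by_cases htop : en2 (s + 2) ψ = ⊤
  · rw [htop, ENNReal.mul_top (by norm_cast; positivity)]
    exact le_top
  obtain ⟨h1, h2⟩ := ENNReal.add_lt_top.mp (lt_top_iff_ne_top.mpr htop)
  have hd1 : ψ.fst ∈ T.domain :=
    hT.mem_domain_of_en_lt_top hκ ((en_mono (by linarith) _).trans_lt h1)
  have hd2 : ψ.snd ∈ S.domain :=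
    hS.mem_domain_of_en_lt_top hκ ((en_mono (by linarith) _).trans_lt h2)
  have hg := LinearPMap.mem_graph (offDiagonal S T) ⟨ψ, hd1, hd2⟩
  set y := offDiagonal S T ⟨ψ, hd1, hd2⟩
  have hy : y ∈ (rootMStar a b)ᗮ := hr.map_mem_orthogonal ψ y hψ hg
  have h3 := (hD _ _ (h.graph_apply_I hg t)).2
  have h4 := (hD _ _ hg).1
  calc en2 (s + 2) (U t ψ) ≤ D * (en2 s (U t y) + en2 s (U t ψ)) := h3
    _ ≤ D * (C * en2 s y + C * en2 s ψ) := by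
        gcongr
        · exact hC t y hy
        · exact hC t ψ hψ
    _ ≤ D * (C * (D * en2 (s + 2) ψ) + C * en2 (s + 2) ψ) := by
        gcongr
        exact en2_mono (by linarith) ψ
    _ = ((D * (C * (D + 1)) : ℝ≥0) : ℝ≥0∞) * en2 (s + 2) ψ := by push_cast; ring
    _ ≤ _ := by gcongr; exact le_self_add

theorem IsRootSystem.rootProj_apply (hr : IsRootSystem S T a b c q)
    (h : IsC0Group U (Complex.I • offDiagonal S T))
    (hS : IsSchr (resRoot n κ) W₁ S) (hT : IsSchr (resRoot n κ) W₂ T) (t : ℝ) (ψ : L2x2 n) :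
    rootProj a b (U t ψ) = U t (rootProj a b ψ) := by
  have h1 : U t ψ = U t (rootProj a b ψ) + U t (ψ - rootProj a b ψ) := by
    rw [← map_add, add_sub_cancel]
  obtain ⟨y, -, h2⟩ := hr.apply_mem_rootM h t _ (sub_rootProj_mem (a := a) (b := b) ψ)
  rw [h1, map_add, rootProj_eq_zero hr.biorth h2, add_zero,
    rootProj_eq_self (hr.apply_mem_orthogonal h hS hT t _ (rootProj_mem hr.biorth ψ))]

/-- The projection is built in because interpolation and duality need an operator on all of L² × L²;
splittings do not respect the subspace. The orders 1, 3, 5, … come by induction. Since the adjoint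
of U(t)P is its conjugate under the exchange of components, order N implies order -N, and
interpolation fills the gap. -/
theorem IsRootSystem.exists_en2_le (hr : IsRootSystem S T a b c q) (hκ : 0 < κ)
    (h : IsC0Group U (Complex.I • offDiagonal S T))
    (hS : IsSchr (resRoot n κ) W₁ S) (hT : IsSchr (resRoot n κ) W₂ T)
    (hW₁ : SobBounded W₁) (hW₂ : SobBounded W₂)
    (ha : ∀ s i, en s (a i) < ⊤) (hb : ∀ s i, en s (b i) < ⊤)
    (hst : IsStable U (rootMStar a b) 1) (s : ℝ) :
    ∃ C : ℝ≥0, ∀ t ψ, en2 s (U t (rootProj a b ψ)) ≤ C * en2 s ψ := by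
  have h1 : ∀ k : ℕ, IsStable U (rootMStar a b) (1 + 2 * k) := by
    intro k
    induction k with
    | zero => simpa using hst
    | succ k ih =>
      have := hr.isStable_add_two hκ h hS hT hW₁ hW₂ (by positivity) ih
      convert this using 1
      push_cast
      ring
  obtain ⟨k, hk⟩ := exists_nat_gt |s|
  obtain ⟨C, hC⟩ := h1 k
  set N : ℝ := 1 + 2 * k with hN
  have hsN : |s| < N := by
    have : (0 : ℝ) ≤ k := by positivity
    linarith
  obtain ⟨D, hD⟩ := exists_en2_rootProj_le (a := a) (b := b) N ha hb
  have h2 : ∀ t ψ, en2 N (U t (rootProj a b ψ)) ≤ ((C * D : ℝ≥0) : ℝ≥0∞) * en2 N ψ := by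
    intro t ψ
    refine (hC t _ (rootProj_mem hr.biorth ψ)).trans ?_
    rw [ENNReal.coe_mul, mul_assoc]
    gcongr
    exact hD ψ
  have h3 : ∀ t ψ, en2 (-N) (U t (rootProj a b ψ)) ≤ ((2 * (C * D) : ℝ≥0) : ℝ≥0∞) * en2 (-N) ψ := by
    intro t ψ
    refine en2_le_of_inner_le _ _ _ fun χ hχ => ?_
    rw [neg_neg] at hχ ⊢
    rw [h.inner_apply_eq_swap hS hT, inner_rootProj, swap_swap, hr.rootProj_apply h hS hT]
    refine (enorm_inner2_sq_le (-N) _ _).trans ?_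
    rw [neg_neg, en2_swap]
    calc _ ≤ 2 * ((((C * D : ℝ≥0) : ℝ≥0∞) * en2 N (swap χ)) * en2 (-N) ψ) := by
          gcongr
          exact h2 t _
      _ = _ := by
          rw [en2_swap]
          push_cast
          ring
  refine ⟨C * D + 2 * (C * D), fun t ψ => ?_⟩
  refine en2_le_of_interpolation (U t ∘L rootProj a b) _ (N := N) (fun ψ => ?_) (fun ψ => ?_) hsN ψ
  · refine (h2 t ψ).trans ?_
    gcongr
    exact le_self_add
  · refine (h3 t ψ).trans ?_
    gcongr
    exact le_add_self

theorem mem_rootM_orthogonal {ψ : L2x2 n} : ψ ∈ (rootM a b)ᗮ ↔ swap ψ ∈ (rootMStar a b)ᗮ := by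
  rw [IsRootSystem.mem_rootMStar_orthogonal, rootM, mem_prodSub_orthogonal, mem_span_range_orthogonal,
    mem_span_range_orthogonal, swap_fst, swap_snd, and_comm]

theorem norm_le_of_en2_zero_le {C : ℝ≥0} {ψ χ : L2x2 n} (h : en2 0 ψ ≤ C * en2 0 χ) :
    ‖ψ‖ ≤ Real.sqrt C * ‖χ‖ := by
  rw [en2_zero_eq, en2_zero_eq, ← ofReal_norm, ← ofReal_norm, ← ENNReal.ofReal_pow (norm_nonneg _),
    ← ENNReal.ofReal_pow (norm_nonneg _), ← ENNReal.ofReal_coe_nnreal,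
    ← ENNReal.ofReal_mul (NNReal.coe_nonneg C), ENNReal.ofReal_le_ofReal_iff (by positivity)] at h
  rw [← abs_of_nonneg (norm_nonneg ψ), ← abs_of_nonneg (mul_nonneg (Real.sqrt_nonneg _) (norm_nonneg χ)),
    ← sq_le_sq, mul_pow, Real.sq_sqrt (NNReal.coe_nonneg C)]
  exact h

theorem opShift_zero {X : Type*} [NormedAddCommGroup X] [InnerProductSpace ℂ X] (A : X →ₗ.[ℂ] X) :
    opShift A 0 = A := by
  refine LinearPMap.eq_of_eq_graph (SetLike.ext fun p => ?_)
  obtain ⟨x, y⟩ := p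
  rw [mem_graph_opShift, zero_smul, add_zero]

theorem rootSpace_le_discreteRootSpace {X : Type*} [NormedAddCommGroup X] [InnerProductSpace ℂ X]
    (A : X →ₗ.[ℂ] X) {μ : ℝ} (hμ : 0 < μ) : rootSpace A ≤ discreteRootSpace A μ := by
  refine le_trans ?_ (le_iSup₂ (f := fun (e : ℝ) (_ : e ∈ Ioo (-μ) μ) =>
    rootSpace (opShift A ((e : ℝ) : ℂ))) 0 ⟨by linarith, hμ⟩)
  rw [Complex.ofReal_zero, opShift_zero]

/-- The eigenvalue 0 belongs to the interval, so the discrete root space of the adjoint contains its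
root space at 0. The complement in question is thus contained in the one where the L² bound is
known, and other eigenvalues need no analysis. -/
theorem IsRootSystem.linearStability (hr : IsRootSystem S T a b c q)
    (hf : IsRootSystem.IsFull S T a b)
    (hS : IsSchr (resRoot n κ) W₁ S) (hT : IsSchr (resRoot n κ) W₂ T)
    (hst : IsStable U (rootMStar a b) 0) {μ : ℝ} (hμ : 0 < μ) :
    LinearStability U (offDiagonal S T) (offDiagonal S T).adjoint μ := by
  obtain ⟨C, hC⟩ := hst
  have hle : (discreteRootSpace (offDiagonal S T).adjoint μ)ᗮ ≤ (rootMStar a b)ᗮ := by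
    refine Submodule.orthogonal_le ?_
    rw [← hr.rootSpace_adjoint_eq hf, ← adjoint_offDiagonal hS hT]
    exact rootSpace_le_discreteRootSpace _ hμ
  have h1 : ∀ t : ℝ, ∀ ψ ∈ (discreteRootSpace (offDiagonal S T).adjoint μ)ᗮ,
      ‖U t ψ‖ ≤ Real.sqrt C * ‖ψ‖ := fun t ψ hψ => norm_le_of_en2_zero_le (hC t ψ (hle hψ))
  refine ⟨⟨_, h1⟩, fun P _ _ hP => ⟨Real.sqrt C * ‖P‖, fun t => ?_⟩⟩
  refine ContinuousLinearMap.opNorm_le_bound _ (by positivity) fun ψ => ?_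
  have h2 : P ψ ∈ (discreteRootSpace (offDiagonal S T).adjoint μ)ᗮ := by
    rw [← hP]
    exact ⟨ψ, rfl⟩
  refine (h1 t _ h2).trans ?_
  rw [mul_assoc]
  gcongr
  exact P.le_opNorm ψ

/-- Each vector is a bounded part plus a root vector, whose orbit is affine in t. Hence every orbit
divided by 1 + |t| is bounded, and the uniform boundedness principle makes this a norm bound. -/
theorem IsRootSystem.exists_norm_le (hr : IsRootSystem S T a b c q)
    (h : IsC0Group U (Complex.I • offDiagonal S T))
    (hst : IsStable U (rootMStar a b) 0) : ∃ K : ℝ, ∀ t, ‖U t‖ ≤ K * (1 + |t|) := by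
  obtain ⟨C, hC⟩ := hst
  have hpos : ∀ t : ℝ, 0 < 1 + |t| := fun t => by positivity
  have hb : ∀ ψ, ∃ K, ∀ t : ℝ, ‖(((1 + |t|)⁻¹ : ℝ) : ℂ) • U t ψ‖ ≤ K := by
    intro ψ
    obtain ⟨y, hy, h1, h2⟩ := hr.exists_map_of_mem_rootM _ (sub_rootProj_mem (a := a) (b := b) ψ)
    rw [mem_graph_iff_I_smul] at h1 h2
    have h3 := graph_smul _ Complex.I h2
    rw [smul_zero, smul_zero] at h3
    refine ⟨Real.sqrt C * ‖rootProj a b ψ‖ + ‖ψ - rootProj a b ψ‖ + ‖Complex.I • y‖, fun t => ?_⟩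
    have h4 : U t ψ = U t (rootProj a b ψ) + U t (ψ - rootProj a b ψ) := by
      rw [← map_add, add_sub_cancel]
    have h5 := norm_le_of_en2_zero_le (hC t _ (rootProj_mem hr.biorth ψ))
    rw [norm_smul, Complex.norm_real, Real.norm_of_nonneg (inv_nonneg.mpr (hpos t).le),
      inv_mul_le_iff₀ (hpos t), h4, h.apply_of_nilpotent h1 h3]
    refine (norm_add_le _ _).trans ((add_le_add h5 (norm_add_le _ _)).trans ?_)
    rw [norm_smul, Complex.norm_real, Real.norm_eq_abs]
    have := abs_nonneg t
    have e1 : 0 ≤ Real.sqrt C * ‖rootProj a b ψ‖ := by positivity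
    have e2 := norm_nonneg (ψ - rootProj a b ψ)
    have e3 := norm_nonneg (Complex.I • y)
    nlinarith [mul_nonneg this e1, mul_nonneg this e2]
  obtain ⟨K, hK⟩ := banach_steinhaus (g := fun t : ℝ => (((1 + |t|)⁻¹ : ℝ) : ℂ) • U t) hb
  refine ⟨K, fun t => ?_⟩
  have h1 := hK t
  rw [norm_smul, Complex.norm_real, Real.norm_of_nonneg (inv_nonneg.mpr (hpos t).le),
    inv_mul_le_iff₀ (hpos t)] at h1
  linarith

/-- Linear growth is slower than e^(ε|t|) for every ε > 0, so the Laplace transform of the group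
converges on every open half plane away from the axis. -/
theorem IsC0Group.im_eq_zero_of_mem_spectrum {X : Type*} [NormedAddCommGroup X]
    [InnerProductSpace ℂ X] [CompleteSpace X] {U : ℝ → X →L[ℂ] X} {A : X →ₗ.[ℂ] X}
    (h : IsC0Group U (Complex.I • A)) {K : ℝ} (hK : ∀ t, ‖U t‖ ≤ K * (1 + |t|)) (z : ℂ)
    (hz : z ∈ opSpectrum A) : z.im = 0 := by
  by_contra hne
  have hbound : ∀ ε : ℝ, 0 < ε → ∀ t, ‖U t‖ ≤ (K * (1 + ε⁻¹)) * Real.exp (ε * |t|) := by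
    intro ε hε t
    have hK0 : 0 ≤ K := by
      have := (norm_nonneg _).trans (hK 0)
      simpa using this
    refine (hK t).trans ?_
    rw [mul_assoc]
    gcongr
    have h1 := Real.add_one_le_exp (ε * |t|)
    have h2 : 1 + |t| ≤ (1 + ε⁻¹) * (ε * |t| + 1) := by
      have h3 : ε⁻¹ * (ε * |t|) = |t| := inv_mul_cancel_left₀ hε.ne' _
      have h4 : 0 < ε⁻¹ := by positivity
      have h5 : 0 ≤ ε * |t| := by positivity
      nlinarith
    refine h2.trans ?_
    gcongr
  apply hz
  rcases lt_or_gt_of_ne hne with hlt | hgt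
  -- Here iz has positive real part -Im z, and iz - iA = -i(A - z). In the other half plane the
  -- backward group is used. The rate ε is half the distance of z from the real axis.
  · obtain ⟨R, hR1, hR2⟩ := h.exists_resolvent _ _ (hbound (-z.im / 2) (by linarith))
      (Complex.I * z) (by simp; linarith)
    refine ⟨(-Complex.I) • R, fun x => ?_, fun y => ?_⟩
    · have h1 := hR1 x
      have h2 : (Complex.I * z) • (x : X) - (Complex.I • A) x = (-Complex.I) • opShift A z x := by
        change (Complex.I * z) • (x : X) - Complex.I • A x = (-Complex.I) • (A x - z • (x : X))
        module
      rw [h2, map_smul] at h1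
      exact h1
    · obtain ⟨hy, h1⟩ := hR2 y
      have hd : (-Complex.I) • R y ∈ A.domain := A.domain.smul_mem _ hy
      refine ⟨hd, ?_⟩
      change A ⟨(-Complex.I) • R y, hd⟩ - z • ((-Complex.I) • R y) = y
      have h2 : A ⟨(-Complex.I) • R y, hd⟩ = (-Complex.I) • A ⟨R y, hy⟩ :=
        LinearPMap.map_smul A (-Complex.I) ⟨R y, hy⟩
      have h3 : (Complex.I * z) • R y - Complex.I • A ⟨R y, hy⟩ = y := h1
      rw [h2]
      nth_rw 3 [← h3]
      module
  · obtain ⟨R, hR1, hR2⟩ := h.neg.exists_resolvent (K * (1 + (z.im / 2)⁻¹)) (z.im / 2)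
      (fun t => by simpa using hbound (z.im / 2) (by linarith) (-t))
      (-(Complex.I * z)) (by simp; linarith)
    refine ⟨Complex.I • R, fun x => ?_, fun y => ?_⟩
    · have h1 := hR1 x
      have h2 : (-(Complex.I * z)) • (x : X) - (-(Complex.I • A)) x = Complex.I • opShift A z x := by
        change (-(Complex.I * z)) • (x : X) - (-(Complex.I • A x)) = Complex.I • (A x - z • (x : X))
        module
      rw [h2, map_smul] at h1
      exact h1
    · obtain ⟨hy, h1⟩ := hR2 y
      have hd : Complex.I • R y ∈ A.domain := A.domain.smul_mem _ hy
      refine ⟨hd, ?_⟩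
      change A ⟨Complex.I • R y, hd⟩ - z • (Complex.I • R y) = y
      have h2 : A ⟨Complex.I • R y, hd⟩ = Complex.I • A ⟨R y, hy⟩ :=
        LinearPMap.map_smul A Complex.I ⟨R y, hy⟩
      have h3 : (-(Complex.I * z)) • R y - -(Complex.I • A ⟨R y, hy⟩) = y := h1
      rw [h2]
      nth_rw 3 [← h3]
      module

theorem opKer_opShift_eq_bot {X : Type*} [NormedAddCommGroup X] [InnerProductSpace ℂ X]
    {A : X →ₗ.[ℂ] X} {z : ℂ} (hz : z ∉ opSpectrum A) : opKer (opShift A z) = ⊥ := by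
  rw [opSpectrum, mem_ofPred_eq, not_not] at hz
  obtain ⟨R, hR, -⟩ := hz
  rw [eq_bot_iff]
  rintro x ⟨y, hy, rfl⟩
  have h1 := hR y
  have h2 : opShift A z y = 0 := hy
  rw [h2, map_zero] at h1
  exact h1.symm

theorem IsSchr.inner_pos_of_coercive {R W : L2 n →L[ℂ] L2 n} {L : L2 n →ₗ.[ℂ] L2 n}
    (hL : IsSchr R W L) {c₁ : ℝ} (hc₁ : 0 < c₁) {ι' : Type*} (a : ι' → L2 n)
    (hcoer : ∀ f, (∀ i, (inner ℂ (a i) (R f) : ℂ) = 0) → c₁ * ‖f‖ ^ 2 ≤ qf (formOp R W) f)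
    (v w : L2 n) (hvw : (v, w) ∈ L.graph) (hv : ∀ i, (inner ℂ (a i) v : ℂ) = 0) (hv0 : v ≠ 0) :
    0 < (inner ℂ v w : ℂ).re := by
  obtain ⟨f, hf⟩ := (hL.mem_domain _).mp (LinearPMap.mem_domain_of_mem_graph hvw)
  rw [LinearPMap.mem_graph_iff] at hvw
  obtain ⟨x, hx1, hx2⟩ := hvw
  simp only at hx1 hx2
  have h1 := hL.qf_formOp_eq x (R f) (by rw [hf, hx1])
  have h2 := hcoer (R f) (by rw [hf]; exact hv)
  have h3 : R f ≠ 0 := fun h0 => hv0 (by rw [← hf, h0, map_zero])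
  have h4 : 0 < ‖R f‖ ^ 2 := by positivity
  rw [hx1, hx2] at h1
  rw [← inner_conj_symm, Complex.conj_re, ← h1]
  exact (mul_pos hc₁ h4).trans_le h2

/-- `0` is the only point with a nontrivial Jordan chain. -/
theorem IsRootSystem.exists_opKer_ne_iff (hr : IsRootSystem S T a b c q)
    (hS : IsSchr (resRoot n κ) W₁ S) (hT : IsSchr (resRoot n κ) W₂ T) {c₁ : ℝ} (hc₁ : 0 < c₁)
    (hcT : ∀ f, (∀ i, (inner ℂ (a i) (resRoot n κ f) : ℂ) = 0) →
      c₁ * ‖f‖ ^ 2 ≤ qf (formOp (resRoot n κ) W₂) f)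
    (hcS : ∀ f, (∀ i, (inner ℂ (b i) (resRoot n κ f) : ℂ) = 0) →
      c₁ * ‖f‖ ^ 2 ≤ qf (formOp (resRoot n κ) W₁) f)
    (hspec : ∀ z ∈ opSpectrum (offDiagonal S T), z.im = 0) (z : ℂ) :
    (∃ k : ℕ, 1 ≤ k ∧ opKer (opPow (opShift (offDiagonal S T) z) k) ≠
      opKer (opShift (offDiagonal S T) z)) ↔ z = 0 := by
  constructor
  · rintro ⟨k, hk, hne⟩
    by_contra hz
    refine hne (opKer_opPow_eq_of_two _ ?_ k hk)
    by_cases him : z.im = 0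
    · have hzr : z = (z.re : ℂ) := Complex.ext rfl (by simpa using him)
      rw [hzr]
      refine hr.opKer_opShift_sq_le (hS.inner_pos_of_coercive hc₁ b hcS)
        (hT.inner_pos_of_coercive hc₁ a hcT) z.re fun h0 => hz ?_
      rw [hzr, h0, Complex.ofReal_zero]
    · have hbot := opKer_opShift_eq_bot fun hmem => him (hspec z hmem)
      intro x hx
      rw [mem_opKer_opPow_succ] at hx
      obtain ⟨y, hy1, hy2⟩ := hx
      rw [opKer_opPow_one, hbot, Submodule.mem_bot] at hy2
      rw [mem_opKer_iff_graph, ← hy2]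
      exact hy1
  · rintro rfl
    refine ⟨2, by norm_num, ?_⟩
    rw [opShift_zero]
    exact hr.opKer_sq_ne

end Stability

/-! ### Stability of coercivity under perturbation -/

section Perturbation

variable {X : Type*} [NormedAddCommGroup X] [InnerProductSpace ℂ X] {ι : Type*} [Fintype ι]
  [DecidableEq ι]

theorem qf_add_vec_ge (T : X →L[ℂ] X) (f d : X) :
    qf T (f + d) - ‖T‖ * (2 * ‖f‖ * ‖d‖ + ‖d‖ ^ 2) ≤ qf T f := by
  have h1 : ∀ x y : X, (inner ℂ (T x) y : ℂ).re ≤ ‖T‖ * ‖x‖ * ‖y‖ := fun x y =>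
    (Complex.re_le_norm _).trans ((norm_inner_le_norm _ _).trans
      (by gcongr; exact T.le_opNorm x))
  have h2 : qf T (f + d) = qf T f + (inner ℂ (T f) d : ℂ).re + (inner ℂ (T d) f : ℂ).re +
      (inner ℂ (T d) d : ℂ).re := by
    rw [qf, qf, map_add, inner_add_left, inner_add_right, inner_add_right]
    simp only [Complex.add_re]
    ring
  nlinarith [h1 f d, h1 d f, h1 d d]

/-- Coercivity of a form on the vectors satisfying finitely many orthogonality conditions is
stable under perturbation of the form and of the conditions. -/
theorem eventually_coercive {l : Filter ℝ} (R : X →L[ℂ] X) (T : ℝ → X →L[ℂ] X) (T₀ : X →L[ℂ] X)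
    (hT : Tendsto T l (𝓝 T₀)) (a : ℝ → ι → X) (a₀ β : ι → X)
    (ha : ∀ i, Tendsto (fun r => a r i) l (𝓝 (a₀ i)))
    (hβ : ∀ i j, (inner ℂ (a₀ i) (R (β j)) : ℂ) = if i = j then 1 else 0) {c : ℝ} (hc : 0 < c)
    (hcoer : ∀ f, (∀ i, (inner ℂ (a₀ i) (R f) : ℂ) = 0) → c * ‖f‖ ^ 2 ≤ qf T₀ f) :
    ∀ᶠ r in l, ∀ f, (∀ i, (inner ℂ (a r i) (R f) : ℂ) = 0) → c / 2 * ‖f‖ ^ 2 ≤ qf (T r) f := by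
  -- A vector f satisfying the perturbed conditions satisfies the original ones after adding a
  -- vector d in the span of the β's, with ‖d‖ ≤ δ‖f‖. The quantity e collects the loss from d and
  -- from the change of the form; it tends to c, so it eventually exceeds c/2.
  let δ : ℝ → ℝ := fun r => ∑ i, ‖a r i - a₀ i‖ * ‖R‖ * ‖β i‖
  let e : ℝ → ℝ := fun r => c * (1 - 2 * δ r) - ‖T r - T₀‖ - ‖T₀‖ * (2 * δ r + δ r ^ 2)
  have hδ : Tendsto δ l (𝓝 0) := by
    have h1 : Tendsto δ l (𝓝 (∑ i : ι, ‖a₀ i - a₀ i‖ * ‖R‖ * ‖β i‖)) :=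
      tendsto_finsetSum _ fun i _ => (((ha i).sub_const _).norm.mul_const _).mul_const _
    simpa using h1
  have he : Tendsto e l (𝓝 (c * (1 - 2 * 0) - ‖T₀ - T₀‖ - ‖T₀‖ * (2 * 0 + 0 ^ 2))) :=
    (((tendsto_const_nhds.sub (hδ.const_mul 2)).const_mul c).sub ((hT.sub_const T₀).norm)).sub
      (((hδ.const_mul 2).add (hδ.pow 2)).const_mul _)
  have he' : Tendsto e l (𝓝 c) := by simpa using he
  filter_upwards [he'.eventually (lt_mem_nhds (half_lt_self hc))] with r hr f hf
  let d : X := ∑ i, (inner ℂ (a r i - a₀ i) (R f) : ℂ) • β i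
  have hd : ‖d‖ ≤ δ r * ‖f‖ := by
    rw [Finset.sum_mul]
    refine norm_sum_le_of_le _ fun i _ => ?_
    rw [norm_smul]
    calc _ ≤ ‖a r i - a₀ i‖ * (‖R‖ * ‖f‖) * ‖β i‖ := by
          gcongr
          exact (norm_inner_le_norm _ _).trans (by gcongr; exact R.le_opNorm f)
      _ = _ := by ring
  have h1 : ∀ i, (inner ℂ (a₀ i) (R (f + d)) : ℂ) = 0 := by
    intro i
    have h2 : (inner ℂ (a₀ i) (R d) : ℂ) = inner ℂ (a r i - a₀ i) (R f) := by
      simp only [d, map_sum, map_smul, inner_sum, inner_smul_right, hβ, mul_ite, mul_one, mul_zero,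
        Finset.sum_ite_eq, Finset.mem_univ, if_true]
    rw [map_add, inner_add_right, h2, inner_sub_left, hf i]
    ring
  have h2 := hcoer _ h1
  have h3 := qf_add_vec_ge T₀ f d
  have h4 : qf T₀ f - ‖T r - T₀‖ * ‖f‖ ^ 2 ≤ qf (T r) f := by
    have h5 : qf (T r) f = qf (T r - T₀) f + qf T₀ f := by rw [← qf_add, sub_add_cancel]
    have h6 := neg_le_of_abs_le (qf_le (T r - T₀) f)
    linarith
  have h5 : ‖f‖ - ‖d‖ ≤ ‖f + d‖ := by
    have := norm_sub_le (f + d) d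
    rw [add_sub_cancel_right] at this
    linarith
  have hδ0 : 0 ≤ δ r := Finset.sum_nonneg fun i _ => by positivity
  have h6 : (1 - 2 * δ r) * ‖f‖ ^ 2 ≤ ‖f + d‖ ^ 2 := by
    have h7 : ‖f‖ ≤ ‖f + d‖ + δ r * ‖f‖ := by linarith
    rcases le_or_gt (1 - δ r) 0 with h8 | h8
    · have h9 : (1 - 2 * δ r) * ‖f‖ ^ 2 ≤ 0 :=
        mul_nonpos_of_nonpos_of_nonneg (by linarith) (by positivity)
      exact h9.trans (by positivity)
    · have h9 : ((1 - δ r) * ‖f‖) ^ 2 ≤ ‖f + d‖ ^ 2 :=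
        pow_le_pow_left₀ (by positivity) (by linarith) 2
      nlinarith [mul_nonneg (sq_nonneg (δ r)) (sq_nonneg ‖f‖)]
  have h7 : ‖T₀‖ * (2 * ‖f‖ * ‖d‖ + ‖d‖ ^ 2) ≤ ‖T₀‖ * (2 * δ r + δ r ^ 2) * ‖f‖ ^ 2 := by
    calc _ ≤ ‖T₀‖ * (2 * ‖f‖ * (δ r * ‖f‖) + (δ r * ‖f‖) ^ 2) := by gcongr
      _ = _ := by ring
  have h8 := mul_le_mul_of_nonneg_left h6 hc.le
  have h9 := mul_le_mul_of_nonneg_right hr.le (sq_nonneg ‖f‖)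
  simp only [e] at h9
  nlinarith

end Perturbation

/-! ### Calculus of real Schwartz functions -/

section SchwartzCalculus

variable {n : ℕ}

theorem exists_bound_of_continuousOn_family {f : ℕ → ℝ → ℝ} {t : Set ℝ} (ht : IsCompact t)
    (hf : ∀ k, ContinuousOn (f k) t) (N : ℕ) :
    ∃ C : ℝ, 0 ≤ C ∧ ∀ k ≤ N, ∀ x ∈ t, ‖f k x‖ ≤ C := by
  choose C hC using fun k => ht.exists_bound_of_continuousOn (hf k)
  refine ⟨∑ k ∈ Finset.range (N + 1), |C k|, Finset.sum_nonneg fun _ _ => abs_nonneg _,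
    fun k hk x hx => ?_⟩
  refine (hC k x hx).trans ((le_abs_self _).trans ?_)
  exact Finset.single_le_sum (f := fun k => |C k|) (fun _ _ => abs_nonneg _)
    (Finset.mem_range.mpr (by omega))

theorem exists_abs_le (u : 𝓢(E n, ℝ)) : ∃ M : ℝ, 0 < M ∧ ∀ x, |u x| ≤ M := by
  obtain ⟨M, hM, h⟩ := u.decay 0 0
  exact ⟨M, hM, fun x => by simpa using h x⟩

theorem hasTemperateGrowth_comp (u : 𝓢(E n, ℝ)) {g : ℝ → ℝ} (hg : ContDiff ℝ ∞ g) :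
    (fun x => g (u x)).HasTemperateGrowth := by
  obtain ⟨M, hM, h⟩ := exists_abs_le u
  have ht : UniqueDiffOn ℝ (Icc (-M) M) := uniqueDiffOn_Icc (by linarith)
  refine Function.HasTemperateGrowth.comp' (g := g) (f := u) (t := Icc (-M) M) ?_ ht
    hg.contDiffOn (fun N => ?_) u.hasTemperateGrowth
  · rintro _ ⟨x, rfl⟩
    exact abs_le.mp (h x)
  · obtain ⟨C, hC0, hC⟩ := exists_bound_of_continuousOn_family isCompact_Icc
      (f := fun k x => ‖iteratedFDerivWithin ℝ k g (Icc (-M) M) x‖) (fun k =>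
        ((hg.contDiffOn (s := Icc (-M) M)).continuousOn_iteratedFDerivWithin
          (m := k) (by exact_mod_cast le_top) ht).norm) N
    exact ⟨0, C, hC0, fun k hk x hx => by simpa using hC k hk x hx⟩

/-- The values decay because g vanishes at 0 and is Lipschitz on the range of u. The derivative is
g'(u)∇u, a Schwartz function multiplied by one of temperate growth, so all higher derivatives decay
too. -/
theorem exists_schwartz_comp (u : 𝓢(E n, ℝ)) {g : ℝ → ℝ} (hg : ContDiff ℝ ∞ g) (h0 : g 0 = 0) :
    ∃ v : 𝓢(E n, ℝ), ∀ x, v x = g (u x) := by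
  obtain ⟨M, hM, hu⟩ := exists_abs_le u
  have hg1 : ContDiff ℝ ∞ (deriv g) := (contDiff_infty_iff_deriv.mp hg).2
  have hd : Differentiable ℝ g := (contDiff_infty_iff_deriv.mp hg).1
  obtain ⟨L, hL⟩ := isCompact_Icc.exists_bound_of_continuousOn
    (hg1.continuous.continuousOn (s := Icc (-M) M))
  have hlip : ∀ t ∈ Icc (-M) M, |g t| ≤ L * |t| := by
    intro t ht
    have := (convex_Icc (-M) M).norm_image_sub_le_of_norm_deriv_le (f := g) (C := L) (x := 0) (y := t)
      (fun x _ => hd x) hL ⟨by linarith, hM.le⟩ ht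
    simpa [h0] using this
  let w : 𝓢(E n, E n →L[ℝ] ℝ) :=
    SchwartzMap.smulLeftCLM (E n →L[ℝ] ℝ) (fun x => deriv g (u x)) (SchwartzMap.fderivCLM ℝ (E n) ℝ u)
  have hw : fderiv ℝ (fun x => g (u x)) = w := by
    funext x
    rw [SchwartzMap.smulLeftCLM_apply_apply (hasTemperateGrowth_comp u hg1)]
    exact ((hd (u x)).hasDerivAt.comp_hasFDerivAt x u.differentiableAt.hasFDerivAt).fderiv
  refine ⟨⟨fun x => g (u x), hg.comp u.smooth', fun k m => ?_⟩, fun x => rfl⟩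
  cases m with
  | zero =>
    obtain ⟨C, hC, h⟩ := u.decay k 0
    refine ⟨L * C, fun x => ?_⟩
    have h1 := h x
    simp only [norm_iteratedFDeriv_zero, Real.norm_eq_abs] at h1 ⊢
    have hL0 : 0 ≤ L := (norm_nonneg _).trans (hL 0 ⟨by linarith, hM.le⟩)
    calc ‖x‖ ^ k * |g (u x)| ≤ ‖x‖ ^ k * (L * |u x|) := by
          gcongr
          exact hlip _ (abs_le.mp (hu x))
      _ = L * (‖x‖ ^ k * |u x|) := by ring
      _ ≤ L * C := by gcongr
  | succ m =>
    obtain ⟨C, hC, h⟩ := w.decay k m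
    refine ⟨C, fun x => ?_⟩
    rw [← norm_iteratedFDeriv_fderiv, hw]
    exact h x

/-- Multiplication by the `j`-th coordinate. -/
def coordMul (j : Fin n) : 𝓢(E n, ℝ) →L[ℝ] 𝓢(E n, ℝ) :=
  SchwartzMap.smulLeftCLM ℝ fun x : E n => x j

theorem hasTemperateGrowth_coord (j : Fin n) : (fun x : E n => x j).HasTemperateGrowth :=
  (EuclideanSpace.proj (𝕜 := ℝ) j : E n →L[ℝ] ℝ).hasTemperateGrowth

theorem coordMul_apply (j : Fin n) (u : 𝓢(E n, ℝ)) (x : E n) : coordMul j u x = x j * u x :=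
  SchwartzMap.smulLeftCLM_apply_apply (hasTemperateGrowth_coord j) u x

/-- The `j`-th partial derivative. -/
def pd (j : Fin n) (u : 𝓢(E n, ℝ)) : 𝓢(E n, ℝ) := ∂_{(EuclideanSpace.single j (1 : ℝ) : E n)} u

theorem pd_apply (j : Fin n) (u : 𝓢(E n, ℝ)) (x : E n) :
    pd j u x = fderiv ℝ u x (EuclideanSpace.single j 1) := rfl

theorem pd_add (j : Fin n) (u v : 𝓢(E n, ℝ)) : pd j (u + v) = pd j u + pd j v :=
  LineDeriv.lineDerivOpCLM ℝ 𝓢(E n, ℝ) (EuclideanSpace.single j (1 : ℝ) : E n) |>.map_add u v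

theorem pd_coordMul (i j : Fin n) (u : 𝓢(E n, ℝ)) :
    pd i (coordMul j u) = (if i = j then u else 0) + coordMul j (pd i u) := by
  ext x
  have h1 : HasFDerivAt (fun x : E n => x j) (EuclideanSpace.proj (𝕜 := ℝ) j : E n →L[ℝ] ℝ) x :=
    (EuclideanSpace.proj (𝕜 := ℝ) j : E n →L[ℝ] ℝ).hasFDerivAt
  have h2 : HasFDerivAt (fun x : E n => x j * u x) _ x :=
    h1.mul (u.differentiableAt (x := x)).hasFDerivAt
  have h3 : (coordMul j u : E n → ℝ) = fun x => x j * u x := funext (coordMul_apply j u)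
  have h4 : ((if i = j then u else 0) + coordMul j (pd i u)) x =
      (if i = j then u else 0 : 𝓢(E n, ℝ)) x + x j * fderiv ℝ u x (EuclideanSpace.single i 1) := by
    rw [← pd_apply, ← coordMul_apply]
    rfl
  rw [pd_apply, h3, h2.fderiv, h4]
  have h5 : (x j • fderiv ℝ u x + u x • (EuclideanSpace.proj (𝕜 := ℝ) j : E n →L[ℝ] ℝ))
      (EuclideanSpace.single i 1) =
      x j * fderiv ℝ u x (EuclideanSpace.single i 1) + u x * (if j = i then 1 else 0) := by
    rw [← PiLp.single_apply 2 ℝ i 1 j]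
    rfl
  rw [h5]
  by_cases h : i = j
  · subst h
    simp
    ring
  · have h' : ¬ j = i := fun h'' => h h''.symm
    simp [h, h']

/-- The Laplacian. -/
def lap (u : 𝓢(E n, ℝ)) : 𝓢(E n, ℝ) := Δ u

theorem lap_apply (u : 𝓢(E n, ℝ)) (x : E n) : lap u x = Δ (u : E n → ℝ) x :=
  SchwartzMap.laplacian_apply u x

theorem laplacian_eq_sum_pd (u : 𝓢(E n, ℝ)) : lap u = ∑ i, pd i (pd i u) := by
  rw [lap, SchwartzMap.laplacian_eq_sum (EuclideanSpace.basisFun (Fin n) ℝ)]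
  simp [pd]

theorem pd_comm (i j : Fin n) (u : 𝓢(E n, ℝ)) : pd i (pd j u) = pd j (pd i u) := by
  ext x
  have h1 : ∀ i j : Fin n, pd i (pd j u) x = iteratedFDeriv ℝ 2 u x
      ![EuclideanSpace.single i 1, EuclideanSpace.single j 1] := by
    intro i j
    rw [← SchwartzMap.iteratedLineDerivOp_eq_iteratedFDeriv]
    simp [LineDeriv.iteratedLineDerivOp_succ_left, pd]
  rw [h1, h1]
  have h2 : IsSymmSndFDerivAt ℝ u x :=
    (u.contDiffAt 2).isSymmSndFDerivAt (by simp)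
  rw [iteratedFDeriv_two_apply, iteratedFDeriv_two_apply]
  exact h2 _ _

theorem laplacian_pd (j : Fin n) (u : 𝓢(E n, ℝ)) : lap (pd j u) = pd j (lap u) := by
  rw [laplacian_eq_sum_pd, laplacian_eq_sum_pd]
  have h1 : pd j (∑ i, pd i (pd i u)) = ∑ i, pd j (pd i (pd i u)) := LineDeriv.lineDerivOp_sum _ _ _
  rw [h1]
  refine Finset.sum_congr rfl fun i _ => ?_
  rw [pd_comm i j, pd_comm i j]

theorem laplacian_coordMul (j : Fin n) (u : 𝓢(E n, ℝ)) :
    lap (coordMul j u) = (2 : ℝ) • pd j u + coordMul j (lap u) := by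
  rw [laplacian_eq_sum_pd, laplacian_eq_sum_pd, map_sum]
  have h1 : ∀ i, pd i (pd i (coordMul j u)) = (if i = j then (2 : ℝ) • pd j u else 0) +
      coordMul j (pd i (pd i u)) := by
    intro i
    rw [pd_coordMul, pd_add, pd_coordMul]
    by_cases h : i = j
    · subst h
      simp only [if_true, two_smul]
      abel
    · simp only [h, if_false, zero_add, add_eq_right]
      exact LineDeriv.lineDerivOp_zero _
  simp only [h1, Finset.sum_add_distrib, Finset.sum_ite_eq', Finset.mem_univ, if_true]

theorem integral_mul_pd (j : Fin n) (u v : 𝓢(E n, ℝ)) :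
    ∫ x, u x * pd j v x = -∫ x, pd j u x * v x :=
  SchwartzMap.integral_mul_lineDerivOp_right_eq_neg_left u v _

theorem integrable_mul (u v : 𝓢(E n, ℝ)) : Integrable fun x => u x * v x := by
  have h1 : MemLp u 2 (volume : Measure (E n)) := u.memLp 2
  have h2 : MemLp v 2 (volume : Measure (E n)) := v.memLp 2
  exact h1.integrable_mul h2

theorem integral_coordMul_mul_pd (i j : Fin n) (u : 𝓢(E n, ℝ)) :
    ∫ x, coordMul i u x * pd j u x = if i = j then -(1 / 2) * ∫ x, u x * u x else 0 := by
  have h1 := integral_mul_pd j (coordMul i u) u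
  rw [pd_coordMul] at h1
  have h2 : ∫ x, ((if j = i then u else 0) + coordMul i (pd j u)) x * u x =
      (∫ x, (if j = i then u else 0 : 𝓢(E n, ℝ)) x * u x) + ∫ x, coordMul i u x * pd j u x := by
    rw [← integral_add (integrable_mul _ _) (integrable_mul _ _)]
    refine integral_congr_ae (ae_of_all _ fun x => ?_)
    simp only [_root_.add_apply, coordMul_apply]
    ring
  rw [h2] at h1
  by_cases h : i = j
  · subst h
    simp only [if_true] at h1 ⊢
    linarith
  · have h' : ¬ j = i := fun h'' => h h''.symm
    simp only [h', h, if_false, _root_.zero_apply, zero_mul, integral_zero] at h1 ⊢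
    linarith

end SchwartzCalculus

/-! ### Schwartz functions as elements of L² -/

section SchwartzL2

variable {n : ℕ}

theorem toL2_ae {f : E n → ℝ} (h : MemLp (fun x => (f x : ℂ)) 2 (volume : Measure (E n))) :
    toL2 f =ᵐ[volume] fun x => (f x : ℂ) := by
  rw [toL2, dif_pos h]
  exact h.coeFn_toLp

theorem memLp_ofReal {f : E n → ℝ} (h : MemLp f 2 (volume : Measure (E n))) :
    MemLp (fun x => (f x : ℂ)) 2 (volume : Measure (E n)) := h.ofReal

theorem toL2_ae' {f : E n → ℝ} (h : MemLp f 2 (volume : Measure (E n))) :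
    toL2 f =ᵐ[volume] fun x => (f x : ℂ) := toL2_ae (memLp_ofReal h)

theorem toL2_eq_of_ae {f : E n → ℝ} (h : MemLp f 2 (volume : Measure (E n))) {g : L2 n}
    (hg : g =ᵐ[volume] fun x => (f x : ℂ)) : toL2 f = g :=
  Lp.ext ((toL2_ae' h).trans hg.symm)

theorem toL2_smul {f : E n → ℝ} (hf : MemLp f 2 (volume : Measure (E n))) (c : ℝ) :
    toL2 (fun x => c * f x) = (c : ℂ) • toL2 f := by
  refine toL2_eq_of_ae (hf.const_mul c) ?_
  filter_upwards [Lp.coeFn_smul (c : ℂ) (toL2 f), toL2_ae' hf] with x h1 h2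
  rw [h1, Pi.smul_apply, h2, smul_eq_mul, Complex.ofReal_mul]

theorem toL2_sub {f g : E n → ℝ} (hf : MemLp f 2 (volume : Measure (E n)))
    (hg : MemLp g 2 (volume : Measure (E n))) : toL2 (fun x => f x - g x) = toL2 f - toL2 g := by
  refine toL2_eq_of_ae (hf.sub hg) ?_
  filter_upwards [Lp.coeFn_sub (toL2 f) (toL2 g), toL2_ae' hf, toL2_ae' hg] with x h1 h2 h3
  rw [h1, Pi.sub_apply, h2, h3]
  exact (Complex.ofReal_sub _ _).symm

theorem inner_toL2 {f g : E n → ℝ} (hf : MemLp f 2 (volume : Measure (E n)))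
    (hg : MemLp g 2 (volume : Measure (E n))) :
    (inner ℂ (toL2 f) (toL2 g) : ℂ) = ((∫ x, f x * g x : ℝ) : ℂ) := by
  rw [L2_inner_def, ← integral_complex_ofReal]
  refine integral_congr_ae ?_
  filter_upwards [toL2_ae' hf, toL2_ae' hg] with x h1 h2
  rw [h1, h2]
  simp [mul_comm]

theorem enorm_toL2 {f : E n → ℝ} (hf : MemLp f 2 (volume : Measure (E n))) :
    ‖toL2 f‖ₑ = eLpNorm f 2 volume := by
  rw [Lp.enorm_def, eLpNorm_congr_ae (toL2_ae' hf)]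
  refine eLpNorm_congr_norm_ae (ae_of_all _ fun x => ?_)
  simp

theorem memLp_schwartz (u : 𝓢(E n, ℝ)) : MemLp u 2 (volume : Measure (E n)) := u.memLp 2

/-- The complexification of a real Schwartz function. -/
def cx (u : 𝓢(E n, ℝ)) : 𝓢(E n, ℂ) := u.postcompCLM Complex.ofRealCLM

theorem cx_apply (u : 𝓢(E n, ℝ)) (x : E n) : cx u x = (u x : ℂ) := rfl

theorem toL2_schwartz (u : 𝓢(E n, ℝ)) : toL2 u = (cx u).toLp 2 := by
  refine toL2_eq_of_ae (memLp_schwartz u) ?_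
  filter_upwards [(cx u).coeFn_toLp 2 volume] with x hx
  rw [hx, cx_apply]

theorem laplacian_cx (u : 𝓢(E n, ℝ)) : Δ (cx u) = cx (lap u) := by
  rw [lap, SchwartzMap.laplacian_eq_sum (EuclideanSpace.basisFun (Fin n) ℝ),
    SchwartzMap.laplacian_eq_sum (EuclideanSpace.basisFun (Fin n) ℝ)]
  have h1 : ∀ (m : E n) (u : 𝓢(E n, ℝ)), ∂_{m} (cx u) = cx (∂_{m} u) := by
    intro m u
    ext x
    have h2 : HasFDerivAt (cx u) (Complex.ofRealCLM ∘L fderiv ℝ u x) x :=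
      Complex.ofRealCLM.hasFDerivAt.comp x u.differentiableAt.hasFDerivAt
    rw [SchwartzMap.lineDerivOp_apply_eq_fderiv, h2.fderiv]
    rfl
  have h3 : ∀ F : Fin n → 𝓢(E n, ℝ), cx (∑ i, F i) = ∑ i, cx (F i) := fun F =>
    map_sum (SchwartzMap.postcompCLM (E := E n) Complex.ofRealCLM) _ _
  rw [h3]
  simp only [h1]

theorem en_toL2_schwartz_lt_top (s : ℝ) (u : 𝓢(E n, ℝ)) : en s (toL2 u) < ⊤ := by
  have h1 : ft (toL2 u) = (FourierTransform.fourier (cx u)).toLp 2 := by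
    rw [toL2_schwartz]
    exact SchwartzMap.toLp_fourier_eq (cx u)
  set G := FourierTransform.fourier (cx u)
  obtain ⟨C, hC, hG⟩ := G.decay 0 0
  have h2 : ∀ ξ, ‖G ξ‖ ≤ C := fun ξ => by simpa using hG ξ
  have h3 : en s (toL2 u) ≤ ∫⁻ ξ, ENNReal.ofReal C * (ENNReal.ofReal (wt ξ ^ s) * ‖G ξ‖ₑ) := by
    refine lintegral_mono_ae ?_
    rw [h1]
    filter_upwards [G.coeFn_toLp 2 volume] with ξ hξ
    rw [hξ, sq, ← mul_assoc, mul_comm]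
    gcongr
    rw [← ofReal_norm]
    exact ENNReal.ofReal_le_ofReal (h2 ξ)
  refine h3.trans_lt ?_
  rw [lintegral_const_mul' _ _ ENNReal.ofReal_ne_top]
  exact ENNReal.mul_lt_top ENNReal.ofReal_lt_top (lintegral_wt_mul_schwartz_lt_top s G)

theorem mem_graph_schrodinger {V : E n → ℝ} (u w : 𝓢(E n, ℝ))
    (hw : ∀ x, w x = -(1 / 2) * lap u x + V x * u x) :
    (toL2 u, toL2 w) ∈ (schrodinger V).graph := by
  have hlap : Δ (toDist (toL2 u)) = toDist (toL2 (lap u)) := by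
    rw [toL2_schwartz, toL2_schwartz, ← laplacian_cx]
    simp only [toDist, Lp.toTemperedDistribution_toLp_eq, laplacian_toTemperedDistributionCLM_eq]
  have h2 : toL2 u ∈ H2 n := by
    rw [mem_H2_iff]
    have h1 := en_toL2_schwartz_lt_top 2 u
    obtain ⟨g, hg⟩ := exists_of_en_lt_top h1
    exact ⟨g, by simpa using hg⟩
  have h3 : laplacianL2 n ⟨toL2 u, h2⟩ = toL2 (lap u) :=
    toDist_injective ((exists_laplacian ⟨toL2 u, h2⟩).choose_spec.symm.trans hlap)
  have h4 : (fun x => (V x : ℂ) * toL2 u x) =ᵐ[volume]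
      (toL2 w + (1 / 2 : ℂ) • toL2 (lap u) : L2 n) := by
    filter_upwards [toL2_ae' (memLp_schwartz u), toL2_ae' (memLp_schwartz w),
      toL2_ae' (memLp_schwartz (lap u)), Lp.coeFn_add (toL2 w) ((1 / 2 : ℂ) • toL2 (lap u)),
      Lp.coeFn_smul (1 / 2 : ℂ) (toL2 (lap u))] with x e1 e2 e3 e4 e5
    rw [e1, e4, Pi.add_apply, e5, Pi.smul_apply, e2, e3, hw]
    push_cast
    simp only [smul_eq_mul]
    ring
  have h5 : toL2 u ∈ (mulL2 V).domain := (memLp_congr_ae h4).mpr (Lp.memLp _)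
  have h6 : mulL2 V ⟨toL2 u, h5⟩ = toL2 w + (1 / 2 : ℂ) • toL2 (lap u) :=
    Lp.ext ((MemLp.coeFn_toLp h5).trans h4)
  rw [LinearPMap.mem_graph_iff]
  refine ⟨⟨toL2 u, h2, h5⟩, rfl, ?_⟩
  change (-(1 / 2 : ℂ)) • laplacianL2 n ⟨toL2 u, h2⟩ + mulL2 V ⟨toL2 u, h5⟩ = _
  rw [h3, h6]
  module

end SchwartzL2

/-! ### Differentiation in L² with respect to the parameter -/

section ParameterDerivative

variable {n : ℕ}

theorem lintegral_enorm_sq_eq {f : E n → ℝ} :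
    ∫⁻ x, ‖f x‖ₑ ^ 2 = eLpNorm f 2 volume ^ 2 := by
  have h := eLpNorm_nnreal_pow_eq_lintegral (μ := (volume : Measure (E n))) (f := f) (p := 2)
    two_ne_zero
  have h2 : ((2 : ℝ≥0) : ℝ≥0∞) = 2 := rfl
  rw [h2] at h
  have h3 : ((2 : ℝ≥0) : ℝ) = ((2 : ℕ) : ℝ) := rfl
  simp only [h3, ENNReal.rpow_natCast] at h
  exact h.symm

theorem enorm_sub_sq_le_lintegral {f f' : ℝ → ℝ} {a b : ℝ} (hab : a ≤ b)
    (hf : ∀ t ∈ Icc a b, HasDerivAt f (f' t) t) (hc : ContinuousOn f' (Icc a b)) :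
    ‖f b - f a‖ₑ ^ 2 ≤ ENNReal.ofReal (b - a) * ∫⁻ t in Ioc a b, ‖f' t‖ₑ ^ 2 := by
  have h1 : ∫ t in a..b, f' t = f b - f a :=
    intervalIntegral.integral_eq_sub_of_hasDerivAt (by rwa [uIcc_of_le hab])
      (by
        apply ContinuousOn.intervalIntegrable
        rwa [uIcc_of_le hab])
  have hm : AEMeasurable f' (volume.restrict (Ioc a b)) :=
    (hc.mono Ioc_subset_Icc_self).aemeasurable measurableSet_Ioc
  rw [← h1, intervalIntegral.integral_of_le hab]
  calc _ ≤ (∫⁻ t in Ioc a b, 1 * ‖f' t‖ₑ) ^ 2 := by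
        gcongr
        simpa using enorm_integral_le_lintegral_enorm f'
    _ ≤ (∫⁻ t in Ioc a b, 1 ^ 2) * ∫⁻ t in Ioc a b, ‖f' t‖ₑ ^ 2 :=
        sq_lintegral_mul_le aemeasurable_const hm.enorm
    _ = _ := by simp

/-- A mean value inequality in L². At each x, the fundamental theorem of calculus and Cauchy–Schwarz
in t; then Tonelli. -/
theorem lintegral_enorm_sub_sq_le {F F' : ℝ → E n → ℝ} {a b : ℝ} (hab : a ≤ b)
    (hF : ∀ x, ∀ t ∈ Icc a b, HasDerivAt (fun t => F t x) (F' t x) t)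
    (hc : ContinuousOn (fun p : ℝ × E n => F' p.1 p.2) (Icc a b ×ˢ univ)) (K : ℝ≥0∞)
    (hK : ∀ t ∈ Icc a b, eLpNorm (F' t) 2 volume ≤ K) :
    eLpNorm (fun x => F b x - F a x) 2 volume ≤ ENNReal.ofReal (b - a) * K := by
  have hm : AEMeasurable (fun p : E n × ℝ => ‖F' p.2 p.1‖ₑ ^ 2)
      (volume.prod (volume.restrict (Ioc a b))) := by
    have h1 : ContinuousOn (fun p : E n × ℝ => F' p.2 p.1) (univ ×ˢ Ioc a b) := by
      refine hc.comp (continuous_swap.continuousOn) fun p hp => ?_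
      exact ⟨Ioc_subset_Icc_self hp.2, trivial⟩
    have h2 := h1.aemeasurable (MeasurableSet.univ.prod measurableSet_Ioc) (μ := volume)
    rw [Measure.volume_eq_prod, ← Measure.prod_restrict, Measure.restrict_univ] at h2
    exact h2.enorm.pow_const 2
  have h1 : eLpNorm (fun x => F b x - F a x) 2 volume ^ 2 ≤ (ENNReal.ofReal (b - a) * K) ^ 2 := by
    rw [← lintegral_enorm_sq_eq]
    calc _ ≤ ∫⁻ x, ENNReal.ofReal (b - a) * ∫⁻ t in Ioc a b, ‖F' t x‖ₑ ^ 2 := by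
          refine lintegral_mono fun x => enorm_sub_sq_le_lintegral hab (hF x) ?_
          exact hc.comp (f := fun t => (t, x)) (by fun_prop) fun t ht => ⟨ht, trivial⟩
      _ = ENNReal.ofReal (b - a) * ∫⁻ t in Ioc a b, ∫⁻ x, ‖F' t x‖ₑ ^ 2 := by
          rw [lintegral_const_mul' _ _ ENNReal.ofReal_ne_top, lintegral_lintegral_swap hm]
      _ ≤ ENNReal.ofReal (b - a) * ∫⁻ t in Ioc a b, K ^ 2 := by
          refine mul_le_mul_right ?_ _
          refine setLIntegral_mono measurable_const fun t ht => ?_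
          rw [lintegral_enorm_sq_eq]
          exact pow_le_pow_left₀ zero_le (hK t (Ioc_subset_Icc_self ht)) 2
      _ = _ := by
          rw [lintegral_const]
          simp only [MeasurableSet.univ, Measure.restrict_apply, univ_inter, Real.volume_Ioc]
          ring
  exact (ENNReal.pow_le_pow_left_iff two_ne_zero).mp h1

theorem norm_toL2_le {f : E n → ℝ} (hf : MemLp f 2 (volume : Measure (E n))) {K : ℝ}
    (h : eLpNorm f 2 volume ≤ ENNReal.ofReal K) (hK : 0 ≤ K) : ‖toL2 f‖ ≤ K := by
  rw [← enorm_toL2 hf, ← ofReal_norm] at h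
  exact (ENNReal.ofReal_le_ofReal_iff hK).mp h

theorem eLpNorm_eq_ofReal_norm {f : E n → ℝ} (hf : MemLp f 2 (volume : Measure (E n))) :
    eLpNorm f 2 volume = ENNReal.ofReal ‖toL2 f‖ := by
  rw [← enorm_toL2 hf, ofReal_norm]

theorem norm_toL2_sub_le {F F' : ℝ → E n → ℝ} {a b : ℝ}
    (hm : ∀ t ∈ uIcc a b, MemLp (F t) 2 (volume : Measure (E n)))
    (hF : ∀ x, ∀ t ∈ uIcc a b, HasDerivAt (fun t => F t x) (F' t x) t)
    (hc : ContinuousOn (fun p : ℝ × E n => F' p.1 p.2) (uIcc a b ×ˢ univ)) {K : ℝ} (hK0 : 0 ≤ K)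
    (hK : ∀ t ∈ uIcc a b, eLpNorm (F' t) 2 volume ≤ ENNReal.ofReal K) :
    ‖toL2 (F b) - toL2 (F a)‖ ≤ |b - a| * K := by
  have key : ∀ a b : ℝ, a ≤ b → (∀ t ∈ Icc a b, MemLp (F t) 2 (volume : Measure (E n))) →
      (∀ x, ∀ t ∈ Icc a b, HasDerivAt (fun t => F t x) (F' t x) t) →
      ContinuousOn (fun p : ℝ × E n => F' p.1 p.2) (Icc a b ×ˢ univ) →
      (∀ t ∈ Icc a b, eLpNorm (F' t) 2 volume ≤ ENNReal.ofReal K) →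
      ‖toL2 (F b) - toL2 (F a)‖ ≤ |b - a| * K := by
    intro a b hab hm hF hc hK
    have hb := hm b ⟨hab, le_rfl⟩
    have ha := hm a ⟨le_rfl, hab⟩
    rw [← toL2_sub hb ha, abs_of_nonneg (by linarith)]
    refine norm_toL2_le (hb.sub ha) ?_ (mul_nonneg (by linarith) hK0)
    rw [ENNReal.ofReal_mul (by linarith)]
    exact lintegral_enorm_sub_sq_le hab hF hc _ hK
  rcases le_total a b with hab | hab
  · rw [uIcc_of_le hab] at hm hF hc hK
    exact key a b hab hm hF hc hK
  · rw [uIcc_of_ge hab] at hm hF hc hK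
    rw [norm_sub_rev, abs_sub_comm]
    exact key b a hab hm hF hc hK

/-- A family of functions with pointwise derivatives that depend continuously on the parameter in
`L²` is differentiable in `L²`. -/
theorem hasDerivAt_toL2 {F F' : ℝ → E n → ℝ} {c : ℝ} {I : Set ℝ} (hI : IsOpen I)
    (hIc : I.OrdConnected) (hc : c ∈ I)
    (hm : ∀ t ∈ I, MemLp (F t) 2 (volume : Measure (E n)))
    (hm' : ∀ t ∈ I, MemLp (F' t) 2 (volume : Measure (E n)))
    (hF : ∀ x, ∀ t ∈ I, HasDerivAt (fun t => F t x) (F' t x) t)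
    (hcont : ContinuousOn (fun p : ℝ × E n => F' p.1 p.2) (I ×ˢ univ))
    (hlim : Tendsto (fun t => toL2 (F' t)) (𝓝 c) (𝓝 (toL2 (F' c)))) :
    HasDerivAt (fun t => toL2 (F t)) (toL2 (F' c)) c := by
  rw [hasDerivAt_iff_isLittleO, Asymptotics.isLittleO_iff]
  intro ε hε
  have h1 : ∀ᶠ t in 𝓝 c, t ∈ I ∧ ‖toL2 (F' t) - toL2 (F' c)‖ ≤ ε :=
    Filter.Eventually.and (hI.mem_nhds hc) (by
      filter_upwards [Metric.tendsto_nhds.mp hlim ε hε] with t ht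
      rw [← dist_eq_norm]
      exact ht.le)
  obtain ⟨δ, hδ, h2⟩ := Metric.eventually_nhds_iff.mp h1
  filter_upwards [Metric.ball_mem_nhds c hδ] with b hb
  have hsub : ∀ t ∈ uIcc c b, dist t c < δ := by
    intro t ht
    rw [Real.dist_eq]
    have h3 := abs_sub_left_of_mem_uIcc ht
    rw [Metric.mem_ball, Real.dist_eq] at hb
    exact h3.trans_lt hb
  have hb' : b ∈ I := (h2 hb).1
  have hsI : uIcc c b ⊆ I := hIc.uIcc_subset hc hb'
  -- Subtracting the tangent at c leaves a family whose derivative F'(t) - F'(c) has L² norm at most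
  -- ε near c, so the mean value inequality gives exactly the error required of a derivative.
  have h3 : ∀ t ∈ I, MemLp (fun x => F t x - t * F' c x) 2 (volume : Measure (E n)) :=
    fun t ht => (hm t ht).sub ((hm' c hc).const_mul t)
  have h4 := norm_toL2_sub_le (F := fun t x => F t x - t * F' c x)
    (F' := fun t x => F' t x - F' c x) (a := c) (b := b) (fun t ht => h3 t (hsI ht))
    (fun x t ht => by
      have h5 := (hF x t (hsI ht)).sub ((hasDerivAt_id t).mul_const (F' c x))
      rw [one_mul] at h5
      exact h5)
    ((hcont.mono (prod_mono hsI le_rfl)).sub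
      (hcont.comp (f := fun p : ℝ × E n => (c, p.2)) (by fun_prop) fun p _ => ⟨hc, trivial⟩))
    hε.le (fun t ht => by
      have h7 : MemLp (fun x => F' t x - F' c x) 2 (volume : Measure (E n)) :=
        (hm' t (hsI ht)).sub (hm' c hc)
      rw [eLpNorm_eq_ofReal_norm h7,
        toL2_sub (hm' t (hsI ht)) (hm' c hc)]
      exact ENNReal.ofReal_le_ofReal (h2 (hsub t ht)).2)
  rw [toL2_sub (hm b hb') ((hm' c hc).const_mul b), toL2_sub (hm c hc) ((hm' c hc).const_mul c),
    toL2_smul (hm' c hc), toL2_smul (hm' c hc)] at h4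
  have h5 : toL2 (F b) - toL2 (F c) - (b - c) • toL2 (F' c) =
      toL2 (F b) - (b : ℂ) • toL2 (F' c) - (toL2 (F c) - (c : ℂ) • toL2 (F' c)) := by
    have h6 : ((b - c) • toL2 (F' c) : L2 n) = ((b - c : ℝ) : ℂ) • toL2 (F' c) := rfl
    rw [h6, Complex.ofReal_sub, sub_smul]
    abel
  rw [h5, Real.norm_eq_abs, mul_comm]
  exact h4

theorem contDiffOn_deriv_fst {f : ℝ × E n → ℝ} {I : Set ℝ} (hI : IsOpen I)
    (hf : ContDiffOn ℝ ∞ f (I ×ˢ univ)) :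
    ContDiffOn ℝ ∞ (fun p : ℝ × E n => deriv (fun a => f (a, p.2)) p.1) (I ×ˢ univ) ∧
      ∀ x, ∀ t ∈ I, HasDerivAt (fun a => f (a, x)) (deriv (fun a => f (a, x)) t) t := by
  have ho : IsOpen (I ×ˢ (univ : Set (E n))) := hI.prod isOpen_univ
  have h1 : ∀ x, ∀ t ∈ I, HasDerivAt (fun a => f (a, x)) (fderiv ℝ f (t, x) (1, 0)) t := by
    intro x t ht
    have h2 : DifferentiableAt ℝ f (t, x) :=
      (hf.contDiffAt (ho.mem_nhds ⟨ht, trivial⟩)).differentiableAt (by simp)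
    have h3 : HasDerivAt (fun a : ℝ => (a, x)) ((1 : ℝ), (0 : E n)) t :=
      (hasDerivAt_id t).prodMk (hasDerivAt_const t x)
    exact h2.hasFDerivAt.comp_hasDerivAt t h3
  refine ⟨?_, fun x t ht => (h1 x t ht).differentiableAt.hasDerivAt⟩
  have h4 : ContDiffOn ℝ ∞ (fun p => fderiv ℝ f p ((1 : ℝ), (0 : E n))) (I ×ˢ univ) :=
    (hf.fderiv_of_isOpen ho (by simp)).clm_apply contDiffOn_const
  exact h4.congr fun p hp => (h1 p.2 p.1 hp.1).deriv

theorem continuousOn_fderiv_snd {f : ℝ × E n → ℝ} {I : Set ℝ} (hI : IsOpen I)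
    (hf : ContDiffOn ℝ ∞ f (I ×ˢ univ)) (v : E n) :
    ContinuousOn (fun p : ℝ × E n => fderiv ℝ (fun x => f (p.1, x)) p.2 v) (I ×ˢ univ) := by
  have ho : IsOpen (I ×ˢ (univ : Set (E n))) := hI.prod isOpen_univ
  have h4 : ContinuousOn (fun p => fderiv ℝ f p ((0 : ℝ), v)) (I ×ˢ univ) :=
    ((hf.fderiv_of_isOpen ho (m := ∞) (by simp)).clm_apply contDiffOn_const).continuousOn
  refine h4.congr fun p hp => ?_
  have h2 : DifferentiableAt ℝ f (p.1, p.2) :=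
    (hf.contDiffAt (ho.mem_nhds hp)).differentiableAt (by simp)
  have h3 : HasFDerivAt (fun x : E n => (p.1, x)) (ContinuousLinearMap.inr ℝ ℝ (E n)) p.2 :=
    hasFDerivAt_prodMk_right p.1 p.2
  have h5 := h2.hasFDerivAt.comp p.2 h3
  have h6 : HasFDerivAt (fun x => f (p.1, x)) _ p.2 := h5
  rw [h6.fderiv]
  rfl

theorem tendsto_mulOp {l : Filter ℝ} {m : ℝ → E n → ℝ} {m₀ : E n → ℝ}
    (hm : ∀ᶠ t in l, MemLp (fun x => (m t x : ℂ)) ∞ (volume : Measure (E n)))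
    (hm₀ : MemLp (fun x => (m₀ x : ℂ)) ∞ (volume : Measure (E n)))
    (h : ∀ ε > 0, ∀ᶠ t in l, ∀ x, |m t x - m₀ x| ≤ ε) :
    Tendsto (fun t => mulOp (fun x => (m t x : ℂ))) l (𝓝 (mulOp fun x => (m₀ x : ℂ))) := by
  rw [Metric.tendsto_nhds]
  intro ε hε
  filter_upwards [hm, h (ε / 2) (half_pos hε)] with t h1 h2
  rw [dist_eq_norm]
  refine lt_of_le_of_lt ?_ (half_lt_self hε)
  refine ContinuousLinearMap.opNorm_le_bound _ (half_pos hε).le fun f => ?_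
  have h3 : mulOp (fun x => (m t x : ℂ)) f - mulOp (fun x => (m₀ x : ℂ)) f =
      mulOp (fun x => ((m t x : ℂ) - m₀ x)) f := by
    refine Lp.ext ?_
    filter_upwards [Lp.coeFn_sub (mulOp (fun x => (m t x : ℂ)) f) (mulOp (fun x => (m₀ x : ℂ)) f),
      mulOp_ae h1 f, mulOp_ae hm₀ f, mulOp_ae (h1.sub hm₀) f] with x e1 e2 e3 e4
    have e5 : mulOp (fun x => ((m t x : ℂ) - m₀ x)) f x = ((m t x : ℂ) - m₀ x) * f x := e4
    rw [e1, Pi.sub_apply, e2, e3, e5, sub_mul]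
  rw [_root_.sub_apply, h3]
  refine norm_mulOp_apply_le (h1.sub hm₀) _ (ae_of_all _ fun x => ?_) f
  change ‖(m t x : ℂ) - (m₀ x : ℂ)‖ ≤ ε / 2
  rw [← Complex.ofReal_sub, Complex.norm_real]
  exact h2 x

theorem mulOp_toL2 {m f : E n → ℝ} (hm : MemLp (fun x => (m x : ℂ)) ∞ (volume : Measure (E n)))
    (hf : MemLp f 2 (volume : Measure (E n)))
    (hmf : MemLp (fun x => m x * f x) 2 (volume : Measure (E n))) :
    mulOp (fun x => (m x : ℂ)) (toL2 f) = toL2 fun x => m x * f x := by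
  refine (toL2_eq_of_ae hmf ?_).symm
  filter_upwards [mulOp_ae hm (toL2 f), toL2_ae' hf] with x h1 h2
  rw [h1, h2, Complex.ofReal_mul]

/-- Decay of every order, uniform in the parameter, provides the square integrable majorant (1 +
‖x‖)^(-k). -/
theorem tendsto_toL2_of_decay {H : ℝ → E n → ℝ} {c : ℝ} {I : Set ℝ} (hI : I ∈ 𝓝 c)
    (hm : ∀ t ∈ I, MemLp (H t) 2 (volume : Measure (E n)))
    (hdecay : ∀ k : ℕ, ∃ C : ℝ, ∀ t ∈ I, ∀ x, ‖x‖ ^ k * |H t x| ≤ C)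
    (hlim : ∀ x, Tendsto (fun t => H t x) (𝓝 c) (𝓝 (H c x))) :
    Tendsto (fun t => toL2 (H t)) (𝓝 c) (𝓝 (toL2 (H c))) := by
  classical
  have hc : c ∈ I := mem_of_mem_nhds hI
  obtain ⟨k, hk⟩ := Measure.HasTemperateGrowth.exists_eLpNorm_lt_top 2
    (μ := (volume : Measure (E n))) inferInstance
  obtain ⟨C₀, h0⟩ := hdecay 0
  obtain ⟨C₁, h1⟩ := hdecay k
  have hC0 : 0 ≤ C₀ := le_trans (by positivity) (h0 c hc 0)
  have hbd : ∀ t ∈ I, ∀ x, |H t x| ≤ 2 ^ k * (C₀ + C₁) * (1 + ‖x‖) ^ (-(k : ℝ)) := by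
    intro t ht x
    have hpos : 0 < (1 + ‖x‖) ^ k := by positivity
    rw [Real.rpow_neg (by positivity), Real.rpow_natCast, ← div_eq_mul_inv, le_div_iff₀ hpos]
    have h2 : (1 + ‖x‖) ^ k ≤ 2 ^ k * (1 + ‖x‖ ^ k) := by
      rcases le_total ‖x‖ 1 with hx | hx
      · calc (1 + ‖x‖) ^ k ≤ 2 ^ k := pow_le_pow_left₀ (by positivity) (by linarith) k
          _ ≤ _ := le_mul_of_one_le_right (by positivity) (by simp)
      · calc (1 + ‖x‖) ^ k ≤ (2 * ‖x‖) ^ k := pow_le_pow_left₀ (by positivity) (by linarith) k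
          _ = 2 ^ k * ‖x‖ ^ k := mul_pow _ _ _
          _ ≤ _ := by gcongr; linarith
    have h3 := h0 t ht x
    rw [pow_zero, one_mul] at h3
    calc |H t x| * (1 + ‖x‖) ^ k ≤ |H t x| * (2 ^ k * (1 + ‖x‖ ^ k)) := by gcongr
      _ = 2 ^ k * (|H t x| + ‖x‖ ^ k * |H t x|) := by ring
      _ ≤ _ := by gcongr; exact h1 t ht x
  -- The dominated convergence lemma wants a bound for all indices, so off the neighbourhood the
  -- family is replaced by its value at c.
  let H' : ℝ → E n → ℂ := fun t x => if t ∈ I then (H t x : ℂ) else (H c x : ℂ)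
  have hae := toL2_ae' (hm c hc)
  have h2 : Tendsto (fun t => if t ∈ I then toL2 (H t) else toL2 (H c)) (𝓝 c)
      (𝓝 (toL2 (H c))) := by
    refine tendsto_L2_of_dominated H' (fun t => ?_)
      (fun x => 2 * (2 ^ k * (C₀ + C₁)) * (1 + ‖x‖) ^ (-(k : ℝ))) ?_ ?_ ?_
    · by_cases ht : t ∈ I
      · simp only [H', ht, if_true]
        exact toL2_ae' (hm t ht)
      · simp only [H', ht, if_false]
        exact hae
    · refine MemLp.const_mul ⟨?_, hk⟩ _
      have h3 : Continuous fun x : E n => (1 + ‖x‖) ^ (-(k : ℝ)) :=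
        (continuous_const.add continuous_norm).rpow_const fun x =>
        Or.inl (by positivity : (1 : ℝ) + ‖x‖ ≠ 0)
      exact h3.aestronglyMeasurable
    · filter_upwards [hae] with x hx t
      rw [hx]
      have e1 := hbd c hc x
      by_cases ht : t ∈ I
      · simp only [H', ht, if_true]
        rw [← Complex.ofReal_sub, Complex.norm_real, Real.norm_eq_abs]
        have e2 := hbd t ht x
        have e3 := abs_sub (H t x) (H c x)
        linarith
      · simp only [H', ht, if_false, sub_self, norm_zero]
        have e2 := abs_nonneg (H c x)
        linarith
    · filter_upwards [hae] with x hx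
      rw [hx]
      have e1 := (Complex.continuous_ofReal.tendsto _).comp (hlim x)
      refine e1.congr' ?_
      filter_upwards [hI] with t ht
      simp [H', ht]
  refine h2.congr' ?_
  filter_upwards [hI] with t ht
  simp [ht]

end ParameterDerivative

/-! ### The soliton family and the root relations -/

section Soliton

variable {n : ℕ} {β : ℝ → ℝ} {φ : ℝ → E n → ℝ} {α₀ c₀ : ℝ}

/-- The nonlinearity `t ↦ β(t²)`. -/
def nl (β : ℝ → ℝ) (t : ℝ) : ℝ := β (t ^ 2)

/-- The derivative of `t ↦ β(t²) t`. -/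
def nlp (β : ℝ → ℝ) (t : ℝ) : ℝ := nl β t + t * deriv (nl β) t

theorem contDiff_nl (hβ : ContDiffOn ℝ ∞ β (Ici 0)) : ContDiff ℝ ∞ (nl β) :=
  contDiffOn_univ.mp (hβ.comp (contDiff_id.pow 2).contDiffOn fun t _ => sq_nonneg t)

theorem contDiff_nlp (hβ : ContDiffOn ℝ ∞ β (Ici 0)) : ContDiff ℝ ∞ (nlp β) :=
  (contDiff_nl hβ).add (contDiff_id.mul (contDiff_infty_iff_deriv.mp (contDiff_nl hβ)).2)

theorem hasDerivAt_nl (hβ : ContDiffOn ℝ ∞ β (Ici 0)) (t : ℝ) :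
    HasDerivAt (nl β) (deriv (nl β) t) t :=
  ((contDiff_infty_iff_deriv.mp (contDiff_nl hβ)).1 t).hasDerivAt

theorem hasDerivAt_nl_mul (hβ : ContDiffOn ℝ ∞ β (Ici 0)) (t : ℝ) :
    HasDerivAt (fun t => nl β t * t) (nlp β t) t := by
  have h : HasDerivAt (fun t => nl β t * t) (deriv (nl β) t * t + nl β t * 1) t :=
    (hasDerivAt_nl hβ t).mul (hasDerivAt_id t)
  convert h using 1
  rw [nlp]
  ring

/-- β is smooth only on [0, ∞), so the two-sided `deriv β` at 0 carries no information, but the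
factor t² removes it there. The potential of L₊ is thereby expressed through `nlp`, which is smooth
on the whole line. -/
theorem mul_deriv_nl (hβ : ContDiffOn ℝ ∞ β (Ici 0)) (t : ℝ) :
    t * deriv (nl β) t = 2 * deriv β (t ^ 2) * t ^ 2 := by
  by_cases ht : t = 0
  · simp [ht]
  · have h0 : 0 < t ^ 2 := by positivity
    have h1 : HasDerivAt β (deriv β (t ^ 2)) (t ^ 2) :=
      ((hβ.contDiffAt (Ici_mem_nhds h0)).differentiableAt (by simp)).hasDerivAt
    have h2 : HasDerivAt (nl β) (deriv β (t ^ 2) * (2 * t)) t := by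
      have h3 : HasDerivAt (fun t : ℝ => t ^ 2) (2 * t) t := by simpa using hasDerivAt_pow 2 t
      exact HasDerivAt.comp t h1 h3
    rw [h2.deriv]
    ring

theorem nl_zero (hβ0 : β 0 = 0) : nl β 0 = 0 := by simp [nl, hβ0]

theorem nlp_zero (hβ0 : β 0 = 0) : nlp β 0 = 0 := by simp [nlp, nl, hβ0]

theorem opLplus_eq (hβ : ContDiffOn ℝ ∞ β (Ici 0)) (φ : ℝ → E n → ℝ) (α : ℝ) :
    opLplus β φ α = schrodinger fun x => α ^ 2 / 2 - nlp β (φ α x) := by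
  rw [opLplus]
  congr 1
  funext x
  rw [nlp, mul_deriv_nl hβ, nl]
  ring

theorem toL2_zero : toL2 (fun _ : E n => (0 : ℝ)) = 0 := by
  have h := toL2_smul (MemLp.zero' : MemLp (fun _ : E n => (0 : ℝ)) 2 volume) 0
  simpa using h

namespace IsSolitonFamily

/-- The profile as a Schwartz function. -/
def sol (hφ : IsSolitonFamily β α₀ c₀ φ) {α : ℝ} (hα : α ∈ Ioo (α₀ - c₀) (α₀ + c₀)) :
    𝓢(E n, ℝ) where
  toFun := φ α
  smooth' := contDiffOn_univ.mp (hφ.smooth.comp (f := fun x : E n => (α, x)) (by fun_prop)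
    fun x _ => ⟨hα, trivial⟩)
  decay' k m := by
    obtain ⟨C, hC⟩ := hφ.decay k m
    exact ⟨C, hC α hα⟩

theorem coe_sol (hφ : IsSolitonFamily β α₀ c₀ φ) {α : ℝ}
    (hα : α ∈ Ioo (α₀ - c₀) (α₀ + c₀)) : (hφ.sol hα : E n → ℝ) = φ α := rfl

theorem coe_pd (hφ : IsSolitonFamily β α₀ c₀ φ) {α : ℝ}
    (hα : α ∈ Ioo (α₀ - c₀) (α₀ + c₀)) (j : Fin n) : (pd j (hφ.sol hα) : E n → ℝ) = dSpace φ α j := rfl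

theorem coe_coordMul (hφ : IsSolitonFamily β α₀ c₀ φ) {α : ℝ}
    (hα : α ∈ Ioo (α₀ - c₀) (α₀ + c₀)) (j : Fin n) : (coordMul j (hφ.sol hα) : E n → ℝ) = fun x => x j * φ α x :=
  funext (coordMul_apply j _)

theorem lap_sol (hφ : IsSolitonFamily β α₀ c₀ φ) {α : ℝ}
    (hα : α ∈ Ioo (α₀ - c₀) (α₀ + c₀)) (x : E n) :
    lap (hφ.sol hα) x = α ^ 2 * φ α x - 2 * (nl β (φ α x) * φ α x) := by
  have h1 := hφ.equation α hα x
  have h2 : lap (hφ.sol hα) x = Δ (φ α) x := lap_apply _ x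
  rw [h2, nl]
  linarith

theorem graph_phase (hφ : IsSolitonFamily β α₀ c₀ φ) {α : ℝ}
    (hα : α ∈ Ioo (α₀ - c₀) (α₀ + c₀)) : (toL2 (φ α), 0) ∈ (opLminus β φ α).graph := by
  have h1 := mem_graph_schrodinger (V := fun x => α ^ 2 / 2 - nl β (φ α x)) (hφ.sol hα) 0
    fun x => by
      rw [hφ.lap_sol hα, hφ.coe_sol hα]
      simp only [_root_.zero_apply]
      ring
  have h2 : toL2 ((0 : 𝓢(E n, ℝ)) : E n → ℝ) = 0 := toL2_zero
  rw [h2] at h1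
  exact h1

/-- L₋φ = 0 and the commutator of -½Δ with x_j is -∂_j. -/
theorem graph_boost (hφ : IsSolitonFamily β α₀ c₀ φ) {α : ℝ}
    (hα : α ∈ Ioo (α₀ - c₀) (α₀ + c₀)) (j : Fin n) :
    (toL2 (fun x => x j * φ α x), -toL2 (dSpace φ α j)) ∈ (opLminus β φ α).graph := by
  have h1 := mem_graph_schrodinger (V := fun x => α ^ 2 / 2 - nl β (φ α x))
    (coordMul j (hφ.sol hα)) ((-1 : ℝ) • pd j (hφ.sol hα)) fun x => by
      rw [laplacian_coordMul]
      simp only [_root_.add_apply, _root_.smul_apply, coordMul_apply, smul_eq_mul,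
        hφ.lap_sol hα, hφ.coe_sol hα]
      ring
  have h2 : toL2 (((-1 : ℝ) • pd j (hφ.sol hα) : 𝓢(E n, ℝ)) : E n → ℝ) =
      -toL2 (dSpace φ α j) := by
    have := toL2_smul (memLp_schwartz (pd j (hφ.sol hα))) (-1)
    rw [hφ.coe_pd hα] at this
    have h3 : (((-1 : ℝ) • pd j (hφ.sol hα) : 𝓢(E n, ℝ)) : E n → ℝ) =
      fun x => -1 * dSpace φ α j x := rfl
    rw [h3, this]
    simp
  rw [h2, hφ.coe_coordMul hα] at h1
  exact h1

/-- The derivative of the soliton equation in x_j. -/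
theorem graph_translation (hφ : IsSolitonFamily β α₀ c₀ φ) {α : ℝ}
    (hα : α ∈ Ioo (α₀ - c₀) (α₀ + c₀)) (hβ : ContDiffOn ℝ ∞ β (Ici 0)) (j : Fin n) :
    (toL2 (dSpace φ α j), 0) ∈ (opLplus β φ α).graph := by
  rw [opLplus_eq hβ]
  have h1 := mem_graph_schrodinger (V := fun x => α ^ 2 / 2 - nlp β (φ α x))
    (pd j (hφ.sol hα)) 0 fun x => by
      have h3 : HasFDerivAt (φ α) (fderiv ℝ (φ α) x) x := (hφ.sol hα).hasFDerivAt x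
      have h4 : HasFDerivAt (lap (hφ.sol hα)) (α ^ 2 • fderiv ℝ (φ α) x -
          (2 : ℝ) • (nlp β (φ α x) • fderiv ℝ (φ α) x)) x := by
        have h5 : (lap (hφ.sol hα) : E n → ℝ) =
            fun x => α ^ 2 * φ α x - 2 * (nl β (φ α x) * φ α x) := funext (hφ.lap_sol hα)
        rw [h5]
        exact (h3.const_mul (α ^ 2)).sub
          (((hasDerivAt_nl_mul hβ (φ α x)).comp_hasFDerivAt x h3).const_mul 2)
      rw [laplacian_pd, pd_apply, h4.fderiv, pd_apply, hφ.coe_sol hα]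
      simp only [_root_.zero_apply, _root_.sub_apply, _root_.smul_apply, smul_eq_mul]
      ring
  have h2 : toL2 ((0 : 𝓢(E n, ℝ)) : E n → ℝ) = 0 := toL2_zero
  rw [h2] at h1
  exact h1

theorem memLp_phi (hφ : IsSolitonFamily β α₀ c₀ φ) {α : ℝ}
    (hα : α ∈ Ioo (α₀ - c₀) (α₀ + c₀)) : MemLp (φ α) 2 (volume : Measure (E n)) := memLp_schwartz (hφ.sol hα)

theorem memLp_coord (hφ : IsSolitonFamily β α₀ c₀ φ) {α : ℝ}
    (hα : α ∈ Ioo (α₀ - c₀) (α₀ + c₀)) (j : Fin n) : MemLp (fun x => x j * φ α x) 2 (volume : Measure (E n)) := by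
  rw [← hφ.coe_coordMul hα]
  exact memLp_schwartz _

theorem memLp_dSpace (hφ : IsSolitonFamily β α₀ c₀ φ) {α : ℝ}
    (hα : α ∈ Ioo (α₀ - c₀) (α₀ + c₀)) (j : Fin n) : MemLp (dSpace φ α j) 2 (volume : Measure (E n)) := by
  rw [← hφ.coe_pd hα]
  exact memLp_schwartz _

theorem hasDerivAt_alpha (hφ : IsSolitonFamily β α₀ c₀ φ) {α : ℝ}
    (hα : α ∈ Ioo (α₀ - c₀) (α₀ + c₀)) (x : E n) : HasDerivAt (fun a => φ a x) (dAlpha φ α x) α :=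
  (contDiffOn_deriv_fst isOpen_Ioo hφ.smooth).2 x α hα

theorem contDiffOn_dAlpha (hφ : IsSolitonFamily β α₀ c₀ φ) : ContDiffOn ℝ ∞ (fun p : ℝ × E n => dAlpha φ p.1 p.2)
    (Ioo (α₀ - c₀) (α₀ + c₀) ×ˢ univ) := (contDiffOn_deriv_fst isOpen_Ioo hφ.smooth).1

theorem hasDerivAt_dAlpha (hφ : IsSolitonFamily β α₀ c₀ φ) {α : ℝ}
    (hα : α ∈ Ioo (α₀ - c₀) (α₀ + c₀)) (x : E n) : HasDerivAt (fun a => dAlpha φ a x) (dAlpha2 φ α x) α := by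
  have h := (contDiffOn_deriv_fst isOpen_Ioo hφ.contDiffOn_dAlpha).2 x α hα
  have h2 : dAlpha2 φ α x = deriv (fun a => dAlpha φ a x) α := by
    rw [dAlpha2, iteratedDeriv_succ, iteratedDeriv_one]
    rfl
  rw [h2]
  exact h

theorem continuousOn_dAlpha2 (hφ : IsSolitonFamily β α₀ c₀ φ) : ContinuousOn (fun p : ℝ × E n => dAlpha2 φ p.1 p.2)
    (Ioo (α₀ - c₀) (α₀ + c₀) ×ˢ univ) := by
  refine (contDiffOn_deriv_fst isOpen_Ioo hφ.contDiffOn_dAlpha).1.continuousOn.congr fun p _ => ?_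
  rw [dAlpha2, iteratedDeriv_succ, iteratedDeriv_one]
  rfl

theorem memLp_dAlpha (hφ : IsSolitonFamily β α₀ c₀ φ) {α : ℝ}
    (hα : α ∈ Ioo (α₀ - c₀) (α₀ + c₀)) : MemLp (dAlpha φ α) 2 (volume : Measure (E n)) := by
  obtain ⟨K, hK⟩ := hφ.alpha_deriv
  have h1 : Continuous (dAlpha φ α) := continuousOn_univ.mp
    (hφ.contDiffOn_dAlpha.continuousOn.comp (f := fun x : E n => (α, x)) (by fun_prop)
      fun x _ => ⟨hα, trivial⟩)
  exact ⟨h1.aestronglyMeasurable, ((hK α hα).1.1).trans_lt ENNReal.coe_lt_top⟩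

theorem tendsto_dAlpha (hφ : IsSolitonFamily β α₀ c₀ φ) {α : ℝ}
    (hα : α ∈ Ioo (α₀ - c₀) (α₀ + c₀)) :
    Tendsto (fun t => toL2 (dAlpha φ t)) (𝓝 α) (𝓝 (toL2 (dAlpha φ α))) := by
  obtain ⟨K, hK⟩ := hφ.alpha_deriv
  rw [tendsto_iff_norm_sub_tendsto_zero]
  have h1 : ∀ᶠ t in 𝓝 α, ‖toL2 (dAlpha φ t) - toL2 (dAlpha φ α)‖ ≤ |t - α| * K := by
    filter_upwards [isOpen_Ioo.mem_nhds hα] with t ht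
    have hsub : uIcc α t ⊆ Ioo (α₀ - c₀) (α₀ + c₀) := ordConnected_Ioo.uIcc_subset hα ht
    refine norm_toL2_sub_le (fun s hs => hφ.memLp_dAlpha (hsub hs))
      (fun x s hs => hφ.hasDerivAt_dAlpha (hsub hs) x)
      (hφ.continuousOn_dAlpha2.mono (prod_mono hsub le_rfl)) K.2 fun s hs => ?_
    refine (hK s (hsub hs)).2.1.trans ?_
    rw [ENNReal.ofReal_coe_nnreal]
  have h2 : Tendsto (fun t : ℝ => |t - α| * K) (𝓝 α) (𝓝 0) := by
    have h3 : Continuous fun t : ℝ => |t - α| * K := by fun_prop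
    have := h3.tendsto α
    simpa using this
  exact squeeze_zero' (Eventually.of_forall fun t => norm_nonneg _) h1 h2

theorem tendsto_pointwise (hφ : IsSolitonFamily β α₀ c₀ φ) {α : ℝ}
    (hα : α ∈ Ioo (α₀ - c₀) (α₀ + c₀)) (x : E n) : Tendsto (fun t => φ t x) (𝓝 α) (𝓝 (φ α x)) :=
  (hφ.hasDerivAt_alpha hα x).continuousAt.tendsto

theorem tendsto_phi (hφ : IsSolitonFamily β α₀ c₀ φ) {α : ℝ}
    (hα : α ∈ Ioo (α₀ - c₀) (α₀ + c₀)) : Tendsto (fun t => toL2 (φ t)) (𝓝 α) (𝓝 (toL2 (φ α))) := by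
  refine tendsto_toL2_of_decay (isOpen_Ioo.mem_nhds hα) (fun t ht => hφ.memLp_phi ht)
    (fun k => ?_) (hφ.tendsto_pointwise hα)
  obtain ⟨C, hC⟩ := hφ.decay k 0
  exact ⟨C, fun t ht x => by simpa using hC t ht x⟩

theorem tendsto_coord (hφ : IsSolitonFamily β α₀ c₀ φ) {α : ℝ}
    (hα : α ∈ Ioo (α₀ - c₀) (α₀ + c₀)) (j : Fin n) : Tendsto (fun t => toL2 fun x => x j * φ t x) (𝓝 α)
    (𝓝 (toL2 fun x => x j * φ α x)) := by
  refine tendsto_toL2_of_decay (H := fun t x => x j * φ t x) (isOpen_Ioo.mem_nhds hα)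
    (fun t ht => hφ.memLp_coord ht j) (fun k => ?_)
    (fun x => (hφ.tendsto_pointwise hα x).const_mul _)
  obtain ⟨C, hC⟩ := hφ.decay (k + 1) 0
  refine ⟨C, fun t ht x => le_trans ?_ (hC t ht x)⟩
  rw [norm_iteratedFDeriv_zero, abs_mul, Real.norm_eq_abs, pow_succ, mul_assoc]
  gcongr
  exact PiLp.norm_apply_le x j

theorem tendsto_dSpace (hφ : IsSolitonFamily β α₀ c₀ φ) {α : ℝ}
    (hα : α ∈ Ioo (α₀ - c₀) (α₀ + c₀)) (j : Fin n) : Tendsto (fun t => toL2 (dSpace φ t j)) (𝓝 α)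
    (𝓝 (toL2 (dSpace φ α j))) := by
  refine tendsto_toL2_of_decay (H := fun t => dSpace φ t j) (isOpen_Ioo.mem_nhds hα)
    (fun t ht => hφ.memLp_dSpace ht j) (fun k => ?_) (fun x => ?_)
  · obtain ⟨C, hC⟩ := hφ.decay k 1
    refine ⟨C, fun t ht x => le_trans ?_ (hC t ht x)⟩
    gcongr
    rw [norm_iteratedFDeriv_one, dSpace, ← Real.norm_eq_abs]
    refine ((fderiv ℝ (φ t) x).le_opNorm _).trans ?_
    simp
  · have h1 := continuousOn_fderiv_snd isOpen_Ioo hφ.smooth (EuclideanSpace.single j (1 : ℝ))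
    have h2 := h1.continuousAt ((isOpen_Ioo.prod isOpen_univ).mem_nhds
      (⟨hα, trivial⟩ : (α, x) ∈ Ioo (α₀ - c₀) (α₀ + c₀) ×ˢ (univ : Set (E n))))
    have h3 : Continuous fun t : ℝ => (t, x) := by fun_prop
    exact h2.tendsto.comp (h3.tendsto α)

theorem exists_bound (hφ : IsSolitonFamily β α₀ c₀ φ) : ∃ M : ℝ, ∀ t ∈ Ioo (α₀ - c₀) (α₀ + c₀), ∀ x, |φ t x| ≤ M := by
  obtain ⟨C, hC⟩ := hφ.decay 0 0
  exact ⟨C, fun t ht x => by simpa using hC t ht x⟩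

/-- Outside the ball of radius 2C/ε both profiles are small by the uniform decay C/‖x‖; on the ball
compactness turns joint continuity into uniformity. This yields convergence of the potentials in
operator norm. -/
theorem eventually_abs_sub_le (hφ : IsSolitonFamily β α₀ c₀ φ) {α : ℝ}
    (hα : α ∈ Ioo (α₀ - c₀) (α₀ + c₀)) {ε : ℝ} (hε : 0 < ε) :
    ∀ᶠ t in 𝓝 α, ∀ x, |φ t x - φ α x| ≤ ε := by
  obtain ⟨C, hC⟩ := hφ.decay 1 0
  have hC' : ∀ t ∈ Ioo (α₀ - c₀) (α₀ + c₀), ∀ x, ‖x‖ * |φ t x| ≤ C := fun t ht x => by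
    simpa using hC t ht x
  have h1 : ∀ᶠ t in 𝓝 α, ∀ x ∈ Metric.closedBall (0 : E n) (2 * C / ε), |φ t x - φ α x| ≤ ε := by
    refine (isCompact_closedBall _ _).eventually_forall_of_forall_eventually fun x _ => ?_
    have h2 : ContinuousAt (fun p : ℝ × E n => φ p.1 p.2) (α, x) :=
      hφ.smooth.continuousOn.continuousAt ((isOpen_Ioo.prod isOpen_univ).mem_nhds ⟨hα, trivial⟩)
    have h3 : ContinuousAt (fun p : ℝ × E n => φ α p.2) (α, x) :=
      ((hφ.sol hα).continuous.comp continuous_snd).continuousAt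
    have h4 := (h2.sub h3).abs.tendsto
    rw [Pi.sub_apply, sub_self, abs_zero] at h4
    exact (h4.eventually (gt_mem_nhds hε)).mono fun p hp => le_of_lt hp
  filter_upwards [h1, isOpen_Ioo.mem_nhds hα] with t ht1 ht2 x
  by_cases hx : ‖x‖ ≤ 2 * C / ε
  · exact ht1 x (by simpa using hx)
  · push Not at hx
    have e1 := hC' t ht2 x
    have e2 := hC' α hα x
    have hC0 : 0 ≤ C := le_trans (by positivity) e1
    have hx0 : 0 < ‖x‖ := lt_of_le_of_lt (by positivity) hx
    have e3 : 2 * C < ‖x‖ * ε := (div_lt_iff₀ hε).mp hx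
    have e4 : ‖x‖ * |φ t x - φ α x| ≤ ‖x‖ * ε := by
      calc _ ≤ ‖x‖ * (|φ t x| + |φ α x|) := by gcongr; exact abs_sub _ _
        _ ≤ _ := by linarith
    exact le_of_mul_le_mul_left e4 hx0

theorem eventually_abs_comp_sub_le (hφ : IsSolitonFamily β α₀ c₀ φ) {α : ℝ}
    (hα : α ∈ Ioo (α₀ - c₀) (α₀ + c₀)) {g : ℝ → ℝ} (hg : Continuous g) {ε : ℝ} (hε : 0 < ε) :
    ∀ᶠ t in 𝓝 α, ∀ x, |g (φ t x) - g (φ α x)| ≤ ε := by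
  obtain ⟨M, hM⟩ := hφ.exists_bound
  obtain ⟨δ, hδ, h1⟩ := Metric.uniformContinuousOn_iff.mp
    ((isCompact_Icc (a := -M) (b := M)).uniformContinuousOn_of_continuous hg.continuousOn) ε hε
  filter_upwards [hφ.eventually_abs_sub_le hα (half_pos hδ), isOpen_Ioo.mem_nhds hα] with t ht1 ht2 x
  have h2 := h1 _ (abs_le.mp (hM t ht2 x)) _ (abs_le.mp (hM α hα x)) (by
    rw [Real.dist_eq]
    exact (ht1 x).trans_lt (half_lt_self hδ))
  rw [Real.dist_eq] at h2
  exact h2.le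

/-- Multiplication by `α²/2 - g(φ) - κ`. -/
def potOp (g : ℝ → ℝ) (φ : ℝ → E n → ℝ) (κ α : ℝ) : L2 n →L[ℂ] L2 n :=
  mulOp fun x => ((α ^ 2 / 2 - g (φ α x) - κ : ℝ) : ℂ)

theorem exists_pot_bound (hφ : IsSolitonFamily β α₀ c₀ φ) {α : ℝ}
    (hα : α ∈ Ioo (α₀ - c₀) (α₀ + c₀)) {g : ℝ → ℝ} (hg : Continuous g) (κ : ℝ) :
    ∃ C, ∀ x, |α ^ 2 / 2 - g (φ α x) - κ| ≤ C := by
  obtain ⟨M, hM⟩ := hφ.exists_bound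
  obtain ⟨C, hC⟩ := (isCompact_Icc (a := -M) (b := M)).exists_bound_of_continuousOn hg.continuousOn
  refine ⟨|α ^ 2 / 2 - κ| + C, fun x => ?_⟩
  have h1 := hC _ (abs_le.mp (hM α hα x))
  rw [Real.norm_eq_abs] at h1
  calc _ = |(α ^ 2 / 2 - κ) - g (φ α x)| := by ring_nf
    _ ≤ _ := (abs_sub _ _).trans (by gcongr)

theorem measurable_pot (hφ : IsSolitonFamily β α₀ c₀ φ) {α : ℝ}
    (hα : α ∈ Ioo (α₀ - c₀) (α₀ + c₀)) {g : ℝ → ℝ} (hg : Continuous g) :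
    Measurable fun x => α ^ 2 / 2 - g (φ α x) := by
  have h1 : Continuous (φ α) := (hφ.sol hα).continuous
  exact (continuous_const.sub (hg.comp h1)).measurable

theorem memLp_pot (hφ : IsSolitonFamily β α₀ c₀ φ) {α : ℝ}
    (hα : α ∈ Ioo (α₀ - c₀) (α₀ + c₀)) {g : ℝ → ℝ} (hg : Continuous g) (κ : ℝ) :
    MemLp (fun x => ((α ^ 2 / 2 - g (φ α x) - κ : ℝ) : ℂ)) ∞ (volume : Measure (E n)) := by
  obtain ⟨C, hC⟩ := hφ.exists_pot_bound hα hg κ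
  exact memLp_top_real ((hφ.measurable_pot hα hg).sub_const κ) C hC

theorem isSchr (hφ : IsSolitonFamily β α₀ c₀ φ) {α : ℝ}
    (hα : α ∈ Ioo (α₀ - c₀) (α₀ + c₀)) {g : ℝ → ℝ} (hg : Continuous g) {κ : ℝ} (hκ : 0 < κ) :
    IsSchr (resRoot n κ) (potOp g φ κ α) (schrodinger fun x => α ^ 2 / 2 - g (φ α x)) := by
  obtain ⟨C, hC⟩ := hφ.exists_pot_bound hα hg κ
  exact isSchr_schrodinger hκ (hφ.measurable_pot hα hg) C hC

theorem tendsto_potOp (hφ : IsSolitonFamily β α₀ c₀ φ) {α : ℝ}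
    (hα : α ∈ Ioo (α₀ - c₀) (α₀ + c₀)) {g : ℝ → ℝ} (hg : Continuous g) (κ : ℝ) :
    Tendsto (potOp g φ κ) (𝓝 α) (𝓝 (potOp g φ κ α)) := by
  refine tendsto_mulOp (m := fun t x => t ^ 2 / 2 - g (φ t x) - κ) ?_ (hφ.memLp_pot hα hg κ) ?_
  · filter_upwards [isOpen_Ioo.mem_nhds hα] with t ht
    exact hφ.memLp_pot ht hg κ
  · intro ε hε
    have h1 : ∀ᶠ t in 𝓝 α, |t ^ 2 / 2 - α ^ 2 / 2| < ε / 2 := by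
      have h2 : Continuous fun t : ℝ => |t ^ 2 / 2 - α ^ 2 / 2| := by fun_prop
      have h3 := h2.tendsto α
      simp only [sub_self, abs_zero] at h3
      exact h3.eventually (gt_mem_nhds (half_pos hε))
    filter_upwards [h1, hφ.eventually_abs_comp_sub_le hα hg (half_pos hε)] with t ht1 ht2 x
    calc _ = |(t ^ 2 / 2 - α ^ 2 / 2) - (g (φ t x) - g (φ α x))| := by ring_nf
      _ ≤ |t ^ 2 / 2 - α ^ 2 / 2| + |g (φ t x) - g (φ α x)| := abs_sub _ _
      _ ≤ ε := by linarith [ht2 x]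

/-- For κ = α²/2 the constant cancels and the potential is -g(φ), a Schwartz function because g(0) =
0. Here β(0) = 0 enters. -/
theorem exists_schwartz_pot (hφ : IsSolitonFamily β α₀ c₀ φ) {α : ℝ}
    (hα : α ∈ Ioo (α₀ - c₀) (α₀ + c₀)) {g : ℝ → ℝ} (hg : ContDiff ℝ ∞ g) (h0 : g 0 = 0) :
    ∃ W : 𝓢(E n, ℂ), (∀ x, W x = ((α ^ 2 / 2 - g (φ α x) - α ^ 2 / 2 : ℝ) : ℂ)) ∧
      mulOp W = potOp g φ (α ^ 2 / 2) α := by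
  obtain ⟨v, hv⟩ := exists_schwartz_comp (hφ.sol hα) hg h0
  have h1 : ∀ x, cx (-v) x = ((α ^ 2 / 2 - g (φ α x) - α ^ 2 / 2 : ℝ) : ℂ) := by
    intro x
    have h2 : (-v) x = -(v x) := rfl
    rw [cx_apply, h2, hv, hφ.coe_sol hα]
    congr 1
    ring
  exact ⟨cx (-v), h1, by rw [potOp]; congr 1; exact funext h1⟩

theorem sobBounded_potOp (hφ : IsSolitonFamily β α₀ c₀ φ) {α : ℝ}
    (hα : α ∈ Ioo (α₀ - c₀) (α₀ + c₀)) {g : ℝ → ℝ} (hg : ContDiff ℝ ∞ g) (h0 : g 0 = 0) :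
    SobBounded (potOp g φ (α ^ 2 / 2) α) := by
  obtain ⟨W, hW, h1⟩ := hφ.exists_schwartz_pot hα hg h0
  intro s
  rw [← h1]
  exact exists_en_mulOp_le _ W hW s

theorem isCompactOperator_potOp (hφ : IsSolitonFamily β α₀ c₀ φ) {α : ℝ}
    (hα : α ∈ Ioo (α₀ - c₀) (α₀ + c₀)) {g : ℝ → ℝ} (hg : ContDiff ℝ ∞ g) (h0 : g 0 = 0)
    (hα0 : 0 < α) : IsCompactOperator (potOp g φ (α ^ 2 / 2) α ∘L resRoot n (α ^ 2 / 2)) := by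
  obtain ⟨W, hW, h1⟩ := hφ.exists_schwartz_pot hα hg h0
  rw [← h1]
  exact isCompactOperator_mulOp_resRoot (by positivity) _ W hW

theorem hasDerivAt_toL2_phi (hφ : IsSolitonFamily β α₀ c₀ φ) {α : ℝ}
    (hα : α ∈ Ioo (α₀ - c₀) (α₀ + c₀)) : HasDerivAt (fun t => toL2 (φ t)) (toL2 (dAlpha φ α)) α :=
  hasDerivAt_toL2 isOpen_Ioo ordConnected_Ioo hα (fun _ ht => hφ.memLp_phi ht)
    (fun _ ht => hφ.memLp_dAlpha ht) (fun x _ ht => hφ.hasDerivAt_alpha ht x)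
    hφ.contDiffOn_dAlpha.continuousOn (hφ.tendsto_dAlpha hα)

theorem potOp_toL2 (hφ : IsSolitonFamily β α₀ c₀ φ) {α : ℝ}
    (hα : α ∈ Ioo (α₀ - c₀) (α₀ + c₀)) {g : ℝ → ℝ} (hg : Continuous g) (κ : ℝ) {f : E n → ℝ}
    (hf : MemLp f 2 (volume : Measure (E n))) :
    MemLp (fun x => (α ^ 2 / 2 - g (φ α x) - κ) * f x) 2 (volume : Measure (E n)) ∧
    potOp g φ κ α (toL2 f) = toL2 fun x => (α ^ 2 / 2 - g (φ α x) - κ) * f x := by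
  obtain ⟨C, hC⟩ := hφ.exists_pot_bound hα hg κ
  have h1 : MemLp (fun x => (α ^ 2 / 2 - g (φ α x) - κ) * f x) 2 (volume : Measure (E n)) := by
    refine MemLp.of_le_mul (c := C) hf
      (((hφ.measurable_pot hα hg).sub_const κ).aestronglyMeasurable.mul hf.1)
      (ae_of_all _ fun x => ?_)
    rw [norm_mul]
    gcongr
    exact hC x
  exact ⟨h1, mulOp_toL2 (hφ.memLp_pot hα hg κ) hf h1⟩

theorem resRoot_phi (hφ : IsSolitonFamily β α₀ c₀ φ) {α : ℝ}
    (hα : α ∈ Ioo (α₀ - c₀) (α₀ + c₀)) {κ : ℝ} (hκ : 0 < κ) (hβ : ContDiffOn ℝ ∞ β (Ici 0)) :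
    resRoot n κ (resRoot n κ (toL2 fun x => (κ - α ^ 2 / 2) * φ α x + nl β (φ α x) * φ α x)) =
      toL2 (φ α) := by
  have hc := (contDiff_nl hβ).continuous
  have h1 := ((hφ.isSchr hα hc hκ).mem_graph_iff _ _).mp (hφ.graph_phase hα)
  obtain ⟨h2, h3⟩ := hφ.potOp_toL2 hα hc κ (hφ.memLp_phi hα)
  rw [h3, zero_sub] at h1
  have h4 : (toL2 fun x => (κ - α ^ 2 / 2) * φ α x + nl β (φ α x) * φ α x) =
      -toL2 fun x => (α ^ 2 / 2 - nl β (φ α x) - κ) * φ α x := by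
    have h5 := toL2_smul h2 (-1)
    rw [Complex.ofReal_neg, Complex.ofReal_one, neg_one_smul] at h5
    rw [← h5]
    congr 1
    funext x
    ring
  rw [h4]
  exact h1

/-- Differentiating the soliton equation in α directly would require ∂_αφ in H², which is not
assumed. Instead the resolvent identity R²H(t) = φ(t) is differentiated in L²; the result says at
once that ∂_αφ lies in the domain and what its image is. -/
theorem graph_scaling (hφ : IsSolitonFamily β α₀ c₀ φ) {α : ℝ}
    (hα : α ∈ Ioo (α₀ - c₀) (α₀ + c₀)) (hβ : ContDiffOn ℝ ∞ β (Ici 0)) :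
    (toL2 (dAlpha φ α), -(α : ℂ) • toL2 (φ α)) ∈ (opLplus β φ α).graph := by
  rw [opLplus_eq hβ]
  have hc := (contDiff_nlp hβ).continuous
  have hcn := (contDiff_nl hβ).continuous
  rw [(hφ.isSchr hα hc one_pos).mem_graph_iff]
  -- H is R⁻²φ according to the equation, and H' is its derivative in t. The value κ = 1 is
  -- arbitrary, but it must not vary with t.
  let H : ℝ → E n → ℝ := fun t x => (1 - t ^ 2 / 2) * φ t x + nl β (φ t x) * φ t x
  let H' : ℝ → E n → ℝ := fun t x => -t * φ t x - (t ^ 2 / 2 - nlp β (φ t x) - 1) * dAlpha φ t x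
  have hH' : ∀ t ∈ Ioo (α₀ - c₀) (α₀ + c₀), MemLp (H' t) 2 (volume : Measure (E n)) ∧
      toL2 (H' t) = -(t : ℂ) • toL2 (φ t) - potOp (nlp β) φ 1 t (toL2 (dAlpha φ t)) := by
    intro t ht
    obtain ⟨e1, e2⟩ := hφ.potOp_toL2 ht hc 1 (hφ.memLp_dAlpha ht)
    have e3 := (hφ.memLp_phi ht).const_mul (-t)
    refine ⟨e3.sub e1, ?_⟩
    rw [e2, ← Complex.ofReal_neg, ← toL2_smul (hφ.memLp_phi ht), ← toL2_sub e3 e1]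
  have hcontφ : ContinuousOn (fun p : ℝ × E n => φ p.1 p.2) (Ioo (α₀ - c₀) (α₀ + c₀) ×ˢ univ) :=
    hφ.smooth.continuousOn
  have hd : HasDerivAt (fun t => toL2 (H t)) (toL2 (H' α)) α := by
    refine hasDerivAt_toL2 isOpen_Ioo ordConnected_Ioo hα (fun t ht => ?_)
      (fun t ht => (hH' t ht).1) (fun x t ht => ?_) ?_ ?_
    · obtain ⟨e1, -⟩ := hφ.potOp_toL2 ht hcn 1 (hφ.memLp_phi ht)
      have e2 := e1.neg
      have e3 : H t = -fun x => (t ^ 2 / 2 - nl β (φ t x) - 1) * φ t x := by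
        funext x
        change (1 - t ^ 2 / 2) * φ t x + nl β (φ t x) * φ t x =
          -((t ^ 2 / 2 - nl β (φ t x) - 1) * φ t x)
        ring
      rw [e3]
      exact e2
    · have e1 := hφ.hasDerivAt_alpha ht x
      have e2 : HasDerivAt (fun t : ℝ => 1 - t ^ 2 / 2) (-t) t := by
        exact (((hasDerivAt_pow 2 t).div_const 2).const_sub 1).congr_deriv (by simp)
      have e3 := (e2.mul e1).add ((hasDerivAt_nl_mul hβ (φ t x)).comp t e1)
      refine e3.congr_deriv ?_
      change _ = -t * φ t x - (t ^ 2 / 2 - nlp β (φ t x) - 1) * dAlpha φ t x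
      ring
    · have e1 : ContinuousOn (fun p : ℝ × E n => p.1) (Ioo (α₀ - c₀) (α₀ + c₀) ×ˢ univ) :=
        continuous_fst.continuousOn
      exact (e1.neg.mul hcontφ).sub ((((e1.pow 2).div_const 2).sub
        (hc.comp_continuousOn hcontφ)).sub continuousOn_const |>.mul
          hφ.contDiffOn_dAlpha.continuousOn)
    · rw [(hH' α hα).2]
      have e1 : Tendsto (fun t : ℝ => -(t : ℂ)) (𝓝 α) (𝓝 (-(α : ℂ))) :=
        (Complex.continuous_ofReal.tendsto α).neg
      have e3 : Tendsto (fun t => potOp (nlp β) φ 1 t (toL2 (dAlpha φ t))) (𝓝 α)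
          (𝓝 (potOp (nlp β) φ 1 α (toL2 (dAlpha φ α)))) :=
        (isBoundedBilinearMap_apply.continuous.tendsto
          (potOp (nlp β) φ 1 α, toL2 (dAlpha φ α))).comp
            ((hφ.tendsto_potOp hα hc 1).prodMk_nhds (hφ.tendsto_dAlpha hα))
      have e2 := (e1.smul (hφ.tendsto_phi hα)).sub e3
      refine e2.congr' ?_
      filter_upwards [isOpen_Ioo.mem_nhds hα] with t ht
      rw [(hH' t ht).2]
  have h1 := hasDerivAt_apply (resRoot n 1) (hasDerivAt_apply (resRoot n 1) hd)
  have h2 : (fun t => resRoot n 1 (resRoot n 1 (toL2 (H t)))) =ᶠ[𝓝 α] fun t => toL2 (φ t) := by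
    filter_upwards [isOpen_Ioo.mem_nhds hα] with t ht
    exact hφ.resRoot_phi ht one_pos hβ
  have h3 := (h1.congr_of_eventuallyEq h2.symm).unique (hφ.hasDerivAt_toL2_phi hα)
  rw [(hH' α hα).2] at h3
  exact h3

end IsSolitonFamily

end Soliton

/-! ### The biorthogonal families and the spaces M, M_* -/

section RootFamilies

variable {n : ℕ} {β : ℝ → ℝ} {φ : ℝ → E n → ℝ} {α₀ c₀ : ℝ}

/-- `½ ‖φ‖²`. -/
def halfMass (φ : ℝ → E n → ℝ) (α : ℝ) : ℝ := 1 / 2 * ∫ x, φ α x * φ α x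

/-- `⟨∂_α φ, φ⟩`. -/
def massRate (φ : ℝ → E n → ℝ) (α : ℝ) : ℝ := ∫ x, dAlpha φ α x * φ α x

/-- `⟨x_j φ, ∂_α φ⟩`. -/
def coordRate (φ : ℝ → E n → ℝ) (α : ℝ) (j : Fin n) : ℝ := ∫ x, x j * φ α x * dAlpha φ α x

/-- `φ` and `x_j φ`. -/
def famA (φ : ℝ → E n → ℝ) (α : ℝ) : Option (Fin n) → L2 n
  | none => toL2 (φ α)
  | some j => toL2 fun x => x j * φ α x

/-- The basis of the span of `∂_α φ` and `∂_j φ` that is dual to `famA`. -/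
def famB (φ : ℝ → E n → ℝ) (α : ℝ) : Option (Fin n) → L2 n
  | none => (((massRate φ α)⁻¹ : ℝ) : ℂ) • (toL2 (dAlpha φ α) +
      ∑ j, ((coordRate φ α j * (halfMass φ α)⁻¹ : ℝ) : ℂ) • toL2 (dSpace φ α j))
  | some j => ((-(halfMass φ α)⁻¹ : ℝ) : ℂ) • toL2 (dSpace φ α j)

theorem span_famA : Submodule.span ℂ (range (famA φ α₀)) =
    Submodule.span ℂ ({toL2 (φ α₀)} ∪ range fun j : Fin n => toL2 fun x => x j * φ α₀ x) := by
  congr 1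
  ext f
  simp only [mem_range, Option.exists, famA, singleton_union, mem_insert_iff, eq_comm]

theorem span_famB (hp : massRate φ α₀ ≠ 0) (hm : halfMass φ α₀ ≠ 0) :
    Submodule.span ℂ (range (famB φ α₀)) =
    Submodule.span ℂ ({toL2 (dAlpha φ α₀)} ∪ range fun j : Fin n => toL2 (dSpace φ α₀ j)) := by
  have hp' : (((massRate φ α₀)⁻¹ : ℝ) : ℂ) ≠ 0 := by simpa using hp
  have hm' : ((-(halfMass φ α₀)⁻¹ : ℝ) : ℂ) ≠ 0 := by simpa using hm
  have hB : ∀ j, toL2 (dSpace φ α₀ j) ∈ Submodule.span ℂ (range (famB φ α₀)) := fun j => by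
    have h : famB φ α₀ (some j) ∈ Submodule.span ℂ (range (famB φ α₀)) :=
      Submodule.subset_span ⟨_, rfl⟩
    exact (Submodule.smul_mem_iff _ hm').mp h
  apply le_antisymm
  · rw [Submodule.span_le]
    have h1 : ∀ j, toL2 (dSpace φ α₀ j) ∈ Submodule.span ℂ
        ({toL2 (dAlpha φ α₀)} ∪ range fun j : Fin n => toL2 (dSpace φ α₀ j)) := fun j =>
      Submodule.subset_span (Or.inr ⟨j, rfl⟩)
    rintro _ ⟨i, rfl⟩
    rcases i with _ | j
    · exact Submodule.smul_mem _ _ (Submodule.add_mem _ (Submodule.subset_span (Or.inl rfl))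
        (Submodule.sum_mem _ fun j _ => Submodule.smul_mem _ _ (h1 j)))
    · exact Submodule.smul_mem _ _ (h1 j)
  · rw [Submodule.span_le]
    rintro f (hf | ⟨j, rfl⟩)
    · rw [mem_singleton_iff] at hf
      subst hf
      have h : famB φ α₀ none ∈ Submodule.span ℂ (range (famB φ α₀)) :=
        Submodule.subset_span ⟨_, rfl⟩
      have h2 := (Submodule.smul_mem_iff _ hp').mp h
      exact (Submodule.add_mem_iff_left _ (Submodule.sum_mem _ fun j _ =>
        Submodule.smul_mem _ _ (hB j))).mp h2
    · exact hB j

theorem pair_zero_mem_span {s : Set (L2 n)} {M : Submodule ℂ (L2x2 n)}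
    (h : ∀ f ∈ s, WithLp.toLp 2 (f, (0 : L2 n)) ∈ M) (f : L2 n) (hf : f ∈ Submodule.span ℂ s) :
    WithLp.toLp 2 (f, (0 : L2 n)) ∈ M := by
  induction hf using Submodule.span_induction with
  | mem f hf => exact h f hf
  | zero => exact M.zero_mem
  | add f g _ _ hf hg =>
    have := M.add_mem hf hg
    rwa [← WithLp.toLp_add, Prod.mk_add_mk, add_zero] at this
  | smul c f _ hf =>
    have := M.smul_mem c hf
    rwa [← WithLp.toLp_smul, Prod.smul_mk, smul_zero] at this

theorem zero_pair_mem_span {s : Set (L2 n)} {M : Submodule ℂ (L2x2 n)}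
    (h : ∀ f ∈ s, WithLp.toLp 2 ((0 : L2 n), f) ∈ M) (f : L2 n) (hf : f ∈ Submodule.span ℂ s) :
    WithLp.toLp 2 ((0 : L2 n), f) ∈ M := by
  induction hf using Submodule.span_induction with
  | mem f hf => exact h f hf
  | zero => exact M.zero_mem
  | add f g _ _ hf hg =>
    have := M.add_mem hf hg
    rwa [← WithLp.toLp_add, Prod.mk_add_mk, add_zero] at this
  | smul c f _ hf =>
    have := M.smul_mem c hf
    rwa [← WithLp.toLp_smul, Prod.smul_mk, smul_zero] at this

theorem mem_of_fst_snd {s t : Set (L2 n)} {M : Submodule ℂ (L2x2 n)}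
    (hs : ∀ f ∈ s, WithLp.toLp 2 (f, (0 : L2 n)) ∈ M)
    (ht : ∀ f ∈ t, WithLp.toLp 2 ((0 : L2 n), f) ∈ M) :
    prodSub (Submodule.span ℂ s) (Submodule.span ℂ t) ≤ M := by
  intro ψ hψ
  have h := M.add_mem (pair_zero_mem_span hs _ hψ.1) (zero_pair_mem_span ht _ hψ.2)
  rw [← WithLp.toLp_add, Prod.mk_add_mk, add_zero, zero_add] at h
  exact h

theorem spaceM_eq (hp : massRate φ α₀ ≠ 0) (hm : halfMass φ α₀ ≠ 0) :
    spaceM φ α₀ = rootM (famA φ α₀) (famB φ α₀) := by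
  rw [rootM, span_famA, span_famB hp hm]
  apply le_antisymm
  · rw [spaceM, Submodule.span_le]
    rintro _ ⟨i, rfl⟩
    cases i with
    | phase => exact ⟨Submodule.zero_mem _, Submodule.subset_span (Or.inl rfl)⟩
    | scaling => exact ⟨Submodule.subset_span (Or.inl rfl), Submodule.zero_mem _⟩
    | boost j => exact ⟨Submodule.zero_mem _, Submodule.subset_span (Or.inr ⟨j, rfl⟩)⟩
    | translation j => exact ⟨Submodule.subset_span (Or.inr ⟨j, rfl⟩), Submodule.zero_mem _⟩
  · refine mem_of_fst_snd ?_ ?_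
    · rintro f (hf | ⟨j, rfl⟩)
      · rw [mem_singleton_iff.mp hf]
        exact Submodule.subset_span ⟨.scaling, rfl⟩
      · exact Submodule.subset_span ⟨.translation j, rfl⟩
    · rintro f (hf | ⟨j, rfl⟩)
      · rw [mem_singleton_iff.mp hf]
        exact Submodule.subset_span ⟨.phase, rfl⟩
      · exact Submodule.subset_span ⟨.boost j, rfl⟩

theorem spaceMStar_eq (hp : massRate φ α₀ ≠ 0) (hm : halfMass φ α₀ ≠ 0) :
    spaceMStar φ α₀ = rootMStar (famA φ α₀) (famB φ α₀) := by
  rw [rootMStar, span_famA, span_famB hp hm]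
  apply le_antisymm
  · rw [spaceMStar, Submodule.span_le]
    rintro _ ⟨i, rfl⟩
    cases i with
    | phase => exact ⟨Submodule.subset_span (Or.inl rfl), Submodule.zero_mem _⟩
    | scaling => exact ⟨Submodule.zero_mem _, Submodule.subset_span (Or.inl rfl)⟩
    | boost j => exact ⟨Submodule.subset_span (Or.inr ⟨j, rfl⟩), Submodule.zero_mem _⟩
    | translation j => exact ⟨Submodule.zero_mem _, Submodule.subset_span (Or.inr ⟨j, rfl⟩)⟩
  · refine mem_of_fst_snd ?_ ?_
    · rintro f (hf | ⟨j, rfl⟩)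
      · rw [mem_singleton_iff.mp hf]
        exact Submodule.subset_span ⟨.phase, rfl⟩
      · exact Submodule.subset_span ⟨.boost j, rfl⟩
    · rintro f (hf | ⟨j, rfl⟩)
      · rw [mem_singleton_iff.mp hf]
        exact Submodule.subset_span ⟨.scaling, rfl⟩
      · exact Submodule.subset_span ⟨.translation j, rfl⟩

namespace IsSolitonFamily

theorem inner_phi_dAlpha (hφ : IsSolitonFamily β α₀ c₀ φ) {α : ℝ}
    (hα : α ∈ Ioo (α₀ - c₀) (α₀ + c₀)) :
    (inner ℂ (toL2 (φ α)) (toL2 (dAlpha φ α)) : ℂ) = massRate φ α := by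
  rw [inner_toL2 (hφ.memLp_phi hα) (hφ.memLp_dAlpha hα), massRate]
  simp only [mul_comm]

theorem inner_coord_dAlpha (hφ : IsSolitonFamily β α₀ c₀ φ) {α : ℝ}
    (hα : α ∈ Ioo (α₀ - c₀) (α₀ + c₀)) (j : Fin n) :
    (inner ℂ (toL2 fun x => x j * φ α x) (toL2 (dAlpha φ α)) : ℂ) = coordRate φ α j :=
  inner_toL2 (hφ.memLp_coord hα j) (hφ.memLp_dAlpha hα)

theorem inner_phi_dSpace (hφ : IsSolitonFamily β α₀ c₀ φ) {α : ℝ}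
    (hα : α ∈ Ioo (α₀ - c₀) (α₀ + c₀)) (j : Fin n) :
    (inner ℂ (toL2 (φ α)) (toL2 (dSpace φ α j)) : ℂ) = 0 := by
  rw [inner_toL2 (hφ.memLp_phi hα) (hφ.memLp_dSpace hα j)]
  have h := integral_mul_pd j (hφ.sol hα) (hφ.sol hα)
  rw [hφ.coe_pd hα, hφ.coe_sol hα] at h
  have h2 : ∫ x, dSpace φ α j x * φ α x = ∫ x, φ α x * dSpace φ α j x := by
    simp only [mul_comm]
  rw [h2] at h
  have h3 : ∫ x, φ α x * dSpace φ α j x = 0 := by linarith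
  rw [h3, Complex.ofReal_zero]

theorem inner_coord_dSpace (hφ : IsSolitonFamily β α₀ c₀ φ) {α : ℝ}
    (hα : α ∈ Ioo (α₀ - c₀) (α₀ + c₀)) (i j : Fin n) :
    (inner ℂ (toL2 fun x => x i * φ α x) (toL2 (dSpace φ α j)) : ℂ) =
      if i = j then -(halfMass φ α : ℂ) else 0 := by
  rw [inner_toL2 (hφ.memLp_coord hα i) (hφ.memLp_dSpace hα j)]
  have h := integral_coordMul_mul_pd i j (hφ.sol hα)
  rw [hφ.coe_pd hα, hφ.coe_coordMul hα, hφ.coe_sol hα] at h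
  rw [h]
  split_ifs
  · rw [halfMass]
    push_cast
    ring
  · exact Complex.ofReal_zero

theorem halfMass_pos (hφ : IsSolitonFamily β α₀ c₀ φ) {α : ℝ}
    (hα : α ∈ Ioo (α₀ - c₀) (α₀ + c₀)) (hp : 0 < massRate φ α) : 0 < halfMass φ α := by
  have h1 : ((∫ x, φ α x * φ α x : ℝ) : ℂ) = (‖toL2 (φ α)‖ : ℂ) ^ 2 := by
    rw [← inner_toL2 (hφ.memLp_phi hα) (hφ.memLp_phi hα)]
    exact inner_self_eq_norm_sq_to_K _
  have h2 : (∫ x, φ α x * φ α x) = ‖toL2 (φ α)‖ ^ 2 := by exact_mod_cast h1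
  have h3 : toL2 (φ α) ≠ 0 := by
    intro h
    have h4 := hφ.inner_phi_dAlpha hα
    rw [h, inner_zero_left] at h4
    have h5 : massRate φ α = 0 := by exact_mod_cast h4.symm
    exact hp.ne' h5
  rw [halfMass, h2]
  have := norm_pos_iff.mpr h3
  positivity

/-- The multiples of ∂_jφ added to ∂_αφ cancel the pairings ⟨x_jφ, ∂_αφ⟩ and do not change the image
under L₊, since L₊∂_jφ = 0. Dividing by ⟨∂_αφ, φ⟩ turns -αφ into -cφ with c = α/⟨∂_αφ, φ⟩, and
L₋(x_jφ) = -∂_jφ becomes q b_j with q = ½‖φ‖². -/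
theorem isRootSystem (hφ : IsSolitonFamily β α₀ c₀ φ) {α : ℝ}
    (hα : α ∈ Ioo (α₀ - c₀) (α₀ + c₀)) (hβ : ContDiffOn ℝ ∞ β (Ici 0)) (hα0 : 0 < α)
    (hp : 0 < massRate φ α) :
    IsRootSystem (opLminus β φ α) (opLplus β φ α) (famA φ α) (famB φ α)
      (α / massRate φ α) (halfMass φ α) := by
  have hm := hφ.halfMass_pos hα hp
  have hpc : (massRate φ α : ℂ) ≠ 0 := by exact_mod_cast hp.ne'
  have hmc : (halfMass φ α : ℂ) ≠ 0 := by exact_mod_cast hm.ne'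
  have hT : ∀ j, (toL2 (dSpace φ α j), 0) ∈ (opLplus β φ α).graph :=
    hφ.graph_translation hα hβ
  refine ⟨(hφ.isSchr hα (contDiff_nl hβ).continuous one_pos).symm_graph, ?_, div_pos hα0 hp, hm,
    ?_, hφ.graph_phase hα, ?_, ?_, ?_⟩
  · rw [opLplus_eq hβ]
    exact (hφ.isSchr hα (contDiff_nlp hβ).continuous one_pos).symm_graph
  · rintro (_ | i) (_ | j)
    · simp only [famA, famB, inner_smul_right, inner_add_right, inner_sum, hφ.inner_phi_dAlpha hα,
        hφ.inner_phi_dSpace hα, mul_zero, Finset.sum_const_zero, add_zero, Complex.ofReal_inv]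
      rw [inv_mul_cancel₀ hpc, if_true]
    · simp only [famA, famB, inner_smul_right, hφ.inner_phi_dSpace hα, mul_zero]
      rw [if_neg (by simp)]
    · simp only [famA, famB, inner_smul_right, inner_add_right, inner_sum,
        hφ.inner_coord_dAlpha hα, hφ.inner_coord_dSpace hα, mul_ite, mul_zero,
        Finset.sum_ite_eq, Finset.mem_univ, if_true]
      rw [if_neg (by simp)]
      push_cast
      field_simp
      ring
    · simp only [famA, famB, inner_smul_right, hφ.inner_coord_dSpace hα, mul_ite, mul_zero,
        Option.some.injEq]
      split_ifs
      · push_cast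
        field_simp
      · rfl
  · intro j
    have h1 := hφ.graph_boost hα j
    have h2 : -toL2 (dSpace φ α j) = (halfMass φ α : ℂ) • famB φ α (some j) := by
      rw [famB, smul_smul]
      push_cast
      rw [mul_neg, mul_inv_cancel₀ hmc, neg_one_smul]
    rw [h2] at h1
    exact h1
  · have h1 := hφ.graph_scaling hα hβ
    have h2 : (∑ j, ((coordRate φ α j * (halfMass φ α)⁻¹ : ℝ) : ℂ) • toL2 (dSpace φ α j), 0) ∈
        (opLplus β φ α).graph := by
      rw [← mem_opKer_iff_graph]
      exact Submodule.sum_mem _ fun j _ => Submodule.smul_mem _ _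
        ((mem_opKer_iff_graph _ _).mpr (hT j))
    have h3 := graph_smul _ (((massRate φ α)⁻¹ : ℝ) : ℂ) (graph_add _ h1 h2)
    rw [add_zero, smul_smul] at h3
    have h4 : -((α / massRate φ α : ℝ) : ℂ) = (((massRate φ α)⁻¹ : ℝ) : ℂ) * -(α : ℂ) := by
      push_cast
      field_simp
    rw [h4]
    exact h3
  · intro j
    have h3 := graph_smul _ ((-(halfMass φ α)⁻¹ : ℝ) : ℂ) (hT j)
    rw [smul_zero] at h3
    exact h3

/-- Bootstrap in L₊∂_αφ = -αφ: the right side is Schwartz, and each use of elliptic regularity gains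
two derivatives, starting from L². -/
theorem en_dAlpha_lt_top (hφ : IsSolitonFamily β α₀ c₀ φ) {α : ℝ}
    (hα : α ∈ Ioo (α₀ - c₀) (α₀ + c₀)) (hβ : ContDiffOn ℝ ∞ β (Ici 0)) (hβ0 : β 0 = 0)
    (hα0 : 0 < α) (s : ℝ) : en s (toL2 (dAlpha φ α)) < ⊤ := by
  have hκ : 0 < α ^ 2 / 2 := by positivity
  have hL := hφ.isSchr hα (contDiff_nlp hβ).continuous hκ
  have hW := hφ.sobBounded_potOp hα (contDiff_nlp hβ) (nlp_zero hβ0)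
  have hg := hφ.graph_scaling hα hβ
  rw [opLplus_eq hβ] at hg
  have hy : ∀ s, en s (-(α : ℂ) • toL2 (φ α)) < ⊤ := fun s => by
    have h1 : -(α : ℂ) • toL2 (φ α) = toL2 ((-α) • hφ.sol hα : 𝓢(E n, ℝ)) := by
      have h2 := toL2_smul (hφ.memLp_phi hα) (-α)
      rw [Complex.ofReal_neg] at h2
      exact h2.symm
    rw [h1]
    exact en_toL2_schwartz_lt_top s _
  have key : ∀ k : ℕ, en (2 * k : ℝ) (toL2 (dAlpha φ α)) < ⊤ := by
    intro k
    induction k with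
    | zero => simpa using en_zero_lt_top _
    | succ k ih =>
      obtain ⟨C, hC⟩ := hL.exists_en_graph_le hκ hW (2 * k : ℝ)
      have h := (hC _ _ hg).2
      have e : (2 * (k + 1 : ℕ) : ℝ) = 2 * k + 2 := by push_cast; ring
      rw [e]
      exact h.trans_lt (ENNReal.mul_lt_top ENNReal.coe_lt_top (ENNReal.add_lt_top.mpr ⟨hy _, ih⟩))
  obtain ⟨k, hk⟩ := exists_nat_ge (s / 2)
  exact (en_mono (by linarith) _).trans_lt (key k)

end IsSolitonFamily

end RootFamilies

/-! ### Orthogonality conditions, independence and dimension -/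

section Constraint

variable {X : Type*} [NormedAddCommGroup X] [InnerProductSpace ℂ X] {ι : Type*}

/-- The vectors `f` with `R f` orthogonal to all `a i`. -/
def constraint (R : X →L[ℂ] X) (a : ι → X) : Submodule ℂ X :=
  (Submodule.span ℂ (range a))ᗮ.comap (R : X →ₗ[ℂ] X)

theorem mem_constraint {R : X →L[ℂ] X} {a : ι → X} {f : X} :
    f ∈ constraint R a ↔ ∀ i, (inner ℂ (a i) (R f) : ℂ) = 0 :=
  mem_span_range_orthogonal a (R f)

theorem isClosed_constraint (R : X →L[ℂ] X) (a : ι → X) :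
    IsClosed (constraint R a : Set X) :=
  (Submodule.isClosed_orthogonal _).preimage R.continuous

theorem eq_zero_of_biorthogonal [Fintype ι] [DecidableEq ι] {a b : ι → X}
    (h : ∀ i j, (inner ℂ (a i) (b j) : ℂ) = if i = j then 1 else 0) {y : X}
    (hy : y ∈ Submodule.span ℂ (range b)) (hy0 : ∀ i, (inner ℂ (a i) y : ℂ) = 0) : y = 0 := by
  rw [eq_sum_of_mem_span a b h y hy]
  simp [hy0]

theorem linearIndependent_of_biorthogonal [Fintype ι] [DecidableEq ι] {a b : ι → X}
    (h : ∀ i j, (inner ℂ (a i) (b j) : ℂ) = if i = j then 1 else 0) : LinearIndependent ℂ b := by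
  rw [Fintype.linearIndependent_iff]
  intro g hg i
  have h1 : (inner ℂ (a i) (∑ j, g j • b j) : ℂ) = g i := by
    simp only [inner_sum, inner_smul_right, h, mul_ite, mul_one, mul_zero, Finset.sum_ite_eq,
      Finset.mem_univ, if_true]
  rw [← h1, hg, inner_zero_right]

theorem finrank_prodSub (p q : Submodule ℂ X) [FiniteDimensional ℂ p] [FiniteDimensional ℂ q] :
    Module.finrank ℂ (prodSub p q) = Module.finrank ℂ p + Module.finrank ℂ q := by
  rw [← Module.finrank_prod]
  exact LinearEquiv.finrank_eq
    { toFun := fun ψ => (⟨ψ.1.fst, ψ.2.1⟩, ⟨ψ.1.snd, ψ.2.2⟩)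
      invFun := fun ψ => ⟨WithLp.toLp 2 (ψ.1.1, ψ.2.1), ψ.1.2, ψ.2.2⟩
      map_add' := fun _ _ => rfl
      map_smul' := fun _ _ => rfl
      left_inv := fun _ => rfl
      right_inv := fun _ => rfl }

end Constraint

section RootIndexCard

/-- The labels as two copies of the labels of `famA`. -/
def rootIndexEquiv (n : ℕ) : RootIndex n ≃ Option (Fin n) ⊕ Option (Fin n) where
  toFun
    | .phase => Sum.inl none
    | .scaling => Sum.inr none
    | .boost j => Sum.inl (some j)
    | .translation j => Sum.inr (some j)
  invFun
    | Sum.inl none => .phase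
    | Sum.inr none => .scaling
    | Sum.inl (some j) => .boost j
    | Sum.inr (some j) => .translation j
  left_inv i := by cases i <;> rfl
  right_inv i := by rcases i with (_ | _) | (_ | _) <;> rfl

/-- There are 2n + 2 labels, so a span of that dimension leaves no room for a relation. This
transfers independence from the biorthogonal families to the original vectors. -/
theorem linearIndependent_of_finrank_span {n : ℕ} {V : Type*} [AddCommGroup V] [Module ℂ V]
    (v : RootIndex n → V) (h : Module.finrank ℂ (Submodule.span ℂ (range v)) = 2 * n + 2) :
    LinearIndependent ℂ v := by
  have : Fintype (RootIndex n) := Fintype.ofEquiv _ (rootIndexEquiv n).symm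
  rw [linearIndependent_iff_card_eq_finrank_span, Set.finrank, h,
    Fintype.card_congr (rootIndexEquiv n)]
  simp
  ring

theorem finrank_rootM {n : ℕ} {a b : Option (Fin n) → L2 n}
    (h : ∀ i j, (inner ℂ (a i) (b j) : ℂ) = if i = j then 1 else 0) :
    Module.finrank ℂ (rootM a b) = 2 * n + 2 ∧ Module.finrank ℂ (rootMStar a b) = 2 * n + 2 := by
  have ha := finrank_span_eq_card (linearIndependent_of_biorthogonal (biorth_symm h))
  have hb := finrank_span_eq_card (linearIndependent_of_biorthogonal h)
  rw [Fintype.card_option, Fintype.card_fin] at ha hb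
  have : FiniteDimensional ℂ (Submodule.span ℂ (range a)) :=
    FiniteDimensional.span_of_finite ℂ (finite_range a)
  have : FiniteDimensional ℂ (Submodule.span ℂ (range b)) :=
    FiniteDimensional.span_of_finite ℂ (finite_range b)
  constructor
  · rw [rootM, finrank_prodSub, ha, hb]
    ring
  · rw [rootMStar, finrank_prodSub, ha, hb]
    ring

end RootIndexCard

/-! ### Coercivity at α₀ and for nearby parameters -/

section Soliton

variable {n : ℕ} {β : ℝ → ℝ} {φ : ℝ → E n → ℝ} {α₀ c₀ : ℝ}

namespace IsSolitonFamily

theorem isSchr_minus (hφ : IsSolitonFamily β α₀ c₀ φ) {α : ℝ}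
    (hα : α ∈ Ioo (α₀ - c₀) (α₀ + c₀)) (hβ : ContDiffOn ℝ ∞ β (Ici 0)) {κ : ℝ} (hκ : 0 < κ) :
    IsSchr (resRoot n κ) (potOp (nl β) φ κ α) (opLminus β φ α) :=
  hφ.isSchr hα (contDiff_nl hβ).continuous hκ

theorem isSchr_plus (hφ : IsSolitonFamily β α₀ c₀ φ) {α : ℝ}
    (hα : α ∈ Ioo (α₀ - c₀) (α₀ + c₀)) (hβ : ContDiffOn ℝ ∞ β (Ici 0)) {κ : ℝ} (hκ : 0 < κ) :
    IsSchr (resRoot n κ) (potOp (nlp β) φ κ α) (opLplus β φ α) := by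
  rw [opLplus_eq hβ]
  exact hφ.isSchr hα (contDiff_nlp hβ).continuous hκ

theorem en_famA_lt_top (hφ : IsSolitonFamily β α₀ c₀ φ) {α : ℝ}
    (hα : α ∈ Ioo (α₀ - c₀) (α₀ + c₀)) (s : ℝ) (i : Option (Fin n)) :
    en s (famA φ α i) < ⊤ := by
  rcases i with _ | j
  · exact en_toL2_schwartz_lt_top s (hφ.sol hα)
  · rw [famA, ← hφ.coe_coordMul hα]
    exact en_toL2_schwartz_lt_top s _

theorem en_famB_lt_top (hφ : IsSolitonFamily β α₀ c₀ φ) {α : ℝ}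
    (hα : α ∈ Ioo (α₀ - c₀) (α₀ + c₀)) (hβ : ContDiffOn ℝ ∞ β (Ici 0)) (hβ0 : β 0 = 0)
    (hα0 : 0 < α) (s : ℝ) (i : Option (Fin n)) : en s (famB φ α i) < ⊤ := by
  have hsmul : ∀ (c : ℂ) (f : L2 n), en s f < ⊤ → en s (c • f) < ⊤ := fun c f hf => by
    rw [en_smul]
    exact ENNReal.mul_lt_top (ENNReal.pow_lt_top enorm_lt_top) hf
  have hadd : ∀ f g : L2 n, en s f < ⊤ → en s g < ⊤ → en s (f + g) < ⊤ := fun f g hf hg =>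
    (en_add_le s f g).trans_lt (ENNReal.add_lt_top.mpr
      ⟨ENNReal.mul_lt_top (by simp) hf, ENNReal.mul_lt_top (by simp) hg⟩)
  have hd : ∀ j, en s (toL2 (dSpace φ α j)) < ⊤ := fun j => by
    rw [← hφ.coe_pd hα]
    exact en_toL2_schwartz_lt_top s _
  rcases i with _ | j
  · refine hsmul _ _ (hadd _ _ (hφ.en_dAlpha_lt_top hα hβ hβ0 hα0 s) ?_)
    refine Finset.sum_induction _ (fun f => en s f < ⊤) hadd ?_ fun j _ => hsmul _ _ (hd j)
    rw [en_zero]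
    exact ENNReal.zero_lt_top
  · exact hsmul _ _ (hd j)

/-- The kernels are those of the spectral assumption, and the solvability conditions come from the
Fredholm alternative with the compact potential at κ = α₀²/2. -/
theorem isFull (hφ : IsSolitonFamily β α₀ c₀ φ) (hα : α₀ ∈ Ioo (α₀ - c₀) (α₀ + c₀))
    (hβ : ContDiffOn ℝ ∞ β (Ici 0)) (hβ0 : β 0 = 0) (hα0 : 0 < α₀)
    (hL : SpectralAssumption β φ α₀) :
    IsRootSystem.IsFull (opLminus β φ α₀) (opLplus β φ α₀) (famA φ α₀) (famB φ α₀) := by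
  have hκ : 0 < α₀ ^ 2 / 2 := by positivity
  have hm := hφ.halfMass_pos hα hL.convexity
  have hm' : ((-(halfMass φ α₀)⁻¹ : ℝ) : ℂ) ≠ 0 := by
    exact_mod_cast neg_ne_zero.mpr (inv_ne_zero hm.ne')
  have hspan : opKer (opLplus β φ α₀) ≤
      Submodule.span ℂ (range fun j => famB φ α₀ (some j)) := by
    rw [hL.ker_plus, Submodule.span_le]
    rintro _ ⟨j, rfl⟩
    have h : famB φ α₀ (some j) ∈ Submodule.span ℂ (range fun j => famB φ α₀ (some j)) :=
      Submodule.subset_span ⟨_, rfl⟩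
    exact (Submodule.smul_mem_iff _ hm').mp h
  refine ⟨fun x hx => ?_, fun x hx => ?_, fun y hy => ?_, fun y hy => ?_⟩
  · rw [← mem_opKer_iff_graph, hL.ker_minus] at hx
    exact hx
  · exact hspan ((mem_opKer_iff_graph _ _).mpr hx)
  · have hfin : FiniteDimensional ℂ (opKer (opLminus β φ α₀)) := by
      rw [hL.ker_minus]
      exact FiniteDimensional.span_of_finite ℂ (finite_singleton _)
    obtain ⟨x, hx⟩ := (hφ.isSchr_minus hα hβ hκ).exists_solution
      (hφ.isCompactOperator_potOp hα (contDiff_nl hβ) (nl_zero hβ0) hα0) hfin y (by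
        rw [hL.ker_minus, Submodule.mem_orthogonal_singleton_iff_inner_right]
        exact hy)
    exact ⟨x, (LinearPMap.mem_graph_iff _).mpr ⟨x, rfl, hx⟩⟩
  · have hfin : FiniteDimensional ℂ (opKer (opLplus β φ α₀)) := by
      rw [hL.ker_plus]
      exact FiniteDimensional.span_of_finite ℂ (finite_range _)
    obtain ⟨x, hx⟩ := (hφ.isSchr_plus hα hβ hκ).exists_solution
      (hφ.isCompactOperator_potOp hα (contDiff_nlp hβ) (nlp_zero hβ0) hα0) hfin y
      (Submodule.orthogonal_le hspan ((mem_span_range_orthogonal _ _).mpr hy))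
    exact ⟨x, (LinearPMap.mem_graph_iff _).mpr ⟨x, rfl, hx⟩⟩

theorem exists_coercive_minus (hφ : IsSolitonFamily β α₀ c₀ φ)
    (hα : α₀ ∈ Ioo (α₀ - c₀) (α₀ + c₀)) (hβ : ContDiffOn ℝ ∞ β (Ici 0)) (hβ0 : β 0 = 0)
    (hα0 : 0 < α₀) (hL : SpectralAssumption β φ α₀) :
    ∃ c : ℝ, 0 < c ∧ ∀ f, (∀ i, (inner ℂ (famB φ α₀ i) (resRoot n (α₀ ^ 2 / 2) f) : ℂ) = 0) →
      c * ‖f‖ ^ 2 ≤ qf (formOp (resRoot n (α₀ ^ 2 / 2)) (potOp (nl β) φ (α₀ ^ 2 / 2) α₀)) f := by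
  have hκ : 0 < α₀ ^ 2 / 2 := by positivity
  have hr := hφ.isRootSystem hα hβ hα0 hL.convexity
  obtain ⟨c, hc, h⟩ := (hφ.isSchr_minus hα hβ hκ).exists_coercive_of_nonneg
    (hφ.isCompactOperator_potOp hα (contDiff_nl hβ) (nl_zero hβ0) hα0) hL.nonneg_minus
    (constraint (resRoot n (α₀ ^ 2 / 2)) (famB φ α₀)) (isClosed_constraint _ _)
    fun f hf hker => by
      rw [hL.ker_minus] at hker
      exact eq_zero_of_biorthogonal (biorth_symm hr.biorth)
        (Submodule.span_mono (singleton_subset_iff.mpr (mem_range_self none)) hker) (mem_constraint.mp hf)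
  exact ⟨c, hc, fun f hf => h f (mem_constraint.mpr hf)⟩

theorem exists_coercive_plus (hφ : IsSolitonFamily β α₀ c₀ φ)
    (hα : α₀ ∈ Ioo (α₀ - c₀) (α₀ + c₀)) (hβ : ContDiffOn ℝ ∞ β (Ici 0)) (hβ0 : β 0 = 0)
    (hα0 : 0 < α₀) (hL : SpectralAssumption β φ α₀) :
    ∃ c : ℝ, 0 < c ∧ ∀ f, (∀ i, (inner ℂ (famA φ α₀ i) (resRoot n (α₀ ^ 2 / 2) f) : ℂ) = 0) →
      c * ‖f‖ ^ 2 ≤ qf (formOp (resRoot n (α₀ ^ 2 / 2)) (potOp (nlp β) φ (α₀ ^ 2 / 2) α₀)) f := by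
  have hκ : 0 < α₀ ^ 2 / 2 := by positivity
  have hr := hφ.isRootSystem hα hβ hα0 hL.convexity
  have hfull := hφ.isFull hα hβ hβ0 hα0 hL
  obtain ⟨E₁, -, ⟨ψ, hψpos, hψ⟩, huniq⟩ := hL.neg_eigenvalue
  have hψ0 : ψ ≠ 0 := by
    rintro rfl
    have h1 : ∀ᵐ _ : E n, False := by
      filter_upwards [hψpos, Lp.coeFn_zero ℂ 2 (volume : Measure (E n))] with x ⟨r, hr, h2⟩ h3
      rw [h3] at h2
      have h4 : (0 : ℂ) = (r : ℂ) := h2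
      have h5 : (0 : ℝ) = r := by exact_mod_cast h4
      exact hr.ne h5
    exact h1.exists.elim fun _ h => h
  obtain ⟨g, hg1, hg2⟩ := (LinearPMap.mem_graph_iff _).mp hr.T_none
  obtain ⟨c, hc, h⟩ := (hφ.isSchr_plus hα hβ hκ).exists_coercive_of_neg_eigenvalue
    (hφ.isCompactOperator_potOp hα (contDiff_nlp hβ) (nlp_zero hβ0) hα0) E₁ ψ hψ0
    (hψ ▸ Submodule.mem_span_singleton_self ψ)
    (fun E₂ hE₂ => by
      by_cases hb : opKer (opShift (opLplus β φ α₀) E₂) = ⊥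
      · rw [hb]
        exact bot_le
      · rw [huniq E₂ hE₂ hb, hψ])
    -- The vector with a negative value of the form is b_none: it satisfies L₊b_none = -cφ, and
    -- biorthogonality makes ⟨φ, b_none⟩ = 1. The orthogonality to the x_jφ serves only to exclude
    -- the kernel.
    g (famA φ α₀ none) _ 1 hr.c_pos one_pos (by rw [hg2, neg_smul])
    (by rw [hg1, hr.biorth, if_pos rfl, Complex.ofReal_one])
    (constraint (resRoot n (α₀ ^ 2 / 2)) (famA φ α₀)) (isClosed_constraint _ _)
    (fun f hf => mem_constraint.mp hf none)
    fun f hf hker => eq_zero_of_biorthogonal hr.biorth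
      (Submodule.span_mono (range_comp_subset_range some (famB φ α₀))
        (hfull.ker_T _ ((mem_opKer_iff_graph _ _).mp hker))) (mem_constraint.mp hf)
  exact ⟨c, hc, fun f hf => h f (mem_constraint.mpr hf)⟩

theorem tendsto_massRate (hφ : IsSolitonFamily β α₀ c₀ φ) {α : ℝ}
    (hα : α ∈ Ioo (α₀ - c₀) (α₀ + c₀)) :
    Tendsto (massRate φ) (𝓝 α) (𝓝 (massRate φ α)) := by
  have h := (Complex.continuous_re.tendsto _).comp ((hφ.tendsto_phi hα).inner (𝕜 := ℂ)
    (hφ.tendsto_dAlpha hα))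
  rw [hφ.inner_phi_dAlpha hα, Complex.ofReal_re] at h
  refine h.congr' ?_
  filter_upwards [isOpen_Ioo.mem_nhds hα] with t ht
  rw [Function.comp_apply, hφ.inner_phi_dAlpha ht, Complex.ofReal_re]

theorem tendsto_coordRate (hφ : IsSolitonFamily β α₀ c₀ φ) {α : ℝ}
    (hα : α ∈ Ioo (α₀ - c₀) (α₀ + c₀)) (j : Fin n) :
    Tendsto (fun t => coordRate φ t j) (𝓝 α) (𝓝 (coordRate φ α j)) := by
  have h := (Complex.continuous_re.tendsto _).comp ((hφ.tendsto_coord hα j).inner (𝕜 := ℂ)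
    (hφ.tendsto_dAlpha hα))
  rw [hφ.inner_coord_dAlpha hα, Complex.ofReal_re] at h
  refine h.congr' ?_
  filter_upwards [isOpen_Ioo.mem_nhds hα] with t ht
  rw [Function.comp_apply, hφ.inner_coord_dAlpha ht, Complex.ofReal_re]

theorem tendsto_halfMass (hφ : IsSolitonFamily β α₀ c₀ φ) {α : ℝ}
    (hα : α ∈ Ioo (α₀ - c₀) (α₀ + c₀)) :
    Tendsto (halfMass φ) (𝓝 α) (𝓝 (halfMass φ α)) := by
  have h := (Complex.continuous_re.tendsto _).comp ((hφ.tendsto_phi hα).inner (𝕜 := ℂ)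
    (hφ.tendsto_phi hα))
  rw [inner_toL2 (hφ.memLp_phi hα) (hφ.memLp_phi hα), Complex.ofReal_re] at h
  refine (h.congr' ?_).const_mul (1 / 2)
  filter_upwards [isOpen_Ioo.mem_nhds hα] with t ht
  rw [Function.comp_apply, inner_toL2 (hφ.memLp_phi ht) (hφ.memLp_phi ht), Complex.ofReal_re]

theorem tendsto_famA (hφ : IsSolitonFamily β α₀ c₀ φ) {α : ℝ}
    (hα : α ∈ Ioo (α₀ - c₀) (α₀ + c₀)) (i : Option (Fin n)) :
    Tendsto (fun t => famA φ t i) (𝓝 α) (𝓝 (famA φ α i)) := by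
  rcases i with _ | j
  · exact hφ.tendsto_phi hα
  · exact hφ.tendsto_coord hα j

theorem tendsto_famB (hφ : IsSolitonFamily β α₀ c₀ φ) {α : ℝ}
    (hα : α ∈ Ioo (α₀ - c₀) (α₀ + c₀)) (hp : 0 < massRate φ α) (i : Option (Fin n)) :
    Tendsto (fun t => famB φ t i) (𝓝 α) (𝓝 (famB φ α i)) := by
  have hm := (hφ.tendsto_halfMass hα).inv₀ (hφ.halfMass_pos hα hp).ne'
  have hof : ∀ {f : ℝ → ℝ} {r : ℝ}, Tendsto f (𝓝 α) (𝓝 r) →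
      Tendsto (fun t => (f t : ℂ)) (𝓝 α) (𝓝 (r : ℂ)) := fun h =>
    (Complex.continuous_ofReal.tendsto _).comp h
  rcases i with _ | j
  · exact (hof ((hφ.tendsto_massRate hα).inv₀ hp.ne')).smul ((hφ.tendsto_dAlpha hα).add
      (tendsto_finsetSum _ fun j _ =>
        (hof ((hφ.tendsto_coordRate hα j).mul hm)).smul (hφ.tendsto_dSpace hα j)))
  · exact (hof hm.neg).smul (hφ.tendsto_dSpace hα j)

theorem tendsto_formOp (hφ : IsSolitonFamily β α₀ c₀ φ) {α : ℝ}
    (hα : α ∈ Ioo (α₀ - c₀) (α₀ + c₀)) {g : ℝ → ℝ} (hg : Continuous g) (κ : ℝ) :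
    Tendsto (fun t => formOp (resRoot n κ) (potOp g φ κ t)) (𝓝 α)
      (𝓝 (formOp (resRoot n κ) (potOp g φ κ α))) := by
  have h : Continuous fun W : L2 n →L[ℂ] L2 n => formOp (resRoot n κ) W :=
    continuous_const.add (continuous_const.clm_comp (continuous_id.clm_comp continuous_const))
  exact (h.tendsto _).comp (hφ.tendsto_potOp hα hg κ)

/-- The structure at `α₀` persists, with uniform constants, for nearby parameters. -/
theorem eventually_coercive_forms (hφ : IsSolitonFamily β α₀ c₀ φ)
    (hα : α₀ ∈ Ioo (α₀ - c₀) (α₀ + c₀)) (hβ : ContDiffOn ℝ ∞ β (Ici 0)) (hβ0 : β 0 = 0)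
    (hα0 : 0 < α₀) (hL : SpectralAssumption β φ α₀) :
    ∃ c₁ C₂ : ℝ, 0 < c₁ ∧ ∀ᶠ α in 𝓝 α₀, α ∈ Ioo (α₀ - c₀) (α₀ + c₀) ∧ 0 < α ∧
      0 < massRate φ α ∧
      (∀ f, (∀ i, (inner ℂ (famA φ α i) (resRoot n (α₀ ^ 2 / 2) f) : ℂ) = 0) →
        c₁ * ‖f‖ ^ 2 ≤ qf (formOp (resRoot n (α₀ ^ 2 / 2)) (potOp (nlp β) φ (α₀ ^ 2 / 2) α)) f) ∧
      (∀ f, (∀ i, (inner ℂ (famB φ α i) (resRoot n (α₀ ^ 2 / 2) f) : ℂ) = 0) →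
        c₁ * ‖f‖ ^ 2 ≤ qf (formOp (resRoot n (α₀ ^ 2 / 2)) (potOp (nl β) φ (α₀ ^ 2 / 2) α)) f) ∧
      ‖formOp (resRoot n (α₀ ^ 2 / 2)) (potOp (nlp β) φ (α₀ ^ 2 / 2) α)‖ ≤ C₂ ∧
      ‖formOp (resRoot n (α₀ ^ 2 / 2)) (potOp (nl β) φ (α₀ ^ 2 / 2) α)‖ ≤ C₂ := by
  have hκ : 0 < α₀ ^ 2 / 2 := by positivity
  have hr := hφ.isRootSystem hα hβ hα0 hL.convexity
  have hS := hφ.isSchr_minus hα hβ hκ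
  have hT := hφ.isSchr_plus hα hβ hκ
  have hfT := hφ.tendsto_formOp hα (contDiff_nlp hβ).continuous (α₀ ^ 2 / 2)
  have hfS := hφ.tendsto_formOp hα (contDiff_nl hβ).continuous (α₀ ^ 2 / 2)
  obtain ⟨cS, hcS, h1⟩ := hφ.exists_coercive_minus hα hβ hβ0 hα0 hL
  obtain ⟨cT, hcT, h2⟩ := hφ.exists_coercive_plus hα hβ hβ0 hα0 hL
  have hA : ∀ i, ∃ f, resRoot n (α₀ ^ 2 / 2) f = famA φ α₀ i := by
    intro i
    have h : famA φ α₀ i ∈ (opLminus β φ α₀).domain := by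
      rcases i with _ | j
      · exact LinearPMap.mem_domain_of_mem_graph hr.S_none
      · exact LinearPMap.mem_domain_of_mem_graph (hr.S_some j)
    obtain ⟨f, hf⟩ := (hS.mem_domain _).mp h
    exact ⟨_, hf⟩
  have hB : ∀ i, ∃ f, resRoot n (α₀ ^ 2 / 2) f = famB φ α₀ i := by
    intro i
    have h : famB φ α₀ i ∈ (opLplus β φ α₀).domain := by
      rcases i with _ | j
      · exact LinearPMap.mem_domain_of_mem_graph hr.T_none
      · exact LinearPMap.mem_domain_of_mem_graph (hr.T_some j)
    obtain ⟨f, hf⟩ := (hT.mem_domain _).mp h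
    exact ⟨_, hf⟩
  -- The dual vectors required by the perturbation lemma: R-preimages of the b's for the conditions
  -- given by the a's, and conversely. They exist because both families lie in the operator domains,
  -- which are contained in Ran R.
  choose fA hfA using hA
  choose fB hfB using hB
  have e1 := eventually_coercive (resRoot n (α₀ ^ 2 / 2)) _ _ hfT (famA φ) (famA φ α₀) fB
    (hφ.tendsto_famA hα) (fun i j => by rw [hfB, hr.biorth]) hcT h2
  have e2 := eventually_coercive (resRoot n (α₀ ^ 2 / 2)) _ _ hfS (famB φ) (famB φ α₀) fA
    (hφ.tendsto_famB hα hL.convexity) (fun i j => by rw [hfA, biorth_symm hr.biorth]) hcS h1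
  obtain ⟨B₁, e3⟩ : ∃ B, ∀ᶠ t in 𝓝 α₀,
      ‖formOp (resRoot n (α₀ ^ 2 / 2)) (potOp (nlp β) φ (α₀ ^ 2 / 2) t)‖ ≤ B :=
    ⟨_, hfT.norm.eventually_le_const (lt_add_one _)⟩
  obtain ⟨B₂, e4⟩ : ∃ B, ∀ᶠ t in 𝓝 α₀,
      ‖formOp (resRoot n (α₀ ^ 2 / 2)) (potOp (nl β) φ (α₀ ^ 2 / 2) t)‖ ≤ B :=
    ⟨_, hfS.norm.eventually_le_const (lt_add_one _)⟩
  have hmin : 0 < min (cT / 2) (cS / 2) := lt_min (half_pos hcT) (half_pos hcS)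
  refine ⟨min (cT / 2) (cS / 2), max B₁ B₂, hmin, ?_⟩
  filter_upwards [e1, e2, e3, e4, isOpen_Ioo.mem_nhds hα, lt_mem_nhds hα0,
    (hφ.tendsto_massRate hα).eventually (lt_mem_nhds hL.convexity)] with t t1 t2 t3 t4 t5 t6 t7
  refine ⟨t5, t6, t7, fun f hf => (t1 f hf).trans' ?_, fun f hf => (t2 f hf).trans' ?_,
    t3.trans (le_max_left _ _), t4.trans (le_max_right _ _)⟩
  · gcongr
    exact min_le_left _ _
  · gcongr
    exact min_le_right _ _

end IsSolitonFamily

end Soliton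

end

end NLS

/-! ### The main theorem -/

theorem mainTheorem6 (n : ℕ) (hn : 3 ≤ n)
    (β : ℝ → ℝ) (hβ : ContDiffOn ℝ ∞ β (Set.Ici 0)) (hβ0 : β 0 = 0)
    (φ : ℝ → E n → ℝ) (α₀ c₀ : ℝ) (hα₀ : 0 < α₀) (hc₀ : 0 < c₀)
    (hφ : IsSolitonFamily β α₀ c₀ φ) (hL : SpectralAssumption β φ α₀) :
    -- the spectrum is real, only `0` has a generalized eigenspace, `Ran A²` is closed
    (∀ z ∈ opSpectrum (opA β φ α₀), z.im = 0) ∧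
    (∀ z : ℂ, (∃ k : ℕ, 1 ≤ k ∧
      opKer (opPow (opShift (opA β φ α₀) z) k) ≠ opKer (opShift (opA β φ α₀) z)) ↔ z = 0) ∧
    IsClosed (opRange (opPow (opA β φ α₀) 2) : Set (L2x2 n)) ∧
    -- stability of `exp (i t A)` on the orthogonal complement of `M_*`
    (∃ U : ℝ → L2x2 n →L[ℂ] L2x2 n, IsC0Group U (Complex.I • opA β φ α₀) ∧
      (∀ s : ℝ, ∃ C : ℝ≥0, StableOn U (spaceMStar φ α₀) s C) ∧
      LinearStability U (opA β φ α₀) (opA β φ α₀).adjoint (α₀ ^ 2 / 2)) ∧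
    -- stability of `exp (i t A*)` on the orthogonal complement of `M`
    (∃ U : ℝ → L2x2 n →L[ℂ] L2x2 n, IsC0Group U (Complex.I • (opA β φ α₀).adjoint) ∧
      ∀ s : ℝ, ∃ C : ℝ≥0, StableOn U (spaceM φ α₀) s C) ∧
    -- the `H¹` constant is locally uniform in the parameter
    (∃ δ : ℝ, 0 < δ ∧ δ ≤ c₀ ∧ ∃ C : ℝ → ℝ≥0, ∀ α : ℝ, |α - α₀| < δ → C α < 2 * C α₀ ∧
      ∃ U : ℝ → L2x2 n →L[ℂ] L2x2 n, IsC0Group U (Complex.I • opA β φ α) ∧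
        StableOn U (spaceMStar φ α) 1 (C α)) ∧
    -- structure of the root spaces
    rootSpace (opA β φ α₀) = spaceM φ α₀ ∧
    rootSpace (opA β φ α₀).adjoint = spaceMStar φ α₀ ∧
    LinearIndependent ℂ (rootVec φ α₀) ∧
    LinearIndependent ℂ (rootVecStar φ α₀) ∧
    Module.finrank ℂ (rootSpace (opA β φ α₀)) = 2 * n + 2 ∧
    Module.finrank ℂ (rootSpace (opA β φ α₀).adjoint) = 2 * n + 2 ∧
    opKer (opPow (opA β φ α₀) 2) = opKer (opPow (opA β φ α₀) 3) ∧
    opKer (opPow (opA β φ α₀).adjoint 2) = opKer (opPow (opA β φ α₀).adjoint 3) := by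
  have hα : α₀ ∈ Ioo (α₀ - c₀) (α₀ + c₀) := ⟨by linarith, by linarith⟩
  have hκ : 0 < α₀ ^ 2 / 2 := by positivity
  have hr := hφ.isRootSystem hα hβ hα₀ hL.convexity
  have hf := hφ.isFull hα hβ hβ0 hα₀ hL
  have hS := hφ.isSchr_minus hα hβ hκ
  have hT := hφ.isSchr_plus hα hβ hκ
  have hm := hφ.halfMass_pos hα hL.convexity
  have hM := spaceM_eq (φ := φ) (α₀ := α₀) (ne_of_gt hL.convexity) hm.ne'
  have hMS := spaceMStar_eq (φ := φ) (α₀ := α₀) (ne_of_gt hL.convexity) hm.ne'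
  have hadj : (opA β φ α₀).adjoint = offDiagonal (opLplus β φ α₀) (opLminus β φ α₀) :=
    adjoint_offDiagonal hS hT
  obtain ⟨c₁, C₂, hc₁, hev⟩ := hφ.eventually_coercive_forms hα hβ hβ0 hα₀ hL
  obtain ⟨-, -, -, hcT, hcS, hCT, hCS⟩ := hev.self_of_nhds
  obtain ⟨U, hU⟩ := exists_isC0Group_offDiagonal hκ hS hT
  have hst1 : IsStable U (rootMStar (famA φ α₀) (famB φ α₀)) 1 :=
    ⟨_, fun t ψ hψ => hr.en2_one_le hκ hU hS hT hc₁ hcT hcS hCT hCS t ψ hψ⟩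
  have hst : ∀ s, IsStable U (rootMStar (famA φ α₀) (famB φ α₀)) s := fun s => by
    obtain ⟨C, hC⟩ := hr.exists_en2_le hκ hU hS hT
      (hφ.sobBounded_potOp hα (contDiff_nl hβ) (nl_zero hβ0))
      (hφ.sobBounded_potOp hα (contDiff_nlp hβ) (nlp_zero hβ0))
      (hφ.en_famA_lt_top hα) (hφ.en_famB_lt_top hα hβ hβ0 hα₀) hst1 s
    refine ⟨C, fun t ψ hψ => ?_⟩
    have h := hC t ψ
    rwa [rootProj_eq_self hψ] at h
  obtain ⟨K, hK⟩ := hr.exists_norm_le hU (hst 0)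
  have hspec : ∀ z ∈ opSpectrum (opA β φ α₀), z.im = 0 :=
    fun z hz => hU.im_eq_zero_of_mem_spectrum hK z hz
  have hroot : rootSpace (opA β φ α₀) = spaceM φ α₀ := (hr.rootSpace_eq hf).trans hM.symm
  have hrootS : rootSpace (opA β φ α₀).adjoint = spaceMStar φ α₀ := by
    rw [hadj, hMS]
    exact hr.rootSpace_adjoint_eq hf
  obtain ⟨hd, hdS⟩ := finrank_rootM hr.biorth
  rw [← hM] at hd
  rw [← hMS] at hdS
  refine ⟨hspec, hr.exists_opKer_ne_iff hS hT hc₁ hcT hcS hspec, hr.isClosed_opRange_sq hf,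
    ⟨U, hU, fun s => ?_, hr.linearStability hf hS hT (hst 0) hκ⟩,
    ⟨_, hadj ▸ hU.swap_group, fun s => ?_⟩, ?_, hroot, hrootS,
    linearIndependent_of_finrank_span _ hd, linearIndependent_of_finrank_span _ hdS,
    hroot ▸ hd, hrootS ▸ hdS, ?_, ?_⟩
  · obtain ⟨C, hC⟩ := hst s
    exact ⟨_, hMS ▸ stableOn_of_en2_le hC⟩
  · obtain ⟨C, hC⟩ := hst s
    rw [hM]
    refine ⟨_, stableOn_of_en2_le (C := C) fun t ψ hψ => ?_⟩
    -- The group of A* is that of A at time -t, conjugated by the exchange of components, which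
    -- carries M^⊥ to M_*^⊥ and preserves the norms.
    have h := hC (-t) (swap ψ) (mem_rootM_orthogonal.mp hψ)
    rw [en2_swap] at h
    exact (en2_swap s _).trans_le h
  · obtain ⟨ε, hε, h⟩ := Metric.eventually_nhds_iff.mp hev
    -- The constants of coercivity and boundedness are common to all nearby α, so C is a constant
    -- function; it is positive because of the summand 1, whence C < 2C.
    refine ⟨min ε c₀, lt_min hε hc₀, min_le_right _ _,
      fun _ => NNReal.sqrt (2 * (2 * ((1 + (α₀ ^ 2 / 2)⁻¹) * (C₂ / c₁)).toNNReal *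
        (2 * Real.pi ^ 2 + α₀ ^ 2 / 2).toNNReal + 1)), fun α hαδ => ⟨?_, ?_⟩⟩
    · exact lt_mul_of_one_lt_left (NNReal.sqrt_pos.mpr (by positivity)) one_lt_two
    · obtain ⟨hI, h0, hp, hcT', hcS', hCT', hCS'⟩ :=
        h ((Real.dist_eq α α₀).trans_lt (hαδ.trans_le (min_le_left _ _)))
      have hr' := hφ.isRootSystem hI hβ h0 hp
      -- κ stays α₀²/2, so R does not depend on α. For α ≠ α₀ the potential is then only bounded,
      -- which suffices because coercivity comes by perturbation and not from compactness.
      have hS' := hφ.isSchr_minus hI hβ hκ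
      have hT' := hφ.isSchr_plus hI hβ hκ
      obtain ⟨V, hV⟩ := exists_isC0Group_offDiagonal hκ hS' hT'
      refine ⟨V, hV, ?_⟩
      rw [spaceMStar_eq hp.ne' (hφ.halfMass_pos hI hp).ne']
      exact stableOn_of_en2_le fun t ψ hψ =>
        hr'.en2_one_le hκ hV hS' hT' hc₁ hcT' hcS' hCT' hCS' t ψ hψ
  · exact (hr.opKer_opPow_eq hf 2 le_rfl).trans (hr.opKer_opPow_eq hf 3 (by norm_num)).symm
  · rw [hadj]
    exact (hr.opKer_opPow_adjoint_eq hf 2 le_rfl).trans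
      (hr.opKer_opPow_adjoint_eq hf 3 (by norm_num)).symm
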